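/- **Setting.** Let $\mathbb F\subseteq\mathbb C$ be a subfield with $\overline{x}\in\mathbb F$ and $\pm\sqrt x\in\mathbb F$ for all $x\in\mathbb F$. Let $\mathrm{FLT}_{\mathbb F}$ be the set of fractional linear transformations $\beta(x)=\frac{ax+b}{cx+d}$ with $a,b,c,d\in\mathbb F$, $(c,d)\neq(0,0)$, including the constants $b\in\mathbb F$ (which are the cases with $ad=bc$). We treat $z$ and $\overline z$ as independent complex variables. For complex numbers $a_1,\dots,a_n$ let $L_{a_1\dots a_n}(z)=\int_{0<t_1<\dots<t_n<z}\frac{dt_1}{t_1-a_1}\cdots\frac{dt_n}{t_n-a_n}$ be the hyperlogarithm, with $L_e=1$ for the empty word $e$, regularized at $0$ by $L_{0\dots0}(z)=\log^n(z)/n!$; so $\partial_zL_{wa}(z)=L_w(z)/(z-a)$, and $L_w$ has regularized value $0$ at $0$ for $w\ne e$. For finite $A\subset\mathbb F$ let $\mathcal O_A(\overline z)=\mathbb C[\overline z,((\overline z-a)^{-1})_{a\in A}]$, let $\mathcal{HL}_A(\overline z)$ be the $\mathcal O_A(\overline z)$-span of the $L_v(\overline z)$ with $v$ a word in $A$, and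 let $\mathcal{HL}_{\mathbb F}(\overline z)=\bigcup_A\mathcal{HL}_A(\overline z)$. For a finite set $\Sigma\subset\mathrm{FLT}_{\mathbb F}$ of letters $\beta(\overline z)$ let $$\mathcal O_\Sigma(z,\overline z)=\mathbb C\big[z,\ ((z-\beta(\overline z))^{-1})_{\beta\in\Sigma},\ \overline z,\ ((\overline z-\overline b)^{-1})_{b\in\Sigma\cap\mathbb F}\big].$$ Let $\mathcal{GH}_\Sigma$ (respectively $\mathcal{GH}^{\mathbb C}_\Sigma$) be the $\mathcal O_\Sigma(z,\overline z)$-span (respectively the $\mathbb C$-span) of the products $L_v(\overline z)\,L_{w(\overline z)}(z)$, where $w$ is a word in $\Sigma$ and $v$ is a word in the conjugates $\overline b$ of the constants $b\in\Sigma\cap\mathbb F$. Let $\mathcal{GH}_{\mathbb F}$ and $\mathcal{GH}^{\mathbb C}_{\mathbb F}$ be the unions of these spaces over all finite $\Sigma\subset\mathrm{FLT}_{\mathbb F}$. The elements are multivalued holomorphic functions of $(z,\overline z)$. They are represented by their principal branches (straight integration paths from $0$, principal logarithms) near the tangential base point $0<|z|\ll|\overline z|\ll1$, and are equal if these branches agree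 there. **Theorem.** The elements of $\mathcal{GH}_{\mathbb F}$ are holomorphic in $(z,\overline z)$ near the base point, and for every finite $\Sigma\subset\mathrm{FLT}_{\mathbb F}$: 1. $\mathcal{GH}_\Sigma$ is a free $\mathcal O_\Sigma(z,\overline z)$-module; more precisely the products $L_v(\overline z)L_{w(\overline z)}(z)$ that span it are linearly independent over $\mathcal O_\Sigma(z,\overline z)$. It contains $1$ and is closed under multiplication, and $\mathcal{GH}^{\mathbb C}_\Sigma$ is a $\mathbb C$-algebra. 2. The sequence $0\to\mathcal{HL}_{\mathbb F}(\overline z)\to\mathcal{GH}_{\mathbb F}\xrightarrow{\ \partial_z\ }\mathcal{GH}_{\mathbb F}\to0$ is exact: $\mathcal{HL}_{\mathbb F}(\overline z)\subseteq\mathcal{GH}_{\mathbb F}$, $\partial_z$ maps $\mathcal{GH}_{\mathbb F}$ to itself with kernel $\mathcal{HL}_{\mathbb F}(\overline z)$, and every $f\in\mathcal{GH}_{\mathbb F}$ has a primitive $P\in\mathcal{GH}_{\mathbb F}$ with $\partial_zP=f$. 3. $\mathcal{GH}_\Sigma$ is differentially simple: for every $0\ne f\in\mathcal{GH}_\Sigma$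 there is a differential operator $D=\sum_{i,j}c_{ij}\,\partial_z^i\partial_{\overline z}^j$ (a finite sum with $c_{ij}\in\mathcal O_\Sigma(z,\overline z)$) such that $Df=1$. 4. $\mathcal{GH}_{\mathbb F}$ and $\mathcal{GH}^{\mathbb C}_{\mathbb F}$ are stable under complex conjugation, $\overline{\mathcal{GH}_{\mathbb F}}=\mathcal{GH}_{\mathbb F}$ and $\overline{\mathcal{GH}^{\mathbb C}_{\mathbb F}}=\mathcal{GH}^{\mathbb C}_{\mathbb F}$. 5. $\mathcal{GH}_{\mathbb F}$ and $\mathcal{GH}^{\mathbb C}_{\mathbb F}$ are stable under $\mathrm{FLT}_{\mathbb F}$: for $f\in\mathcal{GH}_{\mathbb F}$, $g\in\mathcal{GH}^{\mathbb C}_{\mathbb F}$ and $\beta\in\mathrm{FLT}_{\mathbb F}$ we have $f(\beta(z))\in\mathcal{GH}_{\mathbb F}$ and $g(\beta(z))\in\mathcal{GH}^{\mathbb C}_{\mathbb F}$, where the substitution replaces $(z,\overline z)$ by $(\beta(z),\overline\beta(\overline z))$, and $\overline\beta$ is $\beta$ with conjugated coefficients. In (4) and (5) the functions are multivalued, so membership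 is understood for all branches. Let $X$ be one of the two spaces, and let $T$ be complex conjugation or a substitution by $\beta$. If a branch of $f\in X$ (an analytic continuation along any path) is holomorphic at the image under $T$ of a point at which $T$ has no pole, then its transform at that point is a branch of some $h\in X$. Moreover, every multivalued function on the base region that has this transform as one of its branches lies in $X$. In (4) the converse also holds: if some branch of $h$ is the complex conjugate of a branch of $f$, then $f\in X$ if and only if $h\in X$. If $\beta$ is constant, (5) concerns only branches of $f$ that are holomorphic at the point $(\beta,\overline\beta)$. -/

import Mathlib

open Filter Topology

namespace GenHyperlog

noncomputable section

/-! ### Hyperlogarithms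

`hyperlog [a₁, …, aₙ] z` is `L_{a₁…aₙ}(z)`, the iterated integral of
`dt₁/(t₁ - a₁) ⋯ dtₙ/(tₙ - aₙ)` from `0` to `z` along the straight segment, regularized by
`L_{0…0}(z) = log(z)ⁿ / n!` (principal logarithm). -/

/-- The auxiliary recursion on the reversed word: the head is the outermost (last) letter. All the
integrals converge at `0` because a word that is not a power of the letter `0` gives a function
that is `O(|z| |log z|^k)` at `0`. -/
def hyperlogRev : List ℂ → ℂ → ℂ
  | [], _ => 1
  | a :: u, z =>
    open Classical in
    if ∀ b ∈ a :: u, b = 0 then Complex.log z ^ (u.length + 1) / ((u.length + 1).factorial : ℂ)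
    else ∫ t in (0 : ℝ)..1, z * hyperlogRev u ((t : ℂ) * z) / ((t : ℂ) * z - a)

/-- The hyperlogarithm `L_w(z)`. -/
def hyperlog (w : List ℂ) (z : ℂ) : ℂ := hyperlogRev w.reverse z

/-! ### Fractional linear transformations -/

/-- The fractional linear transformations `x ↦ (a x + b) / (c x + d)` with coefficients in `F`, as
functions. The quotients with `a d = b c` and `(c, d) ≠ (0, 0)` are the constants of `F`; they are
listed in cancelled form, so that equal transformations are equal functions. -/
def FLT (F : Subfield ℂ) : Set (ℂ → ℂ) :=
  {β | (∃ b ∈ F, β = fun _ => b) ∨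
    ∃ a ∈ F, ∃ b ∈ F, ∃ c ∈ F, ∃ d ∈ F, a * d - b * c ≠ 0 ∧
      β = fun x => (a * x + b) / (c * x + d)}

/-- The complex conjugates of the constants in a set of letters. -/
def conjConsts (S : Set (ℂ → ℂ)) : Set ℂ := {c | (fun _ => starRingEnd ℂ c) ∈ S}

/-! ### The tangential base point

The variables are a pair `p = (z, ζ)` of independent complex variables, where `ζ` stands for the
complex conjugate of `z`. A multivalued function is represented by its principal branch near the
tangential base point `0 < |z| ≪ |ζ| ≪ 1`. On a sufficiently small region every letter `β(ζ)` that
is not identically `0` satisfies `|z| < |β(ζ)|`, so that the segment from `0` to `z` meets no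
singularity. -/

/-- A basic (open, simply connected) region at the base point. -/
def baseRegion (ε : ℝ) : Set (ℂ × ℂ) :=
  {p | p.1 ∈ Complex.slitPlane ∧ p.2 ∈ Complex.slitPlane ∧ ‖p.2‖ < ε ∧ ‖p.1‖ < ε * ‖p.2‖}

/-- The filter of neighbourhoods of the base point. -/
def base : Filter (ℂ × ℂ) := ⨅ ε : Set.Ioi (0 : ℝ), 𝓟 (baseRegion ε)

/-- Germs of functions of `(z, ζ)` at the base point. -/
abbrev G : Type := Filter.Germ base ℂ

/-- Germs form a commutative `ℂ`-algebra under pointwise operations. -/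
instance : Algebra ℂ G :=
  Algebra.ofModule
    (fun r x y => by
      induction x using Filter.Germ.inductionOn with | _ f => ?_
      induction y using Filter.Germ.inductionOn with | _ g => ?_
      exact congrArg (fun h : ℂ × ℂ → ℂ => (h : Filter.Germ base ℂ)) (smul_mul_assoc r f g))
    (fun r x y => by
      induction x using Filter.Germ.inductionOn with | _ f => ?_
      induction y using Filter.Germ.inductionOn with | _ g => ?_
      exact congrArg (fun h : ℂ × ℂ → ℂ => (h : Filter.Germ base ℂ)) (mul_smul_comm r f g))

theorem isOpen_baseRegion (ε : ℝ) : IsOpen (baseRegion ε) := by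
  have h1 : IsOpen {p : ℂ × ℂ | p.1 ∈ Complex.slitPlane} :=
    Complex.isOpen_slitPlane.preimage continuous_fst
  have h2 : IsOpen {p : ℂ × ℂ | p.2 ∈ Complex.slitPlane} :=
    Complex.isOpen_slitPlane.preimage continuous_snd
  have h3 : IsOpen {p : ℂ × ℂ | ‖p.2‖ < ε} := isOpen_lt (by fun_prop) (by fun_prop)
  have h4 : IsOpen {p : ℂ × ℂ | ‖p.1‖ < ε * ‖p.2‖} := isOpen_lt (by fun_prop) (by fun_prop)
  exact h1.inter (h2.inter (h3.inter h4))

theorem baseRegion_mono {ε δ : ℝ} (h : ε ≤ δ) : baseRegion ε ⊆ baseRegion δ := by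
  rintro p ⟨h1, h2, h3, h4⟩
  exact ⟨h1, h2, h3.trans_le h, h4.trans_le (mul_le_mul_of_nonneg_right h (norm_nonneg _))⟩

theorem base_hasBasis : base.HasBasis (fun ε : ℝ => 0 < ε) baseRegion := by
  have h : base = ⨅ ε ∈ Set.Ioi (0 : ℝ), 𝓟 (baseRegion ε) := by
    unfold base
    exact iInf_subtype' (f := fun (ε : ℝ) (_ : ε ∈ Set.Ioi (0 : ℝ)) => 𝓟 (baseRegion ε)) |>.symm
  rw [h]
  refine hasBasis_biInf_principal ?_ ⟨1, by simp⟩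
  intro x hx y hy
  exact ⟨min x y, Set.mem_Ioi.2 (lt_min (Set.mem_Ioi.1 hx) (Set.mem_Ioi.1 hy)), baseRegion_mono (min_le_left _ _),
    baseRegion_mono (min_le_right _ _)⟩

theorem eventually_eventually_nhds_base {P : ℂ × ℂ → Prop} (h : ∀ᶠ p in base, P p) :
    ∀ᶠ p in base, ∀ᶠ q in 𝓝 p, P q := by
  obtain ⟨ε, hε, H⟩ := base_hasBasis.eventually_iff.1 h
  refine base_hasBasis.eventually_iff.2 ⟨ε, hε, fun p hp => ?_⟩
  filter_upwards [(isOpen_baseRegion ε).mem_nhds hp] with q hq using H hq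

/-- The germ of a function at the base point. -/
def germ (f : ℂ × ℂ → ℂ) : G := (f : Filter.Germ base ℂ)

/-- `f` is (represented by) a function of two variables that is holomorphic near the base point. -/
def IsHolomorphic (f : G) : Prop := ∃ f₀, germ f₀ = f ∧ ∀ᶠ p in base, AnalyticAt ℂ f₀ p

/-- The partial derivative with respect to `z`. -/
def dz (f : G) : G :=
  Quotient.liftOn' f (fun g => germ fun p => deriv (fun z => g (z, p.2)) p.1) (by
    intro g g' (hg : g =ᶠ[base] g')
    refine Filter.Germ.coe_eq.2 ?_
    filter_upwards [eventually_eventually_nhds_base hg] with p hp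
    refine Filter.EventuallyEq.deriv_eq ?_
    have hc : Tendsto (fun z : ℂ => (z, p.2)) (𝓝 p.1) (𝓝 p) := by
      have : Continuous fun z : ℂ => (z, p.2) := by fun_prop
      exact this.tendsto p.1
    exact hc.eventually hp)

/-- The partial derivative with respect to `ζ`, i.e. the complex conjugate of `z`. -/
def dzbar (f : G) : G :=
  Quotient.liftOn' f (fun g => germ fun p => deriv (fun ζ => g (p.1, ζ)) p.2) (by
    intro g g' (hg : g =ᶠ[base] g')
    refine Filter.Germ.coe_eq.2 ?_
    filter_upwards [eventually_eventually_nhds_base hg] with p hp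
    refine Filter.EventuallyEq.deriv_eq ?_
    have hc : Tendsto (fun ζ : ℂ => (p.1, ζ)) (𝓝 p.2) (𝓝 p) := by
      have : Continuous fun ζ : ℂ => (p.1, ζ) := by fun_prop
      exact this.tendsto p.2
    exact hc.eventually hp)

/-! ### Rings of regular functions and spaces of hyperlogarithms -/

/-- The ring of regular functions `𝒪_S(z, ζ)`, generated over `ℂ` by `z`, `ζ`, the
`1 / (z - β(ζ))` with `β ∈ S`, and the `1 / (ζ - b̄)` with `b ∈ S` constant. -/
def regular (S : Set (ℂ → ℂ)) : Subalgebra ℂ G :=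
  Algebra.adjoin ℂ
    ({germ fun p => p.1, germ fun p => p.2} ∪
      {f | ∃ β ∈ S, f = germ fun p => (p.1 - β p.2)⁻¹} ∪
      {f | ∃ c ∈ conjConsts S, f = germ fun p => (p.2 - c)⁻¹})

/-- Words with letters in a set. -/
abbrev Word {α : Type} (A : Set α) : Type := {w : List α // ∀ a ∈ w, a ∈ A}

/-- The generator `L_v(ζ) L_{w(ζ)}(z)`. -/
def genHyperlog (v : List ℂ) (w : List (ℂ → ℂ)) : G :=
  germ fun p => hyperlog v p.2 * hyperlog (w.map fun β => β p.2) p.1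

/-- The family of all generators `L_v(ζ) L_{w(ζ)}(z)`, where `w` has its letters in `S` and `v` has
its letters among the conjugates of the constants in `S`. -/
def generators (S : Set (ℂ → ℂ)) (i : Word (conjConsts S) × Word S) : G :=
  genHyperlog i.1.1 i.2.1

/-- The space of generalized hyperlogarithms over the alphabet `S`. -/
def GH (S : Set (ℂ → ℂ)) : Submodule (regular S) G :=
  Submodule.span (regular S) (Set.range (generators S))

/-- The generalized hyperlogarithms over the alphabet `S` with constant coefficients. -/
def GHC (S : Set (ℂ → ℂ)) : Submodule ℂ G :=
  Submodule.span ℂ (Set.range (generators S))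

/-- The union of the spaces `GH S` over all finite alphabets `S` of transformations over `F`. -/
def GHF (F : Subfield ℂ) : Set G := {f | ∃ S : Set (ℂ → ℂ), S.Finite ∧ S ⊆ FLT F ∧ f ∈ GH S}

/-- The union of the spaces `GHC S` over all finite alphabets `S` of transformations over `F`. -/
def GHCF (F : Subfield ℂ) : Set G := {f | ∃ S : Set (ℂ → ℂ), S.Finite ∧ S ⊆ FLT F ∧ f ∈ GHC S}

/-- The ring `𝒪_A(ζ) = ℂ[ζ, (1 / (ζ - a))_{a ∈ A}]`. -/
def regularBar (A : Set ℂ) : Subalgebra ℂ G :=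
  Algebra.adjoin ℂ ({germ fun p => p.2} ∪ {f | ∃ a ∈ A, f = germ fun p => (p.2 - a)⁻¹})

/-- The hyperlogarithms `HL_A(ζ)` in the variable `ζ`. -/
def HLbar (A : Set ℂ) : Submodule (regularBar A) G :=
  Submodule.span (regularBar A) (Set.range fun v : Word A => germ fun p => hyperlog v.1 p.2)

/-- `HL_F(ζ)`, the union of the `HL_A(ζ)` over all finite subsets `A` of `F`. -/
def HLbarF (F : Subfield ℂ) : Set G :=
  {f | ∃ A : Set ℂ, A.Finite ∧ A ⊆ (F : Set ℂ) ∧ f ∈ HLbar A}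

/-! ### Branches of multivalued functions -/

/-- `g`, near `q`, is the analytic continuation of `f`, near `p`, along the path `γ`. -/
def ContinuesTo {p q : ℂ × ℂ} (γ : Path p q) (f g : ℂ × ℂ → ℂ) : Prop :=
  ∃ E : unitInterval → ℂ × ℂ → ℂ,
    (∀ t, AnalyticAt ℂ (E t) (γ t)) ∧
    (∀ t, ∀ᶠ s in 𝓝 t, E s =ᶠ[𝓝 (γ s)] E t) ∧
    E 0 =ᶠ[𝓝 p] f ∧ E 1 =ᶠ[𝓝 q] g

/-- `g` is, near `q`, a branch of the multivalued function given by the germ `f`: it arises from `f`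
by analytic continuation along some path from the base point to `q`. -/
def IsBranchAt (f : G) (q : ℂ × ℂ) (g : ℂ × ℂ → ℂ) : Prop :=
  ∃ f₀, germ f₀ = f ∧ ∀ᶠ p in base, ∃ γ : Path p q, ContinuesTo γ f₀ g

/-- Complex conjugation of the pair `(z, ζ)`. It fixes the points with `ζ = z̄`. -/
def conjPt (p : ℂ × ℂ) : ℂ × ℂ := (starRingEnd ℂ p.2, starRingEnd ℂ p.1)

/-- The complex conjugate of a function of `(z, ζ)`. -/
def conjFun (g : ℂ × ℂ → ℂ) (p : ℂ × ℂ) : ℂ := starRingEnd ℂ (g (conjPt p))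

/-- `X̄ = X` for a set `X` of multivalued functions: the complex conjugate of every branch of an
element of `X` is a branch of an element of `X`, and if some branch of `h` is the complex
conjugate of a branch of `f`, then `f ∈ X` if and only if `h ∈ X`. -/
def ConjStable (X : Set G) : Prop :=
  (∀ f ∈ X, ∀ p g, IsBranchAt f p g → ∃ h ∈ X, IsBranchAt h (conjPt p) (conjFun g)) ∧
  ∀ f h p g, IsBranchAt f p g → IsBranchAt h (conjPt p) (conjFun g) → (f ∈ X ↔ h ∈ X)

/-- The substitution `z ↦ β(z)`, which maps the conjugate `ζ` of `z` to the conjugate of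
`β(z)`. -/
def substPt (β : ℂ → ℂ) (p : ℂ × ℂ) : ℂ × ℂ := (β p.1, starRingEnd ℂ (β (starRingEnd ℂ p.2)))

/-- `f(β(z)) ∈ X` for all `f ∈ X` and all fractional linear transformations `β` over `F`: wherever
`β` has no pole, the pull-back of every branch of `f` is a branch of an element of `X`, and every
multivalued function that has this pull-back as a branch belongs to `X`. -/
def FLTStable (F : Subfield ℂ) (X : Set G) : Prop :=
  ∀ β ∈ FLT F, ∀ p : ℂ × ℂ, AnalyticAt ℂ β p.1 → AnalyticAt ℂ β (starRingEnd ℂ p.2) →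
    ∀ f ∈ X, ∀ g, IsBranchAt f (substPt β p) g →
      (∃ h ∈ X, IsBranchAt h p (g ∘ substPt β)) ∧
      ∀ h, IsBranchAt h p (g ∘ substPt β) → h ∈ X

end

end GenHyperlog

/-! Everything rests on the two differential equations of a hyperlogarithm whose letters depend on
`ζ`, the independent variable that stands for the conjugate of `z`. The `z`-derivative strips the
outermost letter `β` and leaves the factor `1/(z - β(ζ))` (`hasDerivAt_revHyperlog_cons`). The
`ζ`-derivative is a combination of words shorter by one letter, whose coefficients are logarithmic
derivatives of differences of letters, plus a term for the motion of the outermost letter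
(`pdζ_revHyperlog_cons`). The second equation and the shuffle product (`exists_shuffle`) are proved
in the same way: the difference of the two sides has `z`-derivative zero, and its expansion in
powers of `log z` at `z = 0` has constant term zero, so it vanishes
(`LogDomain.eq_coeff_of_hasDerivAt_zero`).

For freeness and differential simplicity, `∂_z` is lifted to formal combinations of words
(`wordDerivation`). Denominators are cleared and the derivation is applied until the coefficients of
the longest words are constant; one more application removes these words. The combination is not
lost on the way, because a derivative has no residues (`residue_eq_zero`). This elimination
(`exists_single_nil_mem`), run first for `∂_z` and then for `∂_ζ`, shows that a differentially
stable module containing the value of a nonzero combination contains `1`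
(`one_mem_of_evalWords_mem`). For the zero module this is linear independence; for the module
spanned by all derivatives of `f` it is the operator with `D f = 1`. The kernel of `∂_z` comes from
the same residue argument. Primitives come from partial fractions in `z` and integration by parts;
the denominators `β(ζ) - γ(ζ)` have quadratic numerators, whose roots lie in `F` because `F`
contains square roots.

Stability under conjugation and fractional linear maps needs a description that does not mention the
base point. Up to denominators linear in `ζ`, the functions `z - β(ζ)` and `ζ - c` are bi-affine
forms `Q` in `(z, ζ)`, and differences of letters split into linear factors. Hence generalized
hyperlogarithms are iterated integrals of the `dQ / Q` (the class `Uni`, by `uni_hyperlog`).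
Conjugation and pairs of Möbius maps transform bi-affine forms into bi-affine forms, so the class is
stable under them, and it is preserved by analytic continuation (`GoodAt.of_continuesTo`).
Conversely, near the base point every function of the class is a combination of hyperlogarithms
(`Uni.exists_mem_wordSpan`): letters are appended to integrate in `z`, and the rest is a function of
`ζ` that is determined by regularized values at `z = 0`. Therefore membership can be tested on any
branch at any point (`IsGood.mem_hyperlogSpace`). The parameter `rat` treats regular and constant
coefficients together. -/

namespace GenHyperlog
noncomputable section

/-! ### Analytic functions of two variables -/

/-- The retraction of the plane onto a closed disc. -/
def discRetract (c : ℂ) (R : ℝ) (w : ℂ) : ℂ := c + (w - c) * ((R / max ‖w - c‖ R : ℝ) : ℂ)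

theorem continuous_discRetract (c : ℂ) {R : ℝ} (hR : 0 < R) : Continuous (discRetract c R) := by
  have h : Continuous fun w : ℂ => R / max ‖w - c‖ R := by
    refine Continuous.div (by fun_prop) (by fun_prop) fun w => ?_
    exact (lt_max_of_lt_right hR).ne'
  unfold discRetract
  fun_prop

theorem discRetract_mem (c : ℂ) {R : ℝ} (hR : 0 < R) (w : ℂ) :
    discRetract c R w ∈ Metric.closedBall c R := by
  have h0 : 0 < max ‖w - c‖ R := lt_max_of_lt_right hR
  rw [mem_closedBall_iff_norm, discRetract, add_sub_cancel_left, norm_mul, Complex.norm_real,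
    Real.norm_of_nonneg (by positivity), mul_div_assoc', div_le_iff₀ h0, mul_comm]
  gcongr
  exact le_max_left _ _

theorem discRetract_of_mem {c : ℂ} {R : ℝ} (hR : 0 < R) {w : ℂ} (hw : w ∈ Metric.closedBall c R) :
    discRetract c R w = w := by
  rw [mem_closedBall_iff_norm] at hw
  rw [discRetract, max_eq_right hw, div_self hR.ne']
  simp

/-- Osgood's lemma: a continuous function of two variables that is holomorphic in each of them is
analytic. -/
theorem analyticAt_of_separately {f : ℂ × ℂ → ℂ} {U : Set (ℂ × ℂ)} (hU : IsOpen U)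
    (hc : ContinuousOn f U) (h1 : ∀ p ∈ U, DifferentiableAt ℂ (fun z => f (z, p.2)) p.1)
    (h2 : ∀ p ∈ U, DifferentiableAt ℂ (fun ζ => f (p.1, ζ)) p.2) {p : ℂ × ℂ} (hp : p ∈ U) :
    AnalyticAt ℂ f p := by
  obtain ⟨z₀, ζ₀⟩ := p
  obtain ⟨R, hR, hRU⟩ := Metric.nhds_basis_closedBall.mem_iff.1 (hU.mem_nhds hp)
  rw [← closedBall_prod_same] at hRU
  have hmem : ∀ {z ζ : ℂ}, z ∈ Metric.closedBall z₀ R → ζ ∈ Metric.closedBall ζ₀ R → (z, ζ) ∈ U :=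
    fun hz hζ => hRU ⟨hz, hζ⟩
  have hcirc : ∀ t : ℝ, circleMap ζ₀ R t ∈ Metric.closedBall ζ₀ R := fun t =>
    circleMap_mem_closedBall _ hR.le _
  let I : Set ℝ := Set.Icc (0 : ℝ) (2 * Real.pi)
  -- The retraction gives a function that is defined and continuous for all first arguments, so that
  -- currying yields a continuous map on `ℂ` with values in the Banach algebra `C(I, ℂ)`.
  let F : C(ℂ × I, ℂ) := ⟨fun q => f (discRetract z₀ R q.1, circleMap ζ₀ R q.2), by
    refine hc.comp_continuous ?_ fun q => hmem (discRetract_mem _ hR _) (hcirc _)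
    have := continuous_discRetract z₀ hR
    have := continuous_circleMap ζ₀ R
    fun_prop⟩
  let Φ₀ : C(ℂ, C(I, ℂ)) := F.curry
  -- Cauchy's formula in the first variable, for all points of the second circle at once: a power
  -- series in `z` whose values are functions on that circle.
  let Φ : ℂ → C(I, ℂ) := fun z =>
    (2 * Real.pi * Complex.I : ℂ)⁻¹ • ∮ w in C(z₀, R), (w - z)⁻¹ • Φ₀ w
  have hΦ : AnalyticAt ℂ Φ z₀ := by
    lift R to NNReal using hR.le
    exact (hasFPowerSeriesOn_cauchy_integral (c := z₀) (R := R) (f := Φ₀)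
      (Φ₀.continuous.continuousOn.circleIntegrable R.2) hR).analyticAt
  have hint : ∀ z ∈ Metric.ball z₀ R, CircleIntegrable (fun w => (w - z)⁻¹ • Φ₀ w) z₀ R := by
    intro z hz
    refine ContinuousOn.circleIntegrable hR.le ?_
    refine ContinuousOn.smul (ContinuousOn.inv₀ (f := fun w => w - z) (by fun_prop) fun w hw => ?_)
      Φ₀.continuous.continuousOn
    rw [sub_ne_zero]
    rintro rfl
    rw [mem_sphere_iff_norm] at hw
    rw [mem_ball_iff_norm] at hz
    linarith
  have hΦval : ∀ z ∈ Metric.ball z₀ R, ∀ t : I, Φ z t = f (z, circleMap ζ₀ R t) := by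
    intro z hz t
    have hd : DiffContOnCl ℂ (fun w => f (w, circleMap ζ₀ R t)) (Metric.ball z₀ R) := by
      refine DifferentiableOn.diffContOnCl fun w hw => ?_
      have hw' := Metric.closure_ball_subset_closedBall hw
      exact (h1 _ (hmem hw' (hcirc t))).differentiableWithinAt
    have key := hd.two_pi_i_inv_smul_circleIntegral_sub_inv_smul hz
    rw [← key]
    change ((2 * Real.pi * Complex.I : ℂ)⁻¹ • ∮ w in C(z₀, R), (w - z)⁻¹ • Φ₀ w : C(I, ℂ)) t = _
    rw [ContinuousMap.smul_apply]
    congr 1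
    have h3 := (ContinuousMap.evalCLM ℂ t : C(I, ℂ) →L[ℂ] ℂ).intervalIntegral_comp_comm
      (hint z hz).out
    rw [circleIntegral, circleIntegral]
    refine h3.symm.trans (intervalIntegral.integral_congr fun θ _ => ?_)
    have h4 : discRetract z₀ R (circleMap z₀ R θ) = circleMap z₀ R θ :=
      discRetract_of_mem hR (circleMap_mem_closedBall _ hR.le _)
    change deriv (circleMap z₀ R) θ * ((circleMap z₀ R θ - z)⁻¹ *
      f (discRetract z₀ R (circleMap z₀ R θ), circleMap ζ₀ R t)) = _
    rw [h4]
    rfl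
  let c : C(I, ℂ) := ⟨fun t => circleMap ζ₀ R t, by
    have := continuous_circleMap ζ₀ R
    fun_prop⟩
  let m : C(I, ℂ) := ⟨fun t => (2 * Real.pi * Complex.I : ℂ)⁻¹ * deriv (circleMap ζ₀ R) t, by
    have := continuous_circleMap 0 R
    simp only [deriv_circleMap]
    fun_prop⟩
  -- The Cauchy kernel of the second variable as an element of `C(I, ℂ)`. Inversion is analytic at
  -- the units of a Banach algebra, so the kernel is analytic in `ζ`.
  let k : ℂ → C(I, ℂ) := fun ζ => m * Ring.inverse (c - algebraMap ℂ _ ζ)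
  have hunit : ∀ ζ ∈ Metric.ball ζ₀ R, IsUnit (c - algebraMap ℂ C(I, ℂ) ζ) := by
    intro ζ hζ
    rw [ContinuousMap.isUnit_iff_forall_ne_zero]
    intro t ht
    have h5 : circleMap ζ₀ R t = ζ := sub_eq_zero.1 ht
    have h6 := circleMap_mem_sphere ζ₀ hR.le t
    rw [h5] at h6
    exact Metric.sphere_disjoint_ball.ne_of_mem h6 hζ rfl
  have hkval : ∀ ζ ∈ Metric.ball ζ₀ R, ∀ t : I,
      k ζ t = (2 * Real.pi * Complex.I : ℂ)⁻¹ * (deriv (circleMap ζ₀ R) t *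
        (circleMap ζ₀ R t - ζ)⁻¹) := by
    intro ζ hζ t
    have h7 := congrArg (fun g : C(I, ℂ) => g t) (Ring.mul_inverse_cancel _ (hunit ζ hζ))
    have h8 : Ring.inverse (c - algebraMap ℂ C(I, ℂ) ζ) t = (circleMap ζ₀ R t - ζ)⁻¹ :=
      eq_inv_of_mul_eq_one_right h7
    change (2 * Real.pi * Complex.I : ℂ)⁻¹ * deriv (circleMap ζ₀ R) t * _ = _
    rw [h8, mul_assoc]
  have hk : AnalyticAt ℂ k ζ₀ := by
    have h9 : AnalyticAt ℂ (fun ζ : ℂ => c - algebraMap ℂ C(I, ℂ) ζ) ζ₀ :=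
      analyticAt_const.sub ((algebraMapCLM ℂ C(I, ℂ)).analyticAt ζ₀)
    obtain ⟨u, hu⟩ := hunit ζ₀ (Metric.mem_ball_self hR)
    have h10 : AnalyticAt ℂ Ring.inverse (c - algebraMap ℂ C(I, ℂ) ζ₀) := by
      rw [← hu]
      exact analyticAt_inverse u
    exact analyticAt_const.mul (h10.comp (f := fun ζ : ℂ => c - algebraMap ℂ C(I, ℂ) ζ) h9)
  let J : C(I, ℂ) →L[ℂ] ℂ := LinearMap.mkContinuous
    { toFun := fun g => ∫ t in (0 : ℝ)..(2 * Real.pi), Set.IccExtend Real.two_pi_pos.le g t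
      map_add' := fun g g' => by
        rw [← intervalIntegral.integral_add]
        · rfl
        · exact (g.continuous.Icc_extend' ).intervalIntegrable _ _
        · exact (g'.continuous.Icc_extend' ).intervalIntegrable _ _
      map_smul' := fun a g => by
        rw [RingHom.id_apply, ← intervalIntegral.integral_smul]
        rfl }
    (2 * Real.pi) (fun g => by
      refine (intervalIntegral.norm_integral_le_of_norm_le_const (C := ‖g‖) fun t _ => ?_).trans ?_
      · exact g.norm_coe_le_norm _
      · rw [sub_zero, abs_of_pos Real.two_pi_pos, mul_comm])
  have hJ : ∀ g : C(I, ℂ), J g =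
      ∫ t in (0 : ℝ)..(2 * Real.pi), Set.IccExtend Real.two_pi_pos.le g t := fun g => rfl
  -- The function is a continuous linear functional of a product of two analytic maps, one in each
  -- variable; joint analyticity follows.
  have hval : ∀ p ∈ Metric.ball z₀ R ×ˢ Metric.ball ζ₀ R, f p = J (k p.2 * Φ p.1) := by
    rintro ⟨z, ζ⟩ ⟨hz, hζ⟩
    have hd : DiffContOnCl ℂ (fun w => f (z, w)) (Metric.ball ζ₀ R) := by
      refine DifferentiableOn.diffContOnCl fun w hw => ?_
      have hw' := Metric.closure_ball_subset_closedBall hw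
      exact (h2 _ (hmem (Metric.ball_subset_closedBall hz) hw')).differentiableWithinAt
    have key := hd.two_pi_i_inv_smul_circleIntegral_sub_inv_smul hζ
    rw [← key, hJ, circleIntegral, ← intervalIntegral.integral_smul]
    refine intervalIntegral.integral_congr fun t ht => ?_
    rw [Set.uIcc_of_le Real.two_pi_pos.le] at ht
    simp only [smul_eq_mul]
    rw [Set.IccExtend_of_mem _ _ ht, ContinuousMap.mul_apply, hkval ζ hζ, hΦval z hz]
    ring
  have hA : AnalyticAt ℂ (fun p : ℂ × ℂ => J (k p.2 * Φ p.1)) (z₀, ζ₀) :=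
    (J.analyticAt _).comp ((hk.comp (x := (z₀, ζ₀)) analyticAt_snd).mul
      (hΦ.comp (x := (z₀, ζ₀)) analyticAt_fst))
  refine hA.congr ?_
  filter_upwards [prod_mem_nhds (Metric.ball_mem_nhds z₀ hR) (Metric.ball_mem_nhds ζ₀ hR)] with p hp
  exact (hval p hp).symm

/-- Differentiation under the integral sign for a dominated family of holomorphic functions. -/
theorem hasDerivAt_integral_of_dominated {f : ℝ → ℂ → ℂ} {z₀ : ℂ} {r : ℝ} (hr : 0 < r)
    (hd : ∀ t ∈ Set.Ioc (0 : ℝ) 1, DifferentiableOn ℂ (f t) (Metric.ball z₀ r))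
    (hc : ∀ z ∈ Metric.ball z₀ r, ContinuousOn (fun t => f t z) (Set.Ioc 0 1)) {g : ℝ → ℝ}
    (hg : IntervalIntegrable g MeasureTheory.volume 0 1)
    (hb : ∀ z ∈ Metric.ball z₀ r, ∀ t ∈ Set.Ioc (0 : ℝ) 1, ‖f t z‖ ≤ g t) :
    HasDerivAt (fun z => ∫ t in (0 : ℝ)..1, f t z) (∫ t in (0 : ℝ)..1, deriv (f t) z₀) z₀ := by
  have hI : Set.uIoc (0 : ℝ) 1 = Set.Ioc 0 1 := Set.uIoc_of_le zero_le_one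
  have hr2 : 0 < r / 2 := half_pos hr
  have hball : Metric.ball z₀ (r / 2) ⊆ Metric.ball z₀ r := Metric.ball_subset_ball (by linarith)
  have hmeas : ∀ z ∈ Metric.ball z₀ r, MeasureTheory.AEStronglyMeasurable (fun t => f t z)
      (MeasureTheory.volume.restrict (Set.uIoc (0 : ℝ) 1)) := fun z hz => by
    rw [hI]
    exact (hc z hz).aestronglyMeasurable measurableSet_Ioc
  have hdiff : ∀ t ∈ Set.Ioc (0 : ℝ) 1, ∀ z ∈ Metric.ball z₀ r, HasDerivAt (f t) (deriv (f t) z) z :=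
    fun t ht z hz => ((hd t ht).differentiableAt (Metric.isOpen_ball.mem_nhds hz)).hasDerivAt
  have h0 : z₀ ∈ Metric.ball z₀ r := Metric.mem_ball_self hr
  refine (intervalIntegral.hasDerivAt_integral_of_dominated_loc_of_deriv_le
    (F := fun z t => f t z) (F' := fun z t => deriv (f t) z) (bound := fun t => g t / (r / 2))
    (Metric.ball_mem_nhds z₀ hr2) ?_ ?_ ?_ ?_ (hg.div_const _) ?_).2
  · filter_upwards [Metric.ball_mem_nhds z₀ hr] with z hz using hmeas z hz
  · refine hg.mono_fun (hmeas z₀ h0) ?_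
    rw [hI]
    refine (MeasureTheory.ae_restrict_iff' measurableSet_Ioc).2 (Eventually.of_forall fun t ht => ?_)
    exact (hb z₀ h0 t ht).trans (le_abs_self _)
  -- Measurability of the derivative in `t`: it is the pointwise limit of difference quotients along
  -- this sequence. The shift by `2` keeps even the first point inside the open ball.
  · let s : ℕ → ℂ := fun n => z₀ + ((r / (n + 2) : ℝ) : ℂ)
    have hsn : ∀ n : ℕ, 0 < r / ((n : ℝ) + 2) ∧ r / ((n : ℝ) + 2) < r := fun n => by
      refine ⟨by positivity, ?_⟩
      rw [div_lt_iff₀ (by positivity)]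
      nlinarith [(Nat.cast_nonneg n : (0 : ℝ) ≤ n)]
    have hs : ∀ n, s n ∈ Metric.ball z₀ r := fun n => by
      rw [mem_ball_iff_norm, add_sub_cancel_left, Complex.norm_real,
        Real.norm_of_nonneg (hsn n).1.le]
      exact (hsn n).2
    have hlim : Tendsto s atTop (𝓝[≠] z₀) := by
      refine tendsto_nhdsWithin_iff.2 ⟨?_, Eventually.of_forall fun n hn => ?_⟩
      · have h1 : Tendsto (fun n : ℕ => r / ((n : ℝ) + 2)) atTop (𝓝 0) :=
          tendsto_const_nhds.div_atTop (tendsto_natCast_atTop_atTop.atTop_add tendsto_const_nhds)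
        have h2 : Tendsto (fun n : ℕ => z₀ + ((r / ((n : ℝ) + 2) : ℝ) : ℂ)) atTop
            (𝓝 (z₀ + ((0 : ℝ) : ℂ))) :=
          tendsto_const_nhds.add ((Complex.continuous_ofReal.tendsto 0).comp h1)
        simpa [s] using h2
      · have h3 : ((r / (n + 2) : ℝ) : ℂ) = 0 := by simpa [s] using hn
        exact (hsn n).1.ne' (by exact_mod_cast h3)
    refine aestronglyMeasurable_of_tendsto_ae atTop
      (f := fun n t => slope (f t) z₀ (s n)) (fun n => ?_) ?_
    · simp only [slope_def_field]
      exact ((hmeas _ (hs n)).sub (hmeas z₀ h0)).mul_const (s n - z₀)⁻¹ |>.congr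
        (Eventually.of_forall fun t => by simp [div_eq_mul_inv])
    · rw [hI]
      refine (MeasureTheory.ae_restrict_iff' measurableSet_Ioc).2
        (Eventually.of_forall fun t ht => ?_)
      exact ((hdiff t ht z₀ h0).tendsto_slope).comp hlim
  -- Cauchy's estimate on discs of radius `r / 2` turns the bound on the function into one on its
  -- derivative.
  · refine Eventually.of_forall fun t ht z hz => ?_
    rw [hI] at ht
    have hsub : Metric.closedBall z (r / 2) ⊆ Metric.ball z₀ r := by
      intro w hw
      rw [Metric.mem_closedBall] at hw
      rw [Metric.mem_ball] at hz ⊢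
      linarith [dist_triangle w z z₀]
    refine Complex.norm_deriv_le_of_forall_mem_sphere_norm_le hr2 ?_ fun w hw =>
      hb w (hsub (Metric.sphere_subset_closedBall hw)) t ht
    exact DifferentiableOn.diffContOnCl
      ((hd t ht).mono (Metric.closure_ball_subset_closedBall.trans hsub))
  · refine Eventually.of_forall fun t ht z hz => ?_
    rw [hI] at ht
    exact hdiff t ht z (hball hz)

/-- A dominated integral of analytic functions of two variables is analytic. -/
theorem analyticAt_integral_of_dominated {f : ℝ → ℂ × ℂ → ℂ} {U : Set (ℂ × ℂ)} (hU : IsOpen U)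
    (hd : ∀ t ∈ Set.Ioc (0 : ℝ) 1, ∀ p ∈ U, AnalyticAt ℂ (f t) p)
    (hc : ∀ p ∈ U, ContinuousOn (fun t => f t p) (Set.Ioc 0 1))
    (hb : ∀ p ∈ U, ∃ g : ℝ → ℝ, IntervalIntegrable g MeasureTheory.volume 0 1 ∧
      ∀ᶠ q in 𝓝 p, ∀ t ∈ Set.Ioc (0 : ℝ) 1, ‖f t q‖ ≤ g t) {p : ℂ × ℂ} (hp : p ∈ U) :
    AnalyticAt ℂ (fun q => ∫ t in (0 : ℝ)..1, f t q) p := by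
  have hI : Set.uIoc (0 : ℝ) 1 = Set.Ioc 0 1 := Set.uIoc_of_le zero_le_one
  refine analyticAt_of_separately hU (fun p hp => ContinuousAt.continuousWithinAt ?_) ?_ ?_ hp
  · obtain ⟨g, hg, hgb⟩ := hb p hp
    refine intervalIntegral.continuousAt_of_dominated_interval (bound := g) ?_ ?_ hg ?_
    · filter_upwards [hU.mem_nhds hp] with q hq
      rw [hI]
      exact (hc q hq).aestronglyMeasurable measurableSet_Ioc
    · filter_upwards [hgb] with q hq
      rw [hI]
      exact Eventually.of_forall fun t ht => hq t ht
    · rw [hI]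
      exact Eventually.of_forall fun t ht => (hd t ht p hp).continuousAt
  all_goals
    intro p hp
    obtain ⟨g, hg, hgb⟩ := hb p hp
    obtain ⟨r, hr, hball⟩ := Metric.eventually_nhds_iff_ball.1 (hgb.and (hU.mem_nhds hp))
  · have hm : ∀ z ∈ Metric.ball p.1 r, (z, p.2) ∈ Metric.ball p r := fun z hz => by
      rw [Metric.mem_ball, Prod.dist_eq]
      simpa [hr] using hz
    refine (hasDerivAt_integral_of_dominated (f := fun t z => f t (z, p.2)) hr
      (fun t ht z hz => ?_) (fun z hz => hc _ (hball _ (hm z hz)).2) hg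
      (fun z hz t ht => (hball _ (hm z hz)).1 t ht)).differentiableAt
    have h1 : DifferentiableAt ℂ (fun z : ℂ => (z, p.2)) z := by fun_prop
    exact ((hd t ht _ (hball _ (hm z hz)).2).differentiableAt.comp z h1).differentiableWithinAt
  · have hm : ∀ z ∈ Metric.ball p.2 r, (p.1, z) ∈ Metric.ball p r := fun z hz => by
      rw [Metric.mem_ball, Prod.dist_eq]
      simpa [hr] using hz
    refine (hasDerivAt_integral_of_dominated (f := fun t z => f t (p.1, z)) hr
      (fun t ht z hz => ?_) (fun z hz => hc _ (hball _ (hm z hz)).2) hg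
      (fun z hz t ht => (hball _ (hm z hz)).1 t ht)).differentiableAt
    have h1 : DifferentiableAt ℂ (fun z : ℂ => (p.1, z)) z := by fun_prop
    exact ((hd t ht _ (hball _ (hm z hz)).2).differentiableAt.comp z h1).differentiableWithinAt

end
end GenHyperlog

namespace GenHyperlog
noncomputable section

/-! ### Bounds for hyperlogarithms at the origin -/

/-- Any power of the logarithm is dominated by a small negative power of `‖z‖`. The exponent `1/4`
leaves room below the decay `‖z‖^(1/2)` of the words that are not powers of the letter `0`. -/
theorem exists_norm_log_pow_le (k : ℕ) :
    ∃ C : ℝ, 0 ≤ C ∧ ∀ z : ℂ, z ≠ 0 → ‖z‖ ≤ 1 → ‖Complex.log z ^ k‖ ≤ C * ‖z‖ ^ (-(1 / 4) : ℝ) := by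
  have hk : (0 : ℝ) < 4 * (k + 1) := by positivity
  refine ⟨(4 * (k + 1) + Real.pi) ^ k, by positivity, fun z hz hz1 => ?_⟩
  have hx : 0 < ‖z‖ := norm_pos_iff.2 hz
  set x := ‖z‖ with hxdef
  -- Each factor of the logarithm costs `x ^ (-s)`, so that `k` factors cost at most `x ^ (-1/4)`;
  -- `k + 1` avoids a zero denominator.
  set s : ℝ := 1 / (4 * (k + 1)) with hs
  have hs0 : 0 < s := by positivity
  have h1 : |Real.log x| ≤ 4 * (k + 1) * x ^ (-s) := by
    have h2 := Real.abs_log_mul_self_rpow_lt x s hx hz1 hs0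
    rw [abs_mul, abs_of_pos (Real.rpow_pos_of_pos hx s)] at h2
    rw [Real.rpow_neg hx.le, ← div_eq_mul_inv, le_div_iff₀ (Real.rpow_pos_of_pos hx s)]
    refine h2.le.trans (le_of_eq ?_)
    rw [hs, one_div_one_div]
  have h3 : 1 ≤ x ^ (-s) := Real.one_le_rpow_of_pos_of_le_one_of_nonpos hx hz1 (by linarith)
  have h4 : ‖Complex.log z‖ ≤ (4 * (k + 1) + Real.pi) * x ^ (-s) := by
    have h5 : ‖Complex.log z‖ ≤ |Real.log x| + Real.pi := by
      refine (Complex.norm_le_abs_re_add_abs_im _).trans ?_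
      rw [Complex.log_re, Complex.log_im]
      exact add_le_add le_rfl (Complex.abs_arg_le_pi z)
    nlinarith [Real.pi_pos]
  rw [norm_pow]
  refine (pow_le_pow_left₀ (norm_nonneg _) h4 k).trans ?_
  rw [mul_pow, ← Real.rpow_natCast (x ^ (-s)), ← Real.rpow_mul hx.le]
  refine mul_le_mul_of_nonneg_left ?_ (by positivity)
  refine Real.rpow_le_rpow_of_exponent_ge hx hz1 ?_
  have : s * k ≤ 1 / 4 := by
    rw [hs, one_div, inv_mul_le_iff₀ hk]
    linarith
  linarith

theorem hyperlogRev_of_forall_eq_zero {u : List ℂ} (h : ∀ a ∈ u, a = 0) (z : ℂ) :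
    hyperlogRev u z = Complex.log z ^ u.length / (u.length.factorial : ℂ) := by
  cases u with
  | nil => simp [hyperlogRev]
  | cons a u =>
    rw [hyperlogRev, if_pos h]
    rfl

theorem hyperlogRev_of_not_forall {a : ℂ} {u : List ℂ} (h : ¬ ∀ b ∈ a :: u, b = 0) (z : ℂ) :
    hyperlogRev (a :: u) z =
      ∫ t in (0 : ℝ)..1, z * hyperlogRev u ((t : ℂ) * z) / ((t : ℂ) * z - a) := by
  rw [hyperlogRev, if_neg h]

/-- The growth of the hyperlogarithm of a reversed word at the origin. -/
def GrowthBound (C : ℝ) (u : List ℂ) (z : ℂ) : Prop :=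
  ((∀ a ∈ u, a = 0) → ‖hyperlogRev u z‖ ≤ C * ‖z‖ ^ (-(1 / 4) : ℝ)) ∧
    ((¬ ∀ a ∈ u, a = 0) → ‖hyperlogRev u z‖ ≤ C * ‖z‖ ^ ((1 / 2) : ℝ))

/-- A letter that is zero, or bounded from below by `ρ` and far away from `z`. -/
def FarLetter (ρ : ℝ) (z a : ℂ) : Prop := a = 0 ∨ (ρ ≤ ‖a‖ ∧ 2 * ‖z‖ ≤ ‖a‖)

theorem FarLetter.mul {ρ : ℝ} {z a : ℂ} (h : FarLetter ρ z a) {t : ℝ} (ht : t ∈ Set.Ioc (0 : ℝ) 1) :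
    FarLetter ρ (t * z) a := by
  refine h.imp_right fun h => ⟨h.1, ?_⟩
  rw [norm_mul, Complex.norm_real, Real.norm_of_nonneg ht.1.le]
  nlinarith [ht.2, norm_nonneg z, h.2]

/-- If the letter is `0`, the remaining word is not a power of `0`, and its decay `‖t z‖^(1/2)`
compensates part of the pole. If the letter is nonzero, the denominator is at least `ρ / 2`, and
even a growth of `‖t z‖^(-1/2)` is integrable. Either way the singularity in `t` is at worst
`t^(-1/2)`. -/
theorem norm_integrand_le {C ρ : ℝ} (hC : 0 ≤ C) (hρ : 0 < ρ) {u : List ℂ} {a z : ℂ} {t : ℝ}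
    (ht : t ∈ Set.Ioc (0 : ℝ) 1) (hu : GrowthBound C u (t * z)) (hz : z ≠ 0) (hz1 : ‖z‖ ≤ 1)
    (ha : FarLetter ρ z a) (h : ¬ ∀ b ∈ a :: u, b = 0) :
    ‖z * hyperlogRev u ((t : ℂ) * z) / ((t : ℂ) * z - a)‖ ≤
      C * (1 + 2 / ρ) * ‖z‖ ^ ((1 / 2) : ℝ) * t ^ (-(1 / 2) : ℝ) := by
  have hx : 0 < ‖z‖ := norm_pos_iff.2 hz
  have ht0 := ht.1
  have htz : ‖(t : ℂ) * z‖ = t * ‖z‖ := by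
    rw [norm_mul, Complex.norm_real, Real.norm_of_nonneg ht0.le]
  have htx : 0 < t * ‖z‖ := mul_pos ht0 hx
  have htx1 : t * ‖z‖ ≤ 1 := by nlinarith [ht.2]
  have e1 : (0 : ℝ) < ‖z‖ ^ ((1 / 2) : ℝ) := Real.rpow_pos_of_pos hx _
  have e2 : (0 : ℝ) < t ^ (-(1 / 2) : ℝ) := Real.rpow_pos_of_pos ht0 _
  rw [norm_div, norm_mul]
  unfold GrowthBound at hu
  rw [htz] at hu
  rcases eq_or_ne a 0 with rfl | ha0
  · have hu' : ¬ ∀ b ∈ u, b = 0 := fun h' => h (by simpa using h')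
    have h1 := hu.2 hu'
    rw [sub_zero, htz, div_le_iff₀ htx]
    have e3 : (t * ‖z‖) ^ ((1 / 2) : ℝ) = t ^ (-(1 / 2) : ℝ) * t * ‖z‖ ^ ((1 / 2) : ℝ) := by
      rw [Real.mul_rpow ht0.le hx.le]
      congr 1
      rw [← Real.rpow_add_one ht0.ne']
      norm_num
    rw [e3] at h1
    calc ‖z‖ * ‖hyperlogRev u ((t : ℂ) * z)‖
        ≤ ‖z‖ * (C * (t ^ (-(1 / 2) : ℝ) * t * ‖z‖ ^ ((1 / 2) : ℝ))) := by gcongr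
      _ ≤ ‖z‖ * (C * (1 + 2 / ρ) * (t ^ (-(1 / 2) : ℝ) * t * ‖z‖ ^ ((1 / 2) : ℝ))) := by
          gcongr
          have : 0 ≤ 2 / ρ := by positivity
          nlinarith
      _ = _ := by ring
  · obtain ⟨h1, h2⟩ := ha.resolve_left ha0
    have h3 : ρ / 2 ≤ ‖(t : ℂ) * z - a‖ := by
      have h4 := norm_sub_norm_le a ((t : ℂ) * z)
      rw [htz, norm_sub_rev] at h4
      nlinarith [ht.2]
    have h5 : ‖hyperlogRev u ((t : ℂ) * z)‖ ≤ C * (t * ‖z‖) ^ (-(1 / 2) : ℝ) := by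
      by_cases hu0 : ∀ b ∈ u, b = 0
      · refine (hu.1 hu0).trans (mul_le_mul_of_nonneg_left ?_ hC)
        exact Real.rpow_le_rpow_of_exponent_ge htx htx1 (by norm_num)
      · refine (hu.2 hu0).trans (mul_le_mul_of_nonneg_left ?_ hC)
        exact Real.rpow_le_rpow_of_exponent_ge htx htx1 (by norm_num)
    have e4 : ‖z‖ * (t * ‖z‖) ^ (-(1 / 2) : ℝ) = ‖z‖ ^ ((1 / 2) : ℝ) * t ^ (-(1 / 2) : ℝ) := by
      rw [Real.mul_rpow ht0.le hx.le, mul_left_comm, mul_comm]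
      congr 1
      rw [mul_comm, ← Real.rpow_add_one hx.ne']
      norm_num
    have h6 : 0 < ‖(t : ℂ) * z - a‖ := lt_of_lt_of_le (by positivity) h3
    rw [div_le_iff₀ h6]
    calc ‖z‖ * ‖hyperlogRev u ((t : ℂ) * z)‖ ≤ ‖z‖ * (C * (t * ‖z‖) ^ (-(1 / 2) : ℝ)) := by gcongr
      _ = C * (‖z‖ * (t * ‖z‖) ^ (-(1 / 2) : ℝ)) := by ring
      _ = C * (2 / ρ) * ‖z‖ ^ ((1 / 2) : ℝ) * t ^ (-(1 / 2) : ℝ) * (ρ / 2) := by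
          rw [e4]
          field_simp
      _ ≤ C * (1 + 2 / ρ) * ‖z‖ ^ ((1 / 2) : ℝ) * t ^ (-(1 / 2) : ℝ) * ‖(t : ℂ) * z - a‖ := by
          gcongr
          linarith

theorem intervalIntegrable_rpow_neg_half :
    IntervalIntegrable (fun t : ℝ => t ^ (-(1 / 2) : ℝ)) MeasureTheory.volume 0 1 :=
  intervalIntegral.intervalIntegrable_rpow' (by norm_num)

/-- The constant depends only on the length of the word and on the lower bound for the nonzero
letters, which makes the estimate uniform when the letters move with `ζ`. The induction step
integrates `norm_integrand_le`; the factor `2` is `∫₀¹ t^(-1/2) dt`. -/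
theorem exists_growthBound (n : ℕ) {ρ : ℝ} (hρ : 0 < ρ) :
    ∃ C : ℝ, 0 ≤ C ∧ ∀ u : List ℂ, u.length = n → ∀ z : ℂ, z ≠ 0 → ‖z‖ ≤ 1 →
      (∀ a ∈ u, FarLetter ρ z a) → GrowthBound C u z := by
  induction n with
  | zero =>
    refine ⟨1, zero_le_one, fun u hu z hz hz1 _ => ?_⟩
    rw [List.length_eq_zero_iff] at hu
    subst hu
    refine ⟨fun _ => ?_, fun h => absurd (by simp) h⟩
    rw [hyperlogRev, norm_one, one_mul]
    exact Real.one_le_rpow_of_pos_of_le_one_of_nonpos (norm_pos_iff.2 hz) hz1 (by norm_num)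
  | succ n ih =>
    obtain ⟨C, hC, H⟩ := ih
    obtain ⟨C', hC', H'⟩ := exists_norm_log_pow_le (n + 1)
    refine ⟨C' + 2 * (C * (1 + 2 / ρ)), by positivity, fun u hu z hz hz1 hfar => ?_⟩
    obtain ⟨a, u, rfl⟩ := List.exists_cons_of_length_eq_add_one hu
    have hx : 0 < ‖z‖ := norm_pos_iff.2 hz
    constructor
    · intro h0
      rw [hyperlogRev_of_forall_eq_zero h0, hu, norm_div, Complex.norm_natCast]
      have h1 : (1 : ℝ) ≤ ((n + 1).factorial : ℝ) := by
        exact_mod_cast Nat.one_le_iff_ne_zero.2 (Nat.factorial_ne_zero _)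
      refine (div_le_self (norm_nonneg _) h1).trans ((H' z hz hz1).trans ?_)
      have : 0 < ‖z‖ ^ (-(1 / 4) : ℝ) := Real.rpow_pos_of_pos hx _
      gcongr
      have : 0 ≤ 2 * (C * (1 + 2 / ρ)) := by positivity
      linarith
    · intro h0
      rw [hyperlogRev_of_not_forall h0]
      have hint : ∫ t in (0 : ℝ)..1, C * (1 + 2 / ρ) * ‖z‖ ^ ((1 / 2) : ℝ) * t ^ (-(1 / 2) : ℝ) =
          2 * (C * (1 + 2 / ρ)) * ‖z‖ ^ ((1 / 2) : ℝ) := by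
        rw [intervalIntegral.integral_const_mul, integral_rpow (Or.inl (by norm_num))]
        norm_num
        ring
      refine (intervalIntegral.norm_integral_le_of_norm_le zero_le_one
        (Eventually.of_forall fun t ht => ?_)
        (intervalIntegrable_rpow_neg_half.const_mul (C * (1 + 2 / ρ) * ‖z‖ ^ ((1 / 2) : ℝ)))).trans ?_
      · have htz : ‖(t : ℂ) * z‖ = t * ‖z‖ := by
          rw [norm_mul, Complex.norm_real, Real.norm_of_nonneg ht.1.le]
        refine norm_integrand_le hC hρ ht (H u (by simpa using hu) _ ?_ ?_ ?_) hz hz1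
          (hfar a (by simp)) h0
        · exact mul_ne_zero (by exact_mod_cast ht.1.ne') hz
        · rw [htz]
          nlinarith [ht.2]
        · exact fun b hb => (hfar b (by simp [hb])).mul ht
      · rw [hint]
        have : 0 < ‖z‖ ^ ((1 / 2) : ℝ) := Real.rpow_pos_of_pos hx _
        gcongr
        linarith

end
end GenHyperlog

namespace GenHyperlog
noncomputable section

/-! ### Hyperlogarithms with variable letters -/

/-- `H_u(z, ζ)`: the hyperlogarithm `L_w(z)` where `w` is the reverse of the word `u`, with its
letters evaluated at `ζ`. -/
def revHyperlog (u : List (ℂ → ℂ)) (p : ℂ × ℂ) : ℂ := hyperlogRev (u.map fun β => β p.2) p.1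

/-- An open domain on which the radial segment from `z = 0` stays in the domain. -/
structure LogDomain (U : Set (ℂ × ℂ)) : Prop where
  isOpen : IsOpen U
  slit : ∀ p ∈ U, p.1 ∈ Complex.slitPlane
  norm_le : ∀ p ∈ U, ‖p.1‖ ≤ 1
  radial : ∀ p ∈ U, ∀ t ∈ Set.Ioc (0 : ℝ) 1, ((t : ℂ) * p.1, p.2) ∈ U

/-- A letter that is analytic on `U`, and zero or far away from `z`. -/
structure LetterOn (U : Set (ℂ × ℂ)) (β : ℂ → ℂ) : Prop where
  analytic : ∀ p ∈ U, AnalyticAt ℂ β p.2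
  far : (∀ p ∈ U, β p.2 = 0) ∨ ∀ p ∈ U, β p.2 ≠ 0 ∧ 2 * ‖p.1‖ ≤ ‖β p.2‖

variable {U : Set (ℂ × ℂ)}

theorem LogDomain.ne_zero (hU : LogDomain U) {p : ℂ × ℂ} (hp : p ∈ U) : p.1 ≠ 0 :=
  Complex.slitPlane_ne_zero (hU.slit p hp)

theorem LetterOn.sub_ne_zero (hU : LogDomain U) {β : ℂ → ℂ} (hβ : LetterOn U β) {p : ℂ × ℂ}
    (hp : p ∈ U) : p.1 - β p.2 ≠ 0 := by
  have hz := hU.ne_zero hp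
  rcases hβ.far with h | h
  · rwa [h p hp, sub_zero]
  · intro h0
    have h1 := (h p hp).2
    rw [← _root_.sub_eq_zero.1 h0] at h1
    linarith [norm_pos_iff.2 hz]

/-- By continuity a nonzero letter stays above half of its modulus at the centre, so one `ρ` serves
for all nearby `ζ` and all admissible `z`. -/
theorem eventually_farLetter {u : List (ℂ → ℂ)} (hu : ∀ β ∈ u, LetterOn U β)
    {p : ℂ × ℂ} (hp : p ∈ U) :
    ∃ ρ : ℝ, 0 < ρ ∧ ∀ᶠ q in 𝓝 p.2, ∀ z, (z, q) ∈ U → ∀ β ∈ u, FarLetter ρ z (β q) := by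
  induction u with
  | nil => exact ⟨1, one_pos, by simp⟩
  | cons β u ih =>
    obtain ⟨ρ, hρ, h⟩ := ih fun γ hγ => hu γ (by simp [hγ])
    have hβ := hu β (by simp)
    have key : ∃ ρ' : ℝ, 0 < ρ' ∧ ∀ᶠ q in 𝓝 p.2, ∀ z, (z, q) ∈ U → FarLetter ρ' z (β q) := by
      rcases hβ.far with h0 | h0
      · exact ⟨1, one_pos, Eventually.of_forall fun q z hq => Or.inl (h0 _ hq)⟩
      · have h1 : 0 < ‖β p.2‖ := norm_pos_iff.2 (h0 p hp).1
        refine ⟨‖β p.2‖ / 2, half_pos h1, ?_⟩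
        have h2 := (hβ.analytic p hp).continuousAt.norm.eventually (lt_mem_nhds (half_lt_self h1))
        filter_upwards [h2] with q hq z hz
        exact Or.inr ⟨hq.le, (h0 _ hz).2⟩
    obtain ⟨ρ', hρ', h'⟩ := key
    refine ⟨min ρ ρ', lt_min hρ hρ', ?_⟩
    filter_upwards [h, h'] with q hq hq' z hz γ hγ
    rcases List.mem_cons.1 hγ with rfl | hγ
    · exact (hq' z hz).imp_right fun h => ⟨(min_le_right _ _).trans h.1, h.2⟩
    · exact (hq z hz γ hγ).imp_right fun h => ⟨(min_le_left _ _).trans h.1, h.2⟩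

theorem eventually_growthBound (hU : LogDomain U) {u : List (ℂ → ℂ)} (hu : ∀ β ∈ u, LetterOn U β)
    {p : ℂ × ℂ} (hp : p ∈ U) :
    ∃ C : ℝ, 0 ≤ C ∧ ∀ᶠ q in 𝓝 p.2, ∀ z, (z, q) ∈ U →
      GrowthBound C (u.map fun β => β q) z := by
  obtain ⟨ρ, hρ, h⟩ := eventually_farLetter hu hp
  obtain ⟨C, hC, H⟩ := exists_growthBound u.length hρ
  refine ⟨C, hC, ?_⟩
  filter_upwards [h] with q hq z hz
  refine H _ (by simp) z (hU.ne_zero hz) (hU.norm_le _ hz) fun a ha => ?_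
  obtain ⟨β, hβ, rfl⟩ := List.mem_map.1 ha
  exact hq z hz β hβ

/-- The dichotomy in `LetterOn.far` fixes over all of `U` which letters are zero, so the case
distinction in `hyperlogRev` does not change from point to point. -/
theorem forall_letters_eq_zero_iff {u : List (ℂ → ℂ)} (hu : ∀ β ∈ u, LetterOn U β) {p q : ℂ × ℂ}
    (hp : p ∈ U) (hq : q ∈ U) :
    (∀ a ∈ u.map (fun β => β p.2), a = 0) ↔ ∀ a ∈ u.map (fun β => β q.2), a = 0 := by
  have key : ∀ {p q : ℂ × ℂ}, p ∈ U → q ∈ U →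
      (∀ a ∈ u.map (fun β => β p.2), a = 0) → ∀ a ∈ u.map (fun β => β q.2), a = 0 := by
    intro p q hp hq h a ha
    obtain ⟨β, hβ, rfl⟩ := List.mem_map.1 ha
    rcases (hu β hβ).far with h0 | h0
    · exact h0 q hq
    · exact absurd (h _ (List.mem_map_of_mem (f := fun β : ℂ → ℂ => β p.2) hβ)) (h0 p hp).1
  exact ⟨key hp hq, key hq hp⟩

theorem revHyperlog_of_zero {u : List (ℂ → ℂ)} {p : ℂ × ℂ}
    (h : ∀ a ∈ u.map (fun β => β p.2), a = 0) :
    revHyperlog u p = Complex.log p.1 ^ u.length / (u.length.factorial : ℂ) := by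
  rw [revHyperlog, hyperlogRev_of_forall_eq_zero h, List.length_map]

theorem revHyperlog_cons_of_not {β : ℂ → ℂ} {u : List (ℂ → ℂ)} {p : ℂ × ℂ}
    (h : ¬ ∀ a ∈ (β :: u).map (fun β => β p.2), a = 0) :
    revHyperlog (β :: u) p = ∫ t in (0 : ℝ)..1,
      p.1 * revHyperlog u ((t : ℂ) * p.1, p.2) / ((t : ℂ) * p.1 - β p.2) := by
  rw [revHyperlog, List.map_cons, hyperlogRev_of_not_forall (by simpa using h)]
  rfl

theorem analyticAt_log_fst {p : ℂ × ℂ} (hp : p.1 ∈ Complex.slitPlane) :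
    AnalyticAt ℂ (fun q : ℂ × ℂ => Complex.log q.1) p :=
  AnalyticAt.clog (f := fun q : ℂ × ℂ => q.1) analyticAt_fst hp

/-- Induction on the word: the integrand is analytic for each `t` in `(0, 1]`, and it is dominated
by a multiple of `t^(-1/2)` locally uniformly in both variables. -/
theorem analyticAt_revHyperlog (hU : LogDomain U) {u : List (ℂ → ℂ)} (hu : ∀ β ∈ u, LetterOn U β)
    {p : ℂ × ℂ} (hp : p ∈ U) : AnalyticAt ℂ (revHyperlog u) p := by
  induction u generalizing p with
  | nil => exact analyticAt_const (v := (1 : ℂ))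
  | cons β u ih =>
    have hβ := hu β (by simp)
    have hu' : ∀ γ ∈ u, LetterOn U γ := fun γ hγ => hu γ (by simp [hγ])
    by_cases h0 : ∀ a ∈ (β :: u).map (fun β => β p.2), a = 0
    · have h1 : AnalyticAt ℂ (fun q : ℂ × ℂ => Complex.log q.1 ^ (β :: u).length /
          ((β :: u).length.factorial : ℂ)) p :=
        ((analyticAt_log_fst (hU.slit p hp)).pow _).div_const
      refine h1.congr ?_
      filter_upwards [hU.isOpen.mem_nhds hp] with q hq
      exact (revHyperlog_of_zero ((forall_letters_eq_zero_iff hu hp hq).1 h0)).symm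
    · have h1 : AnalyticAt ℂ (fun q : ℂ × ℂ => ∫ t in (0 : ℝ)..1,
          q.1 * revHyperlog u ((t : ℂ) * q.1, q.2) / ((t : ℂ) * q.1 - β q.2)) p := by
        refine analyticAt_integral_of_dominated hU.isOpen (fun t ht q hq => ?_) (fun q hq => ?_)
          (fun q hq => ?_) hp
        · have hr := hU.radial q hq t ht
          have h2 : AnalyticAt ℂ (fun q : ℂ × ℂ => revHyperlog u ((t : ℂ) * q.1, q.2)) q := by
            refine AnalyticAt.comp (f := fun q : ℂ × ℂ => ((t : ℂ) * q.1, q.2)) (ih hu' hr) ?_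
            exact (analyticAt_const.mul analyticAt_fst).prod analyticAt_snd
          refine (analyticAt_fst.mul h2).div ?_ (hβ.sub_ne_zero hU hr)
          exact (analyticAt_const.mul analyticAt_fst).sub
            (AnalyticAt.comp (f := fun q : ℂ × ℂ => q.2) (hβ.analytic q hq) analyticAt_snd)
        · intro t ht
          have hr := hU.radial q hq t ht
          have h2 : ContinuousAt (fun t : ℝ => revHyperlog u ((t : ℂ) * q.1, q.2)) t :=
            ContinuousAt.comp (f := fun t : ℝ => ((t : ℂ) * q.1, q.2)) (ih hu' hr).continuousAt
              (by fun_prop)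
          refine ContinuousAt.continuousWithinAt ?_
          exact (continuousAt_const.mul h2).div (by fun_prop) (hβ.sub_ne_zero hU hr)
        · obtain ⟨C, hC, hg⟩ := eventually_growthBound hU hu' hq
          obtain ⟨ρ, hρ, hf⟩ := eventually_farLetter hu hq
          refine ⟨fun t => C * (1 + 2 / ρ) * t ^ (-(1 / 2) : ℝ),
            intervalIntegrable_rpow_neg_half.const_mul _, ?_⟩
          filter_upwards [hU.isOpen.mem_nhds hq, continuousAt_snd.eventually hg,
            continuousAt_snd.eventually hf] with r hr hgr hfr t ht
          have hrad := hU.radial r hr t ht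
          have hn : ¬ ∀ b ∈ β r.2 :: u.map (fun β => β r.2), b = 0 := fun h =>
            h0 ((forall_letters_eq_zero_iff hu hp hr).2 (by simpa using h))
          refine (norm_integrand_le hC hρ ht (hgr _ hrad) (hU.ne_zero hr) (hU.norm_le r hr)
            (hfr r.1 hr β (by simp)) hn).trans ?_
          have h3 : ‖r.1‖ ^ ((1 / 2) : ℝ) ≤ 1 :=
            Real.rpow_le_one (norm_nonneg _) (hU.norm_le r hr) (by norm_num)
          have h4 : 0 ≤ t ^ (-(1 / 2) : ℝ) := Real.rpow_nonneg ht.1.le _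
          refine mul_le_mul_of_nonneg_right (mul_le_of_le_one_right (by positivity) h3) h4
      refine h1.congr ?_
      filter_upwards [hU.isOpen.mem_nhds hp] with q hq
      exact (revHyperlog_cons_of_not
        (fun h => h0 ((forall_letters_eq_zero_iff hu hp hq).2 h))).symm

theorem hasDerivAt_log_pow_div_factorial {z : ℂ} (hz : z ∈ Complex.slitPlane) (n : ℕ) :
    HasDerivAt (fun z => Complex.log z ^ (n + 1) / ((n + 1).factorial : ℂ))
      (Complex.log z ^ n / (n.factorial : ℂ) / z) z := by
  have h := ((Complex.hasDerivAt_log hz).pow (n + 1)).div_const ((n + 1).factorial : ℂ)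
  refine h.congr_deriv ?_
  have h1 : ((n + 1 : ℕ) : ℂ) ≠ 0 := Nat.cast_ne_zero.2 (Nat.succ_ne_zero n)
  have h2 : (n.factorial : ℂ) ≠ 0 := Nat.cast_ne_zero.2 (Nat.factorial_ne_zero n)
  have h3 := Complex.slitPlane_ne_zero hz
  rw [Nat.factorial_succ, Nat.cast_mul, Nat.add_sub_cancel]
  field_simp

theorem eventually_mem_snd {p : ℂ × ℂ} (hU : IsOpen U) (hp : p ∈ U) : ∀ᶠ z in 𝓝 p.2, (p.1, z) ∈ U :=
  (Continuous.continuousAt (f := fun z : ℂ => (p.1, z)) (by fun_prop)).eventually_mem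
    (hU.mem_nhds hp)

theorem _root_.AnalyticAt.differentiableAt_fst {f : ℂ × ℂ → ℂ} {p : ℂ × ℂ} (hf : AnalyticAt ℂ f p) :
    DifferentiableAt ℂ (fun z => f (z, p.2)) p.1 :=
  DifferentiableAt.comp (f := fun z : ℂ => (z, p.2)) p.1 hf.differentiableAt (by fun_prop)

theorem _root_.AnalyticAt.differentiableAt_snd {f : ℂ × ℂ → ℂ} {p : ℂ × ℂ} (hf : AnalyticAt ℂ f p) :
    DifferentiableAt ℂ (fun ζ => f (p.1, ζ)) p.2 :=
  DifferentiableAt.comp (f := fun ζ : ℂ => (p.1, ζ)) p.2 hf.differentiableAt (by fun_prop)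

/-- The differential equation `∂_z L_{wβ} = L_w / (z - β)`. -/
theorem hasDerivAt_revHyperlog_cons (hU : LogDomain U) {β : ℂ → ℂ} {u : List (ℂ → ℂ)}
    (hu : ∀ γ ∈ β :: u, LetterOn U γ) {p : ℂ × ℂ} (hp : p ∈ U) :
    HasDerivAt (fun z => revHyperlog (β :: u) (z, p.2)) (revHyperlog u p / (p.1 - β p.2)) p.1 := by
  have hβ := hu β (by simp)
  have hu' : ∀ γ ∈ u, LetterOn U γ := fun γ hγ => hu γ (by simp [hγ])
  by_cases h0 : ∀ a ∈ (β :: u).map (fun β => β p.2), a = 0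
  · have h1 : ∀ z, revHyperlog (β :: u) (z, p.2) =
        Complex.log z ^ (u.length + 1) / ((u.length + 1).factorial : ℂ) := fun z =>
      revHyperlog_of_zero (p := (z, p.2)) h0
    have h2 : β p.2 = 0 := h0 _ (by simp)
    have h3 : revHyperlog u p = Complex.log p.1 ^ u.length / (u.length.factorial : ℂ) :=
      revHyperlog_of_zero fun a ha => h0 a (by
        rw [List.map_cons]
        exact List.mem_cons_of_mem _ ha)
    simp only [h1, h2, h3, sub_zero]
    exact hasDerivAt_log_pow_div_factorial (hU.slit p hp) u.length
  · have hz := hU.ne_zero hp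
    set F : ℂ → ℂ := fun z => revHyperlog (β :: u) (z, p.2) with hF
    set f : ℝ → ℂ := fun s => p.1 * revHyperlog u ((s : ℂ) * p.1, p.2) / ((s : ℂ) * p.1 - β p.2)
      with hf
    have hFd : HasDerivAt F (deriv F p.1) p.1 :=
      (analyticAt_revHyperlog hU hu hp).differentiableAt_fst.hasDerivAt
    -- Since the function is known to be holomorphic, it suffices to differentiate it along the ray
    -- through `p`. There the substitution `s = r t` moves the dependence on `r` to the upper limit
    -- of integration, and the fundamental theorem of calculus applies.
    have hval : ∀ r : ℝ, 0 < r → F ((r : ℂ) * p.1) = ∫ s in (0 : ℝ)..r, f s := by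
      intro r hr
      have h1 : F ((r : ℂ) * p.1) = ∫ t in (0 : ℝ)..1, (r : ℂ) * f (r * t) := by
        rw [hF]
        simp only
        rw [revHyperlog_cons_of_not (p := ((r : ℂ) * p.1, p.2)) h0]
        refine intervalIntegral.integral_congr fun t _ => ?_
        simp only [hf]
        have e : ((t : ℂ) * ((r : ℂ) * p.1)) = ((r * t : ℝ) : ℂ) * p.1 := by
          push_cast
          ring
        rw [e]
        ring
      rw [h1, intervalIntegral.integral_const_mul,
        intervalIntegral.integral_comp_mul_left f hr.ne', mul_zero, mul_one, Complex.real_smul,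
        Complex.ofReal_inv, mul_inv_cancel_left₀ (by exact_mod_cast hr.ne')]
    have hcont : ∀ s : ℝ, ((s : ℂ) * p.1, p.2) ∈ U → ContinuousAt f s := by
      intro s hs
      have h2 : ContinuousAt (fun t : ℝ => revHyperlog u ((t : ℂ) * p.1, p.2)) s :=
        ContinuousAt.comp (f := fun t : ℝ => ((t : ℂ) * p.1, p.2))
          (analyticAt_revHyperlog hU hu' hs).continuousAt (by fun_prop)
      exact (continuousAt_const.mul h2).div (by fun_prop) (hβ.sub_ne_zero hU hs)
    have hopen : IsOpen {s : ℝ | ((s : ℂ) * p.1, p.2) ∈ U} :=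
      hU.isOpen.preimage (by fun_prop)
    have h1U : (1 : ℝ) ∈ {s : ℝ | ((s : ℂ) * p.1, p.2) ∈ U} := by simpa using hp
    have hcon : ContinuousOn f {s : ℝ | ((s : ℂ) * p.1, p.2) ∈ U} := fun s hs =>
      (hcont s hs).continuousWithinAt
    have hint : IntervalIntegrable f MeasureTheory.volume 0 1 := by
      obtain ⟨C, hC, hg⟩ := eventually_growthBound hU hu' hp
      obtain ⟨ρ, hρ, hfar⟩ := eventually_farLetter hu hp
      refine (intervalIntegrable_rpow_neg_half.const_mul
        (C * (1 + 2 / ρ) * ‖p.1‖ ^ ((1 / 2) : ℝ))).mono_fun ?_ ?_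
      · rw [Set.uIoc_of_le zero_le_one]
        exact (hcon.mono fun s hs => hU.radial p hp s hs).aestronglyMeasurable measurableSet_Ioc
      · rw [Set.uIoc_of_le zero_le_one]
        refine (MeasureTheory.ae_restrict_iff' measurableSet_Ioc).2
          (Eventually.of_forall fun t ht => ?_)
        refine (norm_integrand_le hC hρ ht (hg.self_of_nhds _ (hU.radial p hp t ht)) hz
          (hU.norm_le p hp) (hfar.self_of_nhds p.1 hp β (by simp)) (by simpa using h0)).trans ?_
        exact le_abs_self _
    have hd1 : HasDerivAt (fun r : ℝ => ∫ s in (0 : ℝ)..r, f s) (f 1) 1 :=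
      intervalIntegral.integral_hasDerivAt_right hint
        (hcon.stronglyMeasurableAtFilter hopen 1 h1U) (hcont 1 h1U)
    have hd2 : HasDerivAt (fun r : ℝ => F ((r : ℂ) * p.1)) (deriv F p.1 * p.1) 1 := by
      have h3 : HasDerivAt (fun w : ℂ => w * p.1) p.1 ((1 : ℝ) : ℂ) := by
        simpa using (hasDerivAt_id ((1 : ℝ) : ℂ)).mul_const p.1
      have h4 : HasDerivAt F (deriv F p.1) (((1 : ℝ) : ℂ) * p.1) := by simpa using hFd
      exact (h4.comp ((1 : ℝ) : ℂ) h3).comp_ofReal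
    have hd3 : HasDerivAt (fun r : ℝ => F ((r : ℂ) * p.1)) (f 1) 1 := by
      refine hd1.congr_of_eventuallyEq ?_
      filter_upwards [lt_mem_nhds (zero_lt_one (α := ℝ))] with r hr using hval r hr
    have h5 := hd2.unique hd3
    have h6 : deriv F p.1 = revHyperlog u p / (p.1 - β p.2) := by
      have h7 : f 1 = revHyperlog u p / (p.1 - β p.2) * p.1 := by
        simp only [hf, Complex.ofReal_one, one_mul, Prod.mk.eta]
        ring
      rw [h7] at h5
      exact mul_right_cancel₀ hz h5
    rw [← h6]
    exact hFd

end
end GenHyperlog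

namespace GenHyperlog
noncomputable section

/-! ### Partial derivatives -/

/-- The partial derivative in the first variable. -/
def pdz (f : ℂ × ℂ → ℂ) (p : ℂ × ℂ) : ℂ := deriv (fun z => f (z, p.2)) p.1

/-- The partial derivative in the second variable. -/
def pdζ (f : ℂ × ℂ → ℂ) (p : ℂ × ℂ) : ℂ := deriv (fun ζ => f (p.1, ζ)) p.2

variable {f g : ℂ × ℂ → ℂ} {p : ℂ × ℂ}

theorem hasDerivAt_pdz (hf : AnalyticAt ℂ f p) : HasDerivAt (fun z => f (z, p.2)) (pdz f p) p.1 :=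
  hf.differentiableAt_fst.hasDerivAt

theorem hasDerivAt_pdζ (hf : AnalyticAt ℂ f p) : HasDerivAt (fun ζ => f (p.1, ζ)) (pdζ f p) p.2 :=
  hf.differentiableAt_snd.hasDerivAt

theorem hasDerivAt_prodMk_left (p : ℂ × ℂ) : HasDerivAt (fun z : ℂ => (z, p.2)) (1, 0) p.1 :=
  (hasDerivAt_id p.1).prodMk (hasDerivAt_const _ _)

theorem hasDerivAt_prodMk_right (p : ℂ × ℂ) : HasDerivAt (fun ζ : ℂ => (p.1, ζ)) (0, 1) p.2 :=
  (hasDerivAt_const _ _).prodMk (hasDerivAt_id p.2)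

theorem pdz_eq_fderiv (hf : DifferentiableAt ℂ f p) : pdz f p = fderiv ℂ f p (1, 0) :=
  (HasFDerivAt.comp_hasDerivAt (f := fun z : ℂ => (z, p.2)) p.1 hf.hasFDerivAt
    (hasDerivAt_prodMk_left p)).deriv

theorem pdζ_eq_fderiv (hf : DifferentiableAt ℂ f p) : pdζ f p = fderiv ℂ f p (0, 1) :=
  (HasFDerivAt.comp_hasDerivAt (f := fun ζ : ℂ => (p.1, ζ)) p.2 hf.hasFDerivAt
    (hasDerivAt_prodMk_right p)).deriv

theorem pdz_eventuallyEq (hf : AnalyticAt ℂ f p) : pdz f =ᶠ[𝓝 p] fun q => fderiv ℂ f q (1, 0) := by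
  filter_upwards [hf.eventually_analyticAt] with q hq using pdz_eq_fderiv hq.differentiableAt

theorem pdζ_eventuallyEq (hf : AnalyticAt ℂ f p) : pdζ f =ᶠ[𝓝 p] fun q => fderiv ℂ f q (0, 1) := by
  filter_upwards [hf.eventually_analyticAt] with q hq using pdζ_eq_fderiv hq.differentiableAt

theorem _root_.AnalyticAt.pdz (hf : AnalyticAt ℂ f p) : AnalyticAt ℂ (pdz f) p :=
  (((ContinuousLinearMap.apply ℂ ℂ ((1, 0) : ℂ × ℂ)).analyticAt _).comp hf.fderiv).congr
    (pdz_eventuallyEq hf).symm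

theorem _root_.AnalyticAt.pdζ (hf : AnalyticAt ℂ f p) : AnalyticAt ℂ (pdζ f) p :=
  (((ContinuousLinearMap.apply ℂ ℂ ((0, 1) : ℂ × ℂ)).analyticAt _).comp hf.fderiv).congr
    (pdζ_eventuallyEq hf).symm

theorem eventually_prodMk_left {P : ℂ × ℂ → Prop} (h : ∀ᶠ q in 𝓝 p, P q) :
    ∀ᶠ z in 𝓝 p.1, P (z, p.2) :=
  (Continuous.continuousAt (f := fun z : ℂ => (z, p.2)) (by fun_prop)).eventually h

theorem eventually_prodMk_right {P : ℂ × ℂ → Prop} (h : ∀ᶠ q in 𝓝 p, P q) :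
    ∀ᶠ ζ in 𝓝 p.2, P (p.1, ζ) :=
  (Continuous.continuousAt (f := fun ζ : ℂ => (p.1, ζ)) (by fun_prop)).eventually h

theorem pdz_congr (h : f =ᶠ[𝓝 p] g) : pdz f p = pdz g p :=
  EventuallyEq.deriv_eq (eventually_prodMk_left h)

theorem pdζ_congr (h : f =ᶠ[𝓝 p] g) : pdζ f p = pdζ g p :=
  EventuallyEq.deriv_eq (eventually_prodMk_right h)

theorem pdz_pdζ_comm (hf : AnalyticAt ℂ f p) : pdz (pdζ f) p = pdζ (pdz f) p := by
  have hs : IsSymmSndFDerivAt ℂ f p :=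
    (hf.contDiffAt (n := 2)).isSymmSndFDerivAt (by simp)
  have hd := hf.fderiv.differentiableAt
  have h1 : ∀ v w : ℂ × ℂ, fderiv ℂ (fun q => fderiv ℂ f q v) p w = fderiv ℂ (fderiv ℂ f) p w v := by
    intro v w
    rw [fderiv_clm_apply hd (differentiableAt_const _)]
    simp
  rw [pdz_congr (pdζ_eventuallyEq hf), pdζ_congr (pdz_eventuallyEq hf),
    pdz_eq_fderiv ((pdζ_eventuallyEq hf).differentiableAt_iff.1 hf.pdζ.differentiableAt),
    pdζ_eq_fderiv ((pdz_eventuallyEq hf).differentiableAt_iff.1 hf.pdz.differentiableAt), h1, h1]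
  exact hs _ _

theorem pdz_add (hf : AnalyticAt ℂ f p) (hg : AnalyticAt ℂ g p) :
    pdz (fun q => f q + g q) p = pdz f p + pdz g p :=
  ((hasDerivAt_pdz hf).add (hasDerivAt_pdz hg)).deriv

theorem pdζ_add (hf : AnalyticAt ℂ f p) (hg : AnalyticAt ℂ g p) :
    pdζ (fun q => f q + g q) p = pdζ f p + pdζ g p :=
  ((hasDerivAt_pdζ hf).add (hasDerivAt_pdζ hg)).deriv

theorem pdz_sub (hf : AnalyticAt ℂ f p) (hg : AnalyticAt ℂ g p) :
    pdz (fun q => f q - g q) p = pdz f p - pdz g p :=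
  ((hasDerivAt_pdz hf).sub (hasDerivAt_pdz hg)).deriv

theorem pdζ_sub (hf : AnalyticAt ℂ f p) (hg : AnalyticAt ℂ g p) :
    pdζ (fun q => f q - g q) p = pdζ f p - pdζ g p :=
  ((hasDerivAt_pdζ hf).sub (hasDerivAt_pdζ hg)).deriv

theorem pdz_mul (hf : AnalyticAt ℂ f p) (hg : AnalyticAt ℂ g p) :
    pdz (fun q => f q * g q) p = pdz f p * g p + f p * pdz g p :=
  ((hasDerivAt_pdz hf).mul (hasDerivAt_pdz hg)).deriv

theorem pdζ_mul (hf : AnalyticAt ℂ f p) (hg : AnalyticAt ℂ g p) :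
    pdζ (fun q => f q * g q) p = pdζ f p * g p + f p * pdζ g p :=
  ((hasDerivAt_pdζ hf).mul (hasDerivAt_pdζ hg)).deriv

/-! ### Regularized values at the origin -/

/-- A function of `t` that tends to `0` faster than any power of the logarithm of `t z`. -/
def LogSmall (z : ℂ) (φ : ℝ → ℂ) : Prop :=
  ∀ k : ℕ, Tendsto (fun t : ℝ => φ t * Complex.log (t * z) ^ k) (𝓝[>] 0) (𝓝 0)

theorem LogSmall.zero (z : ℂ) : LogSmall z fun _ => 0 := fun k => by simp

theorem LogSmall.congr {z : ℂ} {φ ψ : ℝ → ℂ} (h : LogSmall z φ) (e : ∀ᶠ t in 𝓝[>] 0, φ t = ψ t) :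
    LogSmall z ψ := fun k => by
  refine (h k).congr' ?_
  filter_upwards [e] with t ht
  rw [ht]

theorem LogSmall.add {z : ℂ} {φ ψ : ℝ → ℂ} (hφ : LogSmall z φ) (hψ : LogSmall z ψ) :
    LogSmall z fun t => φ t + ψ t := fun k => by
  simpa [add_mul] using (hφ k).add (hψ k)

theorem LogSmall.const_mul {z : ℂ} {φ : ℝ → ℂ} (hφ : LogSmall z φ) (c : ℂ) :
    LogSmall z fun t => c * φ t := fun k => by
  simpa [mul_assoc] using (hφ k).const_mul c

theorem LogSmall.mul {z : ℂ} {φ ψ : ℝ → ℂ} (hφ : LogSmall z φ) (hψ : LogSmall z ψ) :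
    LogSmall z fun t => φ t * ψ t := fun k => by
  simpa [mul_assoc] using (hφ 0).mul (hψ k)

theorem LogSmall.mul_eval {z : ℂ} {φ : ℝ → ℂ} (hφ : LogSmall z φ) (P : Polynomial ℂ) :
    LogSmall z fun t => φ t * P.eval (Complex.log (t * z)) := by
  induction P using Polynomial.induction_on' with
  | add P Q hP hQ =>
    exact (hP.add hQ).congr (Eventually.of_forall fun t => by rw [Polynomial.eval_add, mul_add])
  | monomial n a =>
    intro k
    have h := (hφ (n + k)).const_mul a
    rw [mul_zero] at h
    refine h.congr fun t => ?_
    simp only [Polynomial.eval_monomial]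
    ring

/-- The decay `t^(1/2)` beats the growth `t^(-1/4)` of any power of the logarithm and leaves
`t^(1/4)`. -/
theorem LogSmall.of_norm_le {z : ℂ} (hz : z ≠ 0) (hz1 : ‖z‖ ≤ 1) {φ : ℝ → ℂ} {C : ℝ}
    (h : ∀ᶠ t in 𝓝[>] (0 : ℝ), ‖φ t‖ ≤ C * t ^ ((1 / 2) : ℝ)) : LogSmall z φ := by
  intro k
  obtain ⟨C', hC', hlog⟩ := exists_norm_log_pow_le k
  have hx : 0 < ‖z‖ := norm_pos_iff.2 hz
  have hlim : Tendsto (fun t : ℝ => C * C' * ‖z‖ ^ (-(1 / 4) : ℝ) * t ^ ((1 / 4) : ℝ)) (𝓝[>] 0)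
      (𝓝 0) := by
    have h1 : Tendsto (fun t : ℝ => t ^ ((1 / 4) : ℝ)) (𝓝[>] 0) (𝓝 0) := by
      have h2 : ContinuousAt (fun t : ℝ => t ^ ((1 / 4) : ℝ)) 0 :=
        Real.continuousAt_rpow_const _ _ (Or.inr (by norm_num))
      have h3 := h2.tendsto
      rw [Real.zero_rpow (by norm_num)] at h3
      exact h3.mono_left nhdsWithin_le_nhds
    simpa using h1.const_mul (C * C' * ‖z‖ ^ (-(1 / 4) : ℝ))
  refine squeeze_zero_norm' ?_ hlim
  filter_upwards [h, Ioo_mem_nhdsGT (zero_lt_one (α := ℝ))] with t ht ht01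
  have ht0 := ht01.1
  have htz : ‖(t : ℂ) * z‖ = t * ‖z‖ := by
    rw [norm_mul, Complex.norm_real, Real.norm_of_nonneg ht0.le]
  have h4 := hlog (t * z) (mul_ne_zero (by exact_mod_cast ht0.ne') hz) (by
    rw [htz]
    nlinarith [ht01.2])
  rw [htz, Real.mul_rpow ht0.le hx.le] at h4
  rw [norm_mul]
  have h5 : t ^ ((1 / 2) : ℝ) * t ^ (-(1 / 4) : ℝ) = t ^ ((1 / 4) : ℝ) := by
    rw [← Real.rpow_add ht0]
    norm_num
  calc ‖φ t‖ * ‖Complex.log (t * z) ^ k‖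
      ≤ C * t ^ ((1 / 2) : ℝ) * (C' * (t ^ (-(1 / 4) : ℝ) * ‖z‖ ^ (-(1 / 4) : ℝ))) := by
        refine mul_le_mul ht h4 (norm_nonneg _) ((norm_nonneg _).trans ht)
    _ = C * C' * ‖z‖ ^ (-(1 / 4) : ℝ) * (t ^ ((1 / 2) : ℝ) * t ^ (-(1 / 4) : ℝ)) := by ring
    _ = _ := by rw [h5]

/-- `f` has the logarithmic expansion `P` at `z = 0` on the ray through `p`. -/
def LogExpansion (f : ℂ × ℂ → ℂ) (p : ℂ × ℂ) (P : Polynomial ℂ) : Prop :=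
  LogSmall p.1 fun t => f ((t : ℂ) * p.1, p.2) - P.eval (Complex.log (t * p.1))

theorem LogExpansion.add {P Q : Polynomial ℂ} (hf : LogExpansion f p P) (hg : LogExpansion g p Q) :
    LogExpansion (fun q => f q + g q) p (P + Q) :=
  (LogSmall.add hf hg).congr (Eventually.of_forall fun t => by
    rw [Polynomial.eval_add]
    ring)

/-- The error of the product is the product of the errors plus each error times the other polynomial
in the logarithm. Because of these mixed terms, `LogSmall` asks for decay against all powers of the
logarithm. -/
theorem LogExpansion.mul {P Q : Polynomial ℂ} (hf : LogExpansion f p P) (hg : LogExpansion g p Q) :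
    LogExpansion (fun q => f q * g q) p (P * Q) :=
  (((LogSmall.mul hf hg).add (hf.mul_eval Q)).add (hg.mul_eval P)).congr
    (Eventually.of_forall fun t => by
      rw [Polynomial.eval_mul]
      ring)

theorem LogExpansion.of_snd (c : ℂ → ℂ) (p : ℂ × ℂ) :
    LogExpansion (fun q => c q.2) p (Polynomial.C (c p.2)) :=
  (LogSmall.zero p.1).congr (Eventually.of_forall fun t => by simp)

theorem LogExpansion.sub {P Q : Polynomial ℂ} (hf : LogExpansion f p P) (hg : LogExpansion g p Q) :
    LogExpansion (fun q => f q - g q) p (P - Q) :=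
  (LogSmall.add hf (LogSmall.const_mul hg (-1))).congr (Eventually.of_forall fun t => by
    rw [Polynomial.eval_sub]
    ring)

theorem LogExpansion.congr {P : Polynomial ℂ} (hf : LogExpansion f p P)
    (h : ∀ t ∈ Set.Ioc (0 : ℝ) 1, f ((t : ℂ) * p.1, p.2) = g ((t : ℂ) * p.1, p.2)) :
    LogExpansion g p P :=
  LogSmall.congr hf (by
    filter_upwards [Ioc_mem_nhdsGT (zero_lt_one (α := ℝ))] with t ht
    rw [h t ht])

/-- A function that is differentiable at `z = 0` tends to its value there. -/
theorem LogExpansion.of_differentiableAt (hp : p.1 ≠ 0) (hp1 : ‖p.1‖ ≤ 1)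
    (hf : DifferentiableAt ℂ (fun z => f (z, p.2)) 0) :
    LogExpansion f p (Polynomial.C (f (0, p.2))) := by
  obtain ⟨C, hC⟩ := hf.isBigO_sub.bound
  have hlim : Tendsto (fun t : ℝ => (t : ℂ) * p.1) (𝓝[>] 0) (𝓝 0) := by
    have h1 : ContinuousAt (fun t : ℝ => (t : ℂ) * p.1) 0 := by fun_prop
    have h2 := h1.tendsto
    simp only [Complex.ofReal_zero, zero_mul] at h2
    exact h2.mono_left nhdsWithin_le_nhds
  refine LogSmall.of_norm_le hp hp1 (C := |C|) ?_
  filter_upwards [hlim.eventually hC, Ioo_mem_nhdsGT (zero_lt_one (α := ℝ))] with t ht ht01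
  rw [Polynomial.eval_C]
  refine ht.trans ?_
  rw [sub_zero, norm_mul, Complex.norm_real, Real.norm_of_nonneg ht01.1.le]
  have h3 : t ≤ t ^ ((1 / 2) : ℝ) := by
    conv_lhs => rw [← Real.rpow_one t]
    exact Real.rpow_le_rpow_of_exponent_ge ht01.1 ht01.2.le (by norm_num)
  have h4 : t * ‖p.1‖ ≤ t ^ ((1 / 2) : ℝ) := by nlinarith [ht01.1, norm_nonneg p.1]
  have h5 : 0 ≤ t * ‖p.1‖ := mul_nonneg ht01.1.le (norm_nonneg _)
  exact mul_le_mul (le_abs_self C) h4 h5 (abs_nonneg C)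

variable {U : Set (ℂ × ℂ)}

/-- The domain contains the segment of the ray below each of its points, so constancy along the ray
needs no connectedness of the slices. -/
theorem LogDomain.eq_of_hasDerivAt_zero (hU : LogDomain U)
    (h : ∀ q ∈ U, HasDerivAt (fun z => f (z, q.2)) 0 q.1) (hp : p ∈ U) {t : ℝ} (ht : t ∈ Set.Ioc (0 : ℝ) 1) :
    f ((t : ℂ) * p.1, p.2) = f p := by
  have hd : ∀ s ∈ Set.Icc t 1, HasDerivAt (fun s : ℝ => f ((s : ℂ) * p.1, p.2)) 0 s := by
    intro s hs
    have hs' := hU.radial p hp s ⟨ht.1.trans_le hs.1, hs.2⟩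
    have h1 := h _ hs'
    have h2 : HasDerivAt (fun w : ℂ => w * p.1) p.1 (s : ℂ) := by
      simpa using (hasDerivAt_id (s : ℂ)).mul_const p.1
    have h3 := (HasDerivAt.comp (s : ℂ) (h₂ := fun z => f (z, p.2)) h1 h2).comp_ofReal
    simpa using h3
  have h4 := constant_of_has_deriv_right_zero
    (fun s hs => (hd s hs).continuousAt.continuousWithinAt)
    (fun s hs => (hd s (Set.Ico_subset_Icc_self hs)).hasDerivWithinAt) 1
    (Set.right_mem_Icc.2 ht.2)
  simp only [Complex.ofReal_one, one_mul] at h4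
  exact h4.symm

theorem tendsto_norm_log_mul {z : ℂ} (hz : z ≠ 0) :
    Tendsto (fun t : ℝ => ‖Complex.log (t * z)‖) (𝓝[>] 0) atTop := by
  have h1 : Tendsto (fun t : ℝ => -(Real.log t + Real.log ‖z‖)) (𝓝[>] 0) atTop :=
    tendsto_neg_atBot_atTop.comp
      (tendsto_atBot_add_const_right _ _ Real.tendsto_log_nhdsGT_zero)
  refine tendsto_atTop_mono' _ ?_ h1
  filter_upwards [self_mem_nhdsWithin] with t ht
  have h2 : (Complex.log (t * z)).re = Real.log t + Real.log ‖z‖ := by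
    rw [Complex.log_re, norm_mul, Complex.norm_real, Real.norm_of_nonneg (le_of_lt ht),
      Real.log_mul (ne_of_gt ht) (norm_ne_zero_iff.2 hz)]
  rw [← h2]
  exact (neg_le_abs _).trans (Complex.abs_re_le_norm _)

/-- A function that does not depend on `z` is equal to the constant term of its expansion. -/
theorem LogDomain.eq_coeff_of_hasDerivAt_zero (hU : LogDomain U)
    (h : ∀ q ∈ U, HasDerivAt (fun z => f (z, q.2)) 0 q.1) (hp : p ∈ U) {P : Polynomial ℂ} (hP : LogExpansion f p P) :
    f p = P.coeff 0 ∧ P = Polynomial.C (f p) := by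
  have h1 : Tendsto (fun t : ℝ => P.eval (Complex.log (t * p.1))) (𝓝[>] 0) (𝓝 (f p)) := by
    have h2 := (hP 0).const_sub (f p)
    rw [sub_zero] at h2
    refine h2.congr' ?_
    filter_upwards [Ioc_mem_nhdsGT (zero_lt_one (α := ℝ))] with t ht
    rw [hU.eq_of_hasDerivAt_zero h hp ht]
    ring
  -- A nonconstant polynomial would be unbounded along the logarithm, whereas the values converge.
  have h3 : P.degree ≤ 0 := by
    by_contra hdeg
    have h4 := P.tendsto_norm_atTop (not_le.1 hdeg) (tendsto_norm_log_mul (hU.ne_zero hp))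
    exact not_tendsto_nhds_of_tendsto_atTop h4 _ h1.norm
  have h5 := Polynomial.eq_C_of_degree_le_zero h3
  rw [h5] at h1
  simp only [Polynomial.eval_C] at h1
  have h6 := tendsto_nhds_unique h1 tendsto_const_nhds
  exact ⟨h6, h6 ▸ h5⟩

end
end GenHyperlog

/-! ### Expansions of hyperlogarithms and of their `ζ`-derivatives at the origin -/

namespace GenHyperlog
noncomputable section

variable {U : Set (ℂ × ℂ)} {p : ℂ × ℂ}

theorem logExpansion_revHyperlog_of_not (hU : LogDomain U) {u : List (ℂ → ℂ)}
    (hu : ∀ β ∈ u, LetterOn U β) (hp : p ∈ U) (h : ¬ ∀ a ∈ u.map (fun β => β p.2), a = 0) :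
    LogExpansion (revHyperlog u) p 0 := by
  obtain ⟨C, hC, hg⟩ := eventually_growthBound hU hu hp
  have hg' := hg.self_of_nhds
  refine LogSmall.of_norm_le (hU.ne_zero hp) (hU.norm_le p hp) (C := C) ?_
  filter_upwards [Ioc_mem_nhdsGT (zero_lt_one (α := ℝ))] with t ht
  rw [Polynomial.eval_zero, sub_zero]
  refine ((hg' _ (hU.radial p hp t ht)).2 h).trans ?_
  rw [norm_mul, Complex.norm_real, Real.norm_of_nonneg ht.1.le]
  have := hU.norm_le p hp
  gcongr
  · exact mul_nonneg ht.1.le (norm_nonneg _)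
  · nlinarith [ht.1]

/-- A power of the letter `0` is exactly a monomial in the logarithm, and every other word decays.
The expansion is thus homogeneous of degree equal to the length, and a nonempty word has regularized
value `0`. -/
theorem exists_logExpansion_revHyperlog (hU : LogDomain U) {u : List (ℂ → ℂ)}
    (hu : ∀ β ∈ u, LetterOn U β) (hp : p ∈ U) :
    ∃ c : ℂ, LogExpansion (revHyperlog u) p (Polynomial.C c * Polynomial.X ^ u.length) := by
  by_cases h : ∀ a ∈ u.map (fun β => β p.2), a = 0
  · refine ⟨(u.length.factorial : ℂ)⁻¹, (LogSmall.zero p.1).congr (Eventually.of_forall fun t => ?_)⟩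
    rw [revHyperlog_of_zero (p := ((t : ℂ) * p.1, p.2)) h]
    simp only [Polynomial.eval_mul, Polynomial.eval_C, Polynomial.eval_pow, Polynomial.eval_X]
    ring
  · refine ⟨0, ?_⟩
    rw [Polynomial.C_0, zero_mul]
    exact logExpansion_revHyperlog_of_not hU hu hp h

/-- A power of the letter `0` does not depend on `ζ`. For all other words the decay at the origin is
locally uniform in `ζ`, and Cauchy's estimate in `ζ` transfers it to the derivative. -/
theorem logExpansion_pdζ_revHyperlog (hU : LogDomain U) {u : List (ℂ → ℂ)}
    (hu : ∀ β ∈ u, LetterOn U β) (hp : p ∈ U) : LogExpansion (pdζ (revHyperlog u)) p 0 := by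
  by_cases h : ∀ a ∈ u.map (fun β => β p.2), a = 0
  · refine (LogSmall.zero p.1).congr ?_
    filter_upwards [Ioc_mem_nhdsGT (zero_lt_one (α := ℝ))] with t ht
    have hr := hU.radial p hp t ht
    have h1 : pdζ (revHyperlog u) ((t : ℂ) * p.1, p.2) =
        pdζ (fun q => Complex.log q.1 ^ u.length / (u.length.factorial : ℂ))
          ((t : ℂ) * p.1, p.2) := by
      refine pdζ_congr ?_
      filter_upwards [hU.isOpen.mem_nhds hr] with q hq
      exact revHyperlog_of_zero ((forall_letters_eq_zero_iff hu hp hq).1 h)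
    rw [h1, pdζ]
    simp
  · obtain ⟨C, hC, hg⟩ := eventually_growthBound hU hu hp
    obtain ⟨r, hr, hball⟩ := Metric.eventually_nhds_iff_ball.1
      (hg.and (eventually_mem_snd hU.isOpen hp))
    refine LogSmall.of_norm_le (hU.ne_zero hp) (hU.norm_le p hp) (C := C / (r / 2)) ?_
    filter_upwards [Ioc_mem_nhdsGT (zero_lt_one (α := ℝ))] with t ht
    rw [Polynomial.eval_zero, sub_zero]
    have hmem : ∀ w ∈ Metric.closedBall p.2 (r / 2), ((t : ℂ) * p.1, w) ∈ U ∧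
        GrowthBound C (u.map fun β => β w) (t * p.1) := by
      intro w hw
      have hw' : w ∈ Metric.ball p.2 r := Metric.closedBall_subset_ball (by linarith) hw
      have h1 := hU.radial _ (hball w hw').2 t ht
      exact ⟨h1, (hball w hw').1 _ h1⟩
    have key : ‖pdζ (revHyperlog u) ((t : ℂ) * p.1, p.2)‖ ≤ C * t ^ ((1 / 2) : ℝ) / (r / 2) := by
      refine Complex.norm_deriv_le_of_forall_mem_sphere_norm_le (half_pos hr) ?_ fun w hw => ?_
      · refine DifferentiableOn.diffContOnCl fun w hw => ?_
        have h1 := (hmem w (Metric.closure_ball_subset_closedBall hw)).1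
        exact (analyticAt_revHyperlog hU hu h1).differentiableAt_snd.differentiableWithinAt
      · have h1 := hmem w (Metric.sphere_subset_closedBall hw)
        refine (h1.2.2 fun h2 => h ((forall_letters_eq_zero_iff hu h1.1 hp).1 h2)).trans ?_
        rw [norm_mul, Complex.norm_real, Real.norm_of_nonneg ht.1.le]
        have := hU.norm_le p hp
        gcongr
        · exact mul_nonneg ht.1.le (norm_nonneg _)
        · nlinarith [ht.1]
    refine key.trans (le_of_eq ?_)
    ring

/-! ### The derivative in the letters -/

/-- The logarithmic derivative of the difference of two letters. -/
def logDiff (a b : ℂ → ℂ) (ζ : ℂ) : ℂ := (deriv a ζ - deriv b ζ) / (a ζ - b ζ)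

/-- The terms of the `ζ`-derivative of a reversed word whose coefficients do not depend on `z`. -/
def lowerTerms : List (ℂ → ℂ) → List ((ℂ → ℂ) × List (ℂ → ℂ))
  | [] => []
  | [a] => [(fun ζ => -logDiff a 0 ζ, [])]
  | b :: a :: u => (lowerTerms (a :: u)).map (fun x => (x.1, b :: x.2)) ++
      [(logDiff a b, b :: u), (fun ζ => -logDiff a b ζ, a :: u)]

/-- The linear combination of hyperlogarithms given by a list of terms. -/
def evalTerms (l : List ((ℂ → ℂ) × List (ℂ → ℂ))) (p : ℂ × ℂ) : ℂ :=
  (l.map fun x => x.1 p.2 * revHyperlog x.2 p).sum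

theorem evalTerms_append (l l' : List ((ℂ → ℂ) × List (ℂ → ℂ))) (p : ℂ × ℂ) :
    evalTerms (l ++ l') p = evalTerms l p + evalTerms l' p := by
  simp [evalTerms]

theorem length_of_mem_lowerTerms {u : List (ℂ → ℂ)} {x : (ℂ → ℂ) × List (ℂ → ℂ)}
    (hx : x ∈ lowerTerms u) : x.2.length + 1 = u.length := by
  induction u generalizing x with
  | nil => simp [lowerTerms] at hx
  | cons b u ih =>
    cases u with
    | nil =>
      simp only [lowerTerms, List.mem_singleton] at hx
      simp [hx]
    | cons a u =>
      simp only [lowerTerms, List.mem_append, List.mem_map, List.mem_cons, List.not_mem_nil,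
        or_false] at hx
      rcases hx with ⟨y, hy, rfl⟩ | rfl | rfl
      · simp [← ih hy]
      · simp
      · simp

theorem mem_of_mem_lowerTerms {u : List (ℂ → ℂ)} {x : (ℂ → ℂ) × List (ℂ → ℂ)}
    (hx : x ∈ lowerTerms u) {γ : ℂ → ℂ} (hγ : γ ∈ x.2) : γ ∈ u := by
  induction u generalizing x with
  | nil => simp [lowerTerms] at hx
  | cons b u ih =>
    cases u with
    | nil =>
      simp only [lowerTerms, List.mem_singleton] at hx
      simp [hx] at hγ
    | cons a u =>
      simp only [lowerTerms, List.mem_append, List.mem_map, List.mem_cons, List.not_mem_nil,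
        or_false] at hx
      rcases hx with ⟨y, hy, rfl⟩ | rfl | rfl
      · rcases List.mem_cons.1 hγ with rfl | hγ
        · simp
        · exact List.mem_cons_of_mem _ (ih hy hγ)
      · rcases List.mem_cons.1 hγ with rfl | hγ <;> simp_all
      · exact List.mem_cons_of_mem _ hγ

/-- The choice `b = 0` stands for the base point of the integration and comes from the innermost
letter. This is why `0` is adjoined to the alphabet wherever differences of letters occur. -/
theorem coeff_of_mem_lowerTerms {u : List (ℂ → ℂ)} {x : (ℂ → ℂ) × List (ℂ → ℂ)}
    (hx : x ∈ lowerTerms u) : ∃ a ∈ u, ∃ b, (b = 0 ∨ b ∈ u) ∧ ∃ ε : ℂ,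
      x.1 = fun ζ => ε * logDiff a b ζ := by
  induction u generalizing x with
  | nil => simp [lowerTerms] at hx
  | cons b u ih =>
    cases u with
    | nil =>
      simp only [lowerTerms, List.mem_singleton] at hx
      subst hx
      exact ⟨b, by simp, 0, by simp, -1, by simp⟩
    | cons a u =>
      simp only [lowerTerms, List.mem_append, List.mem_map, List.mem_cons, List.not_mem_nil,
        or_false] at hx
      rcases hx with ⟨y, hy, rfl⟩ | rfl | rfl
      · obtain ⟨c, hc, d, hd, ε, h⟩ := ih hy
        exact ⟨c, List.mem_cons_of_mem _ hc, d, hd.imp_right fun h => List.mem_cons_of_mem _ h, ε, h⟩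
      · exact ⟨a, by simp, b, by simp, 1, by simp⟩
      · exact ⟨a, by simp, b, by simp, -1, by simp⟩

theorem hasDerivAt_evalTerms_cons (hU : LogDomain U) {β : ℂ → ℂ} (hβ : LetterOn U β)
    {l : List ((ℂ → ℂ) × List (ℂ → ℂ))} (hl : ∀ x ∈ l, ∀ γ ∈ x.2, LetterOn U γ) (hp : p ∈ U) :
    HasDerivAt (fun z => evalTerms (l.map fun x => (x.1, β :: x.2)) (z, p.2))
      (evalTerms l p / (p.1 - β p.2)) p.1 := by
  induction l with
  | nil => simpa [evalTerms] using hasDerivAt_const p.1 (0 : ℂ)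
  | cons x l ih =>
    have h1 := (hasDerivAt_revHyperlog_cons hU (β := β) (u := x.2) (fun γ hγ => by
      rcases List.mem_cons.1 hγ with rfl | hγ
      · exact hβ
      · exact hl x (by simp) γ hγ) hp).const_mul (x.1 p.2)
    have h2 := h1.add (ih fun y hy => hl y (by simp [hy]))
    refine (h2.congr_deriv ?_).congr_of_eventuallyEq (Eventually.of_forall fun z => ?_)
    · simp only [evalTerms, List.map_cons, List.sum_cons]
      ring
    · simp [evalTerms]

theorem exists_logExpansion_evalTerms (hU : LogDomain U) {n : ℕ}
    {l : List ((ℂ → ℂ) × List (ℂ → ℂ))} (hl : ∀ x ∈ l, ∀ γ ∈ x.2, LetterOn U γ)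
    (hn : ∀ x ∈ l, x.2.length = n) (hp : p ∈ U) :
    ∃ c : ℂ, LogExpansion (evalTerms l) p (Polynomial.C c * Polynomial.X ^ n) := by
  induction l with
  | nil =>
    refine ⟨0, (LogSmall.zero p.1).congr (Eventually.of_forall fun t => ?_)⟩
    simp [evalTerms]
  | cons x l ih =>
    obtain ⟨c, hc⟩ := ih (fun y hy => hl y (by simp [hy])) (fun y hy => hn y (by simp [hy]))
    obtain ⟨d, hd⟩ := exists_logExpansion_revHyperlog hU (hl x (by simp)) hp
    rw [hn x (by simp)] at hd
    have h1 := ((LogExpansion.of_snd x.1 p).mul hd).add hc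
    refine ⟨x.1 p.2 * d + c, ?_⟩
    have e : Polynomial.C (x.1 p.2 * d + c) * Polynomial.X ^ n =
        Polynomial.C (x.1 p.2) * (Polynomial.C d * Polynomial.X ^ n) +
          Polynomial.C c * Polynomial.X ^ n := by
      rw [Polynomial.C_add, Polynomial.C_mul]
      ring
    rw [e]
    exact h1.congr fun t _ => by simp [evalTerms]

theorem deriv_eq_zero_of_zero_on (hU : LogDomain U) {β : ℂ → ℂ} (h : ∀ p ∈ U, β p.2 = 0)
    (hp : p ∈ U) : deriv β p.2 = 0 := by
  have h1 : β =ᶠ[𝓝 p.2] fun _ => 0 := by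
    filter_upwards [eventually_mem_snd hU.isOpen hp] with q hq using h _ hq
  rw [h1.deriv_eq]
  simp

/-- This partial fraction identity in `z` makes the induction for the `ζ`-equation close. For `x =
y` the quotients by `x - y` take the default value `0`, and the two other terms cancel only if the
derivatives agree; hence the hypothesis `hxy`. -/
theorem logDiff_identity {x y x' y' z : ℂ} (hx : z ≠ x) (hy : z ≠ y) (hxy : x = y → x' = y') :
    x' / (x - z) / (z - y) - (x' - y') / (x - y) / (z - y) + (x' - y') / (x - y) / (z - x)
      - y' / (y - z) / (z - x) = 0 := by
  have h1 : z - x ≠ 0 := sub_ne_zero.2 hx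
  have h2 : z - y ≠ 0 := sub_ne_zero.2 hy
  have h3 : x - z ≠ 0 := sub_ne_zero.2 hx.symm
  have h4 : y - z ≠ 0 := sub_ne_zero.2 hy.symm
  by_cases h : x = y
  · subst h
    rw [hxy rfl]
    simp
  · have h5 : x - y ≠ 0 := sub_ne_zero.2 h
    field_simp
    ring

/-- Interchanging the two derivatives and using the `z`-equation reduces this to the `ζ`-derivative
of the quotient `H_u / (z - a)`. -/
theorem hasDerivAt_pdζ_revHyperlog (hU : LogDomain U) {a : ℂ → ℂ} {u : List (ℂ → ℂ)}
    (hu : ∀ β ∈ a :: u, LetterOn U β) (hp : p ∈ U) :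
    HasDerivAt (fun z => pdζ (revHyperlog (a :: u)) (z, p.2))
      (pdζ (revHyperlog u) p / (p.1 - a p.2) +
        revHyperlog u p * deriv a p.2 / (p.1 - a p.2) ^ 2) p.1 := by
  have ha := hu a (by simp)
  have hu' : ∀ γ ∈ u, LetterOn U γ := fun γ hγ => hu γ (by simp [hγ])
  have hA := analyticAt_revHyperlog hU hu hp
  have h1 := hasDerivAt_pdz hA.pdζ
  refine h1.congr_deriv ?_
  rw [pdz_pdζ_comm hA]
  have h2 : pdz (revHyperlog (a :: u)) =ᶠ[𝓝 p] fun q => revHyperlog u q / (q.1 - a q.2) := by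
    filter_upwards [hU.isOpen.mem_nhds hp] with q hq
    exact (hasDerivAt_revHyperlog_cons hU hu hq).deriv
  rw [pdζ_congr h2]
  have h3 : HasDerivAt (fun ζ => p.1 - a ζ) (-deriv a p.2) p.2 := by
    simpa using (ha.analytic p hp).differentiableAt.hasDerivAt.const_sub p.1
  have h4 := (hasDerivAt_pdζ (analyticAt_revHyperlog hU hu' hp)).fun_div h3 (ha.sub_ne_zero hU hp)
  refine h4.deriv.trans ?_
  have h5 := ha.sub_ne_zero hU hp
  field_simp
  ring

theorem hasDerivAt_kernel_mul (hU : LogDomain U) {a : ℂ → ℂ} {u : List (ℂ → ℂ)}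
    (hu : ∀ β ∈ a :: u, LetterOn U β) (hp : p ∈ U) :
    HasDerivAt (fun z => deriv a p.2 / (a p.2 - z) * revHyperlog u (z, p.2))
      (deriv a p.2 / (p.1 - a p.2) ^ 2 * revHyperlog u p +
        deriv a p.2 / (a p.2 - p.1) * pdz (revHyperlog u) p) p.1 := by
  have ha := hu a (by simp)
  have hu' : ∀ γ ∈ u, LetterOn U γ := fun γ hγ => hu γ (by simp [hγ])
  have h5 : a p.2 - p.1 ≠ 0 := by
    have := ha.sub_ne_zero hU hp
    rwa [← neg_sub, neg_ne_zero]
  have h1 := ((hasDerivAt_const p.1 (deriv a p.2)).fun_div ((hasDerivAt_id p.1).const_sub (a p.2))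
    h5).mul (hasDerivAt_pdz (analyticAt_revHyperlog hU hu' hp))
  refine h1.congr_deriv ?_
  have h6 : (p.1 - a p.2) ^ 2 = (a p.2 - p.1) ^ 2 := by ring
  rw [h6]
  simp

/-- For a nonzero letter the kernel is differentiable at `z = 0`, with value `a' / a`. For a letter
that vanishes on the domain, its derivative vanishes and both sides are `0`. -/
theorem logExpansion_kernel (hU : LogDomain U) {a : ℂ → ℂ} (ha : LetterOn U a) (hp : p ∈ U) :
    LogExpansion (fun q => deriv a q.2 / (a q.2 - q.1)) p (Polynomial.C (logDiff a 0 p.2)) := by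
  rcases ha.far with h | h
  · have h0 := deriv_eq_zero_of_zero_on hU h hp
    have h1 : logDiff a 0 p.2 = 0 := by
      have h2 : deriv (0 : ℂ → ℂ) p.2 = 0 := by simp
      rw [logDiff, h0, h2]
      simp
    rw [h1]
    exact (LogSmall.zero p.1).congr (Eventually.of_forall fun t => by simp [h0])
  · have h1 : logDiff a 0 p.2 = deriv a p.2 / (a p.2 - 0) := by
      have h2 : deriv (0 : ℂ → ℂ) p.2 = 0 := by simp
      rw [logDiff, h2, sub_zero, Pi.zero_apply]
    rw [h1]
    refine LogExpansion.of_differentiableAt (f := fun q => deriv a q.2 / (a q.2 - q.1))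
      (hU.ne_zero hp) (hU.norm_le p hp) ?_
    have h2 : a p.2 - 0 ≠ 0 := by simpa using (h p hp).1
    exact DifferentiableAt.fun_div (c := fun _ => deriv a p.2) (d := fun z => a p.2 - z)
      (differentiableAt_const _) (by fun_prop) h2

/-- The differential equation in `ζ`. -/
theorem pdζ_revHyperlog_cons (hU : LogDomain U) {a : ℂ → ℂ} {u : List (ℂ → ℂ)}
    (hu : ∀ β ∈ a :: u, LetterOn U β)
    (hs : ∀ β ∈ a :: u, ∀ γ ∈ a :: u, β = γ ∨ ∀ p ∈ U, β p.2 ≠ γ p.2) (hp : p ∈ U) :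
    pdζ (revHyperlog (a :: u)) p = evalTerms (lowerTerms (a :: u)) p +
      deriv a p.2 / (a p.2 - p.1) * revHyperlog u p := by
  induction u generalizing a p with
  | nil =>
    have ha := hu a (by simp)
    have hnil : ∀ q, pdζ (revHyperlog []) q = 0 := fun q => by
      change deriv (fun _ => (1 : ℂ)) _ = 0
      simp
    have hnil' : ∀ q, pdz (revHyperlog []) q = 0 := fun q => by
      change deriv (fun _ => (1 : ℂ)) _ = 0
      simp
    set f : ℂ × ℂ → ℂ := fun q => pdζ (revHyperlog [a]) q - (-logDiff a 0 q.2 +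
      deriv a q.2 / (a q.2 - q.1) * revHyperlog [] q) with hf
    have hd : ∀ q ∈ U, HasDerivAt (fun z => f (z, q.2)) 0 q.1 := fun q hq => by
      refine ((hasDerivAt_pdζ_revHyperlog hU hu hq).sub
        ((hasDerivAt_kernel_mul hU hu hq).const_add (-logDiff a 0 q.2))).congr_deriv ?_
      rw [hnil, hnil']
      ring
    have hone : LogExpansion (revHyperlog []) p (Polynomial.C 1) := LogExpansion.of_snd (fun _ => 1) p
    -- The kernel tends to `a' / a` at `z = 0`; the negative sign of the term with the letter `0` in
    -- `lowerTerms` is what cancels this constant.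
    have hexp := (logExpansion_pdζ_revHyperlog hU hu hp).sub
      ((LogExpansion.of_snd (fun ζ => -logDiff a 0 ζ) p).add
        ((logExpansion_kernel hU ha hp).mul hone))
    have h1 := (hU.eq_coeff_of_hasDerivAt_zero hd hp hexp).1
    have h2 : f p = 0 := by
      rw [h1]
      simp
    have h3 : evalTerms (lowerTerms [a]) p = -logDiff a 0 p.2 := by
      simp [evalTerms, lowerTerms, revHyperlog, hyperlogRev]
    rw [h3]
    exact sub_eq_zero.1 h2
  | cons b u ih =>
    have ha := hu a (by simp)
    have hb := hu b (by simp)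
    have hu' : ∀ γ ∈ b :: u, LetterOn U γ := fun γ hγ => hu γ (List.mem_cons_of_mem _ hγ)
    have hau : ∀ γ ∈ a :: u, LetterOn U γ := fun γ hγ => hu γ (by
      rcases List.mem_cons.1 hγ with rfl | hγ <;> simp_all)
    have hl : ∀ x ∈ lowerTerms (b :: u), ∀ γ ∈ x.2, LetterOn U γ := fun x hx γ hγ =>
      hu' γ (mem_of_mem_lowerTerms hx hγ)
    have hl' : ∀ x ∈ lowerTerms (a :: b :: u), ∀ γ ∈ x.2, LetterOn U γ := fun x hx γ hγ =>
      hu γ (mem_of_mem_lowerTerms hx hγ)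
    set f : ℂ × ℂ → ℂ := fun q => pdζ (revHyperlog (a :: b :: u)) q -
      (evalTerms (lowerTerms (a :: b :: u)) q +
        deriv a q.2 / (a q.2 - q.1) * revHyperlog (b :: u) q) with hf
    have hd : ∀ q ∈ U, HasDerivAt (fun z => f (z, q.2)) 0 q.1 := fun q hq => by
      have hE : ∀ q, evalTerms (lowerTerms (a :: b :: u)) q =
          evalTerms ((lowerTerms (b :: u)).map fun x => (x.1, a :: x.2)) q +
            logDiff b a q.2 * (revHyperlog (a :: u) q - revHyperlog (b :: u) q) := fun q => by
        rw [lowerTerms, evalTerms_append]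
        simp only [evalTerms, List.map_cons, List.map_nil, List.sum_cons, List.sum_nil]
        ring
      have hEd : HasDerivAt (fun z => evalTerms (lowerTerms (a :: b :: u)) (z, q.2))
          (evalTerms (lowerTerms (b :: u)) q / (q.1 - a q.2) + logDiff b a q.2 *
            (revHyperlog u q / (q.1 - a q.2) - revHyperlog u q / (q.1 - b q.2))) q.1 := by
        simp only [hE]
        exact (hasDerivAt_evalTerms_cons hU ha hl hq).add
          (((hasDerivAt_revHyperlog_cons hU hau hq).sub
            (hasDerivAt_revHyperlog_cons hU hu' hq)).const_mul _)
      refine ((hasDerivAt_pdζ_revHyperlog hU hu hq).sub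
        (hEd.add (hasDerivAt_kernel_mul hU hu hq))).congr_deriv ?_
      have hz : pdz (revHyperlog (b :: u)) q = revHyperlog u q / (q.1 - b q.2) :=
        (hasDerivAt_revHyperlog_cons hU hu' hq).deriv
      rw [hz, ih hu' (fun β hβ γ hγ => hs β (List.mem_cons_of_mem _ hβ) γ
        (List.mem_cons_of_mem _ hγ)) hq]
      -- After the induction hypothesis for the tail `b :: u` only multiples of `revHyperlog u` are
      -- left, and these cancel by partial fractions.
      have key := logDiff_identity (x := b q.2) (y := a q.2) (x' := deriv b q.2)
        (y' := deriv a q.2) (z := q.1) (sub_ne_zero.1 (hb.sub_ne_zero hU hq))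
        (sub_ne_zero.1 (ha.sub_ne_zero hU hq)) (fun h => by
          rcases hs b (by simp) a (by simp) with h' | h'
          · rw [h']
          · exact absurd h (h' q hq))
      unfold logDiff
      linear_combination revHyperlog u q * key
    -- All words involved are nonempty, so each expansion is a multiple of a positive power of `X`
    -- and the constant term vanishes.
    obtain ⟨c, hc⟩ := exists_logExpansion_evalTerms hU (n := (b :: u).length) hl'
      (fun x hx => by simpa using length_of_mem_lowerTerms hx) hp
    obtain ⟨d, hd'⟩ := exists_logExpansion_revHyperlog hU hu' hp
    have hexp := (logExpansion_pdζ_revHyperlog hU hu hp).sub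
      (hc.add ((logExpansion_kernel hU ha hp).mul hd'))
    have h1 := (hU.eq_coeff_of_hasDerivAt_zero hd hp hexp).1
    have h2 : f p = 0 := by
      rw [h1]
      simp
    exact sub_eq_zero.1 h2

/-! ### The shuffle product -/

/-- The recursion strips heads, that is, outermost letters: by the Leibniz rule the product has the
same `z`-derivative as the sum of `a :: (u ⧢ (b :: v))` and `b :: ((a :: u) ⧢ v)`, and both have
regularized value `0`. The list of shuffles stays anonymous, since only the lengths and the letters
of its words matter. -/
theorem exists_shuffle (hU : LogDomain U) (n : ℕ) (u v : List (ℂ → ℂ))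
    (hn : u.length + v.length = n) (hu : ∀ β ∈ u, LetterOn U β) (hv : ∀ β ∈ v, LetterOn U β) :
    ∃ l : List (List (ℂ → ℂ)), (∀ w ∈ l, w.length = n ∧ ∀ β ∈ w, β ∈ u ∨ β ∈ v) ∧
      ∀ p ∈ U, revHyperlog u p * revHyperlog v p = (l.map fun w => revHyperlog w p).sum := by
  induction n generalizing u v with
  | zero =>
    obtain ⟨rfl, rfl⟩ : u = [] ∧ v = [] := by simpa using hn
    exact ⟨[[]], by simp, fun p _ => by simp [revHyperlog, hyperlogRev]⟩
  | succ n ih =>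
    cases u with
    | nil =>
      refine ⟨[v], by simpa using hn, fun p _ => ?_⟩
      simp [revHyperlog, hyperlogRev]
    | cons a u =>
    cases v with
    | nil =>
      refine ⟨[a :: u], by simpa using hn, fun p _ => ?_⟩
      simp [revHyperlog, hyperlogRev]
    | cons b v =>
    have hu' : ∀ β ∈ u, LetterOn U β := fun β h => hu β (by simp [h])
    have hv' : ∀ β ∈ v, LetterOn U β := fun β h => hv β (by simp [h])
    obtain ⟨l₁, hl₁, H₁⟩ := ih u (b :: v) (by simp at hn ⊢; omega) hu' hv
    obtain ⟨l₂, hl₂, H₂⟩ := ih (a :: u) v (by simp at hn ⊢; omega) hu hv'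
    have hW : ∀ w ∈ l₁.map (a :: ·) ++ l₂.map (b :: ·),
        w.length = n + 1 ∧ ∀ β ∈ w, β ∈ a :: u ∨ β ∈ b :: v := by
      intro w hw
      rcases List.mem_append.1 hw with hw | hw
      · obtain ⟨w, hw', rfl⟩ := List.mem_map.1 hw
        refine ⟨by simp [(hl₁ w hw').1], fun β hβ => ?_⟩
        rcases List.mem_cons.1 hβ with rfl | hβ
        · simp
        · exact ((hl₁ w hw').2 β hβ).imp_left (List.mem_cons_of_mem _)
      · obtain ⟨w, hw', rfl⟩ := List.mem_map.1 hw
        refine ⟨by simp [(hl₂ w hw').1], fun β hβ => ?_⟩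
        rcases List.mem_cons.1 hβ with rfl | hβ
        · simp
        · exact ((hl₂ w hw').2 β hβ).imp_right (List.mem_cons_of_mem _)
    have hWL : ∀ w ∈ l₁.map (a :: ·) ++ l₂.map (b :: ·), ∀ β ∈ w, LetterOn U β :=
      fun w hw β hβ => ((hW w hw).2 β hβ).elim (hu β) (hv β)
    refine ⟨l₁.map (a :: ·) ++ l₂.map (b :: ·), hW, fun p hp => ?_⟩
    have hsumd : ∀ (c : ℂ → ℂ) (l : List (List (ℂ → ℂ))),
        (∀ w ∈ l, ∀ β ∈ c :: w, LetterOn U β) → ∀ q ∈ U,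
        HasDerivAt (fun z => (l.map fun w => revHyperlog (c :: w) (z, q.2)).sum)
          ((l.map fun w => revHyperlog w q).sum / (q.1 - c q.2)) q.1 := by
      intro c l hl q hq
      induction l with
      | nil => simpa using hasDerivAt_const q.1 (0 : ℂ)
      | cons w l ihl =>
        refine (((hasDerivAt_revHyperlog_cons hU (hl w (by simp)) hq).add
          (ihl fun w hw => hl w (by simp [hw]))).congr_deriv ?_).congr_of_eventuallyEq
          (Eventually.of_forall fun z => by simp)
        simp only [List.map_cons, List.sum_cons]
        ring
    have hsume : ∀ (l : List (List (ℂ → ℂ))), (∀ w ∈ l, w.length = n + 1) →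
        (∀ w ∈ l, ∀ β ∈ w, LetterOn U β) →
        ∃ c : ℂ, LogExpansion (fun q => (l.map fun w => revHyperlog w q).sum) p
          (Polynomial.C c * Polynomial.X ^ (n + 1)) := by
      intro l hlen hl
      induction l with
      | nil => exact ⟨0, (LogSmall.zero p.1).congr (Eventually.of_forall fun t => by simp)⟩
      | cons w l ihl =>
        obtain ⟨c, hc⟩ := ihl (fun w hw => hlen w (by simp [hw])) fun w hw => hl w (by simp [hw])
        obtain ⟨d, hd⟩ := exists_logExpansion_revHyperlog hU (hl w (by simp)) hp
        rw [hlen w (by simp)] at hd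
        refine ⟨d + c, ?_⟩
        rw [Polynomial.C_add, add_mul]
        exact (hd.add hc).congr fun t _ => by simp
    set f : ℂ × ℂ → ℂ := fun q => revHyperlog (a :: u) q * revHyperlog (b :: v) q -
      ((l₁.map (a :: ·) ++ l₂.map (b :: ·)).map fun w => revHyperlog w q).sum with hf
    have hd : ∀ q ∈ U, HasDerivAt (fun z => f (z, q.2)) 0 q.1 := fun q hq => by
      have h1 := (hasDerivAt_revHyperlog_cons hU hu hq).mul (hasDerivAt_revHyperlog_cons hU hv hq)
      have h2 := (hsumd a l₁ (fun w hw => hWL (a :: w) (by simp [hw])) q hq).add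
        (hsumd b l₂ (fun w hw => hWL (b :: w) (by simp [hw])) q hq)
      refine ((h1.sub h2).congr_deriv ?_).congr_of_eventuallyEq (Eventually.of_forall fun z => ?_)
      · rw [← H₁ q hq, ← H₂ q hq]
        ring
      · simp [hf, Function.comp_def]
    obtain ⟨c, hc⟩ := hsume _ (fun w hw => (hW w hw).1) hWL
    obtain ⟨d, hd'⟩ := exists_logExpansion_revHyperlog hU hu hp
    obtain ⟨e, he⟩ := exists_logExpansion_revHyperlog hU hv hp
    have h1 := (hU.eq_coeff_of_hasDerivAt_zero hd hp ((hd'.mul he).sub hc)).1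
    have h2 : f p = 0 := by
      rw [h1]
      simp
    exact sub_eq_zero.1 h2

end
end GenHyperlog

namespace GenHyperlog
noncomputable section

/-! ### Letters near the base point -/

/-- Every fractional linear transformation is a quotient of coprime linear functions. -/
theorem exists_coeffs_of_mem_FLT {F : Subfield ℂ} {β : ℂ → ℂ} (h : β ∈ FLT F) :
    ∃ a ∈ F, ∃ b ∈ F, ∃ c ∈ F, ∃ d ∈ F, (c ≠ 0 ∨ d ≠ 0) ∧
      (a * d - b * c ≠ 0 ∨ (a = 0 ∧ c = 0 ∧ d = 1)) ∧ ∀ x, β x = (a * x + b) / (c * x + d) := by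
  rcases h with ⟨b, hb, rfl⟩ | ⟨a, ha, b, hb, c, hc, d, hd, hdet, rfl⟩
  · exact ⟨0, F.zero_mem, b, hb, 0, F.zero_mem, 1, F.one_mem, Or.inr one_ne_zero,
      Or.inr ⟨rfl, rfl, rfl⟩, fun x => by simp⟩
  · refine ⟨a, ha, b, hb, c, hc, d, hd, ?_, Or.inl hdet, fun x => rfl⟩
    by_contra! h
    rw [h.1, h.2] at hdet
    simp at hdet

theorem const_mem_FLT {F : Subfield ℂ} {b : ℂ} (hb : b ∈ F) : (fun _ => b) ∈ FLT F :=
  Or.inl ⟨b, hb, rfl⟩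

theorem FLT_mono_top {F : Subfield ℂ} {β : ℂ → ℂ} (h : β ∈ FLT F) : β ∈ FLT ⊤ := by
  rcases h with ⟨b, hb, rfl⟩ | ⟨a, ha, b, hb, c, hc, d, hd, hdet, rfl⟩
  · exact Or.inl ⟨b, trivial, rfl⟩
  · exact Or.inr ⟨a, trivial, b, trivial, c, trivial, d, trivial, hdet, rfl⟩

/-- A nonzero linear function vanishes at most to first order at `0`. The condition `‖z‖ < ε ‖ζ‖` of
the base region relies on this: a letter may tend to `0` with `ζ`, but not faster than `ζ`. -/
theorem exists_le_norm_linear {a b : ℂ} (h : a ≠ 0 ∨ b ≠ 0) :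
    ∃ κ : ℝ, 0 < κ ∧ ∀ᶠ ζ in 𝓝 (0 : ℂ), κ * ‖ζ‖ ≤ ‖a * ζ + b‖ := by
  by_cases hb : b = 0
  · subst hb
    refine ⟨‖a‖, by simpa using h, Eventually.of_forall fun ζ => ?_⟩
    rw [add_zero, norm_mul]
  · have hb' : 0 < ‖b‖ := norm_pos_iff.2 hb
    refine ⟨‖b‖ / 2, half_pos hb', ?_⟩
    have h1 : ContinuousAt (fun ζ : ℂ => ‖a * ζ + b‖) 0 := by fun_prop
    have h2 : ‖b‖ / 2 < ‖a * 0 + b‖ := by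
      rw [mul_zero, zero_add]
      exact half_lt_self hb'
    filter_upwards [h1.eventually (lt_mem_nhds h2), Metric.ball_mem_nhds (0 : ℂ) one_pos]
      with ζ h3 h4
    rw [mem_ball_zero_iff] at h4
    nlinarith

theorem eventually_baseRegion_of_eventually {P : ℂ → Prop} (h : ∀ᶠ ζ in 𝓝[≠] (0 : ℂ), P ζ) :
    ∀ᶠ ε in 𝓝[>] (0 : ℝ), ∀ p ∈ baseRegion ε, P p.2 := by
  obtain ⟨δ, hδ, h⟩ := Metric.mem_nhdsWithin_iff.1 h
  filter_upwards [Ioo_mem_nhdsGT hδ] with ε hε p hp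
  refine h ⟨?_, Complex.slitPlane_ne_zero hp.2.1⟩
  rw [mem_ball_zero_iff]
  exact hp.2.2.1.trans hε.2

theorem eventually_linear_ne_zero {a b : ℂ} (h : a ≠ 0 ∨ b ≠ 0) :
    ∀ᶠ ζ in 𝓝[≠] (0 : ℂ), a * ζ + b ≠ 0 := by
  obtain ⟨κ, hκ, h⟩ := exists_le_norm_linear h
  filter_upwards [h.filter_mono nhdsWithin_le_nhds, self_mem_nhdsWithin] with ζ h1 h2
  have h3 : 0 < ‖ζ‖ := norm_pos_iff.2 h2
  rw [← norm_pos_iff]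
  exact (mul_pos hκ h3).trans_le h1

/-- The numerator is at least `κ ‖ζ‖` and the denominator at most `M`, so `2 ε M < κ` keeps `z` away
from the letter. -/
theorem eventually_letterOn {F : Subfield ℂ} {β : ℂ → ℂ} (h : β ∈ FLT F) :
    ∀ᶠ ε in 𝓝[>] (0 : ℝ), LetterOn (baseRegion ε) β := by
  obtain ⟨a, -, b, -, c, -, d, -, hcd, hdet, hβ⟩ := exists_coeffs_of_mem_FLT h
  have hden := eventually_baseRegion_of_eventually (eventually_linear_ne_zero hcd)
  have han : ∀ᶠ ε in 𝓝[>] (0 : ℝ), ∀ p ∈ baseRegion ε, AnalyticAt ℂ β p.2 := by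
    filter_upwards [hden] with ε hε p hp
    have h1 : AnalyticAt ℂ (fun x => (a * x + b) / (c * x + d)) p.2 :=
      ((analyticAt_const.mul analyticAt_id).add analyticAt_const).div
        ((analyticAt_const.mul analyticAt_id).add analyticAt_const) (hε p hp)
    exact h1.congr (Eventually.of_forall fun x => (hβ x).symm)
  by_cases hab : a ≠ 0 ∨ b ≠ 0
  · obtain ⟨κ, hκ, hnum⟩ := exists_le_norm_linear hab
    set M : ℝ := ‖c‖ + ‖d‖ with hM
    have hM0 : 0 < M := by
      rcases hcd with h | h
      · exact add_pos_of_pos_of_nonneg (norm_pos_iff.2 h) (norm_nonneg _)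
      · exact add_pos_of_nonneg_of_pos (norm_nonneg _) (norm_pos_iff.2 h)
    have h1 := eventually_baseRegion_of_eventually (hnum.filter_mono nhdsWithin_le_nhds)
    filter_upwards [han, hden, h1, Ioo_mem_nhdsGT (zero_lt_one (α := ℝ)),
      Ioo_mem_nhdsGT (div_pos hκ (mul_pos two_pos hM0))] with ε h2 h3 h4 h5 h6
    refine ⟨h2, Or.inr fun p hp => ?_⟩
    have hζ : 0 < ‖p.2‖ := norm_pos_iff.2 (Complex.slitPlane_ne_zero hp.2.1)
    have h7 : ‖c * p.2 + d‖ ≤ M := by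
      refine (norm_add_le _ _).trans ?_
      rw [norm_mul]
      have := hp.2.2.1
      nlinarith [norm_nonneg c, h5.2]
    have h8 : 2 * ‖p.1‖ ≤ ‖β p.2‖ := by
      rw [hβ, norm_div, le_div_iff₀ (norm_pos_iff.2 (h3 p hp))]
      have h9 := h4 p hp
      have h10 := hp.2.2.2
      have h11 : ε * (2 * M) < κ := by
        rw [← lt_div_iff₀ (by positivity)]
        exact h6.2
      calc 2 * ‖p.1‖ * ‖c * p.2 + d‖ ≤ 2 * (ε * ‖p.2‖) * M := by
            have := h5.1
            gcongr
        _ = ε * (2 * M) * ‖p.2‖ := by ring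
        _ ≤ κ * ‖p.2‖ := by gcongr
        _ ≤ _ := h9
    have h12 : 0 < ‖p.1‖ := norm_pos_iff.2 (Complex.slitPlane_ne_zero hp.1)
    exact ⟨norm_pos_iff.1 (by linarith), h8⟩
  · push Not at hab
    filter_upwards [han] with ε h2
    exact ⟨h2, Or.inl fun p _ => by simp [hβ, hab.1, hab.2]⟩

/-- The cross-multiplied difference is a polynomial in `ζ`: it is either nonzero on a punctured
neighbourhood of `0` or identically zero. In the second case the functions agree everywhere, even at
the poles, where both take the default value `0` of the division. -/
theorem eventually_ne_of_mem_FLT {F : Subfield ℂ} {β γ : ℂ → ℂ} (hβ : β ∈ FLT F) (hγ : γ ∈ FLT F)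
    (h : β ≠ γ) : ∀ᶠ ζ in 𝓝[≠] (0 : ℂ), β ζ ≠ γ ζ := by
  obtain ⟨a, -, b, -, c, -, d, -, hcd, hdet, hβ⟩ := exists_coeffs_of_mem_FLT hβ
  obtain ⟨a', -, b', -, c', -, d', -, hcd', hdet', hγ⟩ := exists_coeffs_of_mem_FLT hγ
  set f : ℂ → ℂ := fun ζ => (a * ζ + b) * (c' * ζ + d') - (a' * ζ + b') * (c * ζ + d) with hf
  have hfd : Differentiable ℂ f := by fun_prop
  have hfa : AnalyticOnNhd ℂ f Set.univ := fun x _ => hfd.analyticAt x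
  rcases (hfa 0 trivial).eventually_eq_zero_or_eventually_ne_zero with h0 | h0
  · exfalso
    have h1 : f = fun _ => 0 := hfa.eq_of_eventuallyEq (fun x _ => analyticAt_const) h0
    -- Numerator and denominator have no common zero, so equality of the cross products forces the
    -- poles of the two functions to coincide.
    have hco : ∀ {a b c d ζ : ℂ}, (a * d - b * c ≠ 0 ∨ (a = 0 ∧ c = 0 ∧ d = 1)) →
        c * ζ + d = 0 → a * ζ + b ≠ 0 := by
      intro a b c d ζ hdet h2 h3
      rcases hdet with h4 | ⟨rfl, rfl, rfl⟩
      · apply h4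
        by_cases hc : c = 0
        · have hd : d = 0 := by simpa [hc] using h2
          rw [hc, hd]
          ring
        · have h5 : c * (a * d - b * c) = 0 := by linear_combination c * a * h2 - c * c * h3
          exact (mul_eq_zero.1 h5).resolve_left hc
      · simp at h2
    refine h (funext fun ζ => ?_)
    have h2 : (a * ζ + b) * (c' * ζ + d') - (a' * ζ + b') * (c * ζ + d) = 0 := congrFun h1 ζ
    rw [hβ, hγ]
    by_cases h3 : c * ζ + d = 0
    · have h4 : c' * ζ + d' = 0 := by
        rw [h3, mul_zero, sub_zero] at h2
        exact (mul_eq_zero.1 h2).resolve_left (hco hdet h3)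
      rw [h3, h4, div_zero, div_zero]
    · have h4 : c' * ζ + d' ≠ 0 := fun h4 => by
        rw [h4, mul_zero, zero_sub, neg_eq_zero] at h2
        exact (mul_eq_zero.1 h2).elim (hco hdet' h4) h3
      rw [div_eq_div_iff h3 h4]
      exact sub_eq_zero.1 h2
  · filter_upwards [h0, eventually_linear_ne_zero hcd, eventually_linear_ne_zero hcd']
      with ζ h1 h2 h3 h4
    rw [hβ, hγ, div_eq_div_iff h2 h3] at h4
    exact h1 (sub_eq_zero.2 h4)

theorem logDomain_baseRegion {ε : ℝ} (hε : 0 < ε) (hε1 : ε ≤ 1) : LogDomain (baseRegion ε) where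
  isOpen := isOpen_baseRegion ε
  slit p hp := hp.1
  norm_le p hp := by
    have := hp.2.2.1
    have := hp.2.2.2
    nlinarith [norm_nonneg p.2]
  radial p hp t ht := by
    refine ⟨?_, hp.2.1, hp.2.2.1, ?_⟩
    · have h := hp.1
      rw [Complex.mem_slitPlane_iff] at h ⊢
      rw [Complex.re_ofReal_mul, Complex.im_ofReal_mul]
      exact h.imp (fun h => mul_pos ht.1 h) fun h => mul_ne_zero ht.1.ne' h
    · rw [norm_mul, Complex.norm_real, Real.norm_of_nonneg ht.1.le]
      have := hp.2.2.2
      nlinarith [norm_nonneg p.1, ht.2]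

/-- For constant letters the second variable is a dummy. This domain leaves it unrestricted, so that
the results on variable letters apply to `L_v(ζ)`. -/
theorem logDomain_disc {ε : ℝ} (hε1 : ε ≤ 1) :
    LogDomain {p : ℂ × ℂ | p.1 ∈ Complex.slitPlane ∧ ‖p.1‖ < ε} where
  isOpen := (Complex.isOpen_slitPlane.preimage continuous_fst).inter
    (isOpen_lt (f := fun p : ℂ × ℂ => ‖p.1‖) (g := fun _ => ε) (by fun_prop) (by fun_prop))
  slit p hp := hp.1
  norm_le p hp := hp.2.le.trans hε1
  radial p hp t ht := by
    refine ⟨?_, ?_⟩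
    · have h := hp.1
      rw [Complex.mem_slitPlane_iff] at h ⊢
      rw [Complex.re_ofReal_mul, Complex.im_ofReal_mul]
      exact h.imp (fun h => mul_pos ht.1 h) fun h => mul_ne_zero ht.1.ne' h
    · have h := hp.2
      change ‖(t : ℂ) * p.1‖ < ε
      rw [norm_mul, Complex.norm_real, Real.norm_of_nonneg ht.1.le]
      nlinarith [norm_nonneg p.1, ht.2]

/-- A radius on which the letters in `S` and the constants in `C` have all expected properties. -/
structure NiceRadius (S : Set (ℂ → ℂ)) (C : Set ℂ) (ε : ℝ) : Prop where
  pos : 0 < ε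
  le_one : ε ≤ 1
  letter : ∀ β ∈ S, LetterOn (baseRegion ε) β
  sep : ∀ β ∈ S, ∀ γ ∈ S, β = γ ∨ ∀ p ∈ baseRegion ε, β p.2 ≠ γ p.2
  const : ∀ c ∈ C, c = 0 ∨ 2 * ε ≤ ‖c‖

theorem eventually_niceRadius {F : Subfield ℂ} {S : Set (ℂ → ℂ)} (hS : S.Finite)
    (hSF : S ⊆ FLT F) {C : Set ℂ} (hC : C.Finite) : ∀ᶠ ε in 𝓝[>] (0 : ℝ), NiceRadius S C ε := by
  have h1 : ∀ᶠ ε in 𝓝[>] (0 : ℝ), ∀ β ∈ S, LetterOn (baseRegion ε) β :=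
    (eventually_all_finite hS).2 fun β hβ => eventually_letterOn (hSF hβ)
  have h2 : ∀ᶠ ε in 𝓝[>] (0 : ℝ), ∀ β ∈ S, ∀ γ ∈ S, β = γ ∨ ∀ p ∈ baseRegion ε, β p.2 ≠ γ p.2 := by
    refine (eventually_all_finite hS).2 fun β hβ => (eventually_all_finite hS).2 fun γ hγ => ?_
    by_cases h : β = γ
    · exact Eventually.of_forall fun _ => Or.inl h
    · filter_upwards [eventually_baseRegion_of_eventually
        (eventually_ne_of_mem_FLT (hSF hβ) (hSF hγ) h)] with ε hε using Or.inr hε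
  have h3 : ∀ᶠ ε in 𝓝[>] (0 : ℝ), ∀ c ∈ C, c = 0 ∨ 2 * ε ≤ ‖c‖ := by
    refine (eventually_all_finite hC).2 fun c _ => ?_
    by_cases h : c = 0
    · exact Eventually.of_forall fun _ => Or.inl h
    · filter_upwards [Ioo_mem_nhdsGT (half_pos (norm_pos_iff.2 h))] with ε hε
      exact Or.inr (by linarith [hε.2])
  filter_upwards [h1, h2, h3, Ioc_mem_nhdsGT (zero_lt_one (α := ℝ))] with ε a b c d
  exact ⟨d.1, d.2, a, b, c⟩

theorem exists_niceRadius {F : Subfield ℂ} {S : Set (ℂ → ℂ)} (hS : S.Finite)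
    (hSF : S ⊆ FLT F) {C : Set ℂ} (hC : C.Finite) : ∃ ε, NiceRadius S C ε :=
  (eventually_niceRadius hS hSF hC).exists

theorem NiceRadius.logDomain {S : Set (ℂ → ℂ)} {C : Set ℂ} {ε : ℝ} (h : NiceRadius S C ε) :
    LogDomain (baseRegion ε) := logDomain_baseRegion h.pos h.le_one

theorem nonempty_baseRegion {ε : ℝ} (hε : 0 < ε) : (baseRegion ε).Nonempty := by
  have h1 : (0 : ℝ) < min ε 1 / 2 := by positivity
  have h2 : min ε 1 / 2 < ε := by
    have := min_le_left ε 1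
    have := lt_min hε one_pos
    linarith
  refine ⟨(((min ε 1 / 2 * (min ε 1 / 2) : ℝ) : ℂ), ((min ε 1 / 2 : ℝ) : ℂ)), ?_, ?_, ?_, ?_⟩
  · exact Complex.ofReal_mem_slitPlane.2 (by positivity)
  · exact Complex.ofReal_mem_slitPlane.2 h1
  · rw [Complex.norm_real, Real.norm_of_nonneg h1.le]
    exact h2
  · rw [Complex.norm_real, Complex.norm_real, Real.norm_of_nonneg h1.le,
      Real.norm_of_nonneg (by positivity)]
    exact mul_lt_mul_of_pos_right h2 h1

/-- In logarithmic coordinates the region is convex: it is cut out by linear inequalities for real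
and imaginary parts, and `exp` in both variables maps it back. -/
theorem isPreconnected_baseRegion {ε : ℝ} (hε : 0 < ε) : IsPreconnected (baseRegion ε) := by
  let T : Set (ℂ × ℂ) := {q | |q.1.im| < Real.pi ∧ |q.2.im| < Real.pi ∧ q.2.re < Real.log ε ∧
    q.1.re < Real.log ε + q.2.re}
  have hT : Convex ℝ T := by
    have himf : IsLinearMap ℝ fun q : ℂ × ℂ => q.1.im := ⟨fun _ _ => rfl, fun _ _ => by simp⟩
    have hims : IsLinearMap ℝ fun q : ℂ × ℂ => q.2.im := ⟨fun _ _ => rfl, fun _ _ => by simp⟩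
    have hres : IsLinearMap ℝ fun q : ℂ × ℂ => q.2.re := ⟨fun _ _ => rfl, fun _ _ => by simp⟩
    have hdif : IsLinearMap ℝ fun q : ℂ × ℂ => q.1.re - q.2.re :=
      ⟨fun x y => by simp; ring, fun c x => by simp; ring⟩
    have e : T = ({q | q.1.im < Real.pi} ∩ {q | -Real.pi < q.1.im}) ∩
        ({q | q.2.im < Real.pi} ∩ {q | -Real.pi < q.2.im}) ∩ {q | q.2.re < Real.log ε} ∩
        {q | q.1.re - q.2.re < Real.log ε} := by
      ext q
      simp only [T, abs_lt, Set.mem_ofPred_eq, Set.mem_inter_iff]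
      constructor
      · rintro ⟨⟨a, b⟩, ⟨c, d⟩, e, f⟩
        exact ⟨⟨⟨⟨b, a⟩, d, c⟩, e⟩, by linarith⟩
      · rintro ⟨⟨⟨⟨b, a⟩, d, c⟩, e⟩, f⟩
        exact ⟨⟨a, b⟩, ⟨c, d⟩, e, by linarith⟩
    rw [e]
    exact ((((convex_halfSpace_lt himf _).inter (convex_halfSpace_gt himf _)).inter
      ((convex_halfSpace_lt hims _).inter (convex_halfSpace_gt hims _))).inter
      (convex_halfSpace_lt hres _)).inter (convex_halfSpace_lt hdif _)
  have himage : baseRegion ε = (fun q : ℂ × ℂ => (Complex.exp q.1, Complex.exp q.2)) '' T := by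
    ext p
    constructor
    · rintro ⟨h1, h2, h3, h4⟩
      have hz := Complex.slitPlane_ne_zero h1
      have hζ := Complex.slitPlane_ne_zero h2
      have hζ' := norm_pos_iff.2 hζ
      have harg : ∀ {z : ℂ}, z ∈ Complex.slitPlane → |(Complex.log z).im| < Real.pi := fun {z} h => by
        rw [Complex.log_im, abs_lt]
        exact ⟨Complex.neg_pi_lt_arg z, lt_of_le_of_ne (Complex.arg_le_pi z)
          (Complex.mem_slitPlane_iff_arg.1 h).1⟩
      refine ⟨(Complex.log p.1, Complex.log p.2), ⟨harg h1, harg h2, ?_, ?_⟩, ?_⟩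
      · rw [Complex.log_re]
        exact Real.log_lt_log hζ' h3
      · simp only [Complex.log_re]
        rw [← Real.log_mul hε.ne' hζ'.ne']
        exact Real.log_lt_log (norm_pos_iff.2 hz) h4
      · simp [Complex.exp_log hz, Complex.exp_log hζ]
    · rintro ⟨q, ⟨h1, h2, h3, h4⟩, rfl⟩
      have hslit : ∀ {w : ℂ}, |w.im| < Real.pi → Complex.exp w ∈ Complex.slitPlane := fun {w} h => by
        rw [abs_lt] at h
        rw [Complex.mem_slitPlane_iff_arg, Complex.arg_exp,
          (toIocMod_eq_self Real.two_pi_pos).2 ⟨h.1, by linarith⟩]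
        exact ⟨h.2.ne, Complex.exp_ne_zero _⟩
      refine ⟨hslit h1, hslit h2, ?_, ?_⟩
      · rw [Complex.norm_exp, ← Real.lt_log_iff_exp_lt hε]
        exact h3
      · rw [Complex.norm_exp, Complex.norm_exp]
        conv_rhs => rw [← Real.exp_log hε]
        rw [← Real.exp_add]
        exact Real.exp_lt_exp.2 h4
  rw [himage]
  exact hT.isPreconnected.image _ (by fun_prop)

/-! ### The generators near the base point -/

variable {S : Set (ℂ → ℂ)} {C : Set ℂ} {ε : ℝ} {p : ℂ × ℂ}

theorem hyperlogRev_eq_revHyperlog (v : List ℂ) (z : ℂ) :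
    hyperlogRev v z = revHyperlog (v.map fun c _ => c) (z, 0) := by
  rw [revHyperlog, List.map_map]
  congr 1
  exact (List.map_id v).symm

theorem letterOn_const_disc {c : ℂ} (h : c = 0 ∨ 2 * ε ≤ ‖c‖) :
    LetterOn {p : ℂ × ℂ | p.1 ∈ Complex.slitPlane ∧ ‖p.1‖ < ε} fun _ => c where
  analytic _ _ := analyticAt_const
  far := by
    by_cases h0 : c = 0
    · exact Or.inl fun _ _ => h0
    · have h1 := h.resolve_left h0
      exact Or.inr fun p hp => ⟨h0, by linarith [hp.2]⟩

theorem NiceRadius.letterOn_disc (h : NiceRadius S C ε) {v : List ℂ} (hv : ∀ c ∈ v, c ∈ C) :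
    ∀ β ∈ v.map (fun c (_ : ℂ) => c),
      LetterOn {p : ℂ × ℂ | p.1 ∈ Complex.slitPlane ∧ ‖p.1‖ < ε} β := by
  intro β hβ
  obtain ⟨c, hc, rfl⟩ := List.mem_map.1 hβ
  exact letterOn_const_disc (h.const c (hv c hc))

theorem NiceRadius.analyticAt_hyperlogRev (h : NiceRadius S C ε) {v : List ℂ}
    (hv : ∀ c ∈ v, c ∈ C) {ζ : ℂ} (hζ : ζ ∈ Complex.slitPlane) (hζε : ‖ζ‖ < ε) :
    AnalyticAt ℂ (hyperlogRev v) ζ := by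
  have h1 := analyticAt_revHyperlog (logDomain_disc h.le_one) (h.letterOn_disc hv)
    (p := (ζ, 0)) ⟨hζ, hζε⟩
  have h2 : AnalyticAt ℂ (fun ζ : ℂ => (ζ, (0 : ℂ))) ζ := analyticAt_id.prod analyticAt_const
  exact (h1.comp (f := fun ζ : ℂ => (ζ, (0 : ℂ))) h2).congr (Eventually.of_forall fun z =>
    (hyperlogRev_eq_revHyperlog v z).symm)

theorem NiceRadius.hasDerivAt_hyperlogRev_cons (h : NiceRadius S C ε) {c : ℂ} {v : List ℂ}
    (hv : ∀ d ∈ c :: v, d ∈ C) {ζ : ℂ} (hζ : ζ ∈ Complex.slitPlane) (hζε : ‖ζ‖ < ε) :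
    HasDerivAt (hyperlogRev (c :: v)) (hyperlogRev v ζ / (ζ - c)) ζ := by
  have h1 := hasDerivAt_revHyperlog_cons (logDomain_disc h.le_one) (h.letterOn_disc hv)
    (p := (ζ, 0)) ⟨hζ, hζε⟩
  simp only [hyperlogRev_eq_revHyperlog v ζ]
  exact h1.congr_of_eventuallyEq (Eventually.of_forall fun z =>
    (hyperlogRev_eq_revHyperlog (c :: v) z))

theorem NiceRadius.sub_const_ne_zero (h : NiceRadius S C ε) {c : ℂ} (hc : c ∈ C) {ζ : ℂ}
    (hζ : ζ ∈ Complex.slitPlane) (hζε : ‖ζ‖ < ε) : ζ - c ≠ 0 := by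
  rcases h.const c hc with rfl | h1
  · simpa using Complex.slitPlane_ne_zero hζ
  · intro h2
    rw [sub_eq_zero.1 h2] at hζε
    linarith [h.pos]

theorem NiceRadius.exists_shuffle_const (h : NiceRadius S C ε) (u v : List ℂ)
    (hu : ∀ c ∈ u, c ∈ C) (hv : ∀ c ∈ v, c ∈ C) :
    ∃ l : List (List ℂ), (∀ w ∈ l, ∀ c ∈ w, c ∈ u ∨ c ∈ v) ∧
      ∀ ζ ∈ Complex.slitPlane, ‖ζ‖ < ε →
        hyperlogRev u ζ * hyperlogRev v ζ = (l.map fun w => hyperlogRev w ζ).sum := by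
  obtain ⟨l, hl, H⟩ := exists_shuffle (logDomain_disc h.le_one) _ _ _ rfl (h.letterOn_disc hu)
    (h.letterOn_disc hv)
  refine ⟨l.map (List.map fun β => β 0), fun w hw c hc => ?_, fun ζ hζ hζε => ?_⟩
  · obtain ⟨w, hw', rfl⟩ := List.mem_map.1 hw
    obtain ⟨β, hβ, rfl⟩ := List.mem_map.1 hc
    refine ((hl w hw').2 β hβ).imp (fun h => ?_) fun h => ?_
    all_goals
      obtain ⟨d, hd, rfl⟩ := List.mem_map.1 h
      exact hd
  · rw [hyperlogRev_eq_revHyperlog u, hyperlogRev_eq_revHyperlog v, H (ζ, 0) ⟨hζ, hζε⟩,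
      List.map_map]
    rfl

end
end GenHyperlog

namespace GenHyperlog
noncomputable section

/-! ### Holomorphic germs -/

instance base_neBot : base.NeBot :=
  base_hasBasis.neBot_iff.2 fun hε => nonempty_baseRegion hε

theorem germ_eq_germ {f g : ℂ × ℂ → ℂ} : germ f = germ g ↔ ∀ᶠ p in base, f p = g p :=
  Filter.Germ.coe_eq

theorem germ_congr {f g : ℂ × ℂ → ℂ} (h : ∀ᶠ p in base, f p = g p) : germ f = germ g :=
  germ_eq_germ.2 h

theorem eventually_base_baseRegion {ε : ℝ} (hε : 0 < ε) : ∀ᶠ p in base, p ∈ baseRegion ε :=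
  base_hasBasis.mem_of_mem hε

theorem eventually_base_of_eventually {P : ℝ → ℂ × ℂ → Prop}
    (h : ∀ᶠ ε in 𝓝[>] (0 : ℝ), ∀ p ∈ baseRegion ε, P ε p) : ∃ ε, 0 < ε ∧ ∀ p ∈ baseRegion ε, P ε p := by
  obtain ⟨ε, h1, h2⟩ := (h.and self_mem_nhdsWithin).exists
  exact ⟨ε, h2, h1⟩

theorem eventually_base_snd {P : ℂ → Prop} (h : ∀ᶠ ζ in 𝓝[≠] (0 : ℂ), P ζ) :
    ∀ᶠ p in base, P p.2 := by
  obtain ⟨ε, hε, h⟩ := eventually_base_of_eventually (eventually_baseRegion_of_eventually h)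
  exact base_hasBasis.eventually_iff.2 ⟨ε, hε, fun p hp => h p hp⟩

theorem algebraMap_G (c : ℂ) : algebraMap ℂ G c = germ fun _ => c := by
  rw [Algebra.algebraMap_eq_smul_one]
  exact congrArg germ (funext fun p => mul_one c)

theorem dz_germ (f : ℂ × ℂ → ℂ) : dz (germ f) = germ (pdz f) := rfl

theorem dzbar_germ (f : ℂ × ℂ → ℂ) : dzbar (germ f) = germ (pdζ f) := rfl

theorem IsHolomorphic.of_eventually {f : ℂ × ℂ → ℂ} (h : ∀ᶠ p in base, AnalyticAt ℂ f p) :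
    IsHolomorphic (germ f) := ⟨f, rfl, h⟩

/-- The algebra of holomorphic germs. -/
def holomorphicGerms : Subalgebra ℂ G where
  carrier := {f | IsHolomorphic f}
  mul_mem' := by
    rintro _ _ ⟨f, rfl, hf⟩ ⟨g, rfl, hg⟩
    exact ⟨fun p => f p * g p, rfl, by filter_upwards [hf, hg] with p h1 h2 using h1.mul h2⟩
  add_mem' := by
    rintro _ _ ⟨f, rfl, hf⟩ ⟨g, rfl, hg⟩
    exact ⟨fun p => f p + g p, rfl, by filter_upwards [hf, hg] with p h1 h2 using h1.add h2⟩
  algebraMap_mem' c := ⟨fun _ => c, (algebraMap_G c).symm, Eventually.of_forall fun _ =>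
    analyticAt_const⟩

theorem IsHolomorphic.dz {f : G} (hf : IsHolomorphic f) : IsHolomorphic (dz f) := by
  obtain ⟨f, rfl, hf⟩ := hf
  exact ⟨pdz f, rfl, hf.mono fun p h => h.pdz⟩

theorem IsHolomorphic.dzbar {f : G} (hf : IsHolomorphic f) : IsHolomorphic (dzbar f) := by
  obtain ⟨f, rfl, hf⟩ := hf
  exact ⟨pdζ f, rfl, hf.mono fun p h => h.pdζ⟩

theorem dz_const (c : ℂ) : dz (algebraMap ℂ G c) = 0 := by
  rw [algebraMap_G, dz_germ]
  exact germ_congr (Eventually.of_forall fun p => by simp [pdz])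

theorem dzbar_const (c : ℂ) : dzbar (algebraMap ℂ G c) = 0 := by
  rw [algebraMap_G, dzbar_germ]
  exact germ_congr (Eventually.of_forall fun p => by simp [pdζ])

theorem dz_zero : dz 0 = 0 := by simpa using dz_const 0

theorem dzbar_zero : dzbar 0 = 0 := by simpa using dzbar_const 0

variable {f g : G}

theorem dz_add (hf : IsHolomorphic f) (hg : IsHolomorphic g) : dz (f + g) = dz f + dz g := by
  obtain ⟨f, rfl, hf⟩ := hf
  obtain ⟨g, rfl, hg⟩ := hg
  exact germ_congr (by filter_upwards [hf, hg] with p h1 h2 using pdz_add h1 h2)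

theorem dz_mul (hf : IsHolomorphic f) (hg : IsHolomorphic g) :
    dz (f * g) = dz f * g + f * dz g := by
  obtain ⟨f, rfl, hf⟩ := hf
  obtain ⟨g, rfl, hg⟩ := hg
  exact germ_congr (by filter_upwards [hf, hg] with p h1 h2 using pdz_mul h1 h2)

theorem dzbar_add (hf : IsHolomorphic f) (hg : IsHolomorphic g) :
    dzbar (f + g) = dzbar f + dzbar g := by
  obtain ⟨f, rfl, hf⟩ := hf
  obtain ⟨g, rfl, hg⟩ := hg
  exact germ_congr (by filter_upwards [hf, hg] with p h1 h2 using pdζ_add h1 h2)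

theorem dzbar_mul (hf : IsHolomorphic f) (hg : IsHolomorphic g) :
    dzbar (f * g) = dzbar f * g + f * dzbar g := by
  obtain ⟨f, rfl, hf⟩ := hf
  obtain ⟨g, rfl, hg⟩ := hg
  exact germ_congr (by filter_upwards [hf, hg] with p h1 h2 using pdζ_mul h1 h2)

theorem dz_dzbar (hf : IsHolomorphic f) : dz (dzbar f) = dzbar (dz f) := by
  obtain ⟨f, rfl, hf⟩ := hf
  exact germ_congr (by filter_upwards [hf] with p h1 using pdz_pdζ_comm h1)

theorem eq_const_of_dz_dzbar (hf : IsHolomorphic f) (h1 : dz f = 0) (h2 : dzbar f = 0) :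
    ∃ c : ℂ, f = algebraMap ℂ G c := by
  obtain ⟨f, rfl, hf⟩ := hf
  obtain ⟨ε, hε, H⟩ := base_hasBasis.eventually_iff.1
    (hf.and ((germ_eq_germ (g := fun _ => 0)).1 h1 |>.and ((germ_eq_germ (g := fun _ => 0)).1 h2)))
  obtain ⟨p₀, hp₀⟩ := nonempty_baseRegion hε
  refine ⟨f p₀, ?_⟩
  rw [algebraMap_G]
  refine germ_congr (base_hasBasis.eventually_iff.2 ⟨ε, hε, fun p hp => ?_⟩)
  refine (isOpen_baseRegion ε).is_const_of_fderiv_eq_zero (𝕜 := ℂ) (isPreconnected_baseRegion hε)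
    (fun q hq => (H hq).1.differentiableAt.differentiableWithinAt) (fun q hq => ?_) hp hp₀
  obtain ⟨h3, h4, h5⟩ := H hq
  have h4' : pdz f q = 0 := h4
  have h5' : pdζ f q = 0 := h5
  rw [pdz_eq_fderiv h3.differentiableAt] at h4'
  rw [pdζ_eq_fderiv h3.differentiableAt] at h5'
  ext
  · simpa using h4'
  · simpa using h5'

/-! ### Regular functions -/

theorem germ_fst_mem_regular (S : Set (ℂ → ℂ)) : germ (fun p => p.1) ∈ regular S :=
  Algebra.subset_adjoin (Or.inl (Or.inl (Or.inl rfl)))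

theorem germ_snd_mem_regular (S : Set (ℂ → ℂ)) : germ (fun p => p.2) ∈ regular S :=
  Algebra.subset_adjoin (Or.inl (Or.inl (Or.inr rfl)))

theorem germ_inv_mem_regular {S : Set (ℂ → ℂ)} {β : ℂ → ℂ} (h : β ∈ S) :
    germ (fun p => (p.1 - β p.2)⁻¹) ∈ regular S :=
  Algebra.subset_adjoin (Or.inl (Or.inr ⟨β, h, rfl⟩))

theorem germ_inv_snd_mem_regular {S : Set (ℂ → ℂ)} {c : ℂ} (h : c ∈ conjConsts S) :
    germ (fun p => (p.2 - c)⁻¹) ∈ regular S :=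
  Algebra.subset_adjoin (Or.inr ⟨c, h, rfl⟩)

theorem conjConsts_mono {S T : Set (ℂ → ℂ)} (h : S ⊆ T) : conjConsts S ⊆ conjConsts T :=
  fun _ hc => h hc

theorem regular_mono {S T : Set (ℂ → ℂ)} (h : S ⊆ T) : regular S ≤ regular T := by
  refine Algebra.adjoin_mono (Set.union_subset_union (Set.union_subset_union le_rfl ?_) ?_)
  · rintro _ ⟨β, hβ, rfl⟩
    exact ⟨β, h hβ, rfl⟩
  · rintro _ ⟨c, hc, rfl⟩
    exact ⟨c, conjConsts_mono h hc, rfl⟩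

theorem conjConsts_finite {S : Set (ℂ → ℂ)} (hS : S.Finite) : (conjConsts S).Finite := by
  refine hS.preimage (f := fun c : ℂ => fun _ : ℂ => starRingEnd ℂ c) fun x _ y _ h => ?_
  exact (starRingEnd ℂ).injective (congrFun h 0)

theorem germ_snd_mem_regularBar (A : Set ℂ) : germ (fun p => p.2) ∈ regularBar A :=
  Algebra.subset_adjoin (Or.inl rfl)

theorem germ_inv_snd_mem_regularBar {A : Set ℂ} {c : ℂ} (h : c ∈ A) :
    germ (fun p => (p.2 - c)⁻¹) ∈ regularBar A :=
  Algebra.subset_adjoin (Or.inr ⟨c, h, rfl⟩)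

theorem regularBar_mono {A B : Set ℂ} (h : A ⊆ B) : regularBar A ≤ regularBar B := by
  refine Algebra.adjoin_mono (Set.union_subset_union le_rfl ?_)
  rintro _ ⟨c, hc, rfl⟩
  exact ⟨c, h hc, rfl⟩

theorem regularBar_conjConsts_le (S : Set (ℂ → ℂ)) : regularBar (conjConsts S) ≤ regular S := by
  refine Algebra.adjoin_le ?_
  rintro _ (rfl | ⟨c, hc, rfl⟩)
  · exact germ_snd_mem_regular S
  · exact germ_inv_snd_mem_regular hc

theorem NiceRadius.isHolomorphic_germ {S : Set (ℂ → ℂ)} {C : Set ℂ} {ε : ℝ}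
    (h : NiceRadius S C ε) {f : ℂ × ℂ → ℂ} (hf : ∀ p ∈ baseRegion ε, AnalyticAt ℂ f p) :
    IsHolomorphic (germ f) :=
  .of_eventually (base_hasBasis.eventually_iff.2 ⟨ε, h.pos, fun p hp => hf p hp⟩)

theorem NiceRadius.germ_congr {S : Set (ℂ → ℂ)} {C : Set ℂ} {ε : ℝ}
    (h : NiceRadius S C ε) {f g : ℂ × ℂ → ℂ} (hf : ∀ p ∈ baseRegion ε, f p = g p) :
    germ f = germ g :=
  GenHyperlog.germ_congr (base_hasBasis.eventually_iff.2 ⟨ε, h.pos, fun p hp => hf p hp⟩)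

theorem analyticAt_comp_snd {a : ℂ → ℂ} {p : ℂ × ℂ} (h : AnalyticAt ℂ a p.2) :
    AnalyticAt ℂ (fun q : ℂ × ℂ => a q.2) p :=
  AnalyticAt.comp (f := fun q : ℂ × ℂ => q.2) h analyticAt_snd

theorem NiceRadius.analyticAt_inv {S : Set (ℂ → ℂ)} {C : Set ℂ} {ε : ℝ}
    (h : NiceRadius S C ε) {β : ℂ → ℂ} (hβ : β ∈ S) {p : ℂ × ℂ} (hp : p ∈ baseRegion ε) :
    AnalyticAt ℂ (fun p : ℂ × ℂ => (p.1 - β p.2)⁻¹) p :=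
  (analyticAt_fst.sub (analyticAt_comp_snd ((h.letter β hβ).analytic p hp))).inv
    ((h.letter β hβ).sub_ne_zero h.logDomain hp)

theorem NiceRadius.analyticAt_inv_snd {S : Set (ℂ → ℂ)} {C : Set ℂ} {ε : ℝ}
    (h : NiceRadius S C ε) {c : ℂ} (hc : c ∈ C) {p : ℂ × ℂ} (hp : p ∈ baseRegion ε) :
    AnalyticAt ℂ (fun p : ℂ × ℂ => (p.2 - c)⁻¹) p :=
  (analyticAt_snd.sub analyticAt_const).inv (h.sub_const_ne_zero hc hp.2.1 hp.2.2.1)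

variable {F : Subfield ℂ} {S : Set (ℂ → ℂ)}

theorem isHolomorphic_inv {β : ℂ → ℂ} (hβ : β ∈ FLT F) :
    IsHolomorphic (germ fun p => (p.1 - β p.2)⁻¹) := by
  obtain ⟨ε, h⟩ := exists_niceRadius (Set.finite_singleton β) (by simpa using hβ) Set.finite_empty
  exact h.isHolomorphic_germ fun p hp => h.analyticAt_inv rfl hp

theorem isHolomorphic_inv_snd (c : ℂ) : IsHolomorphic (germ fun p => (p.2 - c)⁻¹) := by
  obtain ⟨ε, h⟩ := exists_niceRadius (F := ⊤) Set.finite_empty (by simp) (Set.finite_singleton c)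
  exact h.isHolomorphic_germ fun p hp => h.analyticAt_inv_snd rfl hp

theorem isHolomorphic_of_mem_regular (hSF : S ⊆ FLT F) {r : G} (hr : r ∈ regular S) :
    IsHolomorphic r := by
  suffices h : regular S ≤ holomorphicGerms from h hr
  refine Algebra.adjoin_le ?_
  rintro _ (((rfl | rfl) | ⟨β, hβ, rfl⟩) | ⟨c, hc, rfl⟩)
  · exact .of_eventually (Eventually.of_forall fun p => analyticAt_fst)
  · exact .of_eventually (Eventually.of_forall fun p => analyticAt_snd)
  · exact isHolomorphic_inv (hSF hβ)
  · exact isHolomorphic_inv_snd c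

/-- A regular function, as a function on the whole of `ℂ²`: it is holomorphic in `z` away from the
letters, and its restriction to `z = z₀` belongs to every algebra that contains the restrictions of
the generators. -/
theorem exists_fun_of_mem_regular {r : G} (hr : r ∈ regular S) (z₀ : ℂ) (B : Subalgebra ℂ G)
    (h0 : germ (fun p => p.2) ∈ B) (h1 : ∀ β ∈ S, germ (fun p => (z₀ - β p.2)⁻¹) ∈ B)
    (h2 : ∀ c ∈ conjConsts S, germ (fun p => (p.2 - c)⁻¹) ∈ B) :
    ∃ R : ℂ × ℂ → ℂ, germ R = r ∧
      (∀ ζ z, (∀ β ∈ S, z ≠ β ζ) → AnalyticAt ℂ (fun z => R (z, ζ)) z) ∧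
      germ (fun p => R (z₀, p.2)) ∈ B := by
  induction hr using Algebra.adjoin_induction with
  | mem x hx =>
    rcases hx with ((rfl | rfl) | ⟨β, hβ, rfl⟩) | ⟨c, hc, rfl⟩
    · refine ⟨_, rfl, fun ζ z _ => analyticAt_id, ?_⟩
      rw [← algebraMap_G]
      exact B.algebraMap_mem z₀
    · exact ⟨_, rfl, fun ζ z _ => analyticAt_const, h0⟩
    · exact ⟨_, rfl, fun ζ z hz => (analyticAt_id.sub analyticAt_const).inv
        (sub_ne_zero.2 (hz β hβ)), h1 β hβ⟩
    · exact ⟨_, rfl, fun ζ z _ => analyticAt_const (v := (ζ - c)⁻¹), h2 c hc⟩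
  | algebraMap c =>
    refine ⟨_, (algebraMap_G c).symm, fun ζ z _ => analyticAt_const, ?_⟩
    rw [← algebraMap_G]
    exact B.algebraMap_mem c
  | add x y _ _ hx hy =>
    obtain ⟨f, rfl, hf, hf'⟩ := hx
    obtain ⟨g, rfl, hg, hg'⟩ := hy
    exact ⟨fun p => f p + g p, rfl, fun ζ z hz => (hf ζ z hz).add (hg ζ z hz), B.add_mem hf' hg'⟩
  | mul x y _ _ hx hy =>
    obtain ⟨f, rfl, hf, hf'⟩ := hx
    obtain ⟨g, rfl, hg, hg'⟩ := hy
    exact ⟨fun p => f p * g p, rfl, fun ζ z hz => (hf ζ z hz).mul (hg ζ z hz), B.mul_mem hf' hg'⟩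

theorem isConnected_compl_finite {A : Set ℂ} (hA : A.Finite) : IsConnected Aᶜ :=
  hA.countable.isConnected_compl_of_one_lt_rank (by rw [Complex.rank_real_complex]; norm_num)

/-- A regular function that does not depend on `z` can be evaluated at any `z₀` that is not a
constant letter. -/
theorem mem_of_dz_eq_zero (hS : S.Finite) (hSF : S ⊆ FLT F) {r : G} (hr : r ∈ regular S)
    (hd : dz r = 0) {z₀ : ℂ} (hz₀ : (fun _ => z₀) ∉ S) (B : Subalgebra ℂ G)
    (h0 : germ (fun p => p.2) ∈ B) (h1 : ∀ β ∈ S, germ (fun p => (z₀ - β p.2)⁻¹) ∈ B)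
    (h2 : ∀ c ∈ conjConsts S, germ (fun p => (p.2 - c)⁻¹) ∈ B) : r ∈ B := by
  obtain ⟨R, rfl, hR, hB⟩ := exists_fun_of_mem_regular hr z₀ B h0 h1 h2
  suffices h : germ R = germ fun p => R (z₀, p.2) by rwa [h]
  obtain ⟨ε, hε⟩ := exists_niceRadius hS hSF Set.finite_empty
  -- No letter is the constant `z₀`, so near the base point `z₀` is not a singularity of the slice
  -- over `ζ`.
  have hz₀' : ∀ᶠ p in base, ∀ β ∈ S, z₀ ≠ β p.2 := by
    refine (eventually_all_finite hS).2 fun β hβ =>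
      eventually_base_snd (P := fun ζ => z₀ ≠ β ζ) ?_
    refine eventually_ne_of_mem_FLT (F := ⊤) (const_mem_FLT trivial) (FLT_mono_top (hSF hβ)) ?_
    rintro rfl
    exact hz₀ hβ
  have hd' := (germ_eq_germ (g := fun _ => 0)).1 hd
  refine germ_congr ?_
  filter_upwards [hz₀', eventually_eventually_nhds_base hd', eventually_base_baseRegion hε.pos]
    with p hp hdp hpε
  have hfin : ((fun β : ℂ → ℂ => β p.2) '' S).Finite := hS.image _
  have hmem : ∀ z, z ∈ ((fun β : ℂ → ℂ => β p.2) '' S)ᶜ ↔ ∀ β ∈ S, z ≠ β p.2 := fun z =>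
    ⟨fun h β hβ e => h ⟨β, hβ, e.symm⟩, fun h ⟨β, hβ, e⟩ => h β hβ e.symm⟩
  have hopen : IsOpen ((fun β : ℂ → ℂ => β p.2) '' S)ᶜ := hfin.isClosed.isOpen_compl
  have hpre := (isConnected_compl_finite hfin).isPreconnected
  have han : AnalyticOnNhd ℂ (fun z => R (z, p.2)) ((fun β : ℂ → ℂ => β p.2) '' S)ᶜ :=
    fun z hz => hR p.2 z ((hmem z).1 hz)
  have hp1 : p.1 ∈ ((fun β : ℂ → ℂ => β p.2) '' S)ᶜ := (hmem _).2 fun β hβ =>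
    sub_ne_zero.1 ((hε.letter β hβ).sub_ne_zero hε.logDomain hpε)
  -- For fixed `ζ` the derivative vanishes near `p.1`, hence on the complement of the finitely many
  -- letters, which is connected. So the values at `p.1` and at `z₀` agree.
  have hder : Set.EqOn (deriv fun z => R (z, p.2)) (fun _ => 0)
      ((fun β : ℂ → ℂ => β p.2) '' S)ᶜ :=
    han.deriv.eqOn_of_preconnected_of_eventuallyEq analyticOnNhd_const hpre hp1
      (eventually_prodMk_left hdp)
  exact hopen.is_const_of_deriv_eq_zero hpre han.differentiableOn hder hp1 ((hmem z₀).2 hp)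

/-- The derivative of a meromorphic function has no residues. -/
theorem residue_eq_zero {ι : Type*} [Fintype ι] {a : ι → ℂ} (ha : Function.Injective a) {c : ι → ℂ}
    {X : ℂ → ℂ} (hX : ∀ z, (∀ i, z ≠ a i) → AnalyticAt ℂ X z) {z₁ : ℂ} (hz₁ : ∀ i, z₁ ≠ a i)
    (h : ∀ᶠ z in 𝓝 z₁, ∑ i, (z - a i)⁻¹ * c i + deriv X z = 0) (i : ι) : c i = 0 := by
  classical
  have hfin : (Set.range a).Finite := Set.finite_range a
  have hmem : ∀ z, z ∈ (Set.range a)ᶜ ↔ ∀ i, z ≠ a i := fun z =>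
    ⟨fun h i e => h ⟨i, e.symm⟩, fun h ⟨i, e⟩ => h i e.symm⟩
  -- The identity theorem carries the relation from a neighbourhood of `z₁` to a small circle around
  -- `a i`, where integration picks out `c i`.
  have hall : Set.EqOn (fun z => ∑ i, (z - a i)⁻¹ * c i + deriv X z) (fun _ => 0)
      (Set.range a)ᶜ := by
    refine AnalyticOnNhd.eqOn_of_preconnected_of_eventuallyEq (𝕜 := ℂ) (fun z hz => ?_)
      analyticOnNhd_const (isConnected_compl_finite hfin).isPreconnected ((hmem z₁).2 hz₁) h
    have hz' := (hmem z).1 hz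
    refine AnalyticAt.add ?_ (hX z hz').deriv
    refine Finset.analyticAt_fun_sum _ fun j _ => ?_
    exact ((analyticAt_id.sub analyticAt_const).inv (sub_ne_zero.2 (hz' j))).mul analyticAt_const
  obtain ⟨r, hr, hball⟩ : ∃ r > 0, ∀ z ∈ Metric.closedBall (a i) r, ∀ j, j ≠ i → z ≠ a j := by
    have h1 : ∀ᶠ z in 𝓝 (a i), ∀ j, j ≠ i → z ≠ a j := by
      refine eventually_all.2 fun j => ?_
      by_cases hj : j = i
      · exact Eventually.of_forall fun _ h => absurd hj h
      · filter_upwards [isOpen_ne.mem_nhds (ha.ne (Ne.symm hj))] with z hz _ using hz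
    obtain ⟨r, hr, h2⟩ := Metric.nhds_basis_closedBall.mem_iff.1 h1
    exact ⟨r, hr, fun z hz => h2 hz⟩
  have hsph : ∀ z ∈ Metric.sphere (a i) r, ∀ j, z ≠ a j := by
    intro z hz j
    by_cases hj : j = i
    · subst hj
      exact ne_of_mem_of_not_mem hz (by simp [hr.ne])
    · exact hball z (Metric.sphere_subset_closedBall hz) j hj
  have hXint : ∮ z in C(a i, r), deriv X z = 0 :=
    circleIntegral.integral_eq_zero_of_hasDerivWithinAt hr.le fun z hz =>
      (hX z (hsph z hz)).differentiableAt.hasDerivAt.hasDerivWithinAt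
  have hjint : ∀ j, j ≠ i → ∮ z in C(a i, r), (z - a j)⁻¹ * c j = 0 := by
    intro j hj
    refine DiffContOnCl.circleIntegral_eq_zero hr.le (DifferentiableOn.diffContOnCl fun z hz => ?_)
    have h1 := hball z (Metric.closure_ball_subset_closedBall hz) j hj
    exact (((differentiableAt_id.sub_const (a j)).inv (sub_ne_zero.2 h1)).mul_const
      (c j)).differentiableWithinAt
  have hiint : ∮ z in C(a i, r), (z - a i)⁻¹ * c i = 2 * Real.pi * Complex.I * c i := by
    have h1 : ∮ z in C(a i, r), (z - a i)⁻¹ * c i = ∮ z in C(a i, r), c i * (z - a i)⁻¹ := by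
      congr 1
      ext z
      ring
    rw [h1, circleIntegral.integral_const_mul, circleIntegral.integral_sub_center_inv _ hr.ne']
    ring
  have hci : ∀ j, CircleIntegrable (fun z => (z - a j)⁻¹ * c j) (a i) r := fun j =>
    ContinuousOn.circleIntegrable hr.le fun z hz => by
      have h1 := hsph z hz j
      exact (((continuousAt_id.sub continuousAt_const).inv₀ (sub_ne_zero.2 h1)).mul
        continuousAt_const).continuousWithinAt
  have hdX : CircleIntegrable (deriv X) (a i) r :=
    ContinuousOn.circleIntegrable hr.le fun z hz =>
      (hX z (hsph z hz)).deriv.continuousAt.continuousWithinAt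
  have hzero : ∮ z in C(a i, r), (∑ j, (z - a j)⁻¹ * c j + deriv X z) = 0 := by
    rw [circleIntegral.integral_congr hr.le (g := fun _ => 0)
      fun z hz => hall ((hmem z).2 (hsph z hz))]
    simp [circleIntegral]
  have hsumint : CircleIntegrable (fun z => ∑ j, (z - a j)⁻¹ * c j) (a i) r :=
    CircleIntegrable.fun_sum _ fun j _ => hci j
  rw [circleIntegral.integral_add hsumint hdX, hXint, add_zero,
    circleIntegral.integral_fun_sum (fun j _ => hci j), Finset.sum_eq_single i
      (fun j _ hj => hjint j hj) (by simp), hiint] at hzero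
  exact (mul_eq_zero.1 hzero).resolve_left Complex.two_pi_I_ne_zero

end
end GenHyperlog

namespace GenHyperlog
noncomputable section

/-! ### Formal combinations of words -/

section Words

variable {R N α : Type*} [CommRing R] [AddCommGroup N] [Module R N]

/-- The derivation on formal combinations of words that extends a derivation `d` of the coefficients
and that removes the head `a` of a word at the cost of the factor `u a`. -/
def wordDerivation (d : N →+ N) (u : α → R) : (List α →₀ N) →+ (List α →₀ N) :=
  Finsupp.liftAddHom fun w => (Finsupp.singleAddHom w).comp d +
    match w with
    | [] => 0
    | a :: w => (Finsupp.singleAddHom w).comp (DistribSMul.toAddMonoidHom N (u a))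

theorem wordDerivation_single_nil (d : N →+ N) (u : α → R) (n : N) :
    wordDerivation d u (Finsupp.single [] n) = Finsupp.single [] (d n) := by
  simp [wordDerivation]

theorem wordDerivation_single_cons (d : N →+ N) (u : α → R) (a : α) (w : List α) (n : N) :
    wordDerivation d u (Finsupp.single (a :: w) n) =
      Finsupp.single (a :: w) (d n) + Finsupp.single w (u a • n) := by
  simp [wordDerivation]

/-- A coefficient receives contributions only from words with one letter more; hence the
coefficients of the longest words see nothing but `d`. -/
theorem wordDerivation_apply [Fintype α] (d : N →+ N) (u : α → R) (m : List α →₀ N) (w : List α) :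
    wordDerivation d u m w = d (m w) + ∑ a, u a • m (a :: w) := by
  classical
  induction m using Finsupp.induction_linear with
  | zero => simp
  | add f g hf hg =>
    rw [map_add, Finsupp.add_apply, hf, hg, Finsupp.add_apply, map_add]
    simp only [Finsupp.add_apply, smul_add, Finset.sum_add_distrib]
    abel
  | single v n =>
    cases v with
    | nil =>
      rw [wordDerivation_single_nil]
      have h : ∀ a, (Finsupp.single [] n : List α →₀ N) (a :: w) = 0 := fun a =>
        Finsupp.single_eq_of_ne (by simp)
      simp only [h, smul_zero, Finset.sum_const_zero, add_zero]
      by_cases hw : w = []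
      · subst hw
        simp
      · rw [Finsupp.single_eq_of_ne hw, Finsupp.single_eq_of_ne hw, map_zero]
    | cons b v =>
      rw [wordDerivation_single_cons]
      simp only [Finsupp.add_apply, Finsupp.single_apply, List.cons.injEq]
      congr 1
      · split_ifs <;> simp
      · by_cases h : v = w
        · simp [h]
        · simp [h]

/-- Elimination on the length of the longest words. By `clear` a scalar that annihilates nothing
makes their coefficients nilpotent under `d`; applying the derivation then makes these coefficients
`d`-constant before all of them vanish. One further derivation removes the longest words, and its
result is nonzero, since otherwise `res`, the absence of residues in a derivative, would annihilate
their coefficients. In the end only the empty word is left. `Good` records that its coefficient has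
been cleared of denominators. -/
theorem exists_single_nil_mem [Fintype α] (d : N →+ N) (u : α → R) (K : Set (List α →₀ N))
    (hKs : ∀ (r : R), ∀ m ∈ K, r • m ∈ K) (hKd : ∀ m ∈ K, wordDerivation d u m ∈ K)
    (Good : N → Prop) (hGd : ∀ n, Good n → Good (d n))
    (clear : ∀ T : Finset N, ∃ q : R, (∀ n : N, q • n = 0 → n = 0) ∧
      ∃ k, ∀ n ∈ T, Good (q • n) ∧ d^[k] (q • n) = 0)
    (res : ∀ (c : α → N) (x : N), (∀ a, d (c a) = 0) → d x + ∑ a, u a • c a = 0 → ∀ a, c a = 0)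
    {m : List α →₀ N} (hm : m ∈ K) (hm0 : m ≠ 0) :
    ∃ n, n ≠ 0 ∧ d n = 0 ∧ Good n ∧ Finsupp.single [] n ∈ K := by
  classical
  -- The hypothesis passed as `IH` treats combinations of words shorter than `L`; `k` bounds the
  -- number of derivations after which all coefficients of length `L` vanish.
  have inner : ∀ L, (∀ m ∈ K, m ≠ 0 → (∀ w, L ≤ w.length → m w = 0) →
      ∃ n, n ≠ 0 ∧ d n = 0 ∧ Good n ∧ Finsupp.single [] n ∈ K) →
      ∀ k, ∀ m ∈ K, (∀ w, L < w.length → m w = 0) → (∃ w, w.length = L ∧ m w ≠ 0) →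
      (∀ w, w.length = L → Good (m w) ∧ d^[k] (m w) = 0) →
      ∃ n, n ≠ 0 ∧ d n = 0 ∧ Good n ∧ Finsupp.single [] n ∈ K := by
    intro L IH k
    induction k with
    | zero =>
      rintro m - - ⟨w, hw, hw0⟩ h
      exact absurd (h w hw).2 hw0
    | succ k ihk =>
      intro m hm hL htop h
      have happ : ∀ w, L ≤ w.length → wordDerivation d u m w = d (m w) := by
        intro w hw
        rw [wordDerivation_apply, Finset.sum_eq_zero, add_zero]
        intro a _
        rw [hL (a :: w) (by simp; omega), smul_zero]
      by_cases hd : ∃ w, w.length = L ∧ d (m w) ≠ 0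
      · obtain ⟨w, hw, hw0⟩ := hd
        refine ihk _ (hKd m hm) (fun w hw => ?_) ⟨w, hw, ?_⟩ fun w hw => ?_
        · rw [happ w hw.le, hL w hw, map_zero]
        · rwa [happ w hw.ge]
        · rw [happ w hw.ge]
          refine ⟨hGd _ (h w hw).1, ?_⟩
          rw [← Function.iterate_succ_apply]
          exact (h w hw).2
      · push Not at hd
        cases L with
        | zero =>
          obtain ⟨w, hw, hw0⟩ := htop
          obtain rfl := List.length_eq_zero_iff.1 hw
          refine ⟨m [], hw0, hd [] rfl, (h [] rfl).1, ?_⟩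
          have e : m = Finsupp.single [] (m []) := by
            ext v
            cases v with
            | nil => simp
            | cons a v => rw [hL _ (by simp), Finsupp.single_apply, if_neg (by simp)]
          rwa [← e]
        | succ l =>
          -- If the derivation gave `0`, its coefficient at the tail `w` of a longest word would
          -- write the sum of the `u a • m (a :: w)` as `-d (m w)`, and `res` would apply.
          by_cases h0 : wordDerivation d u m = 0
          · exfalso
            obtain ⟨w, hw, hw0⟩ := htop
            obtain ⟨b, w, rfl⟩ := List.exists_cons_of_length_eq_add_one hw
            refine hw0 (res (fun a => m (a :: w)) (m w) (fun a => ?_) ?_ b)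
            · exact hd _ (by simpa using hw)
            · rw [← wordDerivation_apply, h0, Finsupp.zero_apply]
          · refine IH _ (hKd m hm) h0 fun w hw => ?_
            rw [happ w hw]
            rcases hw.eq_or_lt with h1 | h1
            · exact hd w h1.symm
            · rw [hL w h1, map_zero]
  have outer : ∀ L, ∀ m ∈ K, m ≠ 0 → (∀ w, L ≤ w.length → m w = 0) →
      ∃ n, n ≠ 0 ∧ d n = 0 ∧ Good n ∧ Finsupp.single [] n ∈ K := by
    intro L
    induction L with
    | zero =>
      intro m _ hm0 h
      exact absurd (Finsupp.ext fun w => h w (Nat.zero_le _)) hm0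
    | succ L ih =>
      intro m hm hm0 h
      by_cases htop : ∃ w, w.length = L ∧ m w ≠ 0
      · obtain ⟨w, hw, hw0⟩ := htop
        -- `0` is inserted because words of length `L` outside the support need the conclusion too.
        obtain ⟨q, hq, k, hk⟩ := clear (insert 0 (m.support.image m))
        refine inner L ih k (q • m) (hKs q m hm) (fun w hw => ?_) ⟨w, hw, fun h1 => ?_⟩ fun w hw => ?_
        · rw [Finsupp.smul_apply, h w hw, smul_zero]
        · exact hw0 (hq _ h1)
        · refine hk (m w) ?_
          by_cases h1 : m w = 0
          · simp [h1]
          · exact Finset.mem_insert_of_mem (Finset.mem_image_of_mem m (Finsupp.mem_support_iff.2 h1))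
      · push Not at htop
        refine ih m hm hm0 fun w hw => ?_
        rcases hw.eq_or_lt with h1 | h1
        · exact htop w h1.symm
        · exact h w h1
  refine outer (m.support.sup List.length + 1) m hm hm0 fun w hw => ?_
  by_contra h1
  have h2 := Finset.le_sup (f := List.length) (Finsupp.mem_support_iff.2 h1)
  omega

end Words

/-! ### Derivatives of regular functions -/

variable {F : Subfield ℂ} {S : Set (ℂ → ℂ)} {A : Set ℂ}

theorem dz_germ_fst : dz (germ fun p => p.1) = 1 :=
  germ_congr (Eventually.of_forall fun p => by simp)

theorem dz_germ_snd (f : ℂ → ℂ) : dz (germ fun p => f p.2) = 0 :=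
  germ_congr (Eventually.of_forall fun p => by simp)

theorem dzbar_germ_fst : dzbar (germ fun p => p.1) = 0 :=
  germ_congr (Eventually.of_forall fun p => by simp)

theorem dzbar_germ_snd : dzbar (germ fun p => p.2) = 1 :=
  germ_congr (Eventually.of_forall fun p => by simp)

theorem dz_germ_inv {β : ℂ → ℂ} (hβ : β ∈ FLT F) :
    dz (germ fun p => (p.1 - β p.2)⁻¹) = -(germ fun p => (p.1 - β p.2)⁻¹) ^ 2 := by
  obtain ⟨ε, h⟩ := exists_niceRadius (Set.finite_singleton β) (by simpa using hβ) Set.finite_empty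
  refine h.germ_congr fun p hp => ?_
  have h1 := (h.letter β rfl).sub_ne_zero h.logDomain hp
  have h2 := ((hasDerivAt_id p.1).sub_const (β p.2)).fun_inv h1
  refine h2.deriv.trans ?_
  change -1 / (p.1 - β p.2) ^ 2 = -((p.1 - β p.2)⁻¹) ^ 2
  field_simp

theorem dzbar_germ_inv_snd (c : ℂ) :
    dzbar (germ fun p => (p.2 - c)⁻¹) = -(germ fun p => (p.2 - c)⁻¹) ^ 2 := by
  obtain ⟨ε, h⟩ := exists_niceRadius (F := ⊤) Set.finite_empty (by simp) (Set.finite_singleton c)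
  refine h.germ_congr fun p hp => ?_
  have h1 := h.sub_const_ne_zero rfl hp.2.1 hp.2.2.1
  have h2 := ((hasDerivAt_id p.2).sub_const c).fun_inv h1
  refine h2.deriv.trans ?_
  change -1 / (p.2 - c) ^ 2 = -((p.2 - c)⁻¹) ^ 2
  field_simp

theorem dz_mem_regular (hSF : S ⊆ FLT F) {r : G} (hr : r ∈ regular S) : dz r ∈ regular S := by
  induction hr using Algebra.adjoin_induction with
  | mem x hx =>
    rcases hx with ((rfl | rfl) | ⟨β, hβ, rfl⟩) | ⟨c, hc, rfl⟩
    · rw [dz_germ_fst]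
      exact one_mem _
    · rw [dz_germ_snd fun ζ => ζ]
      exact zero_mem _
    · rw [dz_germ_inv (hSF hβ)]
      exact neg_mem (pow_mem (germ_inv_mem_regular hβ) 2)
    · rw [dz_germ_snd fun ζ => (ζ - c)⁻¹]
      exact zero_mem _
  | algebraMap c =>
    rw [dz_const]
    exact zero_mem _
  | add x y hx hy h1 h2 =>
    rw [dz_add (isHolomorphic_of_mem_regular hSF hx) (isHolomorphic_of_mem_regular hSF hy)]
    exact add_mem h1 h2
  | mul x y hx hy h1 h2 =>
    rw [dz_mul (isHolomorphic_of_mem_regular hSF hx) (isHolomorphic_of_mem_regular hSF hy)]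
    exact add_mem (mul_mem h1 hy) (mul_mem hx h2)

theorem eventually_base_linear_ne_zero {c d : ℂ} (h : c ≠ 0 ∨ d ≠ 0) :
    ∀ᶠ p in base, c * p.2 + d ≠ 0 :=
  eventually_base_snd (P := fun ζ => c * ζ + d ≠ 0) (eventually_linear_ne_zero h)

theorem eventually_base_sub_ne_zero {β : ℂ → ℂ} (hβ : β ∈ FLT F) :
    ∀ᶠ p in base, p.1 - β p.2 ≠ 0 := by
  obtain ⟨ε, h⟩ := exists_niceRadius (Set.finite_singleton β) (by simpa using hβ) Set.finite_empty
  filter_upwards [eventually_base_baseRegion h.pos] with p hp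
  exact (h.letter β rfl).sub_ne_zero h.logDomain hp

theorem hasDerivAt_linearFractional {a b c d x : ℂ} (h : c * x + d ≠ 0) :
    HasDerivAt (fun x => (a * x + b) / (c * x + d)) ((a * d - b * c) / (c * x + d) ^ 2) x := by
  have h1 : ∀ a b : ℂ, HasDerivAt (fun x => a * x + b) a x := fun a b => by
    simpa using ((hasDerivAt_id x).const_mul a).add_const b
  refine ((h1 a b).fun_div (h1 c d) h).congr_deriv ?_
  ring

/-- The derivative is `β' / (z - β)²` with `β' = Δ / (c ζ + d)²`, and `1 / (c ζ + d)` is not among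
the generators. But `a - c β = Δ / (c ζ + d)`, and `(a - c β) / (z - β) = a I - c (z I - 1)` is
regular. -/
theorem dzbar_germ_inv_mem_regular {β : ℂ → ℂ} (hβS : β ∈ S) (hβ : β ∈ FLT F) :
    dzbar (germ fun p => (p.1 - β p.2)⁻¹) ∈ regular S := by
  obtain ⟨a, -, b, -, c, -, d, -, hcd, hdet, hβ'⟩ := exists_coeffs_of_mem_FLT hβ
  have hβe : β = fun x => (a * x + b) / (c * x + d) := funext hβ'
  set Δ : ℂ := a * d - b * c with hΔ
  set I : G := germ fun p => (p.1 - β p.2)⁻¹ with hI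
  -- For a constant letter `Δ = 0`, and the default value `0⁻¹ = 0` gives the correct derivative.
  have key : dzbar I = algebraMap ℂ G Δ⁻¹ * (algebraMap ℂ G a * I - algebraMap ℂ G c *
      (germ (fun p => p.1) * I - 1)) ^ 2 := by
    simp only [algebraMap_G]
    refine germ_congr ?_
    filter_upwards [eventually_base_linear_ne_zero hcd, eventually_base_sub_ne_zero hβ] with p h1 h2
    have h3 : HasDerivAt β (Δ / (c * p.2 + d) ^ 2) p.2 := by
      rw [hβe]
      exact hasDerivAt_linearFractional h1
    have h4 := (h3.const_sub p.1).fun_inv h2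
    refine h4.deriv.trans ?_
    change -(-(Δ / (c * p.2 + d) ^ 2)) / (p.1 - β p.2) ^ 2 = Δ⁻¹ * (a * (p.1 - β p.2)⁻¹ -
      c * (p.1 * (p.1 - β p.2)⁻¹ - 1)) ^ 2
    rcases hdet with hdet | ⟨rfl, rfl, rfl⟩
    · have h6 : a - c * β p.2 = Δ / (c * p.2 + d) := by
        rw [hβ', eq_div_iff h1, sub_mul, mul_assoc, div_mul_cancel₀ _ h1]
        ring
      have h7 : a * (p.1 - β p.2)⁻¹ - c * (p.1 * (p.1 - β p.2)⁻¹ - 1) =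
          (p.1 - β p.2)⁻¹ * (Δ / (c * p.2 + d)) := by
        rw [← h6]
        field_simp
        ring
      rw [h7]
      field_simp
    · simp [hΔ]
  rw [key]
  have hIm : I ∈ regular S := germ_inv_mem_regular hβS
  refine mul_mem (Subalgebra.algebraMap_mem _ _) (pow_mem (sub_mem ?_ ?_) 2)
  · exact mul_mem (Subalgebra.algebraMap_mem _ _) hIm
  · exact mul_mem (Subalgebra.algebraMap_mem _ _)
      (sub_mem (mul_mem (germ_fst_mem_regular S) hIm) (one_mem _))

theorem dzbar_mem_regular (hSF : S ⊆ FLT F) {r : G} (hr : r ∈ regular S) :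
    dzbar r ∈ regular S := by
  induction hr using Algebra.adjoin_induction with
  | mem x hx =>
    rcases hx with ((rfl | rfl) | ⟨β, hβ, rfl⟩) | ⟨c, hc, rfl⟩
    · rw [dzbar_germ_fst]
      exact zero_mem _
    · rw [dzbar_germ_snd]
      exact one_mem _
    · exact dzbar_germ_inv_mem_regular hβ (hSF hβ)
    · rw [dzbar_germ_inv_snd]
      exact neg_mem (pow_mem (germ_inv_snd_mem_regular hc) 2)
  | algebraMap c =>
    rw [dzbar_const]
    exact zero_mem _
  | add x y hx hy h1 h2 =>
    rw [dzbar_add (isHolomorphic_of_mem_regular hSF hx) (isHolomorphic_of_mem_regular hSF hy)]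
    exact add_mem h1 h2
  | mul x y hx hy h1 h2 =>
    rw [dzbar_mul (isHolomorphic_of_mem_regular hSF hx) (isHolomorphic_of_mem_regular hSF hy)]
    exact add_mem (mul_mem h1 hy) (mul_mem hx h2)

theorem isHolomorphic_of_mem_regularBar {r : G} (hr : r ∈ regularBar A) : IsHolomorphic r := by
  suffices h : regularBar A ≤ holomorphicGerms from h hr
  refine Algebra.adjoin_le ?_
  rintro _ (rfl | ⟨c, hc, rfl⟩)
  · exact .of_eventually (Eventually.of_forall fun p => analyticAt_snd)
  · exact isHolomorphic_inv_snd c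

/-- A regular function of `ζ`, as a function on the whole of `ℂ`. -/
theorem exists_fun_of_mem_regularBar {r : G} (hr : r ∈ regularBar A) :
    ∃ R : ℂ → ℂ, germ (fun p => R p.2) = r ∧ ∀ ζ, ζ ∉ A → AnalyticAt ℂ R ζ := by
  induction hr using Algebra.adjoin_induction with
  | mem x hx =>
    rcases hx with rfl | ⟨c, hc, rfl⟩
    · exact ⟨id, rfl, fun ζ _ => analyticAt_id⟩
    · refine ⟨fun ζ => (ζ - c)⁻¹, rfl, fun ζ hζ => ?_⟩
      refine (analyticAt_id.sub analyticAt_const).inv (sub_ne_zero.2 ?_)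
      rintro rfl
      exact hζ hc
  | algebraMap c => exact ⟨fun _ => c, (algebraMap_G c).symm, fun ζ _ => analyticAt_const⟩
  | add x y _ _ hx hy =>
    obtain ⟨f, rfl, hf⟩ := hx
    obtain ⟨g, rfl, hg⟩ := hy
    exact ⟨fun p => f p + g p, rfl, fun ζ hζ => (hf ζ hζ).add (hg ζ hζ)⟩
  | mul x y _ _ hx hy =>
    obtain ⟨f, rfl, hf⟩ := hx
    obtain ⟨g, rfl, hg⟩ := hy
    exact ⟨fun p => f p * g p, rfl, fun ζ hζ => (hf ζ hζ).mul (hg ζ hζ)⟩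

theorem dz_of_mem_regularBar {r : G} (hr : r ∈ regularBar A) : dz r = 0 := by
  obtain ⟨R, rfl, -⟩ := exists_fun_of_mem_regularBar hr
  exact dz_germ_snd R

theorem dzbar_mem_regularBar {r : G} (hr : r ∈ regularBar A) : dzbar r ∈ regularBar A := by
  induction hr using Algebra.adjoin_induction with
  | mem x hx =>
    rcases hx with rfl | ⟨c, hc, rfl⟩
    · rw [dzbar_germ_snd]
      exact one_mem _
    · rw [dzbar_germ_inv_snd]
      exact neg_mem (pow_mem (germ_inv_snd_mem_regularBar hc) 2)
  | algebraMap c =>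
    rw [dzbar_const]
    exact zero_mem _
  | add x y hx hy h1 h2 =>
    rw [dzbar_add (isHolomorphic_of_mem_regularBar hx) (isHolomorphic_of_mem_regularBar hy)]
    exact add_mem h1 h2
  | mul x y hx hy h1 h2 =>
    rw [dzbar_mul (isHolomorphic_of_mem_regularBar hx) (isHolomorphic_of_mem_regularBar hy)]
    exact add_mem (mul_mem h1 hy) (mul_mem hx h2)

/-! ### Denominators and nilpotency -/

theorem isUnit_germ {f : ℂ × ℂ → ℂ} (h : ∀ᶠ p in base, f p ≠ 0) : IsUnit (germ f) := by
  refine IsUnit.of_mul_eq_one (germ fun p => (f p)⁻¹) (germ_congr ?_)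
  filter_upwards [h] with p hp using mul_inv_cancel₀ hp

/-- `regular ∅` is the polynomial ring in `z` and `ζ`. The denominators are polynomials without
zeros near the base point, hence units among germs, so multiplication by them loses nothing. -/
theorem exists_clear_regular (hSF : S ⊆ FLT F) {r : G} (hr : r ∈ regular S) :
    ∃ q ∈ regular ∅, IsUnit q ∧ q * r ∈ regular ∅ := by
  induction hr using Algebra.adjoin_induction with
  | mem x hx =>
    rcases hx with ((rfl | rfl) | ⟨β, hβ, rfl⟩) | ⟨c, hc, rfl⟩
    · exact ⟨1, one_mem _, isUnit_one, by simpa using germ_fst_mem_regular ∅⟩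
    · exact ⟨1, one_mem _, isUnit_one, by simpa using germ_snd_mem_regular ∅⟩
    · obtain ⟨a, -, b, -, c, -, d, -, hcd, -, hβ'⟩ := exists_coeffs_of_mem_FLT (hSF hβ)
      have hlin : ∀ c d : ℂ, germ (fun p => c * p.2 + d) ∈ regular ∅ := fun c d => by
        have h := add_mem (mul_mem (Subalgebra.algebraMap_mem (regular ∅) c)
          (germ_snd_mem_regular ∅)) (Subalgebra.algebraMap_mem (regular ∅) d)
        simp only [algebraMap_G] at h
        exact h
      have hne := (eventually_base_linear_ne_zero hcd).and (eventually_base_sub_ne_zero (hSF hβ))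
      refine ⟨germ fun p => p.1 * (c * p.2 + d) - (a * p.2 + b), ?_, isUnit_germ ?_, ?_⟩
      · exact sub_mem (mul_mem (germ_fst_mem_regular ∅) (hlin c d)) (hlin a b)
      · filter_upwards [hne] with p hp h0
        apply hp.2
        rw [hβ', sub_eq_zero, eq_div_iff hp.1]
        exact sub_eq_zero.1 h0
      · have e : germ (fun p => p.1 * (c * p.2 + d) - (a * p.2 + b)) *
            germ (fun p => (p.1 - β p.2)⁻¹) = germ fun p => c * p.2 + d := by
          refine germ_congr ?_
          filter_upwards [hne] with p hp
          have h1 := hp.2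
          have h2 := hp.1
          change (p.1 * (c * p.2 + d) - (a * p.2 + b)) * (p.1 - β p.2)⁻¹ = c * p.2 + d
          rw [← div_eq_mul_inv, div_eq_iff h1, hβ', mul_sub, mul_div_cancel₀ _ h2]
          ring
        rw [e]
        exact hlin c d
    · refine ⟨germ fun p => p.2 - c, ?_, isUnit_germ ?_, ?_⟩
      · have h := sub_mem (germ_snd_mem_regular ∅) (Subalgebra.algebraMap_mem (regular ∅) c)
        rw [algebraMap_G] at h
        exact h
      · filter_upwards [eventually_base_linear_ne_zero (c := 1) (d := -c) (Or.inl one_ne_zero)]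
          with p hp
        simpa [sub_eq_add_neg] using hp
      · have e : germ (fun p => p.2 - c) * germ (fun p => (p.2 - c)⁻¹) = 1 := by
          refine germ_congr ?_
          filter_upwards [eventually_base_linear_ne_zero (c := 1) (d := -c) (Or.inl one_ne_zero)]
            with p hp
          exact mul_inv_cancel₀ (by simpa [sub_eq_add_neg] using hp)
        rw [e]
        exact one_mem _
  | algebraMap c => exact ⟨1, one_mem _, isUnit_one, by
      rw [one_mul]
      exact Subalgebra.algebraMap_mem _ _⟩
  | add x y _ _ hx hy =>
    obtain ⟨q, hq, hqu, hqx⟩ := hx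
    obtain ⟨q', hq', hqu', hqy⟩ := hy
    refine ⟨q * q', mul_mem hq hq', hqu.mul hqu', ?_⟩
    have e : q * q' * (x + y) = q' * (q * x) + q * (q' * y) := by ring
    rw [e]
    exact add_mem (mul_mem hq' hqx) (mul_mem hq hqy)
  | mul x y _ _ hx hy =>
    obtain ⟨q, hq, hqu, hqx⟩ := hx
    obtain ⟨q', hq', hqu', hqy⟩ := hy
    refine ⟨q * q', mul_mem hq hq', hqu.mul hqu', ?_⟩
    have e : q * q' * (x * y) = q * x * (q' * y) := by ring
    rw [e]
    exact mul_mem hqx hqy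

theorem exists_clear_regularBar {r : G} (hr : r ∈ regularBar A) :
    ∃ q ∈ regularBar ∅, IsUnit q ∧ q * r ∈ regularBar ∅ := by
  induction hr using Algebra.adjoin_induction with
  | mem x hx =>
    rcases hx with rfl | ⟨c, hc, rfl⟩
    · exact ⟨1, one_mem _, isUnit_one, by simpa using germ_snd_mem_regularBar ∅⟩
    · have hne : ∀ᶠ p in base, p.2 - c ≠ 0 := by
        filter_upwards [eventually_base_linear_ne_zero (c := 1) (d := -c) (Or.inl one_ne_zero)]
          with p hp
        simpa [sub_eq_add_neg] using hp
      refine ⟨germ fun p => p.2 - c, ?_, isUnit_germ hne, ?_⟩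
      · have h := sub_mem (germ_snd_mem_regularBar ∅) (Subalgebra.algebraMap_mem (regularBar ∅) c)
        rw [algebraMap_G] at h
        exact h
      · have e : germ (fun p => p.2 - c) * germ (fun p => (p.2 - c)⁻¹) = 1 := by
          refine germ_congr ?_
          filter_upwards [hne] with p hp
          exact mul_inv_cancel₀ hp
        rw [e]
        exact one_mem _
  | algebraMap c => exact ⟨1, one_mem _, isUnit_one, by
      rw [one_mul]
      exact Subalgebra.algebraMap_mem _ _⟩
  | add x y _ _ hx hy =>
    obtain ⟨q, hq, hqu, hqx⟩ := hx
    obtain ⟨q', hq', hqu', hqy⟩ := hy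
    refine ⟨q * q', mul_mem hq hq', hqu.mul hqu', ?_⟩
    have e : q * q' * (x + y) = q' * (q * x) + q * (q' * y) := by ring
    rw [e]
    exact add_mem (mul_mem hq' hqx) (mul_mem hq hqy)
  | mul x y _ _ hx hy =>
    obtain ⟨q, hq, hqu, hqx⟩ := hx
    obtain ⟨q', hq', hqu', hqy⟩ := hy
    refine ⟨q * q', mul_mem hq hq', hqu.mul hqu', ?_⟩
    have e : q * q' * (x * y) = q * x * (q' * y) := by ring
    rw [e]
    exact mul_mem hqx hqy

/-- A common denominator for a finite set. -/
theorem exists_common_clear {P O : Subalgebra ℂ G}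
    (h : ∀ r ∈ O, ∃ q ∈ P, IsUnit q ∧ q * r ∈ P) (T : Finset G) (hT : ∀ r ∈ T, r ∈ O) :
    ∃ q ∈ P, IsUnit q ∧ ∀ r ∈ T, q * r ∈ P := by
  classical
  induction T using Finset.induction_on with
  | empty => exact ⟨1, one_mem _, isUnit_one, by simp⟩
  | insert r T _ ih =>
    obtain ⟨q, hq, hqu, hqT⟩ := ih fun r hr => hT r (by simp [hr])
    obtain ⟨q', hq', hqu', hqr⟩ := h r (hT r (by simp))
    refine ⟨q * q', mul_mem hq hq', hqu.mul hqu', fun s hs => ?_⟩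
    rcases Finset.mem_insert.1 hs with rfl | hs
    · rw [mul_assoc]
      exact mul_mem hq hqr
    · rw [mul_comm q, mul_assoc]
      exact mul_mem hq' (hqT s hs)

theorem iterate_eq_zero_mono {M : Type*} [Zero M] {d : M → M} (h0 : d 0 = 0) {x : M} {k l : ℕ}
    (h : d^[k] x = 0) (hkl : k ≤ l) : d^[l] x = 0 := by
  obtain ⟨n, rfl⟩ := Nat.exists_eq_add_of_le' hkl
  rw [Function.iterate_add_apply, h, Function.iterate_fixed h0]

/-- By the Leibniz rule each application of `d` consumes one of the orders `k` and `l`. Additivity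
of the iterates is carried along because `d` is assumed to be additive on `O` only. -/
theorem iterate_mul_eq_zero {O : Subalgebra ℂ G} {d : G → G} (h0 : d 0 = 0)
    (hdO : ∀ x ∈ O, d x ∈ O) (hadd : ∀ x ∈ O, ∀ y ∈ O, d (x + y) = d x + d y)
    (hmul : ∀ x ∈ O, ∀ y ∈ O, d (x * y) = d x * y + x * d y) (n : ℕ) :
    (∀ x ∈ O, ∀ y ∈ O, d^[n] (x + y) = d^[n] x + d^[n] y) ∧
    ∀ k l, k + l ≤ n → ∀ x ∈ O, ∀ y ∈ O, d^[k] x = 0 → d^[l] y = 0 → d^[n] (x * y) = 0 := by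
  induction n with
  | zero =>
    refine ⟨fun x _ y _ => rfl, fun k l hkl x _ y _ hx _ => ?_⟩
    obtain rfl : k = 0 := by omega
    have hx' : x = 0 := hx
    simp [hx']
  | succ n ih =>
    have hA : ∀ x ∈ O, ∀ y ∈ O, d^[n + 1] (x + y) = d^[n + 1] x + d^[n + 1] y :=
      fun x hx y hy => by
        simp only [Function.iterate_succ_apply, hadd x hx y hy]
        exact ih.1 _ (hdO x hx) _ (hdO y hy)
    refine ⟨hA, fun k l hkl x hx y hy hkx hly => ?_⟩
    cases k with
    | zero =>
      have hx' : x = 0 := hkx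
      rw [hx', zero_mul]
      exact Function.iterate_fixed h0 _
    | succ k =>
      cases l with
      | zero =>
        have hy' : y = 0 := hly
        rw [hy', mul_zero]
        exact Function.iterate_fixed h0 _
      | succ l =>
        rw [Function.iterate_succ_apply, hmul x hx y hy,
          ih.1 _ (mul_mem (hdO x hx) hy) _ (mul_mem hx (hdO y hy)),
          ih.2 k (l + 1) (by omega) _ (hdO x hx) _ hy hkx hly,
          ih.2 (k + 1) l (by omega) _ hx _ (hdO y hy) hkx hly, add_zero]

theorem exists_iterate_dz_eq_zero {r : G} (hr : r ∈ regular ∅) : ∃ k, dz^[k] r = 0 := by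
  have hh : ∀ x ∈ regular (∅ : Set (ℂ → ℂ)), IsHolomorphic x := fun x hx =>
    isHolomorphic_of_mem_regular (F := ⊤) (by simp) hx
  have key := iterate_mul_eq_zero (O := regular ∅) dz_zero
    (fun x hx => dz_mem_regular (F := ⊤) (by simp) hx) (fun x hx y hy => dz_add (hh x hx) (hh y hy))
    fun x hx y hy => dz_mul (hh x hx) (hh y hy)
  induction hr using Algebra.adjoin_induction with
  | mem x hx =>
    rcases hx with ((rfl | rfl) | ⟨β, hβ, rfl⟩) | ⟨c, hc, rfl⟩
    · refine ⟨2, ?_⟩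
      simp only [Function.iterate_succ_apply, Function.iterate_zero_apply, dz_germ_fst]
      simpa using dz_const 1
    · exact ⟨1, dz_germ_snd fun ζ => ζ⟩
    · exact absurd hβ (by simp)
    · exact absurd hc (by simp [conjConsts])
  | algebraMap c => exact ⟨1, dz_const c⟩
  | add x y hx hy h1 h2 =>
    obtain ⟨k, hk⟩ := h1
    obtain ⟨l, hl⟩ := h2
    refine ⟨k + l, ?_⟩
    rw [(key _).1 x hx y hy, iterate_eq_zero_mono dz_zero hk (by omega),
      iterate_eq_zero_mono dz_zero hl (by omega), add_zero]
  | mul x y hx hy h1 h2 =>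
    obtain ⟨k, hk⟩ := h1
    obtain ⟨l, hl⟩ := h2
    exact ⟨k + l, (key _).2 k l le_rfl x hx y hy hk hl⟩

theorem exists_iterate_dzbar_eq_zero {r : G} (hr : r ∈ regularBar ∅) : ∃ k, dzbar^[k] r = 0 := by
  have hh : ∀ x ∈ regularBar (∅ : Set ℂ), IsHolomorphic x := fun x hx =>
    isHolomorphic_of_mem_regularBar hx
  have key := iterate_mul_eq_zero (O := regularBar ∅) dzbar_zero
    (fun x hx => dzbar_mem_regularBar hx) (fun x hx y hy => dzbar_add (hh x hx) (hh y hy))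
    fun x hx y hy => dzbar_mul (hh x hx) (hh y hy)
  induction hr using Algebra.adjoin_induction with
  | mem x hx =>
    rcases hx with rfl | ⟨c, hc, rfl⟩
    · refine ⟨2, ?_⟩
      simp only [Function.iterate_succ_apply, Function.iterate_zero_apply, dzbar_germ_snd]
      simpa using dzbar_const 1
    · exact absurd hc (by simp)
  | algebraMap c => exact ⟨1, dzbar_const c⟩
  | add x y hx hy h1 h2 =>
    obtain ⟨k, hk⟩ := h1
    obtain ⟨l, hl⟩ := h2
    refine ⟨k + l, ?_⟩
    rw [(key _).1 x hx y hy, iterate_eq_zero_mono dzbar_zero hk (by omega),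
      iterate_eq_zero_mono dzbar_zero hl (by omega), add_zero]
  | mul x y hx hy h1 h2 =>
    obtain ⟨k, hk⟩ := h1
    obtain ⟨l, hl⟩ := h2
    exact ⟨k + l, (key _).2 k l le_rfl x hx y hy hk hl⟩

theorem exists_common_iterate {d : G → G} (h0 : d 0 = 0) {P : Subalgebra ℂ G}
    (h : ∀ r ∈ P, ∃ k, d^[k] r = 0) (T : Finset G) (hT : ∀ r ∈ T, r ∈ P) :
    ∃ k, ∀ r ∈ T, d^[k] r = 0 := by
  classical
  induction T using Finset.induction_on with
  | empty => exact ⟨0, by simp⟩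
  | insert r T _ ih =>
    obtain ⟨k, hk⟩ := ih fun r hr => hT r (by simp [hr])
    obtain ⟨l, hl⟩ := h r (hT r (by simp))
    refine ⟨k + l, fun s hs => ?_⟩
    rcases Finset.mem_insert.1 hs with rfl | hs
    · exact iterate_eq_zero_mono h0 hl (by omega)
    · exact iterate_eq_zero_mono h0 (hk s hs) (by omega)

end
end GenHyperlog

namespace GenHyperlog
noncomputable section

variable {F : Subfield ℂ} {S : Set (ℂ → ℂ)} {A : Set ℂ}

/-! ### The generators as germs -/

/-- The germ of the hyperlogarithm in `z` with the letters `β(ζ)`; the head of the list is the outermost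
letter. -/
def germZ (u : List (ℂ → ℂ)) : G := germ (revHyperlog u)

/-- The germ of the hyperlogarithm in `ζ` with constant letters. -/
def germBar (v : List ℂ) : G := germ fun p => hyperlogRev v p.2

theorem germZ_nil : germZ [] = 1 := rfl

theorem germBar_nil : germBar [] = 1 := rfl

theorem genHyperlog_eq (v : List ℂ) (w : List (ℂ → ℂ)) :
    genHyperlog v w = germBar v.reverse * germZ w.reverse := by
  refine germ_congr (Eventually.of_forall fun p => ?_)
  simp only [hyperlog, ← List.map_reverse]
  rfl

theorem exists_niceRadius_list {u : List (ℂ → ℂ)} (hu : ∀ β ∈ u, β ∈ FLT F) :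
    ∃ ε, NiceRadius {β | β ∈ u} ∅ ε :=
  exists_niceRadius (List.finite_toSet u) hu Set.finite_empty

theorem exists_niceRadius_const (v : List ℂ) : ∃ ε, NiceRadius ∅ {c | c ∈ v} ε :=
  exists_niceRadius (F := ⊤) Set.finite_empty (by simp) (List.finite_toSet v)

theorem isHolomorphic_germZ {u : List (ℂ → ℂ)} (hu : ∀ β ∈ u, β ∈ FLT F) :
    IsHolomorphic (germZ u) := by
  obtain ⟨ε, h⟩ := exists_niceRadius_list hu
  exact h.isHolomorphic_germ fun p hp => analyticAt_revHyperlog h.logDomain h.letter hp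

theorem isHolomorphic_germBar (v : List ℂ) : IsHolomorphic (germBar v) := by
  obtain ⟨ε, h⟩ := exists_niceRadius_const v
  exact h.isHolomorphic_germ fun p hp =>
    analyticAt_comp_snd (h.analyticAt_hyperlogRev (fun _ => id) hp.2.1 hp.2.2.1)

theorem dz_germZ_cons {a : ℂ → ℂ} {u : List (ℂ → ℂ)} (hu : ∀ β ∈ a :: u, β ∈ FLT F) :
    dz (germZ (a :: u)) = germ (fun p => (p.1 - a p.2)⁻¹) * germZ u := by
  obtain ⟨ε, h⟩ := exists_niceRadius_list hu
  refine h.germ_congr fun p hp => ?_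
  refine (hasDerivAt_revHyperlog_cons h.logDomain h.letter hp).deriv.trans ?_
  exact div_eq_inv_mul _ _

theorem dz_germBar (v : List ℂ) : dz (germBar v) = 0 := dz_germ_snd _

theorem dzbar_germBar_cons (c : ℂ) (v : List ℂ) :
    dzbar (germBar (c :: v)) = germ (fun p => (p.2 - c)⁻¹) * germBar v := by
  obtain ⟨ε, h⟩ := exists_niceRadius_const (c :: v)
  refine h.germ_congr fun p hp => ?_
  refine (h.hasDerivAt_hyperlogRev_cons (fun _ => id) hp.2.1 hp.2.2.1).deriv.trans ?_
  exact div_eq_inv_mul _ _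

/-! ### Evaluation of formal combinations of words -/

/-- The derivation `∂_z` of the ring of regular functions. -/
def dzHom (hSF : S ⊆ FLT F) : regular S →+ regular S where
  toFun r := ⟨dz r, dz_mem_regular hSF r.2⟩
  map_zero' := Subtype.ext dz_zero
  map_add' x y := Subtype.ext
    (dz_add (isHolomorphic_of_mem_regular hSF x.2) (isHolomorphic_of_mem_regular hSF y.2))

/-- The derivation `∂_ζ` of the ring of regular functions of `ζ`. -/
def dzbarHom (A : Set ℂ) : regularBar A →+ regularBar A where
  toFun r := ⟨dzbar r, dzbar_mem_regularBar r.2⟩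
  map_zero' := Subtype.ext dzbar_zero
  map_add' x y := Subtype.ext
    (dzbar_add (isHolomorphic_of_mem_regularBar x.2) (isHolomorphic_of_mem_regularBar y.2))

/-- Formal combinations of words with letters in `A` and coefficients in `O`. -/
def BarWords (O : Subalgebra ℂ G) (A : Set ℂ) : Type := List A →₀ O

namespace BarWords

variable (O : Subalgebra ℂ G) (A : Set ℂ)

instance : AddCommGroup (BarWords O A) := inferInstanceAs (AddCommGroup (List A →₀ O))

instance : Module O (BarWords O A) := inferInstanceAs (Module O (List A →₀ O))

variable {O A}

/-- The coefficient of a word. -/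
def coeff (v : List A) : BarWords O A →ₗ[O] O := Finsupp.lapply v

/-- A single word with a coefficient. -/
def single (v : List A) (r : O) : BarWords O A := Finsupp.single v r

/-- The words that occur in a combination. -/
def support (n : BarWords O A) : Finset (List A) := Finsupp.support n

theorem mem_support {n : BarWords O A} {v : List A} : v ∈ n.support ↔ coeff v n ≠ 0 :=
  Finsupp.mem_support_iff

theorem ext {n m : BarWords O A} (h : ∀ v, (coeff v n : G) = coeff v m) : n = m :=
  Finsupp.ext fun v => Subtype.ext (h v)

/-- The action of an additive map on the coefficients. -/
def map (d : O →+ O) : BarWords O A →+ BarWords O A := Finsupp.mapRange.addMonoidHom d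

theorem map_single (d : O →+ O) (v : List A) (r : O) : map d (single v r) = single v (d r) :=
  Finsupp.mapRange_single (hf := map_zero d)

theorem induction_linear {P : BarWords O A → Prop} (n : BarWords O A) (zero : P 0)
    (add : ∀ f g, P f → P g → P (f + g)) (single : ∀ v r, P (single v r)) : P n :=
  Finsupp.induction_linear n zero add single

end BarWords

/-- The value of a formal combination of words in the constant letters. -/
def evalBar (O : Subalgebra ℂ G) (A : Set ℂ) : BarWords O A →ₗ[O] G :=
  Finsupp.linearCombination O fun v => germBar (v.map (↑))

theorem evalBar_single (O : Subalgebra ℂ G) (v : List A) (r : O) :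
    evalBar O A (.single v r) = r * germBar (v.map (↑)) :=
  Finsupp.linearCombination_single ..

/-- The value of a formal combination of pairs of words. -/
def evalWords (S : Set (ℂ → ℂ)) :
    (List S →₀ (BarWords (regular S) (conjConsts S))) →ₗ[regular S] G :=
  Finsupp.lsum (regular S) fun u =>
    (LinearMap.mulRight (regular S) (germZ (u.map (↑)))) ∘ₗ evalBar (regular S) (conjConsts S)

theorem evalWords_single (u : List S) (n : BarWords (regular S) (conjConsts S)) :
    evalWords S (Finsupp.single u n) =
      evalBar (regular S) (conjConsts S) n * germZ (u.map (↑)) := by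
  rw [evalWords, Finsupp.lsum_single]
  rfl

theorem isHolomorphic_evalBar {O : Subalgebra ℂ G} (hO : ∀ r ∈ O, IsHolomorphic r)
    (n : BarWords O A) : IsHolomorphic (evalBar O A n) := by
  induction n using BarWords.induction_linear with
  | zero =>
    rw [map_zero]
    exact zero_mem (S := Subalgebra ℂ G) holomorphicGerms
  | add f g hf hg =>
    rw [map_add]
    exact add_mem (S := Subalgebra ℂ G) (s := holomorphicGerms) hf hg
  | single v r =>
    rw [evalBar_single]
    exact mul_mem (S := Subalgebra ℂ G) (s := holomorphicGerms) (hO r r.2) (isHolomorphic_germBar _)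

theorem dz_evalBar (hSF : S ⊆ FLT F) (n : BarWords (regular S) A) :
    dz (evalBar (regular S) A n) =
      evalBar (regular S) A (BarWords.map (dzHom hSF) n) := by
  have hh := isHolomorphic_evalBar (A := A) fun r (hr : r ∈ regular S) =>
    isHolomorphic_of_mem_regular hSF hr
  induction n using BarWords.induction_linear with
  | zero => simpa using dz_zero
  | add f g hf hg => rw [map_add, dz_add (hh f) (hh g), hf, hg, map_add, map_add]
  | single v r =>
    rw [evalBar_single, dz_mul (isHolomorphic_of_mem_regular hSF r.2) (isHolomorphic_germBar _),
      dz_germBar, mul_zero, add_zero, BarWords.map_single,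
      evalBar_single]
    rfl

theorem letters_mem (hSF : S ⊆ FLT F) (u : List S) : ∀ β ∈ u.map (↑), β ∈ FLT F := by
  intro β hβ
  obtain ⟨b, -, rfl⟩ := List.mem_map.1 hβ
  exact hSF b.2

theorem isHolomorphic_evalWords (hSF : S ⊆ FLT F)
    (m : List S →₀ (BarWords (regular S) (conjConsts S))) : IsHolomorphic (evalWords S m) := by
  induction m using Finsupp.induction_linear with
  | zero =>
    rw [map_zero]
    exact zero_mem (S := Subalgebra ℂ G) holomorphicGerms
  | add f g hf hg =>
    rw [map_add]
    exact add_mem (S := Subalgebra ℂ G) (s := holomorphicGerms) hf hg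
  | single u n =>
    rw [evalWords_single]
    exact mul_mem (S := Subalgebra ℂ G) (s := holomorphicGerms)
      (isHolomorphic_evalBar (fun r hr => isHolomorphic_of_mem_regular hSF hr) n)
      (isHolomorphic_germZ (letters_mem hSF u))

/-- The regular function `1 / (z - β(ζ))`. -/
def letterInv (b : S) : regular S :=
  ⟨germ fun p => (p.1 - (b : ℂ → ℂ) p.2)⁻¹, germ_inv_mem_regular b.2⟩

/-- The regular function `1 / (ζ - c)`. -/
def constInv (c : A) : regularBar A :=
  ⟨germ fun p => (p.2 - (c : ℂ))⁻¹, germ_inv_snd_mem_regularBar c.2⟩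

/-- The formal version of `∂_z`. -/
def zDerivation (hSF : S ⊆ FLT F) : (List S →₀ (BarWords (regular S) (conjConsts S))) →+
    (List S →₀ (BarWords (regular S) (conjConsts S))) :=
  wordDerivation (N := BarWords (regular S) (conjConsts S))
    (BarWords.map (dzHom hSF)) letterInv

/-- The words in `ζ` are constants for `∂_z`, which strips the outermost letter of a word in `z`
just as the formal derivation strips the head. -/
theorem dz_evalWords (hSF : S ⊆ FLT F) (m : List S →₀ (BarWords (regular S) (conjConsts S))) :
    dz (evalWords S m) =
      evalWords S (zDerivation hSF m) := by
  have hh := isHolomorphic_evalBar (A := conjConsts S) fun r (hr : r ∈ regular S) =>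
    isHolomorphic_of_mem_regular hSF hr
  induction m using Finsupp.induction_linear with
  | zero => simpa using dz_zero
  | add f g hf hg =>
    rw [map_add, dz_add (isHolomorphic_evalWords hSF f) (isHolomorphic_evalWords hSF g), hf, hg,
      map_add, map_add]
  | single u n =>
    rw [zDerivation, evalWords_single, dz_mul (hh n) (isHolomorphic_germZ (letters_mem hSF u)), dz_evalBar hSF]
    cases u with
    | nil =>
      rw [wordDerivation_single_nil, evalWords_single, List.map_nil, germZ_nil, ← map_one
        (algebraMap ℂ G), dz_const, mul_zero, add_zero]
    | cons b u =>
      rw [wordDerivation_single_cons, map_add, evalWords_single, evalWords_single, map_smul,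
        List.map_cons, dz_germZ_cons (letters_mem hSF (b :: u))]
      congr 1
      change _ = (letterInv b : G) * _ * _
      rw [letterInv]
      ring

/-- The formal version of `∂_ζ`. -/
def barDerivation (A : Set ℂ) : BarWords (regularBar A) A →+ BarWords (regularBar A) A :=
  wordDerivation (dzbarHom A) constInv

theorem barDerivation_single_nil (r : regularBar A) :
    barDerivation A (.single [] r) = .single [] (dzbarHom A r) :=
  wordDerivation_single_nil ..

theorem barDerivation_single_cons (a : A) (v : List A) (r : regularBar A) :
    barDerivation A (.single (a :: v) r) = .single (a :: v) (dzbarHom A r) +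
      .single v (constInv a * r) :=
  wordDerivation_single_cons ..

theorem dzbar_evalBar (n : BarWords (regularBar A) A) :
    dzbar (evalBar (regularBar A) A n) =
      evalBar (regularBar A) A (barDerivation A n) := by
  have hh := isHolomorphic_evalBar (A := A) fun r (hr : r ∈ regularBar A) =>
    isHolomorphic_of_mem_regularBar hr
  induction n using BarWords.induction_linear with
  | zero => simpa using dzbar_zero
  | add f g hf hg => rw [map_add, dzbar_add (hh f) (hh g), hf, hg, map_add, map_add]
  | single v r =>
    rw [evalBar_single, dzbar_mul (isHolomorphic_of_mem_regularBar r.2) (isHolomorphic_germBar _)]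
    cases v with
    | nil =>
      rw [barDerivation_single_nil, evalBar_single, List.map_nil, germBar_nil, ← map_one
        (algebraMap ℂ G), dzbar_const, mul_zero, add_zero]
      rfl
    | cons c v =>
      rw [barDerivation_single_cons, map_add, evalBar_single, evalBar_single, List.map_cons,
        dzbar_germBar_cons]
      congr 1
      change _ = ((constInv c : G) * r) * _
      rw [constInv]
      ring

/-! ### Residues -/

/-- The germs of functions of `ζ`. -/
def sndGerms : Subalgebra ℂ G where
  carrier := {f | ∃ R : ℂ → ℂ, germ (fun p => R p.2) = f}
  mul_mem' := by
    rintro _ _ ⟨f, rfl⟩ ⟨g, rfl⟩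
    exact ⟨fun p => f p * g p, rfl⟩
  add_mem' := by
    rintro _ _ ⟨f, rfl⟩ ⟨g, rfl⟩
    exact ⟨fun p => f p + g p, rfl⟩
  algebraMap_mem' c := ⟨fun _ => c, (algebraMap_G c).symm⟩

theorem exists_const_notMem (hS : S.Finite) : ∃ z₀ : ℂ, (fun _ => z₀) ∉ S := by
  by_contra! h
  refine Set.infinite_of_injective_forall_mem (f := fun (z : ℂ) (_ : ℂ) => z) (fun x y e => ?_) h hS
  exact congrFun e 0

theorem mem_sndGerms_of_dz_eq_zero (hS : S.Finite) (hSF : S ⊆ FLT F) {r : G} (hr : r ∈ regular S)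
    (hd : dz r = 0) : r ∈ sndGerms := by
  obtain ⟨z₀, hz₀⟩ := exists_const_notMem hS
  exact mem_of_dz_eq_zero hS hSF hr hd hz₀ sndGerms ⟨fun ζ => ζ, rfl⟩
    (fun β _ => ⟨fun ζ => (z₀ - β ζ)⁻¹, rfl⟩) fun c _ => ⟨fun ζ => (ζ - c)⁻¹, rfl⟩

theorem germ_sum {ι : Type*} (s : Finset ι) (f : ι → ℂ × ℂ → ℂ) :
    ∑ i ∈ s, germ (f i) = germ fun p => ∑ i ∈ s, f i p := by
  classical
  induction s using Finset.induction_on with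
  | empty => rfl
  | insert i s hi ih =>
    rw [Finset.sum_insert hi, ih]
    simp only [Finset.sum_insert hi]
    rfl

/-- The `c b` are functions of `ζ` alone. For fixed `ζ` they are, up to sign, the residues of a
`z`-derivative at the points `b(ζ)`, which are distinct near the base point. -/
theorem coeff_eq_zero_of_dz (hS : S.Finite) (hSF : S ⊆ FLT F) [Fintype S] {c : S → G}
    (hc : ∀ b, c b ∈ regular S) (hdc : ∀ b, dz (c b) = 0) {x : G} (hx : x ∈ regular S)
    (h : dz x + ∑ b, (letterInv b : G) * c b = 0) (b : S) : c b = 0 := by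
  choose C hC using fun b => mem_sndGerms_of_dz_eq_zero hS hSF (hc b) (hdc b)
  obtain ⟨X, rfl, hX, -⟩ := exists_fun_of_mem_regular hx 0 ⊤ trivial (fun _ _ => trivial)
    fun _ _ => trivial
  obtain ⟨ε, hε⟩ := exists_niceRadius hS hSF Set.finite_empty
  have e : germ (fun p => pdz X p + ∑ b : S, (p.1 - (b : ℂ → ℂ) p.2)⁻¹ * C b p.2) =
      germ fun _ => 0 := by
    refine Eq.trans ?_ h
    simp only [← hC, letterInv]
    have h1 := germ_sum Finset.univ fun (b : S) (p : ℂ × ℂ) =>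
      (p.1 - (b : ℂ → ℂ) p.2)⁻¹ * C b p.2
    exact congrArg (fun y => germ (pdz X) + y) h1.symm
  have e' := eventually_eventually_nhds_base (germ_eq_germ.1 e)
  rw [← hC]
  refine germ_congr (g := fun _ => 0) ?_
  filter_upwards [e', eventually_base_baseRegion hε.pos] with p hp hpε
  refine residue_eq_zero (a := fun b : S => (b : ℂ → ℂ) p.2) (c := fun b => C b p.2)
    (X := fun z => X (z, p.2)) (z₁ := p.1) (fun β γ hβγ => ?_) (fun z hz => ?_) (fun β => ?_) ?_ b
  · by_contra hne
    exact ((hε.sep β β.2 γ γ.2).resolve_left fun h => hne (Subtype.ext h)) p hpε hβγ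
  · exact hX p.2 z fun β hβ => hz ⟨β, hβ⟩
  · exact sub_ne_zero.1 ((hε.letter β β.2).sub_ne_zero hε.logDomain hpε)
  · filter_upwards [eventually_prodMk_left hp] with z hz
    rw [add_comm]
    exact hz

/-- Being annihilated by both derivatives, the `c b` are complex numbers, and up to sign they are
the residues of a derivative in `ζ`. -/
theorem coeff_eq_zero_of_dzbar [Fintype A] {c : A → G} {x : G}
    (hc : ∀ b, c b ∈ regularBar A) (hdc : ∀ b, dzbar (c b) = 0) (hx : x ∈ regularBar A)
    (h : dzbar x + ∑ b, (constInv b : G) * c b = 0) (b : A) : c b = 0 := by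
  choose C hC using fun b => eq_const_of_dz_dzbar (isHolomorphic_of_mem_regularBar (hc b))
    (dz_of_mem_regularBar (hc b)) (hdc b)
  obtain ⟨X, rfl, hX⟩ := exists_fun_of_mem_regularBar hx
  obtain ⟨ε, hε⟩ := exists_niceRadius (F := ⊤) Set.finite_empty (by simp) (Set.toFinite A)
  have e : germ (fun p => deriv X p.2 + ∑ b : A, (p.2 - (b : ℂ))⁻¹ * C b) =
      germ fun _ => 0 := by
    refine Eq.trans ?_ h
    simp only [hC, constInv, algebraMap_G]
    have h1 := germ_sum Finset.univ fun (b : A) (p : ℂ × ℂ) => (p.2 - (b : ℂ))⁻¹ * C b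
    exact congrArg (fun y => germ (fun p => deriv X p.2) + y) h1.symm
  have e' := eventually_eventually_nhds_base (germ_eq_germ.1 e)
  obtain ⟨p, hp, hpε⟩ := (e'.and (eventually_base_baseRegion hε.pos)).exists
  suffices h0 : C b = 0 by rw [hC, h0, map_zero]
  refine residue_eq_zero (a := fun b : A => (b : ℂ)) (c := C) (X := X) (z₁ := p.2)
    Subtype.val_injective (fun z hz => ?_) (fun β => ?_) ?_ b
  · exact hX z fun hz' => hz ⟨z, hz'⟩ rfl
  · exact sub_ne_zero.1 (hε.sub_const_ne_zero β.2 hpε.2.1 hpε.2.2.1)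
  · filter_upwards [eventually_prodMk_right hp] with z hz
    rw [add_comm]
    exact hz

/-! ### Differential simplicity -/

theorem mem_of_eq {Y : Set G} {a b : G} (h : a = b) (hb : b ∈ Y) : a ∈ Y := h ▸ hb

/-- This is the elimination for `∂_ζ`. Both derivatives of the surviving coefficient vanish, so it
is a nonzero complex number and can be inverted. -/
theorem one_mem_of_evalBar_mem (hA : A.Finite) (Y : AddSubgroup G)
    (hYs : ∀ r ∈ regularBar A, ∀ y ∈ Y, r * y ∈ Y) (hYd : ∀ y ∈ Y, dzbar y ∈ Y)
    {n : BarWords (regularBar A) A} (hn : n ≠ 0) (h : evalBar (regularBar A) A n ∈ Y) : 1 ∈ Y := by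
  classical
  have := hA.fintype
  have key : ∃ r, r ≠ 0 ∧ dzbarHom A r = 0 ∧ True ∧ 
      evalBar (regularBar A) A (.single [] r) ∈ Y := by
    refine exists_single_nil_mem (dzbarHom A) constInv
      {n | evalBar (regularBar A) A n ∈ Y}
      (fun r m hm => ?_) (fun m hm => ?_) (fun _ => True) (fun _ _ => trivial) (fun T => ?_)
      (fun c x hc hx b => ?_) (m := n) h hn
    · exact mem_of_eq (Y := (Y : Set G)) ((evalBar (regularBar A) A).map_smul r m) (hYs r r.2 _ hm)
    · exact mem_of_eq (Y := (Y : Set G)) (dzbar_evalBar (A := A) m).symm (hYd _ hm)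
    · obtain ⟨q, hq, hqu, hqT⟩ := exists_common_clear (P := regularBar ∅) (O := regularBar A)
        (fun r hr => exists_clear_regularBar hr) (T.image (Subtype.val : regularBar A → G)) (by
          intro r hr
          obtain ⟨s, -, rfl⟩ := Finset.mem_image.1 hr
          exact s.2)
      obtain ⟨k, hk⟩ := exists_common_iterate dzbar_zero
        (fun r hr => exists_iterate_dzbar_eq_zero hr) (T.image fun r : regularBar A => q * (r : G)) (by
          intro r hr
          obtain ⟨s, hs, rfl⟩ := Finset.mem_image.1 hr
          exact hqT _ (Finset.mem_image_of_mem _ hs))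
      refine ⟨⟨q, regularBar_mono (Set.empty_subset A) hq⟩, fun x hx => ?_, k, fun x hx => ⟨trivial, ?_⟩⟩
      · obtain ⟨w, rfl⟩ := hqu
        exact Subtype.ext (w.mul_right_eq_zero.1 (congrArg Subtype.val hx))
      · have h1 : ∀ (k : ℕ) (y : regularBar A), (((dzbarHom A)^[k] y : regularBar A) : G) =
            dzbar^[k] y := by
          intro k
          induction k with
          | zero => exact fun y => rfl
          | succ k ih => exact fun y => (ih _)
        exact Subtype.ext ((h1 k _).trans (hk _ (Finset.mem_image_of_mem _ hx)))
    · refine Subtype.ext (coeff_eq_zero_of_dzbar (fun b => (c b).2)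
        (fun b => congrArg Subtype.val (hc b)) x.2 ?_ b)
      have h1 := congrArg (regularBar A).val hx
      rw [map_add, map_sum, map_zero] at h1
      exact h1
  obtain ⟨r, hr0, hdr, -, hrY⟩ := key
  obtain ⟨c, hc⟩ := eq_const_of_dz_dzbar (isHolomorphic_of_mem_regularBar r.2)
    (dz_of_mem_regularBar r.2) (congrArg Subtype.val hdr)
  have hc0 : c ≠ 0 := by
    rintro rfl
    exact hr0 (Subtype.ext (by simpa using hc))
  have h1 : (r : G) ∈ Y := by
    have h2 : evalBar (regularBar A) A (.single [] r) ∈ Y := hrY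
    rwa [evalBar_single, List.map_nil, germBar_nil, mul_one] at h2
  have h2 := hYs _ ((regularBar A).algebraMap_mem c⁻¹) _ h1
  rwa [hc, ← map_mul, inv_mul_cancel₀ hc0, map_one] at h2

theorem evalBar_eq_sum (O : Subalgebra ℂ G) (n : BarWords O A) : evalBar O A n =
    ∑ v ∈ n.support, (BarWords.coeff v n : G) * germBar (v.map (↑)) :=
  Finsupp.linearCombination_apply ..

theorem exists_barWords_of_coeff_mem {O O' : Subalgebra ℂ G} {n : BarWords O A}
    (h : ∀ v, (BarWords.coeff v n : G) ∈ O') : ∃ n' : BarWords O' A,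
      (∀ v, (BarWords.coeff v n' : G) = BarWords.coeff v n) ∧ evalBar O' A n' = evalBar O A n := by
  let n' : BarWords O' A :=
    Finsupp.onFinset n.support (fun v => ⟨BarWords.coeff v n, h v⟩) (by
      intro v hv
      rw [BarWords.mem_support]
      intro h0
      exact hv (Subtype.ext (congrArg (Subtype.val : O → G) h0)))
  have hc : ∀ v, (BarWords.coeff v n' : G) = BarWords.coeff v n := fun v => rfl
  refine ⟨n', hc, ?_⟩
  have hs : n'.support = n.support := by
    ext v
    rw [BarWords.mem_support, BarWords.mem_support, ne_eq, ne_eq, not_iff_not,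
      ← ZeroMemClass.coe_eq_zero, hc, ZeroMemClass.coe_eq_zero]
  rw [evalBar_eq_sum, evalBar_eq_sum, hs]
  exact Finset.sum_congr rfl fun v _ => by rw [hc]

theorem exists_clear_barWords (hSF : S ⊆ FLT F) (T : Finset (BarWords (regular S) A)) :
    ∃ q : regular S, (∀ n : BarWords (regular S) A, q • n = 0 → n = 0) ∧
      ∃ k, ∀ n ∈ T, (∀ v, (BarWords.coeff v (q • n) : G) ∈ regular ∅) ∧
        ∀ v, dz^[k] (BarWords.coeff v (q • n) : G) = 0 := by
  classical
  obtain ⟨q, hq, hqu, hqT⟩ := exists_common_clear (P := regular ∅) (O := regular S)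
    (fun r hr => exists_clear_regular hSF hr)
    (T.biUnion fun n => n.support.image fun v => (BarWords.coeff v n : G)) (by
      intro r hr
      simp only [Finset.mem_biUnion, Finset.mem_image] at hr
      obtain ⟨n, -, v, -, rfl⟩ := hr
      exact (BarWords.coeff v n).2)
  have hq' : ∀ n ∈ T, ∀ v, q * (BarWords.coeff v n : G) ∈ regular ∅ := by
    intro n hn v
    by_cases h0 : BarWords.coeff v n = 0
    · simp [h0, zero_mem]
    · exact hqT _ (Finset.mem_biUnion.2 ⟨n, hn,
        Finset.mem_image_of_mem _ (BarWords.mem_support.2 h0)⟩)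
  obtain ⟨k, hk⟩ := exists_common_iterate dz_zero
    (fun r hr => exists_iterate_dz_eq_zero hr)
    (T.biUnion fun n => n.support.image fun v => q * (BarWords.coeff v n : G)) (by
      intro r hr
      simp only [Finset.mem_biUnion, Finset.mem_image] at hr
      obtain ⟨n, hn, v, -, rfl⟩ := hr
      exact hq' n hn v)
  refine ⟨⟨q, regular_mono (Set.empty_subset S) hq⟩, fun n hn => BarWords.ext fun v => ?_, k,
    fun n hn => ⟨hq' n hn, fun v => ?_⟩⟩
  · obtain ⟨w, rfl⟩ := hqu
    refine w.mul_right_eq_zero.1 ?_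
    exact congrArg (fun n => (BarWords.coeff v n : G)) hn
  · rw [map_smul]
    by_cases h0 : BarWords.coeff v n = 0
    · rw [h0, smul_zero]
      exact Function.iterate_fixed dz_zero k
    · exact hk _ (Finset.mem_biUnion.2 ⟨n, hn,
        Finset.mem_image_of_mem _ (BarWords.mem_support.2 h0)⟩)

theorem barWords_eq_zero_of_dz (hS : S.Finite) (hSF : S ⊆ FLT F) [Fintype S]
    {c : S → BarWords (regular S) A} {x : BarWords (regular S) A}
    (hc : ∀ b, BarWords.map (dzHom hSF) (c b) = 0)
    (hx : BarWords.map (dzHom hSF) x + ∑ b, letterInv b • c b = 0) (b : S) : c b = 0 := by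
  refine BarWords.ext fun v => coeff_eq_zero_of_dz hS hSF
    (c := fun b => (BarWords.coeff v (c b) : G))
    (fun b => (BarWords.coeff v (c b)).2) (fun b => ?_) (BarWords.coeff v x).2 ?_ b
  · have h1 := congrArg (fun n => (BarWords.coeff v n : G)) (hc b)
    exact h1
  · have h1 := congrArg (BarWords.coeff v) hx
    rw [map_add, map_sum, map_zero] at h1
    have h2 := congrArg (regular S).val h1
    rw [map_add, map_sum, map_zero] at h2
    simp only [map_smul] at h2
    exact h2

/-- The elimination is run twice. For `∂_z` the combinations of words in `ζ` serve as coefficients,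
and what survives is such a combination whose coefficients are polynomials independent of `z`, that
is, polynomials in `ζ`. Then the elimination for `∂_ζ` applies. -/
theorem one_mem_of_evalWords_mem (hS : S.Finite) (hSF : S ⊆ FLT F) (Y : Submodule (regular S) G)
    (hYz : ∀ y ∈ Y, dz y ∈ Y) (hYζ : ∀ y ∈ Y, dzbar y ∈ Y)
    {m : List S →₀ BarWords (regular S) (conjConsts S)} (hm : m ≠ 0) (h : evalWords S m ∈ Y) :
    1 ∈ Y := by
  classical
  have := hS.fintype
  set dN : BarWords (regular S) (conjConsts S) →+ BarWords (regular S) (conjConsts S) :=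
    BarWords.map (dzHom hSF) with hdN
  have hiter : ∀ (k : ℕ) (n : BarWords (regular S) (conjConsts S)) (v : List (conjConsts S)),
      (BarWords.coeff v (dN^[k] n) : G) = dz^[k] (BarWords.coeff v n : G) := by
    intro k
    induction k with
    | zero => exact fun n v => rfl
    | succ k ih => exact fun n v => (ih _ v)
  have key : ∃ n : BarWords (regular S) (conjConsts S), n ≠ 0 ∧ dN n = 0 ∧
      (∀ v, (BarWords.coeff v n : G) ∈ regular ∅) ∧ evalWords S (Finsupp.single [] n) ∈ Y := by
    refine exists_single_nil_mem dN letterInv {m | evalWords S m ∈ Y}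
      (fun r m hm => (Y.comap (evalWords S)).smul_mem r hm) (fun m hm => ?_)
      (fun n => ∀ v, (BarWords.coeff v n : G) ∈ regular ∅) (fun n hn v => ?_) (fun T => ?_)
      (fun c x hc hx b => ?_) (m := m) h hm
    · exact mem_of_eq (Y := (Y : Set G)) (dz_evalWords hSF m).symm (hYz _ hm)
    · exact dz_mem_regular (F := ⊤) (by simp) (hn v)
    · obtain ⟨q, hq, k, hk⟩ := exists_clear_barWords hSF T
      refine ⟨q, hq, k, fun n hn => ⟨(hk n hn).1, BarWords.ext fun v => ?_⟩⟩
      exact (hiter k _ v).trans ((hk n hn).2 v)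
    · exact barWords_eq_zero_of_dz hS hSF hc hx b
  obtain ⟨n, hn0, hdn, hnG, hnY⟩ := key
  -- Here `Good` is needed: evaluating a general regular function at a point `z₀` would introduce
  -- denominators `z₀ - β(ζ)`, whereas a polynomial can be evaluated at `z = 0` inside `ℂ[ζ]`.
  have hmem : ∀ v, (BarWords.coeff v n : G) ∈ regularBar (conjConsts S) := by
    intro v
    refine mem_of_dz_eq_zero (F := ⊤) Set.finite_empty (by simp) (hnG v) ?_
      (z₀ := 0) (by simp) _ (germ_snd_mem_regularBar (conjConsts S)) (by simp) (by simp [conjConsts])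
    exact congrArg (fun n => (BarWords.coeff v n : G)) hdn
  obtain ⟨n', hn', hev⟩ := exists_barWords_of_coeff_mem hmem
  refine one_mem_of_evalBar_mem (conjConsts_finite hS) Y.toAddSubgroup (fun r hr y hy => ?_)
    hYζ (n := n') ?_ (hev.symm ▸ ?_)
  · exact Y.smul_mem ⟨r, regularBar_conjConsts_le S hr⟩ hy
  · rintro rfl
    refine hn0 (BarWords.ext fun v => ?_)
    rw [← hn', map_zero, map_zero, ZeroMemClass.coe_zero, ZeroMemClass.coe_zero]
  · rwa [evalWords_single, List.map_nil, germZ_nil, mul_one] at hnY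

end
end GenHyperlog

namespace GenHyperlog
noncomputable section

variable {F : Subfield ℂ} {S : Set (ℂ → ℂ)} {A : Set ℂ}

/-! ### Freeness -/

/-- The zero module is stable under both derivatives and does not contain `1`. -/
theorem evalWords_injective (hS : S.Finite) (hSF : S ⊆ FLT F)
    {m : List S →₀ BarWords (regular S) (conjConsts S)} (h : evalWords S m = 0) : m = 0 := by
  by_contra hm
  have h1 := one_mem_of_evalWords_mem hS hSF ⊥ (fun y hy => ?_) (fun y hy => ?_) hm
    ((Submodule.mem_bot _).2 h)
  · exact one_ne_zero ((Submodule.mem_bot _).1 h1)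
  · rw [(Submodule.mem_bot _).1 hy, dz_zero]
    exact zero_mem _
  · rw [(Submodule.mem_bot _).1 hy, dzbar_zero]
    exact zero_mem _

theorem linearIndependent_lists (hS : S.Finite) (hSF : S ⊆ FLT F) :
    LinearIndependent (regular S) fun x : List S × List (conjConsts S) =>
      germBar (x.2.map (↑)) * germZ (x.1.map (↑)) := by
  classical
  rw [linearIndependent_iff']
  intro s g h j hj
  have h1 : evalWords S (∑ i ∈ s, Finsupp.single i.1 (BarWords.single i.2 (g i))) = 0 := by
    rw [map_sum, ← h]
    refine Finset.sum_congr rfl fun i _ => ?_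
    rw [evalWords_single, evalBar_single, mul_assoc]
    rfl
  have h2 := congrArg (fun m => BarWords.coeff j.2 (m j.1)) (evalWords_injective hS hSF h1)
  simp only [Finsupp.coe_finsetSum, Finset.sum_apply, map_sum, Finsupp.zero_apply, map_zero] at h2
  rw [Finset.sum_eq_single_of_mem j hj] at h2
  · rw [Finsupp.single_eq_same] at h2
    exact Eq.trans (Finsupp.single_eq_same (a := j.2) (b := g j)).symm h2
  · intro i _ hij
    by_cases h3 : j.1 = i.1
    · rw [h3, Finsupp.single_eq_same]
      exact Finsupp.single_eq_of_ne fun h4 => hij (Prod.ext h3.symm h4.symm)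
    · rw [Finsupp.single_eq_of_ne h3, map_zero]

/-- The reversed word, as a list of letters of the alphabet. -/
def Word.toList {α : Type} {B : Set α} (w : Word B) : List B := (w.1.attachWith _ w.2).reverse

theorem Word.map_toList {α : Type} {B : Set α} (w : Word B) :
    w.toList.map (↑) = w.1.reverse := by
  rw [Word.toList, List.map_reverse, List.attachWith_map_subtype_val]

theorem Word.toList_injective {α : Type} {B : Set α} :
    Function.Injective (Word.toList (B := B)) := by
  intro v w h
  have h1 := congrArg (List.map Subtype.val) h
  rw [Word.map_toList, Word.map_toList] at h1
  exact Subtype.ext (List.reverse_injective h1)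

theorem linearIndependent_generators (hS : S.Finite) (hSF : S ⊆ FLT F) :
    LinearIndependent (regular S) (generators S) := by
  have h := (linearIndependent_lists hS hSF).comp
    (fun i : Word (conjConsts S) × Word S => (i.2.toList, i.1.toList)) fun i j hij =>
      Prod.ext (Word.toList_injective (congrArg Prod.snd hij))
        (Word.toList_injective (congrArg Prod.fst hij))
  convert h using 1
  funext i
  rw [generators, genHyperlog_eq]
  simp only [Function.comp_apply, Word.map_toList]

/-! ### Products -/

theorem germBar_mul_germZ_mem_GHC {v : List ℂ} {u : List (ℂ → ℂ)} (hv : ∀ c ∈ v, c ∈ conjConsts S)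
    (hu : ∀ β ∈ u, β ∈ S) : germBar v * germZ u ∈ GHC S := by
  refine Submodule.subset_span ⟨(⟨v.reverse, by simpa using hv⟩, ⟨u.reverse, by simpa using hu⟩), ?_⟩
  rw [generators, genHyperlog_eq, List.reverse_reverse, List.reverse_reverse]

theorem GHC_induction {P : G → Prop} {f : G} (hf : f ∈ GHC S) (h0 : P 0)
    (hadd : ∀ x y, P x → P y → P (x + y)) (hsmul : ∀ (c : ℂ) x, P x → P (c • x))
    (hgen : ∀ v u, (∀ c ∈ v, c ∈ conjConsts S) → (∀ β ∈ u, β ∈ S) → P (germBar v * germZ u)) :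
    P f := by
  induction hf using Submodule.span_induction with
  | mem x hx =>
    obtain ⟨i, rfl⟩ := hx
    rw [generators, genHyperlog_eq]
    exact hgen _ _ (by simpa using i.1.2) (by simpa using i.2.2)
  | zero => exact h0
  | add x y _ _ hx hy => exact hadd x y hx hy
  | smul c x _ hx => exact hsmul c x hx

theorem GH_induction {P : G → Prop} {f : G} (hf : f ∈ GH S) (h0 : P 0)
    (hadd : ∀ x y, P x → P y → P (x + y)) (hsmul : ∀ r ∈ regular S, ∀ x, P x → P (r * x))
    (hgen : ∀ v u, (∀ c ∈ v, c ∈ conjConsts S) → (∀ β ∈ u, β ∈ S) → P (germBar v * germZ u)) :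
    P f := by
  induction hf using Submodule.span_induction with
  | mem x hx =>
    obtain ⟨i, rfl⟩ := hx
    rw [generators, genHyperlog_eq]
    exact hgen _ _ (by simpa using i.1.2) (by simpa using i.2.2)
  | zero => exact h0
  | add x y _ _ hx hy => exact hadd x y hx hy
  | smul c x _ hx => exact hsmul c c.2 x hx

theorem mul_mem_GH {r f : G} (hr : r ∈ regular S) (hf : f ∈ GH S) : r * f ∈ GH S :=
  (GH S).smul_mem ⟨r, hr⟩ hf

theorem GHC_le_GH {f : G} (hf : f ∈ GHC S) : f ∈ GH S := by
  induction hf using Submodule.span_induction with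
  | mem x hx => exact Submodule.subset_span hx
  | zero => exact zero_mem _
  | add x y _ _ hx hy => exact add_mem hx hy
  | smul c x _ hx =>
    rw [Algebra.smul_def]
    exact mul_mem_GH ((regular S).algebraMap_mem c) hx

theorem germBar_mul_germZ_mem_GH {v : List ℂ} {u : List (ℂ → ℂ)} (hv : ∀ c ∈ v, c ∈ conjConsts S)
    (hu : ∀ β ∈ u, β ∈ S) : germBar v * germZ u ∈ GH S :=
  GHC_le_GH (germBar_mul_germZ_mem_GHC hv hu)

theorem mem_GH_of_mem_regular {r : G} (hr : r ∈ regular S) : r ∈ GH S := by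
  have h := mul_mem_GH hr (germBar_mul_germZ_mem_GH (S := S) (v := []) (u := []) (by simp) (by simp))
  rwa [germBar_nil, germZ_nil, mul_one, mul_one] at h

theorem one_mem_GHC (S : Set (ℂ → ℂ)) : (1 : G) ∈ GHC S := by
  have h := germBar_mul_germZ_mem_GHC (S := S) (v := []) (u := []) (by simp) (by simp)
  rwa [germBar_nil, germZ_nil, mul_one] at h

theorem germ_list_sum {α : Type*} (l : List α) (f : α → ℂ × ℂ → ℂ) :
    germ (fun p => (l.map fun i => f i p).sum) = (l.map fun i => germ (f i)).sum := by
  induction l with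
  | nil => rfl
  | cons a l ih =>
    rw [List.map_cons, List.sum_cons, ← ih]
    rfl

theorem exists_germZ_mul {u v : List (ℂ → ℂ)} (hu : ∀ β ∈ u, β ∈ FLT F) (hv : ∀ β ∈ v, β ∈ FLT F) :
    ∃ l : List (List (ℂ → ℂ)), (∀ w ∈ l, ∀ β ∈ w, β ∈ u ∨ β ∈ v) ∧
      germZ u * germZ v = (l.map germZ).sum := by
  obtain ⟨ε, h⟩ := exists_niceRadius_list (F := F) (u := u ++ v) (by
    simpa [or_imp, forall_and] using ⟨hu, hv⟩)
  obtain ⟨l, hl, H⟩ := exists_shuffle h.logDomain _ u v rfl (fun β hβ => h.letter β (by simp [hβ]))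
    fun β hβ => h.letter β (by simp [hβ])
  refine ⟨l, fun w hw => (hl w hw).2, ?_⟩
  exact (h.germ_congr H).trans (germ_list_sum l revHyperlog)

theorem exists_germBar_mul (u v : List ℂ) :
    ∃ l : List (List ℂ), (∀ w ∈ l, ∀ c ∈ w, c ∈ u ∨ c ∈ v) ∧
      germBar u * germBar v = (l.map germBar).sum := by
  obtain ⟨ε, h⟩ := exists_niceRadius_const (u ++ v)
  obtain ⟨l, hl, H⟩ := h.exists_shuffle_const u v (fun c hc => by simp [hc]) fun c hc => by simp [hc]
  refine ⟨l, hl, ?_⟩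
  exact (h.germ_congr fun p hp => H p.2 hp.2.1 hp.2.2.1).trans
    (germ_list_sum l fun w p => hyperlogRev w p.2)

theorem list_sum_mul_mem {M : Submodule ℂ G} {α β : Type*} (l : List α) (k : List β) (f : α → G)
    (g : β → G) (h : ∀ a ∈ l, ∀ b ∈ k, f a * g b ∈ M) : (l.map f).sum * (k.map g).sum ∈ M := by
  rw [← List.sum_map_mul_right]
  refine list_sum_mem fun x hx => ?_
  obtain ⟨a, ha, rfl⟩ := List.mem_map.1 hx
  rw [← List.sum_map_mul_left]
  refine list_sum_mem fun x hx => ?_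
  obtain ⟨b, hb, rfl⟩ := List.mem_map.1 hx
  exact h a ha b hb

theorem generator_mul_mem_GHC (hSF : S ⊆ FLT F) {v v' : List ℂ} {u u' : List (ℂ → ℂ)}
    (hv : ∀ c ∈ v, c ∈ conjConsts S) (hu : ∀ β ∈ u, β ∈ S) (hv' : ∀ c ∈ v', c ∈ conjConsts S)
    (hu' : ∀ β ∈ u', β ∈ S) : germBar v * germZ u * (germBar v' * germZ u') ∈ GHC S := by
  obtain ⟨l, hl, e⟩ := exists_germBar_mul v v'
  obtain ⟨k, hk, e'⟩ := exists_germZ_mul (fun β hβ => hSF (hu β hβ)) fun β hβ => hSF (hu' β hβ)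
  rw [mul_mul_mul_comm, e, e']
  refine list_sum_mul_mem l k _ _ fun w hw w' hw' => germBar_mul_germZ_mem_GHC (fun c hc => ?_)
    fun β hβ => ?_
  · exact (hl w hw c hc).elim (hv c) (hv' c)
  · exact (hk w' hw' β hβ).elim (hu β) (hu' β)

theorem mul_mem_GHC (hSF : S ⊆ FLT F) {f g : G} (hf : f ∈ GHC S) (hg : g ∈ GHC S) :
    f * g ∈ GHC S := by
  refine GHC_induction (P := fun f => f * g ∈ GHC S) hf (by simp) (fun x y hx hy => ?_) (fun c x hx => ?_) fun v u hv hu => ?_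
  · rw [add_mul]
    exact add_mem hx hy
  · rw [smul_mul_assoc]
    exact Submodule.smul_mem _ c hx
  refine GHC_induction (P := fun g => germBar v * germZ u * g ∈ GHC S) hg (by simp) (fun x y hx hy => ?_) (fun c x hx => ?_) fun v' u' hv' hu' => ?_
  · rw [mul_add]
    exact add_mem hx hy
  · rw [mul_smul_comm]
    exact Submodule.smul_mem _ c hx
  exact generator_mul_mem_GHC hSF hv hu hv' hu'

theorem GH_mul_mem (hSF : S ⊆ FLT F) {f g : G} (hf : f ∈ GH S) (hg : g ∈ GH S) :
    f * g ∈ GH S := by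
  refine GH_induction (P := fun f => f * g ∈ GH S) hf (by simp) (fun x y hx hy => ?_) (fun c hc x hx => ?_) fun v u hv hu => ?_
  · rw [add_mul]
    exact add_mem hx hy
  · rw [mul_assoc]
    exact mul_mem_GH hc hx
  refine GH_induction (P := fun g => germBar v * germZ u * g ∈ GH S) hg (by simp) (fun x y hx hy => ?_) (fun c hc x hx => ?_)
    fun v' u' hv' hu' => ?_
  · rw [mul_add]
    exact add_mem hx hy
  · rw [mul_left_comm]
    exact mul_mem_GH hc hx
  exact GHC_le_GH (generator_mul_mem_GHC hSF hv hu hv' hu')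

/-- The algebra of generalized hyperlogarithms with constant coefficients. -/
def subalgebraGHC (hSF : S ⊆ FLT F) : Subalgebra ℂ G :=
  (GHC S).toSubalgebra (one_mem_GHC S) fun _ _ => mul_mem_GHC hSF

theorem isHolomorphic_of_mem_GH (hSF : S ⊆ FLT F) {f : G} (hf : f ∈ GH S) : IsHolomorphic f := by
  refine GH_induction hf (zero_mem (S := Subalgebra ℂ G) holomorphicGerms)
    (fun x y hx hy => add_mem (S := Subalgebra ℂ G) (s := holomorphicGerms) hx hy)
    (fun c hc x hx => ?_) fun v u hv hu => ?_
  · exact mul_mem (S := Subalgebra ℂ G) (s := holomorphicGerms)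
      (isHolomorphic_of_mem_regular hSF hc) hx
  · exact mul_mem (S := Subalgebra ℂ G) (s := holomorphicGerms) (isHolomorphic_germBar v)
      (isHolomorphic_germZ fun β hβ => hSF (hu β hβ))

/-! ### Differential simplicity -/

theorem exists_evalWords_eq {f : G} (hf : f ∈ GH S) : ∃ m, evalWords S m = f := by
  have h : GH S ≤ LinearMap.range (evalWords S) := by
    refine Submodule.span_le.2 ?_
    rintro _ ⟨i, rfl⟩
    refine ⟨Finsupp.single i.2.toList (.single i.1.toList 1), ?_⟩
    rw [evalWords_single, evalBar_single, generators, genHyperlog_eq, Word.map_toList,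
      Word.map_toList, OneMemClass.coe_one, one_mul]
  exact h hf

theorem IsHolomorphic.iterate {f : G} (hf : IsHolomorphic f) (i j : ℕ) :
    IsHolomorphic (GenHyperlog.dz^[i] (GenHyperlog.dzbar^[j] f)) := by
  have h1 : ∀ j f, IsHolomorphic f → IsHolomorphic (GenHyperlog.dzbar^[j] f) := fun j => by
    induction j with
    | zero => exact fun f h => h
    | succ j ih => exact fun f h => ih _ h.dzbar
  have h2 : ∀ j f, IsHolomorphic f → IsHolomorphic (GenHyperlog.dz^[j] f) := fun j => by
    induction j with
    | zero => exact fun f h => h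
    | succ j ih => exact fun f h => ih _ h.dz
  exact h2 i _ (h1 j _ hf)

theorem dzbar_iterate_dz {f : G} (hf : IsHolomorphic f) (i : ℕ) :
    dzbar (dz^[i] f) = dz^[i] (dzbar f) := by
  induction i generalizing f with
  | zero => rfl
  | succ i ih => rw [Function.iterate_succ_apply, ih hf.dz, ← dz_dzbar hf, Function.iterate_succ_apply]

/-- The derivatives of `f` span a module over the regular functions that is stable under `∂_z` and
`∂_ζ`, since these commute. It contains `f`, the value of a nonzero combination of words, and
therefore contains `1`. -/
theorem exists_differential_operator (hS : S.Finite) (hSF : S ⊆ FLT F) {f : G} (hf : f ∈ GH S)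
    (hf0 : f ≠ 0) : ∃ (N : ℕ) (c : ℕ → ℕ → G), (∀ i j, c i j ∈ regular S) ∧
      ∑ i ∈ Finset.range N, ∑ j ∈ Finset.range N, c i j * dz^[i] (dzbar^[j] f) = 1 := by
  have hh := isHolomorphic_of_mem_GH hSF hf
  obtain ⟨m, rfl⟩ := exists_evalWords_eq hf
  set D : ℕ × ℕ → G := fun x => dz^[x.1] (dzbar^[x.2] (evalWords S m)) with hD
  set Y : Submodule (regular S) G := Submodule.span (regular S) (Set.range D) with hY
  have hY' : ∀ y ∈ Y, IsHolomorphic y ∧ dz y ∈ Y ∧ dzbar y ∈ Y := by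
    intro y hy
    induction hy using Submodule.span_induction with
    | mem x hx =>
      obtain ⟨⟨i, j⟩, rfl⟩ := hx
      refine ⟨hh.iterate i j, Submodule.subset_span ⟨(i + 1, j), ?_⟩,
        Submodule.subset_span ⟨(i, j + 1), ?_⟩⟩
      · exact Function.iterate_succ_apply' ..
      · change dz^[i] (dzbar^[j + 1] _) = dzbar (dz^[i] (dzbar^[j] _))
        rw [dzbar_iterate_dz (f := dzbar^[j] _) (hh.iterate 0 j), Function.iterate_succ_apply']
    | zero => exact ⟨zero_mem (S := Subalgebra ℂ G) holomorphicGerms, by rw [dz_zero]; exact zero_mem _,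
        by rw [dzbar_zero]; exact zero_mem _⟩
    | add x y _ _ hx hy =>
      refine ⟨add_mem (S := Subalgebra ℂ G) (s := holomorphicGerms) hx.1 hy.1, ?_, ?_⟩
      · rw [dz_add hx.1 hy.1]
        exact add_mem hx.2.1 hy.2.1
      · rw [dzbar_add hx.1 hy.1]
        exact add_mem hx.2.2 hy.2.2
    | smul r x hxm hx =>
      have hr := isHolomorphic_of_mem_regular hSF r.2
      have e : r • x = (r : G) * x := rfl
      rw [e, dz_mul hr hx.1, dzbar_mul hr hx.1]
      refine ⟨mul_mem (S := Subalgebra ℂ G) (s := holomorphicGerms) hr hx.1, ?_, ?_⟩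
      · exact add_mem (Y.smul_mem ⟨_, dz_mem_regular hSF r.2⟩ hxm) (Y.smul_mem r hx.2.1)
      · exact add_mem (Y.smul_mem ⟨_, dzbar_mem_regular hSF r.2⟩ hxm) (Y.smul_mem r hx.2.2)
  have h1 : (1 : G) ∈ Y := one_mem_of_evalWords_mem hS hSF Y (fun y hy => (hY' y hy).2.1)
    (fun y hy => (hY' y hy).2.2) (m := m) (fun h => hf0 (by rw [h, map_zero]))
    (Submodule.subset_span ⟨(0, 0), rfl⟩)
  obtain ⟨c, hc⟩ := (Finsupp.mem_span_range_iff_exists_finsupp).1 h1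
  obtain ⟨N, hN⟩ : ∃ N, ∀ x ∈ c.support, x.1 < N ∧ x.2 < N := by
    refine ⟨c.support.sup (fun x => x.1 + x.2) + 1, fun x hx => ?_⟩
    have := Finset.le_sup (f := fun x : ℕ × ℕ => x.1 + x.2) hx
    have h2 : x.1 + x.2 ≤ _ := this
    omega
  refine ⟨N, fun i j => c (i, j), fun i j => (c (i, j)).2, ?_⟩
  rw [← Finset.sum_product' (f := fun i j => (c (i, j) : G) * dz^[i] (dzbar^[j] (evalWords S m))),
    ← hc, Finsupp.sum]
  symm
  refine Finset.sum_subset (fun x hx => ?_) fun x _ hx => ?_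
  · simpa using hN x hx
  · rw [Finsupp.notMem_support_iff.1 hx, zero_smul]

end
end GenHyperlog

namespace GenHyperlog
noncomputable section

variable {F : Subfield ℂ} {S T : Set (ℂ → ℂ)} {A B : Set ℂ}

/-! ### Finite alphabets -/

theorem GH_mono (h : S ⊆ T) {f : G} (hf : f ∈ GH S) : f ∈ GH T :=
  GH_induction hf (zero_mem _) (fun _ _ => add_mem) (fun _ hr _ => mul_mem_GH (regular_mono h hr))
    fun _ _ hv hu => germBar_mul_germZ_mem_GH (fun c hc => conjConsts_mono h (hv c hc))
      fun β hβ => h (hu β hβ)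

theorem GHC_mono (h : S ⊆ T) {f : G} (hf : f ∈ GHC S) : f ∈ GHC T :=
  GHC_induction hf (zero_mem _) (fun _ _ => add_mem) (fun c _ => Submodule.smul_mem _ c)
    fun _ _ hv hu => germBar_mul_germZ_mem_GHC (fun c hc => conjConsts_mono h (hv c hc))
      fun β hβ => h (hu β hβ)

theorem exists_finite_of_mem_regular {r : G} (hr : r ∈ regular S) :
    ∃ S₀ ⊆ S, S₀.Finite ∧ r ∈ regular S₀ := by
  induction hr using Algebra.adjoin_induction with
  | mem x hx =>
    rcases hx with ((rfl | rfl) | ⟨β, hβ, rfl⟩) | ⟨c, hc, rfl⟩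
    · exact ⟨∅, Set.empty_subset _, Set.finite_empty, germ_fst_mem_regular _⟩
    · exact ⟨∅, Set.empty_subset _, Set.finite_empty, germ_snd_mem_regular _⟩
    · exact ⟨{β}, by simpa using hβ, Set.finite_singleton _, germ_inv_mem_regular rfl⟩
    · exact ⟨{fun _ => starRingEnd ℂ c}, Set.singleton_subset_iff.2 hc, Set.finite_singleton _,
        germ_inv_snd_mem_regular rfl⟩
  | algebraMap c => exact ⟨∅, Set.empty_subset _, Set.finite_empty, Subalgebra.algebraMap_mem _ _⟩
  | add x y _ _ hx hy =>
    obtain ⟨S₁, h1, h1', h1''⟩ := hx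
    obtain ⟨S₂, h2, h2', h2''⟩ := hy
    exact ⟨S₁ ∪ S₂, Set.union_subset h1 h2, h1'.union h2', add_mem
      (regular_mono Set.subset_union_left h1'') (regular_mono Set.subset_union_right h2'')⟩
  | mul x y _ _ hx hy =>
    obtain ⟨S₁, h1, h1', h1''⟩ := hx
    obtain ⟨S₂, h2, h2', h2''⟩ := hy
    exact ⟨S₁ ∪ S₂, Set.union_subset h1 h2, h1'.union h2', mul_mem
      (regular_mono Set.subset_union_left h1'') (regular_mono Set.subset_union_right h2'')⟩

theorem exists_finite_of_mem_regularBar {r : G} (hr : r ∈ regularBar A) :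
    ∃ A₀ ⊆ A, A₀.Finite ∧ r ∈ regularBar A₀ := by
  induction hr using Algebra.adjoin_induction with
  | mem x hx =>
    rcases hx with rfl | ⟨c, hc, rfl⟩
    · exact ⟨∅, Set.empty_subset _, Set.finite_empty, germ_snd_mem_regularBar _⟩
    · exact ⟨{c}, by simpa using hc, Set.finite_singleton _, germ_inv_snd_mem_regularBar rfl⟩
  | algebraMap c => exact ⟨∅, Set.empty_subset _, Set.finite_empty, Subalgebra.algebraMap_mem _ _⟩
  | add x y _ _ hx hy =>
    obtain ⟨S₁, h1, h1', h1''⟩ := hx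
    obtain ⟨S₂, h2, h2', h2''⟩ := hy
    exact ⟨S₁ ∪ S₂, Set.union_subset h1 h2, h1'.union h2', add_mem
      (regularBar_mono Set.subset_union_left h1'') (regularBar_mono Set.subset_union_right h2'')⟩
  | mul x y _ _ hx hy =>
    obtain ⟨S₁, h1, h1', h1''⟩ := hx
    obtain ⟨S₂, h2, h2', h2''⟩ := hy
    exact ⟨S₁ ∪ S₂, Set.union_subset h1 h2, h1'.union h2', mul_mem
      (regularBar_mono Set.subset_union_left h1'') (regularBar_mono Set.subset_union_right h2'')⟩

theorem exists_finite_words {v : List ℂ} {u : List (ℂ → ℂ)} (hv : ∀ c ∈ v, c ∈ conjConsts S)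
    (hu : ∀ β ∈ u, β ∈ S) : ∃ S₀ ⊆ S, S₀.Finite ∧ (∀ c ∈ v, c ∈ conjConsts S₀) ∧ ∀ β ∈ u, β ∈ S₀ := by
  refine ⟨{β | β ∈ v.map (fun c _ => starRingEnd ℂ c) ++ u}, fun β hβ => ?_, List.finite_toSet _,
    fun c hc => ?_, fun β hβ => List.mem_append_right _ hβ⟩
  · rcases List.mem_append.1 hβ with h | h
    · obtain ⟨c, hc, rfl⟩ := List.mem_map.1 h
      exact hv c hc
    · exact hu β h
  · exact List.mem_append_left _ (List.mem_map_of_mem hc)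

theorem exists_finite_of_mem_GH {f : G} (hf : f ∈ GH S) : ∃ S₀ ⊆ S, S₀.Finite ∧ f ∈ GH S₀ := by
  refine GH_induction (P := fun f => ∃ S₀ ⊆ S, S₀.Finite ∧ f ∈ GH S₀) hf ⟨∅, Set.empty_subset _, Set.finite_empty, zero_mem _⟩ ?_ ?_ ?_
  · rintro x y ⟨S₁, h1, h1', h1''⟩ ⟨S₂, h2, h2', h2''⟩
    exact ⟨S₁ ∪ S₂, Set.union_subset h1 h2, h1'.union h2', add_mem
      (GH_mono Set.subset_union_left h1'') (GH_mono Set.subset_union_right h2'')⟩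
  · rintro r hr x ⟨S₁, h1, h1', h1''⟩
    obtain ⟨S₂, h2, h2', h2''⟩ := exists_finite_of_mem_regular hr
    exact ⟨S₁ ∪ S₂, Set.union_subset h1 h2, h1'.union h2',
      mul_mem_GH (regular_mono Set.subset_union_right h2'') (GH_mono Set.subset_union_left h1'')⟩
  · intro v u hv hu
    obtain ⟨S₀, h1, h2, h3, h4⟩ := exists_finite_words hv hu
    exact ⟨S₀, h1, h2, germBar_mul_germZ_mem_GH h3 h4⟩

theorem exists_finite_of_mem_GHC {f : G} (hf : f ∈ GHC S) : ∃ S₀ ⊆ S, S₀.Finite ∧ f ∈ GHC S₀ := by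
  refine GHC_induction (P := fun f => ∃ S₀ ⊆ S, S₀.Finite ∧ f ∈ GHC S₀) hf ⟨∅, Set.empty_subset _, Set.finite_empty, zero_mem _⟩ ?_ ?_ ?_
  · rintro x y ⟨S₁, h1, h1', h1''⟩ ⟨S₂, h2, h2', h2''⟩
    exact ⟨S₁ ∪ S₂, Set.union_subset h1 h2, h1'.union h2', add_mem
      (GHC_mono Set.subset_union_left h1'') (GHC_mono Set.subset_union_right h2'')⟩
  · rintro c x ⟨S₁, h1, h1', h1''⟩
    exact ⟨S₁, h1, h1', Submodule.smul_mem _ c h1''⟩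
  · intro v u hv hu
    obtain ⟨S₀, h1, h2, h3, h4⟩ := exists_finite_words hv hu
    exact ⟨S₀, h1, h2, germBar_mul_germZ_mem_GHC h3 h4⟩

/-- Each element involves only finitely many letters. Working over the infinite alphabet `FLT F`
from here on avoids enlarging finite alphabets at every step. -/
theorem mem_GHF_iff {f : G} : f ∈ GHF F ↔ f ∈ GH (FLT F) := by
  refine ⟨fun ⟨S, _, hSF, hf⟩ => GH_mono hSF hf, fun hf => ?_⟩
  obtain ⟨S, h1, h2, h3⟩ := exists_finite_of_mem_GH hf
  exact ⟨S, h2, h1, h3⟩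

theorem mem_GHCF_iff {f : G} : f ∈ GHCF F ↔ f ∈ GHC (FLT F) := by
  refine ⟨fun ⟨S, _, hSF, hf⟩ => GHC_mono hSF hf, fun hf => ?_⟩
  obtain ⟨S, h1, h2, h3⟩ := exists_finite_of_mem_GHC hf
  exact ⟨S, h2, h1, h3⟩

theorem germBar_mem_HLbar {v : List ℂ} (hv : ∀ c ∈ v, c ∈ A) : germBar v ∈ HLbar A := by
  refine Submodule.subset_span ⟨⟨v.reverse, by simpa using hv⟩, ?_⟩
  change germ (fun p => hyperlogRev v.reverse.reverse p.2) = _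
  rw [List.reverse_reverse]
  rfl

theorem HLbar_induction {P : G → Prop} {f : G} (hf : f ∈ HLbar A) (h0 : P 0)
    (hadd : ∀ x y, P x → P y → P (x + y)) (hsmul : ∀ r ∈ regularBar A, ∀ x, P x → P (r * x))
    (hgen : ∀ v, (∀ c ∈ v, c ∈ A) → P (germBar v)) : P f := by
  induction hf using Submodule.span_induction with
  | mem x hx =>
    obtain ⟨i, rfl⟩ := hx
    exact hgen i.1.reverse (by simpa using i.2)
  | zero => exact h0
  | add x y _ _ hx hy => exact hadd x y hx hy
  | smul c x _ hx => exact hsmul c c.2 x hx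

theorem mul_mem_HLbar {r f : G} (hr : r ∈ regularBar A) (hf : f ∈ HLbar A) : r * f ∈ HLbar A :=
  (HLbar A).smul_mem ⟨r, hr⟩ hf

theorem HLbar_mono (h : A ⊆ B) {f : G} (hf : f ∈ HLbar A) : f ∈ HLbar B :=
  HLbar_induction hf (zero_mem _) (fun _ _ => add_mem)
    (fun _ hr _ => mul_mem_HLbar (regularBar_mono h hr))
    fun _ hv => germBar_mem_HLbar fun c hc => h (hv c hc)

theorem mem_HLbarF_iff {f : G} : f ∈ HLbarF F ↔ f ∈ HLbar (F : Set ℂ) := by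
  refine ⟨fun ⟨A, _, hA, hf⟩ => HLbar_mono hA hf, fun hf => ?_⟩
  refine HLbar_induction (P := fun f => f ∈ HLbarF F) hf ⟨∅, Set.finite_empty, Set.empty_subset _, zero_mem _⟩ ?_ ?_ ?_
  · rintro x y ⟨S₁, h1, h1', h1''⟩ ⟨S₂, h2, h2', h2''⟩
    exact ⟨S₁ ∪ S₂, h1.union h2, Set.union_subset h1' h2', add_mem
      (HLbar_mono Set.subset_union_left h1'') (HLbar_mono Set.subset_union_right h2'')⟩
  · rintro r hr x ⟨S₁, h1, h1', h1''⟩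
    obtain ⟨S₂, h2, h2', h2''⟩ := exists_finite_of_mem_regularBar hr
    exact ⟨S₁ ∪ S₂, h1.union h2', Set.union_subset h1' h2, mul_mem_HLbar
      (regularBar_mono Set.subset_union_right h2'') (HLbar_mono Set.subset_union_left h1'')⟩
  · intro v hv
    exact ⟨{c | c ∈ v}, List.finite_toSet v, hv, germBar_mem_HLbar fun _ => id⟩

/-! ### Quadratic polynomials -/

theorem mem_of_const_mem_FLT {b : ℂ} (h : (fun _ => b) ∈ FLT F) : b ∈ F := by
  rcases h with ⟨c, hc, e⟩ | ⟨a, ha, b', hb, c, hc, d, hd, hdet, e⟩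
  · rwa [congrFun e 0]
  · have h1 : ∀ x ∈ F, (a * x + b') / (c * x + d) ∈ F := fun x hx =>
      F.div_mem (F.add_mem (F.mul_mem ha hx) hb) (F.add_mem (F.mul_mem hc hx) hd)
    have h2 : b = (a * 0 + b') / (c * 0 + d) := congrFun e 0
    rw [h2]
    exact h1 0 F.zero_mem

theorem conjConsts_FLT (hconj : ∀ x ∈ F, starRingEnd ℂ x ∈ F) : conjConsts (FLT F) = F := by
  ext c
  refine ⟨fun h => ?_, fun h => const_mem_FLT (hconj c h)⟩
  simpa using hconj _ (mem_of_const_mem_FLT h)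

/-- A nonzero quadratic polynomial over a quadratically closed field is a product of linear
factors. -/
theorem exists_roots (hsqrt : ∀ x : ℂ, x ^ 2 ∈ F → x ∈ F) {a b c : ℂ} (ha : a ∈ F) (hb : b ∈ F)
    (hc : c ∈ F) (h : a ≠ 0 ∨ b ≠ 0 ∨ c ≠ 0) : ∃ k ≠ 0, ∃ l : List ℂ, (∀ r ∈ l, r ∈ F) ∧
      ∀ x, a * x ^ 2 + b * x + c = k * (l.map fun r => x - r).prod := by
  by_cases ha0 : a = 0
  · subst ha0
    by_cases hb0 : b = 0
    · subst hb0
      exact ⟨c, by simpa using h, [], by simp, fun x => by simp⟩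
    · refine ⟨b, hb0, [-c / b], by simpa using F.div_mem (F.neg_mem hc) hb, fun x => ?_⟩
      simp only [List.map_cons, List.map_nil, List.prod_cons, List.prod_nil]
      field_simp
      ring
  · obtain ⟨s, hs⟩ := IsAlgClosed.exists_pow_nat_eq (b ^ 2 - 4 * a * c) (n := 2) two_pos
    have h4 : (4 : ℂ) ∈ F := by exact_mod_cast natCast_mem F 4
    have h2 : (2 : ℂ) ∈ F := by exact_mod_cast natCast_mem F 2
    -- The square root of the discriminant; all uses of square roots in `F` go back to this one.
    have hsF : s ∈ F := hsqrt s (hs ▸ F.sub_mem (pow_mem hb 2) (F.mul_mem (F.mul_mem h4 ha) hc))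
    have h2a := F.mul_mem h2 ha
    refine ⟨a, ha0, [(-b + s) / (2 * a), (-b - s) / (2 * a)], ?_, fun x => ?_⟩
    · simp only [List.mem_cons, List.not_mem_nil, or_false, forall_eq_or_imp, forall_eq]
      exact ⟨F.div_mem (F.add_mem (F.neg_mem hb) hsF) h2a,
        F.div_mem (F.sub_mem (F.neg_mem hb) hsF) h2a⟩
    · simp only [List.map_cons, List.map_nil, List.prod_cons, List.prod_nil]
      field_simp
      linear_combination hs

theorem germ_prod_inv_mem {l : List ℂ} (hl : ∀ r ∈ l, r ∈ A) (k : ℂ) :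
    germ (fun p => (k * (l.map fun r => p.2 - r).prod)⁻¹) ∈ regularBar A := by
  induction l with
  | nil =>
    have h := (regularBar A).algebraMap_mem (k * 1)⁻¹
    rwa [algebraMap_G] at h
  | cons r l ih =>
    have h := mul_mem (ih fun s hs => hl s (by simp [hs]))
      (germ_inv_snd_mem_regularBar (A := A) (hl r (by simp)))
    convert h using 1
    refine germ_congr (Eventually.of_forall fun p => ?_)
    change (k * ((p.2 - r) * (l.map fun r => p.2 - r).prod))⁻¹ =
      (k * (l.map fun r => p.2 - r).prod)⁻¹ * (p.2 - r)⁻¹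
    rw [← mul_inv, mul_left_comm, mul_comm (p.2 - r)]

theorem germ_linear_mem_regularBar (a b : ℂ) : germ (fun p => a * p.2 + b) ∈ regularBar A := by
  have h := add_mem (mul_mem ((regularBar A).algebraMap_mem a) (germ_snd_mem_regularBar A))
    ((regularBar A).algebraMap_mem b)
  rwa [algebraMap_G, algebraMap_G] at h

/-- The difference of two letters as a quotient of products of linear functions. -/
theorem exists_sub_eq_quotient (hsqrt : ∀ x : ℂ, x ^ 2 ∈ F → x ∈ F) {β γ : ℂ → ℂ} (hβ : β ∈ FLT F)
    (hγ : γ ∈ FLT F) (h : β ≠ γ) : ∃ c d c' d' k : ℂ, ∃ l : List ℂ, c ∈ F ∧ d ∈ F ∧ c' ∈ F ∧ d' ∈ F ∧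
      (c ≠ 0 ∨ d ≠ 0) ∧ (c' ≠ 0 ∨ d' ≠ 0) ∧ k ≠ 0 ∧ (∀ r ∈ l, r ∈ F) ∧
      ∀ x, c * x + d ≠ 0 → c' * x + d' ≠ 0 →
        (β x - γ x) * ((c * x + d) * (c' * x + d')) = k * (l.map fun r => x - r).prod := by
  obtain ⟨a, ha, b, hb, c, hc, d, hd, hcd, -, hβ'⟩ := exists_coeffs_of_mem_FLT hβ
  obtain ⟨a', ha', b', hb', c', hc', d', hd', hcd', -, hγ'⟩ := exists_coeffs_of_mem_FLT hγ
  have key : ∀ x, c * x + d ≠ 0 → c' * x + d' ≠ 0 →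
      (β x - γ x) * ((c * x + d) * (c' * x + d')) =
        (a * c' - a' * c) * x ^ 2 + (a * d' + b * c' - (a' * d + b' * c)) * x +
          (b * d' - b' * d) := by
    intro x h1 h2
    rw [hβ', hγ', div_sub_div _ _ h1 h2, div_mul_cancel₀ _ (mul_ne_zero h1 h2)]
    ring
  have hne : a * c' - a' * c ≠ 0 ∨ a * d' + b * c' - (a' * d + b' * c) ≠ 0 ∨ b * d' - b' * d ≠ 0 := by
    by_contra! h0
    obtain ⟨x, h1, h2, h3⟩ := ((eventually_ne_of_mem_FLT hβ hγ h).and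
      ((eventually_linear_ne_zero hcd).and (eventually_linear_ne_zero hcd'))).exists
    have h4 := key x h2 h3
    rw [h0.1, h0.2.1, h0.2.2] at h4
    simp only [zero_mul, add_zero, mul_eq_zero, h2, h3, or_false] at h4
    exact h1 (sub_eq_zero.1 h4)
  obtain ⟨k, hk, l, hl, H⟩ := exists_roots hsqrt
    (F.sub_mem (F.mul_mem ha hc') (F.mul_mem ha' hc))
    (F.sub_mem (F.add_mem (F.mul_mem ha hd') (F.mul_mem hb hc'))
      (F.add_mem (F.mul_mem ha' hd) (F.mul_mem hb' hc)))
    (F.sub_mem (F.mul_mem hb hd') (F.mul_mem hb' hd)) hne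
  exact ⟨c, d, c', d', k, l, hc, hd, hc', hd', hcd, hcd', hk, hl, fun x h1 h2 =>
    (key x h1 h2).trans (H x)⟩

theorem germ_inv_linear_mem {c d : ℂ} (hc : c ∈ F) (hd : d ∈ F) (h : c ≠ 0 ∨ d ≠ 0) :
    germ (fun p => (c * p.2 + d)⁻¹) ∈ regularBar (F : Set ℂ) := by
  by_cases hc0 : c = 0
  · subst hc0
    have h1 := (regularBar (F : Set ℂ)).algebraMap_mem d⁻¹
    rw [algebraMap_G] at h1
    simpa using h1
  · have h1 := germ_prod_inv_mem (A := F) (l := [-d / c]) (by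
      simpa using F.div_mem (F.neg_mem hd) hc) c
    convert h1 using 3
    simp only [List.map_cons, List.map_nil, List.prod_cons, List.prod_nil]
    field_simp
    ring

theorem germ_letter_mem {β : ℂ → ℂ} (hβ : β ∈ FLT F) :
    germ (fun p => β p.2) ∈ regularBar (F : Set ℂ) := by
  obtain ⟨a, -, b, -, c, hc, d, hd, hcd, -, hβ'⟩ := exists_coeffs_of_mem_FLT hβ
  have h := mul_mem (germ_linear_mem_regularBar (A := F) a b) (germ_inv_linear_mem hc hd hcd)
  convert h using 1
  exact germ_congr (Eventually.of_forall fun p => (hβ' _).trans (div_eq_mul_inv _ _))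

/-- The poles of `1 / (β - γ)` are roots of a polynomial of degree at most two over `F`, hence lie
in `F`. This keeps partial fractions in `z` within coefficients over `F`. -/
theorem germ_inv_sub_mem (hsqrt : ∀ x : ℂ, x ^ 2 ∈ F → x ∈ F) {β γ : ℂ → ℂ} (hβ : β ∈ FLT F)
    (hγ : γ ∈ FLT F) (h : β ≠ γ) :
    germ (fun p => (β p.2 - γ p.2)⁻¹) ∈ regularBar (F : Set ℂ) := by
  obtain ⟨c, d, c', d', k, l, -, -, -, -, hcd, hcd', hk, hl, H⟩ :=
    exists_sub_eq_quotient hsqrt hβ hγ h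
  have h1 := mul_mem (mul_mem (germ_linear_mem_regularBar (A := F) c d)
    (germ_linear_mem_regularBar (A := F) c' d')) (germ_prod_inv_mem (A := F) hl k)
  convert h1 using 1
  refine germ_congr ?_
  filter_upwards [eventually_base_linear_ne_zero hcd, eventually_base_linear_ne_zero hcd',
    eventually_base_snd (P := fun ζ => β ζ ≠ γ ζ) (eventually_ne_of_mem_FLT hβ hγ h)] with p h2 h3 h4
  change _ = ((c * p.2 + d) * (c' * p.2 + d')) * (k * (l.map fun r => p.2 - r).prod)⁻¹
  rw [← H _ h2 h3]
  rw [mul_inv, mul_left_comm, mul_inv_cancel₀ (mul_ne_zero h2 h3), mul_one]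

/-! ### The kernel of `∂_z` -/

theorem HLbar_le_GH (hconj : ∀ x ∈ F, starRingEnd ℂ x ∈ F) {f : G} (hf : f ∈ HLbar (F : Set ℂ)) :
    f ∈ GH (FLT F) := by
  have h := conjConsts_FLT hconj
  refine HLbar_induction hf (zero_mem _) (fun _ _ => add_mem) (fun r hr x hx => ?_) fun v hv => ?_
  · exact mul_mem_GH (regularBar_conjConsts_le (FLT F) (h.symm ▸ hr)) hx
  · have h1 := germBar_mul_germZ_mem_GH (S := FLT F) (v := v) (u := []) (h.symm ▸ hv) (by simp)
    rwa [germZ_nil, mul_one] at h1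

theorem evalWords_mem_GH (m : List S →₀ BarWords (regular S) (conjConsts S)) :
    evalWords S m ∈ GH S := by
  have hmem : ∀ {α : Type} {D : Set α} (l : List D), ∀ x ∈ l.map (↑), x ∈ D := by
    intro α D l x hx
    obtain ⟨y, -, rfl⟩ := List.mem_map.1 hx
    exact y.2
  induction m using Finsupp.induction_linear with
  | zero =>
    rw [map_zero]
    exact zero_mem _
  | add f g hf hg =>
    rw [map_add]
    exact add_mem hf hg
  | single u n =>
    rw [evalWords_single]
    induction n using BarWords.induction_linear with
    | zero =>
      rw [map_zero, zero_mul]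
      exact zero_mem _
    | add f g hf hg =>
      rw [map_add, add_mul]
      exact add_mem hf hg
    | single v r =>
      rw [evalBar_single, mul_assoc]
      exact mul_mem_GH r.2 (germBar_mul_germZ_mem_GH (hmem v) (hmem u))

theorem dz_mem_GH (hSF : S ⊆ FLT F) {f : G} (hf : f ∈ GH S) : dz f ∈ GH S := by
  obtain ⟨m, rfl⟩ := exists_evalWords_eq hf
  rw [dz_evalWords hSF]
  exact evalWords_mem_GH _

theorem dz_of_mem_HLbar {f : G} (hf : f ∈ HLbar A) : dz f = 0 := by
  suffices h : IsHolomorphic f ∧ dz f = 0 from h.2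
  refine HLbar_induction (P := fun f => IsHolomorphic f ∧ dz f = 0) hf ⟨zero_mem (S := Subalgebra ℂ G) holomorphicGerms, dz_zero⟩ ?_ ?_ ?_
  · rintro x y ⟨h1, h2⟩ ⟨h3, h4⟩
    refine ⟨add_mem (S := Subalgebra ℂ G) (s := holomorphicGerms) h1 h3, ?_⟩
    rw [dz_add h1 h3, h2, h4, add_zero]
  · rintro r hr x ⟨h1, h2⟩
    have h3 := isHolomorphic_of_mem_regularBar hr
    refine ⟨mul_mem (S := Subalgebra ℂ G) (s := holomorphicGerms) h3 h1, ?_⟩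
    rw [dz_mul h3 h1, h2, dz_of_mem_regularBar hr, zero_mul, mul_zero, add_zero]
  · exact fun v _ => ⟨isHolomorphic_germBar v, dz_germBar v⟩

/-- Descending induction on the length: once all longer words have coefficient zero, the
coefficients of the `a :: w` are `d`-constant, and the equation at `w` makes them vanish by `res`.
Only the empty word escapes, since it is not of the form `a :: w`. -/
theorem eq_single_nil_of_wordDerivation_eq_zero {R N α : Type*} [CommRing R] [AddCommGroup N]
    [Module R N] [Fintype α] (d : N →+ N) (u : α → R)
    (res : ∀ (c : α → N) (x : N), (∀ a, d (c a) = 0) → d x + ∑ a, u a • c a = 0 → ∀ a, c a = 0)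
    {m : List α →₀ N} (h : wordDerivation d u m = 0) :
    d (m []) = 0 ∧ m = Finsupp.single [] (m []) := by
  have happ : ∀ w, d (m w) + ∑ a, u a • m (a :: w) = 0 := fun w => by
    rw [← wordDerivation_apply, h, Finsupp.zero_apply]
  have key : ∀ k w, m.support.sup List.length < w.length + k → w ≠ [] → m w = 0 := by
    intro k
    induction k with
    | zero =>
      intro w hw _
      by_contra h1
      have h2 := Finset.le_sup (f := List.length) (Finsupp.mem_support_iff.2 h1)
      omega
    | succ k ih =>
      intro w hw hw0
      obtain ⟨b, w, rfl⟩ := List.exists_cons_of_ne_nil hw0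
      refine res (fun a => m (a :: w)) (m w) (fun a => ?_) (happ w) b
      have h1 := happ (a :: w)
      rwa [Finset.sum_eq_zero, add_zero] at h1
      intro c _
      rw [ih (c :: a :: w) (by simp only [List.length_cons] at hw ⊢; omega) (by simp), smul_zero]
  have hm : ∀ w, w ≠ [] → m w = 0 := fun w => key (m.support.sup List.length + 1) w (by omega)
  constructor
  · have h1 := happ []
    rwa [Finset.sum_eq_zero, add_zero] at h1
    intro a _
    rw [hm _ (by simp), smul_zero]
  · ext w
    by_cases hw : w = []
    · rw [hw, Finsupp.single_eq_same]
    · rw [hm w hw, Finsupp.single_eq_of_ne hw]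

/-- By freeness the formal derivation of a representation vanishes, so only the empty word in `z`
remains, with coefficients independent of `z`. They are evaluated at a point `z₀ ∈ F` that is not a
letter; the new denominators `z₀ - β(ζ)` have their zeros in `F`, so the alphabet may grow but stays
over `F`. -/
theorem mem_HLbar_of_dz_eq_zero (hconj : ∀ x ∈ F, starRingEnd ℂ x ∈ F)
    (hsqrt : ∀ x : ℂ, x ^ 2 ∈ F → x ∈ F) {f : G} (hS : S.Finite) (hSF : S ⊆ FLT F)
    (hf : f ∈ GH S) (hd : dz f = 0) : f ∈ HLbar (F : Set ℂ) := by
  have := hS.fintype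
  have hAF : conjConsts S ⊆ (F : Set ℂ) := conjConsts_FLT hconj ▸ conjConsts_mono hSF
  obtain ⟨m, rfl⟩ := exists_evalWords_eq hf
  rw [dz_evalWords hSF] at hd
  obtain ⟨h1, h2⟩ := eq_single_nil_of_wordDerivation_eq_zero (BarWords.map (dzHom hSF)) letterInv
    (fun c x => barWords_eq_zero_of_dz hS hSF) (evalWords_injective hS hSF hd)
  obtain ⟨z₀, hz₀F, hz₀⟩ : ∃ z₀ ∈ F, (fun _ => z₀) ∉ S := by
    by_contra! h
    refine Set.infinite_of_injective_forall_mem (f := fun (n : ℕ) (_ : ℂ) => (n : ℂ))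
      (fun x y e => ?_) (fun n => h n (natCast_mem F n)) hS
    exact Nat.cast_injective (congrFun e 0)
  have hc : ∀ v, (BarWords.coeff v (m []) : G) ∈ regularBar (F : Set ℂ) := by
    intro v
    refine mem_of_dz_eq_zero hS hSF (BarWords.coeff v (m [])).2 ?_ hz₀ _
      (germ_snd_mem_regularBar _) (fun β hβ => ?_) fun c hc =>
        germ_inv_snd_mem_regularBar (hAF hc)
    · exact congrArg (fun n => (BarWords.coeff v n : G)) h1
    · refine germ_inv_sub_mem hsqrt (const_mem_FLT hz₀F) (hSF hβ) ?_
      rintro rfl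
      exact hz₀ hβ
  rw [h2, evalWords_single, List.map_nil, germZ_nil, mul_one, evalBar_eq_sum]
  refine sum_mem fun v _ => mul_mem_HLbar (hc v) (germBar_mem_HLbar fun c hc => ?_)
  obtain ⟨d, -, rfl⟩ := List.mem_map.1 hc
  exact hAF d.2

/-! ### Primitives -/

/-- The coefficients over which regular functions have a partial fraction decomposition: the
functions of `ζ`. -/
def partialFractions (F : Subfield ℂ) : Submodule (regularBar (F : Set ℂ)) G :=
  Submodule.span _ (Set.range (fun n : ℕ => germ (fun p => p.1) ^ n) ∪
    {f | ∃ β ∈ FLT F, ∃ n : ℕ, f = germ (fun p => (p.1 - β p.2)⁻¹) ^ (n + 1)})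

theorem fst_pow_mem_partialFractions (n : ℕ) : germ (fun p => p.1) ^ n ∈ partialFractions F :=
  Submodule.subset_span (Or.inl ⟨n, rfl⟩)

theorem inv_pow_mem_partialFractions {β : ℂ → ℂ} (hβ : β ∈ FLT F) (n : ℕ) :
    germ (fun p => (p.1 - β p.2)⁻¹) ^ n ∈ partialFractions F := by
  cases n with
  | zero =>
    rw [pow_zero, ← pow_zero (germ fun p => p.1)]
    exact fst_pow_mem_partialFractions 0
  | succ n => exact Submodule.subset_span (Or.inr ⟨β, hβ, n, rfl⟩)

theorem mul_mem_partialFractions {r x : G} (hr : r ∈ regularBar (F : Set ℂ))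
    (hx : x ∈ partialFractions F) : r * x ∈ partialFractions F :=
  (partialFractions F).smul_mem ⟨r, hr⟩ hx

theorem partialFractions_induction {P : G → Prop} {f : G} (hf : f ∈ partialFractions F) (h0 : P 0)
    (hadd : ∀ x y, P x → P y → P (x + y))
    (hsmul : ∀ r ∈ regularBar (F : Set ℂ), ∀ x, P x → P (r * x))
    (hfst : ∀ n : ℕ, P (germ (fun p => p.1) ^ n))
    (hinv : ∀ β ∈ FLT F, ∀ n : ℕ, P (germ (fun p => (p.1 - β p.2)⁻¹) ^ (n + 1))) : P f := by
  induction hf using Submodule.span_induction with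
  | mem x hx =>
    rcases hx with ⟨n, rfl⟩ | ⟨β, hβ, n, rfl⟩
    · exact hfst n
    · exact hinv β hβ n
  | zero => exact h0
  | add x y _ _ hx hy => exact hadd x y hx hy
  | smul c x _ hx => exact hsmul c c.2 x hx

/-- Multiplication by the generators preserves the space, if it maps the powers to the space. -/
theorem mul_partialFractions {g : G}
    (h1 : ∀ n : ℕ, g * germ (fun p => p.1) ^ n ∈ partialFractions F)
    (h2 : ∀ β ∈ FLT F, ∀ n : ℕ, g * germ (fun p => (p.1 - β p.2)⁻¹) ^ (n + 1) ∈ partialFractions F)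
    {x : G} (hx : x ∈ partialFractions F) : g * x ∈ partialFractions F := by
  refine partialFractions_induction (P := fun x => g * x ∈ partialFractions F) hx ?_ ?_ ?_ h1 h2
  · rw [mul_zero]
    exact zero_mem _
  · intro x y hx hy
    rw [mul_add]
    exact add_mem hx hy
  · intro r hr x hx
    rw [mul_left_comm]
    exact mul_mem_partialFractions hr hx

theorem fst_mul_inv {β : ℂ → ℂ} (hβ : β ∈ FLT F) :
    germ (fun p => p.1) * germ (fun p => (p.1 - β p.2)⁻¹) =
      1 + germ (fun p => β p.2) * germ (fun p => (p.1 - β p.2)⁻¹) := by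
  refine germ_congr ?_
  filter_upwards [eventually_base_sub_ne_zero hβ] with p hp
  field_simp
  ring

theorem inv_mul_inv {β γ : ℂ → ℂ} (hβ : β ∈ FLT F) (hγ : γ ∈ FLT F) (h : β ≠ γ) :
    germ (fun p => (p.1 - γ p.2)⁻¹) * germ (fun p => (p.1 - β p.2)⁻¹) =
      germ (fun p => (β p.2 - γ p.2)⁻¹) *
        (germ (fun p => (p.1 - β p.2)⁻¹) - germ (fun p => (p.1 - γ p.2)⁻¹)) := by
  refine germ_congr ?_
  filter_upwards [eventually_base_sub_ne_zero hβ, eventually_base_sub_ne_zero hγ,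
    eventually_base_snd (P := fun ζ => β ζ ≠ γ ζ) (eventually_ne_of_mem_FLT hβ hγ h)] with p h1 h2 h3
  have h4 := sub_ne_zero.2 h3
  change (p.1 - γ p.2)⁻¹ * (p.1 - β p.2)⁻¹ =
    (β p.2 - γ p.2)⁻¹ * ((p.1 - β p.2)⁻¹ - (p.1 - γ p.2)⁻¹)
  field_simp
  ring

theorem fst_mul_mem_partialFractions {x : G} (hx : x ∈ partialFractions F) :
    germ (fun p => p.1) * x ∈ partialFractions F := by
  refine mul_partialFractions (fun n => ?_) (fun β hβ n => ?_) hx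
  · rw [← pow_succ']
    exact fst_pow_mem_partialFractions (n + 1)
  · rw [pow_succ', ← mul_assoc, fst_mul_inv hβ, add_mul, one_mul, mul_assoc, ← pow_succ']
    exact add_mem (inv_pow_mem_partialFractions hβ n)
      (mul_mem_partialFractions (germ_letter_mem hβ) (inv_pow_mem_partialFractions hβ (n + 1)))

/-- Products of poles at distinct letters are separated by `inv_mul_inv`, which lowers an exponent
by one; powers of `z` are lowered by `fst_mul_inv`. -/
theorem inv_mul_mem_partialFractions (hsqrt : ∀ x : ℂ, x ^ 2 ∈ F → x ∈ F) {γ : ℂ → ℂ}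
    (hγ : γ ∈ FLT F) {x : G} (hx : x ∈ partialFractions F) :
    germ (fun p => (p.1 - γ p.2)⁻¹) * x ∈ partialFractions F := by
  have h0 := inv_pow_mem_partialFractions hγ 1
  rw [pow_one] at h0
  refine mul_partialFractions (fun n => ?_) (fun β hβ n => ?_) hx
  · induction n with
    | zero => rwa [pow_zero, mul_one]
    | succ n ih =>
      rw [pow_succ', ← mul_assoc, mul_comm (germ fun p => (p.1 - γ p.2)⁻¹), fst_mul_inv hγ, add_mul,
        one_mul, mul_assoc]
      exact add_mem (fst_pow_mem_partialFractions n)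
        (mul_mem_partialFractions (germ_letter_mem hγ) ih)
  · by_cases h : β = γ
    · rw [h, ← pow_succ']
      exact inv_pow_mem_partialFractions hγ _
    · have hr := germ_inv_sub_mem hsqrt hβ hγ h
      induction n with
      | zero =>
        rw [zero_add, pow_one, inv_mul_inv hβ hγ h]
        refine mul_mem_partialFractions hr (sub_mem ?_ h0)
        simpa using inv_pow_mem_partialFractions hβ 1
      | succ n ih =>
        rw [pow_succ', ← mul_assoc, inv_mul_inv hβ hγ h, mul_assoc, sub_mul, ← pow_succ']
        exact mul_mem_partialFractions hr
          (sub_mem (inv_pow_mem_partialFractions hβ _) ih)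

/-- The claim is strengthened to stability of the space under multiplication by `r`, which passes to
sums and products and is known for the generators. -/
theorem mem_partialFractions (hconj : ∀ x ∈ F, starRingEnd ℂ x ∈ F)
    (hsqrt : ∀ x : ℂ, x ^ 2 ∈ F → x ∈ F) {r : G} (hr : r ∈ regular (FLT F)) :
    r ∈ partialFractions F := by
  suffices h : ∀ x ∈ partialFractions F, r * x ∈ partialFractions F by
    simpa using h _ (fst_pow_mem_partialFractions 0)
  induction hr using Algebra.adjoin_induction with
  | mem y hy =>
    rcases hy with ((rfl | rfl) | ⟨β, hβ, rfl⟩) | ⟨c, hc, rfl⟩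
    · exact fun x => fst_mul_mem_partialFractions
    · exact fun x => mul_mem_partialFractions (germ_snd_mem_regularBar _)
    · exact fun x => inv_mul_mem_partialFractions hsqrt hβ
    · rw [conjConsts_FLT hconj] at hc
      exact fun x => mul_mem_partialFractions (germ_inv_snd_mem_regularBar hc)
  | algebraMap c => exact fun x => mul_mem_partialFractions (Subalgebra.algebraMap_mem _ c)
  | add y y' _ _ hy hy' =>
    intro x hx
    rw [add_mul]
    exact add_mem (hy x hx) (hy' x hx)
  | mul y y' _ _ hy hy' =>
    intro x hx
    rw [mul_assoc]
    exact hy _ (hy' x hx)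

theorem dz_pow_succ {f : G} (hf : IsHolomorphic f) (n : ℕ) :
    dz (f ^ (n + 1)) = (n + 1 : ℂ) • (f ^ n * dz f) := by
  induction n with
  | zero => simp
  | succ n ih =>
    rw [pow_succ, dz_mul (pow_mem (S := holomorphicGerms) hf _) hf, ih, Nat.cast_succ,
      smul_mul_assoc, add_smul, one_smul, add_smul, one_smul]
    simp only [add_smul, one_smul]
    ring_nf

theorem dz_smul {f : G} (hf : IsHolomorphic f) (c : ℂ) : dz (c • f) = c • dz f := by
  rw [Algebra.smul_def, Algebra.smul_def, dz_mul (holomorphicGerms.algebraMap_mem c) hf, dz_const,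
    zero_mul, zero_add]

theorem dz_sub {f g : G} (hf : IsHolomorphic f) (hg : IsHolomorphic g) :
    dz (f - g) = dz f - dz g := by
  rw [eq_sub_iff_add_eq, ← dz_add (sub_mem (S := Subalgebra ℂ G) (H := holomorphicGerms) hf hg) hg,
    sub_add_cancel]

/-- Integration by parts: differentiating the hyperlogarithm in `s H` shortens its word, and the
resulting term is integrated by `ih`. -/
theorem exists_primitive_of_derivative {u : List (ℂ → ℂ)} (hu : ∀ β ∈ u, β ∈ FLT F)
    (ih : ∀ a w, u = a :: w → ∀ r ∈ regular (FLT F), ∃ P ∈ GH (FLT F), dz P = r * germZ w) {s : G}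
    (hs : s ∈ regular (FLT F)) : ∃ P ∈ GH (FLT F), dz P = dz s * germZ u := by
  cases u with
  | nil => exact ⟨s, mem_GH_of_mem_regular hs, by rw [germZ_nil, mul_one]⟩
  | cons a u =>
    obtain ⟨P, hP, e⟩ := ih a u rfl _ (mul_mem hs (germ_inv_mem_regular (hu a (by simp))))
    have h1 : s * germZ (a :: u) ∈ GH (FLT F) := by
      have h2 := mul_mem_GH hs (germBar_mul_germZ_mem_GH (v := []) (by simp) hu)
      rwa [germBar_nil, one_mul] at h2
    refine ⟨s * germZ (a :: u) - P, sub_mem h1 hP, ?_⟩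
    rw [dz_sub (isHolomorphic_of_mem_GH le_rfl h1) (isHolomorphic_of_mem_GH le_rfl hP),
      dz_mul (isHolomorphic_of_mem_regular le_rfl hs) (isHolomorphic_germZ hu), dz_germZ_cons hu, e]
    ring

/-- By partial fractions over functions of `ζ`, which are constants for `∂_z`, only powers of `z`
and of `1 / (z - β)` remain. All except the simple pole are `z`-derivatives of regular functions and
are integrated by parts; the simple pole is integrated by adding `β` to the word. The form of `ih`
makes it void for the empty word. -/
theorem exists_primitive_mul_germZ_step (hconj : ∀ x ∈ F, starRingEnd ℂ x ∈ F)
    (hsqrt : ∀ x : ℂ, x ^ 2 ∈ F → x ∈ F) {u : List (ℂ → ℂ)} (hu : ∀ β ∈ u, β ∈ FLT F)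
    (ih : ∀ a w, u = a :: w → ∀ r ∈ regular (FLT F), ∃ P ∈ GH (FLT F), dz P = r * germZ w) {r : G}
    (hr : r ∈ regular (FLT F)) : ∃ P ∈ GH (FLT F), dz P = r * germZ u := by
  have hR : regularBar (F : Set ℂ) ≤ regular (FLT F) :=
    conjConsts_FLT hconj ▸ regularBar_conjConsts_le (FLT F)
  have hh : ∀ {P}, P ∈ GH (FLT F) → IsHolomorphic P := isHolomorphic_of_mem_GH le_rfl
  have hhr : ∀ {r}, r ∈ regular (FLT F) → IsHolomorphic r := isHolomorphic_of_mem_regular le_rfl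
  have hcast : ∀ n : ℕ, (n + 1 : ℂ) ≠ 0 := fun n => Nat.cast_add_one_ne_zero n
  refine partialFractions_induction (P := fun r => ∃ P ∈ GH (FLT F), dz P = r * germZ _)
    (mem_partialFractions hconj hsqrt hr) ⟨0, zero_mem _, by rw [dz_zero, zero_mul]⟩ ?_ ?_ ?_ ?_
  · rintro x y ⟨P, hP, e⟩ ⟨Q, hQ, e'⟩
    exact ⟨P + Q, add_mem hP hQ, by rw [dz_add (hh hP) (hh hQ), e, e', add_mul]⟩
  · rintro c hc x ⟨P, hP, e⟩
    refine ⟨c * P, mul_mem_GH (hR hc) hP, ?_⟩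
    rw [dz_mul (hhr (hR hc)) (hh hP), dz_of_mem_regularBar hc, zero_mul, zero_add, e, mul_assoc]
  · intro n
    have hz := pow_mem (germ_fst_mem_regular (FLT F)) (n + 1)
    obtain ⟨P, hP, e⟩ := exists_primitive_of_derivative hu ih
      ((regular (FLT F)).smul_mem hz ((n : ℂ) + 1)⁻¹)
    refine ⟨P, hP, ?_⟩
    rw [e, dz_smul (hhr hz), dz_pow_succ (hhr (germ_fst_mem_regular _)), smul_smul,
      inv_mul_cancel₀ (hcast n), one_smul, dz_germ_fst, mul_one]
  · intro β hβ n
    have hI := germ_inv_mem_regular hβ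
    cases n with
    | zero =>
      have hu' : ∀ γ ∈ β :: _, γ ∈ FLT F := List.forall_mem_cons.2 ⟨hβ, hu⟩
      refine ⟨germZ (β :: _), ?_, by rw [dz_germZ_cons hu', zero_add, pow_one]⟩
      have h2 := germBar_mul_germZ_mem_GH (v := []) (by simp) hu'
      rwa [germBar_nil, one_mul] at h2
    | succ n =>
      have hz := pow_mem hI (n + 1)
      obtain ⟨P, hP, e⟩ := exists_primitive_of_derivative hu ih
        ((regular (FLT F)).smul_mem hz (-((n : ℂ) + 1)⁻¹))
      refine ⟨P, hP, ?_⟩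
      rw [e, dz_smul (hhr hz), dz_pow_succ (hhr hI), smul_smul, neg_mul,
        inv_mul_cancel₀ (hcast n), neg_smul, one_smul, dz_germ_inv hβ]
      ring

theorem exists_primitive_mul_germZ (hconj : ∀ x ∈ F, starRingEnd ℂ x ∈ F)
    (hsqrt : ∀ x : ℂ, x ^ 2 ∈ F → x ∈ F) {u : List (ℂ → ℂ)} (hu : ∀ β ∈ u, β ∈ FLT F) {r : G}
    (hr : r ∈ regular (FLT F)) : ∃ P ∈ GH (FLT F), dz P = r * germZ u := by
  induction u generalizing r with
  | nil => exact exists_primitive_mul_germZ_step hconj hsqrt hu (fun _ _ h => by simp at h) hr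
  | cons a u ih =>
    refine exists_primitive_mul_germZ_step hconj hsqrt hu (fun b w h r hr => ?_) hr
    obtain ⟨rfl, rfl⟩ := List.cons.inj h
    exact ih (fun β hβ => hu β (List.mem_cons_of_mem _ hβ)) hr

theorem exists_primitive (hconj : ∀ x ∈ F, starRingEnd ℂ x ∈ F)
    (hsqrt : ∀ x : ℂ, x ^ 2 ∈ F → x ∈ F) {f : G} (hf : f ∈ GH (FLT F)) :
    ∃ P ∈ GH (FLT F), dz P = f := by
  have hh : ∀ {P}, P ∈ GH (FLT F) → IsHolomorphic P := isHolomorphic_of_mem_GH le_rfl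
  suffices h : ∀ r ∈ regular (FLT F), ∃ P ∈ GH (FLT F), dz P = r * f by
    simpa using h 1 (one_mem _)
  refine GH_induction (P := fun f => ∀ r ∈ regular (FLT F), ∃ P ∈ GH (FLT F), dz P = r * f) hf
    (fun r _ => ⟨0, zero_mem _, by rw [dz_zero, mul_zero]⟩) (fun x y hx hy r hr => ?_)
    (fun c hc x hx r hr => ?_) fun v u hv hu r hr => ?_
  · obtain ⟨P, hP, e⟩ := hx r hr
    obtain ⟨Q, hQ, e'⟩ := hy r hr
    exact ⟨P + Q, add_mem hP hQ, by rw [dz_add (hh hP) (hh hQ), e, e', mul_add]⟩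
  · obtain ⟨P, hP, e⟩ := hx _ (mul_mem hr hc)
    exact ⟨P, hP, by rw [e, mul_assoc]⟩
  · obtain ⟨P, hP, e⟩ := exists_primitive_mul_germZ hconj hsqrt hu hr
    have h1 := germBar_mul_germZ_mem_GH (S := FLT F) hv (u := []) (by simp)
    rw [germZ_nil, mul_one] at h1
    refine ⟨germBar v * P, GH_mul_mem le_rfl h1 hP, ?_⟩
    rw [dz_mul (hh h1) (hh hP), dz_germBar, e]
    ring

end
end GenHyperlog

namespace GenHyperlog
noncomputable section

/-! ### Bi-affine forms -/

/-- The bi-affine form `α z ζ + β z + γ ζ + δ`. -/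
@[ext] structure Form where
  (α β γ δ : ℂ)

namespace Form

/-- The value of a form. -/
def eval (Q : Form) (p : ℂ × ℂ) : ℂ := Q.α * p.1 * p.2 + Q.β * p.1 + Q.γ * p.2 + Q.δ

/-- The `z`-derivative. -/
def evalz (Q : Form) (p : ℂ × ℂ) : ℂ := Q.α * p.2 + Q.β

/-- The `ζ`-derivative. -/
def evalζ (Q : Form) (p : ℂ × ℂ) : ℂ := Q.α * p.1 + Q.γ

/-- The form is not identically zero. -/
def Nonzero (Q : Form) : Prop := Q.α ≠ 0 ∨ Q.β ≠ 0 ∨ Q.γ ≠ 0 ∨ Q.δ ≠ 0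

/-- The coefficients belong to `F`. -/
def Over (F : Subfield ℂ) (Q : Form) : Prop := Q.α ∈ F ∧ Q.β ∈ F ∧ Q.γ ∈ F ∧ Q.δ ∈ F

theorem analyticAt_eval (Q : Form) (p : ℂ × ℂ) : AnalyticAt ℂ Q.eval p := by
  exact ((((analyticAt_const.mul analyticAt_fst).mul analyticAt_snd).add
    (analyticAt_const.mul analyticAt_fst)).add (analyticAt_const.mul analyticAt_snd)).add
    analyticAt_const

theorem analyticAt_evalz (Q : Form) (p : ℂ × ℂ) : AnalyticAt ℂ Q.evalz p := by
  exact (analyticAt_const.mul analyticAt_snd).add analyticAt_const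

theorem analyticAt_evalζ (Q : Form) (p : ℂ × ℂ) : AnalyticAt ℂ Q.evalζ p := by
  exact (analyticAt_const.mul analyticAt_fst).add analyticAt_const

theorem continuous_eval (Q : Form) : Continuous Q.eval := by
  unfold eval
  fun_prop

end Form

/-- The points at which no form in `B` vanishes. -/
def Reg (B : Set Form) : Set (ℂ × ℂ) := {p | ∀ Q ∈ B, Q.eval p ≠ 0}

/-- Finite sets of nonzero forms over `F`. -/
structure Alphabet (F : Subfield ℂ) (B : Set Form) : Prop where
  finite : B.Finite
  coeff_mem : ∀ Q ∈ B, Q.Over F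
  nonzero : ∀ Q ∈ B, Q.Nonzero

variable {F : Subfield ℂ} {B : Set Form} {D U : Set (ℂ × ℂ)} {f g : ℂ × ℂ → ℂ} {p q : ℂ × ℂ}

theorem isOpen_Reg (hB : B.Finite) : IsOpen (Reg B) := by
  have e : Reg B = ⋂ Q ∈ B, {p | Q.eval p ≠ 0} := by
    ext p
    simp [Reg]
  rw [e]
  exact hB.isOpen_biInter fun Q _ => isOpen_ne_fun Q.continuous_eval continuous_const

/-- On a complex line that meets the regular set, all but finitely many points are regular. -/
theorem finite_line (hB : B.Finite) {x v : ℂ × ℂ} (hx : x ∈ Reg B) :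
    {t : ℂ | x + t • v ∉ Reg B}.Finite := by
  have e : {t : ℂ | x + t • v ∉ Reg B} = ⋃ Q ∈ B, {t : ℂ | Q.eval (x + t • v) = 0} := by
    ext t
    simp [Reg]
  rw [e]
  refine hB.biUnion fun Q hQ => ?_
  obtain ⟨k, hk, l, -, H⟩ := exists_roots (F := ⊤) (fun _ _ => trivial)
    (a := Q.α * v.1 * v.2) (b := Q.α * (x.1 * v.2 + v.1 * x.2) + Q.β * v.1 + Q.γ * v.2)
    (c := Q.eval x) trivial trivial trivial (Or.inr (Or.inr (hx Q hQ)))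
  refine (List.finite_toSet l).subset fun t ht => ?_
  have h1 : Q.eval (x + t • v) = k * (l.map fun r => t - r).prod := by
    rw [← H]
    simp only [Form.eval, Prod.fst_add, Prod.snd_add, Prod.smul_fst, Prod.smul_snd, smul_eq_mul]
    ring
  rw [Set.mem_ofPred_eq, h1, mul_eq_zero, List.prod_eq_zero_iff] at ht
  obtain ⟨r, hr, h2⟩ := List.mem_map.1 (ht.resolve_left hk)
  rw [sub_eq_zero.1 h2]
  exact hr

/-- A convex open set stays connected when the zeros of finitely many forms are removed. -/
theorem isPreconnected_inter_Reg (hB : B.Finite) (hU : IsOpen U) (hUc : Convex ℝ U) :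
    IsPreconnected (U ∩ Reg B) := by
  refine isPreconnected_of_forall_pair fun x hx y hy => ?_
  set Z := {t : ℂ | x + t • (y - x) ∉ Reg B} with hZ
  have hZf : Z.Finite := finite_line hB hx.2
  -- Parabolic arcs from `0` to `1` in the parameter plane of the complex line through `x` and `y`.
  -- A point with real part strictly between `0` and `1` lies on at most one of them, so all small
  -- `s > 0` avoid the finite set `Z`; compactness keeps the arc in `U`.
  let φ : ℝ → ℝ → ℂ := fun s t => t + Complex.I * (s * (t * (1 - t)) : ℝ)
  have h0 : ∀ᶠ s in 𝓝 (0 : ℝ), ∀ t ∈ Set.Icc (0 : ℝ) 1, x + φ s t • (y - x) ∈ U := by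
    refine isCompact_Icc.eventually_forall_of_forall_eventually fun t ht => ?_
    have h1 : Continuous fun z : ℝ × ℝ => x + φ z.1 z.2 • (y - x) := by
      simp only [φ]
      fun_prop
    refine h1.continuousAt.eventually (hU.mem_nhds ?_)
    have h2 : φ 0 t = (t : ℝ) := by simp [φ]
    have h3 := hUc.add_smul_sub_mem hx.1 hy.1 ht
    simp only [h2]
    exact h3
  have h1 : ∀ᶠ s in 𝓝[>] (0 : ℝ), ∀ w ∈ Z, s ≠ w.im / (w.re * (1 - w.re)) := by
    refine (eventually_all_finite hZf).2 fun w _ => ?_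
    by_cases hw : w.im / (w.re * (1 - w.re)) ≤ 0
    · filter_upwards [self_mem_nhdsWithin] with s hs h
      rw [← h] at hw
      exact absurd hs (not_lt.2 hw)
    · filter_upwards [Ioo_mem_nhdsGT (not_le.1 hw)] with s hs using hs.2.ne
  obtain ⟨s, hs1, hs2⟩ := ((h0.filter_mono nhdsWithin_le_nhds).and h1).exists
  have hcont : Continuous fun t : ℝ => x + φ s t • (y - x) := by
    simp only [φ]
    fun_prop
  refine ⟨(fun t : ℝ => x + φ s t • (y - x)) '' Set.Icc 0 1, ?_, ⟨0, by simp, by simp [φ]⟩,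
    ⟨1, by simp, by simp [φ]⟩, isPreconnected_Icc.image _ hcont.continuousOn⟩
  rintro _ ⟨t, ht, rfl⟩
  refine ⟨hs1 t ht, ?_⟩
  by_contra hbad
  have hre : (φ s t).re = t := by simp [φ]
  have him : (φ s t).im = s * (t * (1 - t)) := by simp [φ]
  by_cases ht0 : t * (1 - t) = 0
  · rcases mul_eq_zero.1 ht0 with h | h
    · subst h
      apply hbad
      simpa [φ] using hx.2
    · have h' : t = 1 := by linarith
      subst h'
      apply hbad
      simpa [φ] using hy.2
  · refine hs2 (φ s t) hbad ?_
    rw [hre, him, mul_div_cancel_right₀ _ ht0]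

/-! ### Iterated integrals of logarithmic forms -/

/-- The class of functions that is generated by integrating `∑ h dQ / Q` with forms `Q ∈ B`. -/
inductive Uni (B : Set Form) (D : Set (ℂ × ℂ)) : (ℂ × ℂ → ℂ) → Prop
  | mk (g : ℂ × ℂ → ℂ) (l : List (Form × (ℂ × ℂ → ℂ))) (hg : ∀ p ∈ D, AnalyticAt ℂ g p)
    (hB : ∀ x ∈ l, x.1 ∈ B) (hU : ∀ x ∈ l, Uni B D x.2)
    (hz : ∀ p ∈ D, pdz g p = (l.map fun x => x.1.evalz p / x.1.eval p * x.2 p).sum)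
    (hζ : ∀ p ∈ D, pdζ g p = (l.map fun x => x.1.evalζ p / x.1.eval p * x.2 p).sum) : Uni B D g

theorem Uni.analyticAt (h : Uni B D g) (hp : p ∈ D) : AnalyticAt ℂ g p := by
  cases h with
  | mk _ l hg => exact hg p hp

theorem Uni.mono {B' : Set Form} {D' : Set (ℂ × ℂ)} (h : Uni B D g) (hB : B ⊆ B') (hD : D' ⊆ D) :
    Uni B' D' g := by
  induction h with
  | mk g l hg hB' _ hz hζ ih =>
    exact .mk g l (fun p hp => hg p (hD hp)) (fun x hx => hB (hB' x hx)) ih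
      (fun p hp => hz p (hD hp)) fun p hp => hζ p (hD hp)

theorem Uni.const (B : Set Form) (D : Set (ℂ × ℂ)) (c : ℂ) : Uni B D fun _ => c :=
  .mk _ [] (fun _ _ => analyticAt_const) (by simp) (by simp) (by simp [pdz]) (by simp [pdζ])

theorem Uni.sub_const (h : Uni B D g) (c : ℂ) : Uni B D fun p => g p - c := by
  cases h with
  | mk _ l hg hB hU hz hζ =>
    refine .mk _ l (fun p hp => (hg p hp).sub analyticAt_const) hB hU (fun p hp => ?_) fun p hp => ?_
    · rw [← hz p hp]
      exact deriv_sub_const ..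
    · rw [← hζ p hp]
      exact deriv_sub_const ..

theorem analyticAt_list_sum {α : Type*} (l : List α) {φ : α → ℂ × ℂ → ℂ}
    (h : ∀ x ∈ l, AnalyticAt ℂ (φ x) p) : AnalyticAt ℂ (fun p => (l.map fun x => φ x p).sum) p := by
  induction l with
  | nil => exact analyticAt_const
  | cons x l ih =>
    simp only [List.map_cons, List.sum_cons]
    exact (h x (by simp)).add (ih fun y hy => h y (by simp [hy]))

theorem convex_eq_of_pd_eq_zero (hD : IsOpen D) (hDc : IsPreconnected D)
    (hf : ∀ p ∈ D, AnalyticAt ℂ f p) (hz : ∀ p ∈ D, pdz f p = 0) (hζ : ∀ p ∈ D, pdζ f p = 0)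
    (hp : p ∈ D) (hq : q ∈ D) : f p = f q := by
  refine hD.is_const_of_fderiv_eq_zero (𝕜 := ℂ) hDc
    (fun q hq => (hf q hq).differentiableAt.differentiableWithinAt) (fun q hq => ?_) hp hq
  have h4 := hz q hq
  have h5 := hζ q hq
  rw [pdz_eq_fderiv (hf q hq).differentiableAt] at h4
  rw [pdζ_eq_fderiv (hf q hq).differentiableAt] at h5
  ext
  · simpa using h4
  · simpa using h5

/-- A closed holomorphic form on a convex open set is exact. -/
theorem exists_primitive_of_closed (hD : IsOpen D) (hDc : Convex ℝ D) {a b : ℂ × ℂ → ℂ}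
    (ha : ∀ p ∈ D, AnalyticAt ℂ a p) (hb : ∀ p ∈ D, AnalyticAt ℂ b p)
    (hab : ∀ p ∈ D, pdζ a p = pdz b p) :
    ∃ f : ℂ × ℂ → ℂ, ∀ p ∈ D, AnalyticAt ℂ f p ∧ pdz f p = a p ∧ pdζ f p = b p := by
  set ω : ℂ × ℂ → ℂ × ℂ →L[ℂ] ℂ := fun p =>
    a p • ContinuousLinearMap.fst ℂ ℂ ℂ + b p • ContinuousLinearMap.snd ℂ ℂ ℂ with hω
  have hd : ∀ p ∈ D, HasFDerivAt ω ((fderiv ℂ a p).smulRight (ContinuousLinearMap.fst ℂ ℂ ℂ) +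
      (fderiv ℂ b p).smulRight (ContinuousLinearMap.snd ℂ ℂ ℂ)) p := by
    intro p hp
    have h1 := (ha p hp).differentiableAt.hasFDerivAt.smul_const (ContinuousLinearMap.fst ℂ ℂ ℂ)
    have h2 := (hb p hp).differentiableAt.hasFDerivAt.smul_const (ContinuousLinearMap.snd ℂ ℂ ℂ)
    exact h1.add h2
  have hlin : ∀ {f : ℂ × ℂ → ℂ} {p : ℂ × ℂ}, AnalyticAt ℂ f p → ∀ x : ℂ × ℂ,
      fderiv ℂ f p x = x.1 * pdz f p + x.2 * pdζ f p := by
    intro f p hf x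
    rw [pdz_eq_fderiv hf.differentiableAt, pdζ_eq_fderiv hf.differentiableAt, ← smul_eq_mul,
      ← smul_eq_mul, ← map_smul, ← map_smul, ← map_add]
    simp
  obtain ⟨f, hf⟩ := hDc.exists_forall_hasFDerivAt_of_fderiv_symmetric (ω := ω) hD
    (fun p hp => ((hd p hp).restrictScalars ℝ).differentiableAt.differentiableWithinAt)
    fun p hp x y => by
      rw [((hd p hp).restrictScalars ℝ).fderiv]
      simp [hlin (ha p hp), hlin (hb p hp), hab p hp]
      ring
  refine ⟨f, fun p hp => ⟨?_, ?_, ?_⟩⟩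
  · refine analyticAt_of_separately hD (fun q hq => (hf q hq).continuousAt.continuousWithinAt)
      (fun q hq => ?_) (fun q hq => ?_) hp
    · exact (hf q hq).differentiableAt.comp q.1 (hasDerivAt_prodMk_left q).differentiableAt
    · exact (hf q hq).differentiableAt.comp q.2 (hasDerivAt_prodMk_right q).differentiableAt
  · rw [pdz_eq_fderiv (hf p hp).differentiableAt, (hf p hp).fderiv]
    simp [hω]
  · rw [pdζ_eq_fderiv (hf p hp).differentiableAt, (hf p hp).fderiv]
    simp [hω]

theorem analyticAt_logForm (hQ : ∀ p ∈ D, p ∈ Reg B) {Q : Form} (hQB : Q ∈ B) {h : ℂ × ℂ → ℂ}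
    (hh : ∀ p ∈ D, AnalyticAt ℂ h p) (hp : p ∈ D) :
    AnalyticAt ℂ (fun p => Q.evalz p / Q.eval p * h p) p ∧
      AnalyticAt ℂ (fun p => Q.evalζ p / Q.eval p * h p) p :=
  ⟨((Q.analyticAt_evalz p).div (Q.analyticAt_eval p) (hQ p hp Q hQB)).mul (hh p hp),
    ((Q.analyticAt_evalζ p).div (Q.analyticAt_eval p) (hQ p hp Q hQB)).mul (hh p hp)⟩

/-- Functions of the class extend to larger convex domains. -/
theorem Uni.exists_extension {D' : Set (ℂ × ℂ)} (h : Uni B D g) (hD : IsOpen D)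
    (hDc : IsPreconnected D) (hne : D.Nonempty) (hD' : IsOpen D') (hD'c : Convex ℝ D') (hDD' : D ⊆ D')
    (hreg : D' ⊆ Reg B) : ∃ g', Uni B D' g' ∧ Set.EqOn g' g D := by
  induction h with
  | mk g l hg hB hU hz hζ ih =>
    have hx : ∀ x : Form × (ℂ × ℂ → ℂ), ∃ h', x ∈ l → Uni B D' h' ∧ Set.EqOn h' x.2 D := by
      intro x
      by_cases hx : x ∈ l
      · obtain ⟨h', H⟩ := ih x hx
        exact ⟨h', fun _ => H⟩
      · exact ⟨0, fun h => absurd h hx⟩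
    choose ext hext using hx
    set l' := l.map fun x => (x.1, ext x) with hl'
    set a : ℂ × ℂ → ℂ := fun p => (l'.map fun x => x.1.evalz p / x.1.eval p * x.2 p).sum with ha
    set b : ℂ × ℂ → ℂ := fun p => (l'.map fun x => x.1.evalζ p / x.1.eval p * x.2 p).sum with hb
    have hB' : ∀ x ∈ l', x.1 ∈ B := by
      intro x hx
      obtain ⟨y, hy, rfl⟩ := List.mem_map.1 hx
      exact hB y hy
    have hU' : ∀ x ∈ l', Uni B D' x.2 := by
      intro x hx
      obtain ⟨y, hy, rfl⟩ := List.mem_map.1 hx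
      exact (hext y hy).1
    have haD : ∀ p ∈ D, a p = pdz g p := by
      intro p hp
      simp only [hz p hp, ha, hl', List.map_map]
      refine congrArg List.sum (List.map_congr_left fun x hx => ?_)
      simp only [Function.comp_apply, (hext x hx).2 hp]
    have hbD : ∀ p ∈ D, b p = pdζ g p := by
      intro p hp
      simp only [hζ p hp, hb, hl', List.map_map]
      refine congrArg List.sum (List.map_congr_left fun x hx => ?_)
      simp only [Function.comp_apply, (hext x hx).2 hp]
    have haA : ∀ p ∈ D', AnalyticAt ℂ a p := fun p hp => analyticAt_list_sum l' fun x hx =>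
      (analyticAt_logForm hreg (hB' x hx) (fun q hq => (hU' x hx).analyticAt hq) hp).1
    have hbA : ∀ p ∈ D', AnalyticAt ℂ b p := fun p hp => analyticAt_list_sum l' fun x hx =>
      (analyticAt_logForm hreg (hB' x hx) (fun q hq => (hU' x hx).analyticAt hq) hp).2
    obtain ⟨p₀, hp₀⟩ := hne
    -- On `D` the form is `dg`, hence closed; the identity theorem extends closedness to `D'`.
    have hclosed : Set.EqOn (pdζ a) (pdz b) D' := by
      refine AnalyticOnNhd.eqOn_of_preconnected_of_eventuallyEq (𝕜 := ℂ)
        (fun p hp => (haA p hp).pdζ) (fun p hp => (hbA p hp).pdz) hD'c.isPreconnected (hDD' hp₀) ?_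
      filter_upwards [hD.mem_nhds hp₀] with p hp
      rw [pdζ_congr (g := pdz g) (eventually_of_mem (hD.mem_nhds hp) haD),
        pdz_congr (g := pdζ g) (eventually_of_mem (hD.mem_nhds hp) hbD), pdz_pdζ_comm (hg p hp)]
    obtain ⟨f, hf⟩ := exists_primitive_of_closed hD' hD'c haA hbA hclosed
    refine ⟨fun p => f p - (f p₀ - g p₀), Uni.sub_const (.mk f l' (fun p hp => (hf p hp).1) hB' hU'
      (fun p hp => (hf p hp).2.1) fun p hp => (hf p hp).2.2) _, fun p hp => ?_⟩
    have h1 : f p - g p = f p₀ - g p₀ := by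
      refine convex_eq_of_pd_eq_zero (f := fun p => f p - g p) hD hDc
        (fun q hq => (hf q (hDD' hq)).1.sub (hg q hq)) (fun q hq => ?_) (fun q hq => ?_) hp hp₀
      · rw [pdz_sub (hf q (hDD' hq)).1 (hg q hq), (hf q (hDD' hq)).2.1, haD q hq, sub_self]
      · rw [pdζ_sub (hf q (hDD' hq)).1 (hg q hq), (hf q (hDD' hq)).2.2, hbD q hq, sub_self]
    simp only
    rw [← h1]
    ring

/-! ### Combinations with regular coefficients -/

/-- The ring of coefficients: constants, or rational functions with denominators in `B`. -/
def coeffRing (rat : Prop) (B : Set Form) : Subalgebra ℂ (ℂ × ℂ → ℂ) :=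
  Algebra.adjoin ℂ {r | rat ∧ (r = Prod.fst ∨ r = Prod.snd ∨ ∃ Q ∈ B, r = fun p => (Q.eval p)⁻¹)}

/-- Linear combinations of functions of the class `Uni`. -/
def Comb (rat : Prop) (B : Set Form) (D : Set (ℂ × ℂ)) (g : ℂ × ℂ → ℂ) : Prop :=
  ∃ l : List ((ℂ × ℂ → ℂ) × (ℂ × ℂ → ℂ)), (∀ x ∈ l, x.1 ∈ coeffRing rat B ∧ Uni B D x.2) ∧
    ∀ p ∈ D, g p = (l.map fun x => x.1 p * x.2 p).sum

variable {rat : Prop}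

theorem analyticAt_coeffRing {r : ℂ × ℂ → ℂ} (hr : r ∈ coeffRing rat B) (hp : p ∈ Reg B) :
    AnalyticAt ℂ r p := by
  induction hr using Algebra.adjoin_induction with
  | mem x hx =>
    obtain ⟨-, rfl | rfl | ⟨Q, hQ, rfl⟩⟩ := hx
    · exact analyticAt_fst
    · exact analyticAt_snd
    · exact (Q.analyticAt_eval p).inv (hp Q hQ)
  | algebraMap c => exact analyticAt_const
  | add x y _ _ hx hy => exact hx.add hy
  | mul x y _ _ hx hy => exact hx.mul hy

theorem coeffRing_mono {B' : Set Form} (h : B ⊆ B') : coeffRing rat B ≤ coeffRing rat B' := by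
  refine Algebra.adjoin_mono ?_
  rintro r ⟨h1, h2 | h2 | ⟨Q, hQ, h2⟩⟩
  · exact ⟨h1, Or.inl h2⟩
  · exact ⟨h1, Or.inr (Or.inl h2)⟩
  · exact ⟨h1, Or.inr (Or.inr ⟨Q, h hQ, h2⟩)⟩

theorem Comb.mono {B' : Set Form} {D' : Set (ℂ × ℂ)} (h : Comb rat B D g) (hB : B ⊆ B')
    (hD : D' ⊆ D) : Comb rat B' D' g := by
  obtain ⟨l, hl, H⟩ := h
  exact ⟨l, fun x hx => ⟨coeffRing_mono hB (hl x hx).1, (hl x hx).2.mono hB hD⟩,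
    fun p hp => H p (hD hp)⟩

theorem Comb.congr (h : Comb rat B D f) (hfg : Set.EqOn f g D) : Comb rat B D g := by
  obtain ⟨l, hl, H⟩ := h
  exact ⟨l, hl, fun p hp => (hfg hp).symm.trans (H p hp)⟩

theorem Comb.const (c : ℂ) : Comb rat B D fun _ => c :=
  ⟨[(1, fun _ => c)], by
    simp only [List.mem_singleton, forall_eq]
    exact ⟨one_mem _, .const B D c⟩, fun p _ => by simp⟩

theorem Comb.exists_extension {D' : Set (ℂ × ℂ)} (h : Comb rat B D g) (hD : IsOpen D)
    (hDc : IsPreconnected D) (hne : D.Nonempty) (hD' : IsOpen D') (hD'c : Convex ℝ D') (hDD' : D ⊆ D')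
    (hreg : D' ⊆ Reg B) :
    ∃ g', Comb rat B D' g' ∧ (∀ p ∈ D', AnalyticAt ℂ g' p) ∧ Set.EqOn g' g D := by
  obtain ⟨l, hl, H⟩ := h
  have hx : ∀ x : (ℂ × ℂ → ℂ) × (ℂ × ℂ → ℂ), ∃ h', x ∈ l → Uni B D' h' ∧ Set.EqOn h' x.2 D := by
    intro x
    by_cases hx : x ∈ l
    · obtain ⟨h', H⟩ := (hl x hx).2.exists_extension hD hDc hne hD' hD'c hDD' hreg
      exact ⟨h', fun _ => H⟩
    · exact ⟨0, fun h => absurd h hx⟩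
  choose ext hext using hx
  refine ⟨fun p => (l.map fun x => x.1 p * ext x p).sum, ⟨l.map fun x => (x.1, ext x), ?_, ?_⟩,
    fun p hp => ?_, fun p hp => ?_⟩
  · intro x hx
    obtain ⟨y, hy, rfl⟩ := List.mem_map.1 hx
    exact ⟨(hl y hy).1, (hext y hy).1⟩
  · intro p _
    rw [List.map_map]
    rfl
  · exact analyticAt_list_sum l fun x hx =>
      (analyticAt_coeffRing (hl x hx).1 (hreg hp)).mul ((hext x hx).1.analyticAt hp)
  · rw [H p hp]
    refine congrArg List.sum (List.map_congr_left fun x hx => ?_)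
    rw [(hext x hx).2 hp]

end
end GenHyperlog

namespace GenHyperlog
noncomputable section

variable {F : Subfield ℂ} {B : Set Form} {D U : Set (ℂ × ℂ)} {f g : ℂ × ℂ → ℂ} {p q x y : ℂ × ℂ}
  {rat : Prop}

/-! ### Regular points -/

/-- A form that depends on `z` vanishes on the graph of a letter. -/
theorem Form.exists_letter {Q : Form} (hQ : Q.Over F) (h : Q.α ≠ 0 ∨ Q.β ≠ 0) :
    ∃ b ∈ FLT F, ∀ p, Q.evalz p ≠ 0 → Q.eval p = Q.evalz p * (p.1 - b p.2) := by
  obtain ⟨h1, h2, h3, h4⟩ := hQ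
  by_cases hdet : -Q.γ * Q.β - -Q.δ * Q.α = 0
  · by_cases hα : Q.α = 0
    · have hβ : Q.β ≠ 0 := h.resolve_left (fun h => h hα)
      have hγ : Q.γ = 0 := by
        rw [hα] at hdet
        simpa [hβ] using hdet
      refine ⟨_, const_mem_FLT (div_mem (neg_mem h4) h2), fun p _ => ?_⟩
      simp only [eval, evalz, hα, hγ]
      field_simp
      ring
    · refine ⟨_, const_mem_FLT (div_mem (neg_mem h3) h1), fun p _ => ?_⟩
      simp only [eval, evalz]
      field_simp
      linear_combination hdet
  · refine ⟨_, Or.inr ⟨-Q.γ, neg_mem h3, -Q.δ, neg_mem h4, Q.α, h1, Q.β, h2, hdet, rfl⟩,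
      fun p hp => ?_⟩
    simp only [evalz] at hp
    simp only [eval, evalz]
    field_simp
    ring

theorem Form.eventually_base_eval_ne_zero {Q : Form} (hQ : Q.Over F) (h : Q.Nonzero) :
    ∀ᶠ p in base, Q.eval p ≠ 0 := by
  by_cases hz : Q.α ≠ 0 ∨ Q.β ≠ 0
  · obtain ⟨b, hb, H⟩ := Q.exists_letter hQ hz
    filter_upwards [eventually_base_linear_ne_zero hz, eventually_base_sub_ne_zero hb] with p h1 h2
    rw [H p h1]
    exact mul_ne_zero h1 h2
  · push Not at hz
    filter_upwards [eventually_base_linear_ne_zero (c := Q.γ) (d := Q.δ)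
      (by simpa [Nonzero, hz.1, hz.2] using h)] with p h1
    simpa [eval, hz.1, hz.2] using h1

theorem Alphabet.eventually_base (hB : Alphabet F B) : ∀ᶠ p in base, p ∈ Reg B :=
  (eventually_all_finite hB.finite).2 fun Q hQ =>
    Q.eventually_base_eval_ne_zero (hB.coeff_mem Q hQ) (hB.nonzero Q hQ)

/-- On the complex line from a regular point to `q` all but finitely many points are regular, so
regular points accumulate at `q` even if `q` is singular. -/
theorem Alphabet.frequently_mem_Reg (hB : Alphabet F B) (q : ℂ × ℂ) : ∃ᶠ x in 𝓝 q, x ∈ Reg B := by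
  obtain ⟨x, hx⟩ := hB.eventually_base.exists
  have h1 : ∀ᶠ t in 𝓝[≠] (1 : ℂ), x + t • (q - x) ∈ Reg B := by
    have h2 := (finite_line (v := q - x) hB.finite hx).isClosed.isOpen_compl
    by_cases h3 : (1 : ℂ) ∈ {t : ℂ | x + t • (q - x) ∉ Reg B}
    · have h4 : ∀ᶠ t in 𝓝[≠] (1 : ℂ), t ∉ {t : ℂ | x + t • (q - x) ∉ Reg B} \ {1} :=
        eventually_nhdsWithin_of_eventually_nhds
          (((finite_line hB.finite hx).subset Set.sdiff_subset).isClosed.isOpen_compl.mem_nhds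
            (by simp))
      filter_upwards [h4, self_mem_nhdsWithin] with t h5 h6
      by_contra h7
      exact h5 ⟨h7, h6⟩
    · filter_upwards [nhdsWithin_le_nhds (h2.mem_nhds h3)] with t ht
      simpa using ht
  have h2 : Tendsto (fun t : ℂ => x + t • (q - x)) (𝓝[≠] 1) (𝓝 q) := by
    have h3 : Continuous fun t : ℂ => x + t • (q - x) := by fun_prop
    have h4 := h3.tendsto 1
    rw [one_smul, add_sub_cancel] at h4
    exact h4.mono_left nhdsWithin_le_nhds
  exact h2.frequently h1.frequently

/-! ### Local membership -/

/-- `g` is a combination of functions of the class on some ball at `x`. -/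
def LocV (rat : Prop) (B : Set Form) (x : ℂ × ℂ) (g : ℂ × ℂ → ℂ) : Prop :=
  ∃ r > 0, Metric.ball x r ⊆ Reg B ∧ Comb rat B (Metric.ball x r) g

theorem Comb.analyticAt (hD : IsOpen D) (h : Comb rat B D g) (hp : p ∈ D) (hreg : D ⊆ Reg B) :
    AnalyticAt ℂ g p := by
  obtain ⟨l, hl, H⟩ := h
  have h1 := analyticAt_list_sum (p := p) (φ := fun x p => x.1 p * x.2 p) l fun x hx =>
    (analyticAt_coeffRing (hl x hx).1 (hreg hp)).mul ((hl x hx).2.analyticAt hp)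
  exact h1.congr (eventually_of_mem (hD.mem_nhds hp) fun q hq => (H q hq).symm)

theorem LocV.mem_Reg (h : LocV rat B x g) : x ∈ Reg B := by
  obtain ⟨r, hr, h1, -⟩ := h
  exact h1 (Metric.mem_ball_self hr)

theorem LocV.analyticAt (h : LocV rat B x g) : AnalyticAt ℂ g x := by
  obtain ⟨r, hr, h1, h2⟩ := h
  exact h2.analyticAt Metric.isOpen_ball (Metric.mem_ball_self hr) h1

theorem LocV.of_comb (hD : IsOpen D) (h : Comb rat B D g) (hreg : D ⊆ Reg B) (hx : x ∈ D) :
    LocV rat B x g := by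
  obtain ⟨r, hr, h1⟩ := Metric.isOpen_iff.1 hD x hx
  exact ⟨r, hr, h1.trans hreg, h.mono le_rfl h1⟩

theorem LocV.eventually (h : LocV rat B x g) : ∀ᶠ y in 𝓝 x, LocV rat B y g := by
  obtain ⟨r, hr, h1, h2⟩ := h
  filter_upwards [Metric.ball_mem_nhds x hr] with y hy using
    .of_comb Metric.isOpen_ball h2 h1 hy

theorem LocV.congr (h : LocV rat B x f) (hfg : f =ᶠ[𝓝 x] g) : LocV rat B x g := by
  obtain ⟨r, hr, h1, h2⟩ := h
  obtain ⟨s, hs, h3⟩ := Metric.eventually_nhds_iff_ball.1 hfg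
  refine .of_comb Metric.isOpen_ball ((h2.mono (D' := Metric.ball x (min r s)) le_rfl
    (Metric.ball_subset_ball (min_le_left _ _))).congr fun y hy => h3 y ?_)
    ((Metric.ball_subset_ball (min_le_left _ _)).trans h1) (Metric.mem_ball_self (lt_min hr hs))
  exact Metric.ball_subset_ball (min_le_right _ _) hy

/-- Local membership near a point extends to a ball of regular points. -/
theorem LocV.exists_extension {r : ℝ} (h : LocV rat B y g) (hy : y ∈ Metric.ball x r)
    (hreg : Metric.ball x r ⊆ Reg B) :
    ∃ g', Comb rat B (Metric.ball x r) g' ∧ (∀ p ∈ Metric.ball x r, AnalyticAt ℂ g' p) ∧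
      g' =ᶠ[𝓝 y] g := by
  obtain ⟨s, hs, h1, h2⟩ := h
  have hyD : y ∈ Metric.ball y s ∩ Metric.ball x r := ⟨Metric.mem_ball_self hs, hy⟩
  have hD : IsOpen (Metric.ball y s ∩ Metric.ball x r) := Metric.isOpen_ball.inter Metric.isOpen_ball
  obtain ⟨g', h3, h4, h5⟩ := (h2.mono (D' := Metric.ball y s ∩ Metric.ball x r) le_rfl
    Set.inter_subset_left).exists_extension hD
    ((convex_ball y s).inter (convex_ball x r)).isPreconnected ⟨y, hyD⟩
    (Metric.isOpen_ball (x := x) (ε := r)) (convex_ball x r) Set.inter_subset_right hreg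
  exact ⟨g', h3, h4, eventually_of_mem (hD.mem_nhds hyD) h5⟩

/-- The points with local membership form an open set that is closed relative to the connected set
of regular points of `U`: near a limit point the combination extends to a whole ball and coincides
with `g` there by the identity theorem. -/
theorem LocV.propagate (hB : B.Finite) (hU : IsOpen U) (hUc : Convex ℝ U)
    (hg : ∀ p ∈ U, AnalyticAt ℂ g p) (hx : x ∈ U) (h : LocV rat B x g) (hy : y ∈ U)
    (hyB : y ∈ Reg B) : LocV rat B y g := by
  have hW : IsOpen (U ∩ Reg B) := hU.inter (isOpen_Reg hB)
  have key := (isPreconnected_inter_Reg hB hU hUc).subset_of_closure_inter_subset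
    (u := {y | LocV rat B y g}) (isOpen_iff_mem_nhds.2 fun y hy => LocV.eventually hy)
    ⟨x, ⟨hx, h.mem_Reg⟩, h⟩ ?_
  · exact key ⟨hy, hyB⟩
  · rintro y ⟨hyc, hyW⟩
    obtain ⟨r, hr, h1⟩ := Metric.isOpen_iff.1 hW y hyW
    obtain ⟨y', h2, h3⟩ := Metric.mem_closure_iff.1 hyc r hr
    rw [dist_comm] at h3
    obtain ⟨g', h4, h5, h6⟩ := LocV.exists_extension h2 (Metric.mem_ball.2 h3)
      (h1.trans Set.inter_subset_right)
    have h7 : Set.EqOn g' g (Metric.ball y r) :=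
      AnalyticOnNhd.eqOn_of_preconnected_of_eventuallyEq (𝕜 := ℂ) h5
        (fun p hp => hg p (h1 hp).1) (convex_ball y r).isPreconnected (Metric.mem_ball.2 h3) h6
    exact .of_comb Metric.isOpen_ball (h4.congr h7) (h1.trans Set.inter_subset_right)
      (Metric.mem_ball_self hr)

/-- `g` is holomorphic at `q` and a combination of functions of the class at the regular points near
`q`. -/
def GoodAt (rat : Prop) (B : Set Form) (q : ℂ × ℂ) (g : ℂ × ℂ → ℂ) : Prop :=
  AnalyticAt ℂ g q ∧ ∀ᶠ x in 𝓝 q, x ∈ Reg B → LocV rat B x g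

theorem GoodAt.congr (h : GoodAt rat B q f) (hfg : f =ᶠ[𝓝 q] g) : GoodAt rat B q g := by
  refine ⟨h.1.congr hfg, ?_⟩
  filter_upwards [h.2, hfg.eventuallyEq_nhds] with x h1 h2 h3 using (h1 h3).congr h2

theorem LocV.goodAt (h : LocV rat B x g) : GoodAt rat B x g :=
  ⟨h.analyticAt, h.eventually.mono fun _ h _ => h⟩

theorem GoodAt.frequently (h : GoodAt rat B q g) (hB : Alphabet F B) : ∃ᶠ x in 𝓝 q, LocV rat B x g :=
  ((hB.frequently_mem_Reg q).and_eventually h.2).mono fun _ h => h.2 h.1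

/-- A regular point close to `p` carries local membership, which spreads to all regular points of
`U`. Singular points in between do not matter, since `g` is holomorphic there. -/
theorem GoodAt.propagate (hB : Alphabet F B) (hU : IsOpen U) (hUc : Convex ℝ U)
    (hg : ∀ p ∈ U, AnalyticAt ℂ g p) (hp : p ∈ U) (h : GoodAt rat B p g) (hq : q ∈ U) :
    GoodAt rat B q g := by
  obtain ⟨x, h1, h2⟩ := ((h.frequently hB).and_eventually (hU.mem_nhds hp)).exists
  refine ⟨hg q hq, ?_⟩
  filter_upwards [hU.mem_nhds hq] with y hy hyB using
    h1.propagate hB.finite hU hUc hg h2 hy hyB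

/-! ### Analytic continuation -/

theorem ContinuesTo.symm {γ : Path p q} (h : ContinuesTo γ f g) : ContinuesTo γ.symm g f := by
  obtain ⟨E, h1, h2, h3, h4⟩ := h
  refine ⟨fun t => E (unitInterval.symm t), fun t => h1 _, fun t => ?_, ?_, ?_⟩
  · exact (unitInterval.continuous_symm.tendsto t).eventually (h2 (unitInterval.symm t))
  · simpa using h4
  · simpa using h3

theorem ContinuesTo.refl_of_analyticAt {γ : Path p q} (h : ∀ t, AnalyticAt ℂ f (γ t)) :
    ContinuesTo γ f f :=
  ⟨fun _ => f, h, fun _ => Eventually.of_forall fun _ => .rfl, .rfl, .rfl⟩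

theorem ContinuesTo.congr {γ : Path p q} {f' g' : ℂ × ℂ → ℂ} (h : ContinuesTo γ f g)
    (hf : f =ᶠ[𝓝 p] f') (hg : g =ᶠ[𝓝 q] g') : ContinuesTo γ f' g' := by
  obtain ⟨E, h1, h2, h3, h4⟩ := h
  exact ⟨E, h1, h2, h3.trans hf, h4.trans hg⟩

theorem ContinuesTo.trans {r : ℂ × ℂ} {γ : Path p q} {γ' : Path q r} {h : ℂ × ℂ → ℂ}
    (h₁ : ContinuesTo γ f g) (h₂ : ContinuesTo γ' g h) : ContinuesTo (γ.trans γ') f h := by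
  obtain ⟨E, a1, a2, a3, a4⟩ := h₁
  obtain ⟨E', b1, b2, b3, b4⟩ := h₂
  let c : unitInterval → unitInterval := fun t => Set.projIcc 0 1 zero_le_one (2 * (t : ℝ))
  let c' : unitInterval → unitInterval := fun t => Set.projIcc 0 1 zero_le_one (2 * (t : ℝ) - 1)
  have hc : Continuous c := by fun_prop
  have hc' : Continuous c' := by fun_prop
  have hγ : ∀ t : unitInterval, (γ.trans γ') t = if (t : ℝ) ≤ 1 / 2 then γ (c t) else γ' (c' t) := by
    intro t
    rw [Path.trans_apply]
    split_ifs with ht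
    · congr 1
      exact (Set.projIcc_of_mem zero_le_one _).symm
    · congr 1
      exact (Set.projIcc_of_mem zero_le_one _).symm
  have hle : ∀ t : unitInterval, (t : ℝ) ≤ 1 / 2 → c' t = 0 := fun t ht =>
    Set.projIcc_of_le_left _ (by linarith)
  have hge : ∀ t : unitInterval, 1 / 2 ≤ (t : ℝ) → c t = 1 := fun t ht =>
    Set.projIcc_of_right_le _ (by linarith)
  have hmid : E' 0 =ᶠ[𝓝 q] E 1 := b3.trans a4.symm
  refine ⟨fun t => if (t : ℝ) ≤ 1 / 2 then E (c t) else E' (c' t), fun t => ?_, fun t => ?_, ?_, ?_⟩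
  · beta_reduce
    rw [hγ]
    split_ifs
    · exact a1 _
    · exact b1 _
  · have e1 := (hc.tendsto t).eventually (a2 (c t))
    have e2 := (hc'.tendsto t).eventually (b2 (c' t))
    rcases lt_trichotomy (t : ℝ) (1 / 2) with ht | ht | ht
    · filter_upwards [e1, continuous_subtype_val.continuousAt.eventually (gt_mem_nhds ht)]
        with s h1 (h2 : (s : ℝ) < 1 / 2)
      rw [hγ, if_pos h2.le, if_pos h2.le, if_pos ht.le]
      exact h1
    -- At the junction `s` may lie on either side, so the start of the second family has to be
    -- compared with the end of the first near all points of the path close to `q`.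
    · have e3 : ∀ᶠ s in 𝓝 t, E' 0 =ᶠ[𝓝 (γ' (c' s))] E 1 := by
        have h1 : Tendsto (fun s => γ' (c' s)) (𝓝 t) (𝓝 q) := by
          have h2 := (γ'.continuous.comp hc').tendsto t
          simpa [Function.comp_def, hle t ht.le] using h2
        exact h1.eventually hmid.eventuallyEq_nhds
      filter_upwards [e1, e2, e3] with s h1 h2 h3
      rw [hγ, if_pos ht.le]
      split_ifs
      · exact h1
      · rw [hle t ht.le] at h2
        rw [hge t ht.ge]
        exact h2.trans h3
    · filter_upwards [e2, continuous_subtype_val.continuousAt.eventually (lt_mem_nhds ht)]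
        with s h1 (h2 : 1 / 2 < (s : ℝ))
      rw [hγ, if_neg h2.not_ge, if_neg h2.not_ge, if_neg ht.not_ge]
      exact h1
  · have h0 : c 0 = 0 := by simp [c]
    simpa [h0] using a3
  · have h0 : c' 1 = 1 := Set.projIcc_of_right_le _ (by norm_num)
    have h1 : ¬ (((1 : unitInterval) : ℝ) ≤ 1 / 2) := by norm_num
    simp only [h1, if_false, h0]
    exact b4

/-- Goodness is locally constant along the path: on a small ball a single holomorphic function
represents the continuation, and `GoodAt.propagate` moves the property between its points. -/
theorem GoodAt.of_continuesTo (hB : Alphabet F B) {γ : Path p q} (h : ContinuesTo γ f g)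
    (hf : GoodAt rat B p f) : GoodAt rat B q g := by
  obtain ⟨E, h1, h2, h3, h4⟩ := h
  have hloc : IsLocallyConstant fun t => GoodAt rat B (γ t) (E t) := by
    refine (IsLocallyConstant.iff_eventually_eq _).2 fun t => ?_
    obtain ⟨r, hr, h5⟩ := Metric.eventually_nhds_iff_ball.1 (h1 t).eventually_analyticAt
    filter_upwards [h2 t, γ.continuous.continuousAt.eventually (Metric.ball_mem_nhds (γ t) hr)]
      with s h6 h7
    refine propext ⟨fun h => ?_, fun h => ?_⟩
    · exact (h.congr h6).propagate hB Metric.isOpen_ball (convex_ball (γ t) r) h5 h7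
        (Metric.mem_ball_self hr)
    · exact (h.propagate hB Metric.isOpen_ball (convex_ball (γ t) r) h5 (Metric.mem_ball_self hr)
        h7).congr h6.symm
  have h5 := hloc.apply_eq_of_preconnectedSpace 0 1
  simp only [γ.source, γ.target] at h5
  exact (h5.mp (hf.congr h3.symm)).congr h4

/-- Straight paths in convex sets. -/
theorem exists_path_of_convex (hU : Convex ℝ U) (hp : p ∈ U) (hq : q ∈ U) :
    ∃ γ : Path p q, ∀ t, γ t ∈ U := by
  have h1 : JoinedIn U p q := (hU.isPathConnected ⟨p, hp⟩).joinedIn p hp q hq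
  exact ⟨h1.somePath, h1.somePath_mem⟩

/-- Combinations of the class continue to all regular points. -/
theorem LocV.exists_continuesTo (hB : B.Finite) (h : LocV rat B x g) (hy : y ∈ Reg B) :
    ∃ g', LocV rat B y g' ∧ ∃ γ : Path x y, ContinuesTo γ g g' := by
  have hW := isOpen_Reg hB
  have hWc := isPreconnected_inter_Reg hB isOpen_univ convex_univ
  rw [Set.univ_inter] at hWc
  refine hWc.subset_of_closure_inter_subset
    (u := {y | ∃ g', LocV rat B y g' ∧ ∃ γ : Path x y, ContinuesTo γ g g'})
    (isOpen_iff_mem_nhds.2 ?_) ⟨x, h.mem_Reg, g, h, Path.refl x, ?_⟩ ?_ hy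
  · rintro y ⟨g', ⟨r, hr, h1, h2⟩, γ, h3⟩
    filter_upwards [Metric.ball_mem_nhds y hr] with y' hy'
    obtain ⟨γ', hγ'⟩ := exists_path_of_convex (convex_ball y r) (Metric.mem_ball_self hr) hy'
    exact ⟨g', .of_comb Metric.isOpen_ball h2 h1 hy', γ.trans γ', h3.trans
      (.refl_of_analyticAt fun t => h2.analyticAt Metric.isOpen_ball (hγ' t) h1)⟩
  · exact .refl_of_analyticAt fun t => h.analyticAt
  · rintro y ⟨hyc, hyW⟩
    obtain ⟨r, hr, h1⟩ := Metric.isOpen_iff.1 hW y hyW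
    obtain ⟨y', ⟨g', h2, γ, h7⟩, h3⟩ := Metric.mem_closure_iff.1 hyc r hr
    rw [dist_comm] at h3
    obtain ⟨g'', h4, h5, h6⟩ := LocV.exists_extension h2 (Metric.mem_ball.2 h3) h1
    obtain ⟨γ', hγ'⟩ := exists_path_of_convex (convex_ball y r) (Metric.mem_ball.2 h3)
      (Metric.mem_ball_self hr)
    exact ⟨g'', .of_comb Metric.isOpen_ball h4 h1 (Metric.mem_ball_self hr), γ.trans γ',
      (h7.congr .rfl h6.symm).trans (.refl_of_analyticAt fun t => h5 _ (hγ' t))⟩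

end
end GenHyperlog

namespace GenHyperlog
noncomputable section

variable {F : Subfield ℂ} {B : Set Form} {D D' U : Set (ℂ × ℂ)} {f g : ℂ × ℂ → ℂ} {p q x y : ℂ × ℂ}
  {rat : Prop}

/-! ### Scalar multiples of iterated integrals -/

theorem sum_map_flatMap {α β : Type*} (l : List α) (f : α → List β) (g : β → ℂ) :
    ((l.flatMap f).map g).sum = (l.map fun x => ((f x).map g).sum).sum := by
  induction l with
  | nil => simp
  | cons x l ih => simp [ih]

theorem Uni.const_mul (h : Uni B D g) (c : ℂ) : Uni B D fun p => c * g p := by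
  induction h with
  | mk g l hg hB _ hz hζ ih =>
    refine .mk _ (l.map fun x => (x.1, fun p => c * x.2 p))
      (fun p hp => analyticAt_const.mul (hg p hp)) ?_ ?_ (fun p hp => ?_) fun p hp => ?_
    · intro x hx
      obtain ⟨y, hy, rfl⟩ := List.mem_map.1 hx
      exact hB y hy
    · intro x hx
      obtain ⟨y, hy, rfl⟩ := List.mem_map.1 hx
      exact ih y hy
    · have h1 : pdz (fun p => c * g p) p = c * pdz g p :=
        ((hasDerivAt_pdz (hg p hp)).const_mul c).deriv
      rw [h1, hz p hp, List.map_map, ← List.sum_map_mul_left]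
      refine congrArg List.sum (List.map_congr_left fun x _ => ?_)
      simp only [Function.comp_apply]
      ring
    · have h1 : pdζ (fun p => c * g p) p = c * pdζ g p :=
        ((hasDerivAt_pdζ (hg p hp)).const_mul c).deriv
      rw [h1, hζ p hp, List.map_map, ← List.sum_map_mul_left]
      refine congrArg List.sum (List.map_congr_left fun x _ => ?_)
      simp only [Function.comp_apply]
      ring

theorem Uni.neg (h : Uni B D g) : Uni B D fun p => -g p := by
  simpa using h.const_mul (-1)

/-! ### Complex conjugation -/

theorem conjPt_conjPt (p : ℂ × ℂ) : conjPt (conjPt p) = p := by simp [conjPt]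

theorem conjFun_conjFun (g : ℂ × ℂ → ℂ) : conjFun (conjFun g) = g := by
  funext p
  simp [conjFun, conjPt_conjPt]

theorem continuous_conjPt : Continuous conjPt := by
  unfold conjPt
  fun_prop

theorem pdz_conjFun (g : ℂ × ℂ → ℂ) (p : ℂ × ℂ) :
    pdz (conjFun g) p = starRingEnd ℂ (pdζ g (conjPt p)) :=
  congrFun (deriv_conj_conj (f := fun ζ => g (starRingEnd ℂ p.2, ζ))) p.1

theorem pdζ_conjFun (g : ℂ × ℂ → ℂ) (p : ℂ × ℂ) :
    pdζ (conjFun g) p = starRingEnd ℂ (pdz g (conjPt p)) :=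
  congrFun (deriv_conj_conj (f := fun z => g (z, starRingEnd ℂ p.1))) p.2

/-- Conjugating both argument and value preserves holomorphy in each variable; joint analyticity is
then Osgood's lemma. -/
theorem analyticAt_conjFun (h : AnalyticAt ℂ g (conjPt p)) : AnalyticAt ℂ (conjFun g) p := by
  obtain ⟨r, hr, h1⟩ := Metric.eventually_nhds_iff_ball.1 h.eventually_analyticAt
  refine analyticAt_of_separately (U := conjPt ⁻¹' Metric.ball (conjPt p) r)
    (Metric.isOpen_ball.preimage continuous_conjPt) (fun q hq => ?_) (fun q hq => ?_)
    (fun q hq => ?_) (Metric.mem_ball_self hr)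
  · refine ContinuousAt.continuousWithinAt ?_
    exact Complex.continuous_conj.continuousAt.comp
      ((h1 _ hq).continuousAt.comp continuous_conjPt.continuousAt)
  · have h2 := (h1 _ hq).differentiableAt_snd.conj_conj
    simp only [conjPt, Complex.conj_conj] at h2
    exact h2
  · have h2 := (h1 _ hq).differentiableAt_fst.conj_conj
    simp only [conjPt, Complex.conj_conj] at h2
    exact h2

/-- The conjugate form. -/
def Form.conj (Q : Form) : Form where
  α := starRingEnd ℂ Q.α
  β := starRingEnd ℂ Q.γ
  γ := starRingEnd ℂ Q.β
  δ := starRingEnd ℂ Q.δ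

theorem Form.eval_conj (Q : Form) (p : ℂ × ℂ) :
    Q.conj.eval p = starRingEnd ℂ (Q.eval (conjPt p)) := by
  simp only [eval, conj, conjPt, map_add, map_mul, Complex.conj_conj]
  ring

theorem Form.evalz_conj (Q : Form) (p : ℂ × ℂ) :
    Q.conj.evalz p = starRingEnd ℂ (Q.evalζ (conjPt p)) := by
  simp [evalz, evalζ, conj, conjPt]

theorem Form.evalζ_conj (Q : Form) (p : ℂ × ℂ) :
    Q.conj.evalζ p = starRingEnd ℂ (Q.evalz (conjPt p)) := by
  simp [evalz, evalζ, conj, conjPt]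

theorem Alphabet.conj (hB : Alphabet F B) (hconj : ∀ x ∈ F, starRingEnd ℂ x ∈ F) :
    Alphabet F (Form.conj '' B) where
  finite := hB.finite.image _
  coeff_mem := by
    rintro _ ⟨Q, hQ, rfl⟩
    obtain ⟨h1, h2, h3, h4⟩ := hB.coeff_mem Q hQ
    exact ⟨hconj _ h1, hconj _ h3, hconj _ h2, hconj _ h4⟩
  nonzero := by
    rintro _ ⟨Q, hQ, rfl⟩
    have h := hB.nonzero Q hQ
    simp only [Form.Nonzero, Form.conj, ne_eq, map_eq_zero] at h ⊢
    tauto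

theorem conjPt_mem_Reg (h : p ∈ Reg (Form.conj '' B)) : conjPt p ∈ Reg B := by
  intro Q hQ h1
  refine h Q.conj ⟨Q, hQ, rfl⟩ ?_
  rw [Q.eval_conj, h1, map_zero]

/-- Conjugation exchanges the two variables, hence the two components of each `dQ / Q`, and replaces
`Q` by the conjugate form. -/
theorem Uni.conj (h : Uni B D g) : Uni (Form.conj '' B) (conjPt ⁻¹' D) (conjFun g) := by
  induction h with
  | mk g l hg hB _ hz hζ ih =>
    refine .mk _ (l.map fun x => (x.1.conj, conjFun x.2)) (fun p hp => analyticAt_conjFun (hg _ hp))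
      ?_ ?_ (fun p hp => ?_) fun p hp => ?_
    · intro x hx
      obtain ⟨y, hy, rfl⟩ := List.mem_map.1 hx
      exact ⟨_, hB y hy, rfl⟩
    · intro x hx
      obtain ⟨y, hy, rfl⟩ := List.mem_map.1 hx
      exact ih y hy
    · rw [pdz_conjFun, hζ _ hp, map_list_sum, List.map_map, List.map_map]
      refine congrArg List.sum (List.map_congr_left fun x _ => ?_)
      simp [Form.evalz_conj, Form.eval_conj, conjFun]
    · rw [pdζ_conjFun, hz _ hp, map_list_sum, List.map_map, List.map_map]
      refine congrArg List.sum (List.map_congr_left fun x _ => ?_)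
      simp [Form.evalζ_conj, Form.eval_conj, conjFun]

theorem conjFun_mem_coeffRing {r : ℂ × ℂ → ℂ} (h : r ∈ coeffRing rat B) :
    conjFun r ∈ coeffRing rat (Form.conj '' B) := by
  induction h using Algebra.adjoin_induction with
  | mem x hx =>
    obtain ⟨hr, rfl | rfl | ⟨Q, hQ, rfl⟩⟩ := hx
    · refine Algebra.subset_adjoin ⟨hr, Or.inr (Or.inl ?_)⟩
      funext p
      simp [conjFun, conjPt]
    · refine Algebra.subset_adjoin ⟨hr, Or.inl ?_⟩
      funext p
      simp [conjFun, conjPt]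
    · refine Algebra.subset_adjoin ⟨hr, Or.inr (Or.inr ⟨Q.conj, ⟨Q, hQ, rfl⟩, ?_⟩)⟩
      funext p
      simp [conjFun, Form.eval_conj]
  | algebraMap c => exact (coeffRing rat _).algebraMap_mem (starRingEnd ℂ c)
  | add x y _ _ hx hy =>
    convert add_mem hx hy using 1
    funext p
    simp [conjFun]
  | mul x y _ _ hx hy =>
    convert mul_mem hx hy using 1
    funext p
    simp [conjFun]

theorem Comb.conj (h : Comb rat B D g) :
    Comb rat (Form.conj '' B) (conjPt ⁻¹' D) (conjFun g) := by
  obtain ⟨l, hl, H⟩ := h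
  refine ⟨l.map fun x => (conjFun x.1, conjFun x.2), ?_, fun p hp => ?_⟩
  · intro x hx
    obtain ⟨y, hy, rfl⟩ := List.mem_map.1 hx
    exact ⟨conjFun_mem_coeffRing (hl y hy).1, (hl y hy).2.conj⟩
  · rw [conjFun, H _ hp, map_list_sum, List.map_map, List.map_map]
    refine congrArg List.sum (List.map_congr_left fun x _ => ?_)
    simp [conjFun]

theorem LocV.conj (hB : B.Finite) (h : LocV rat B (conjPt p) g) (hp : p ∈ Reg (Form.conj '' B)) :
    LocV rat (Form.conj '' B) p (conjFun g) := by
  obtain ⟨r, hr, h1, h2⟩ := h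
  exact .of_comb (D := conjPt ⁻¹' Metric.ball (conjPt p) r ∩ Reg (Form.conj '' B))
    ((Metric.isOpen_ball.preimage continuous_conjPt).inter (isOpen_Reg (hB.image _)))
    (h2.conj.mono le_rfl Set.inter_subset_left) Set.inter_subset_right ⟨Metric.mem_ball_self hr, hp⟩

theorem GoodAt.conj (hB : B.Finite) (h : GoodAt rat B p g) :
    GoodAt rat (Form.conj '' B) (conjPt p) (conjFun g) := by
  rw [← conjPt_conjPt p] at h
  refine ⟨analyticAt_conjFun h.1, ?_⟩
  filter_upwards [continuous_conjPt.continuousAt.eventually h.2] with x h1 h2 using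
    (h1 (conjPt_mem_Reg h2)).conj hB h2

/-! ### Fractional linear transformations -/

/-- A pair of fractional linear transformations that act on the two variables. -/
structure Mob where
  (a b c d a' b' c' d' : ℂ)
  det : a * d - b * c ≠ 0
  det' : a' * d' - b' * c' ≠ 0

namespace Mob

/-- The action on points. -/
def app (T : Mob) (p : ℂ × ℂ) : ℂ × ℂ :=
  ((T.a * p.1 + T.b) / (T.c * p.1 + T.d), (T.a' * p.2 + T.b') / (T.c' * p.2 + T.d'))

/-- The denominator in the first variable. -/
def den (T : Mob) : Form := ⟨0, T.c, 0, T.d⟩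

/-- The denominator in the second variable. -/
def den' (T : Mob) : Form := ⟨0, 0, T.c', T.d'⟩

/-- The numerator of the pull-back of a form. -/
def pull (T : Mob) (Q : Form) : Form where
  α := Q.α * T.a * T.a' + Q.β * T.a * T.c' + Q.γ * T.c * T.a' + Q.δ * T.c * T.c'
  β := Q.α * T.a * T.b' + Q.β * T.a * T.d' + Q.γ * T.c * T.b' + Q.δ * T.c * T.d'
  γ := Q.α * T.b * T.a' + Q.β * T.b * T.c' + Q.γ * T.d * T.a' + Q.δ * T.d * T.c'
  δ := Q.α * T.b * T.b' + Q.β * T.b * T.d' + Q.γ * T.d * T.b' + Q.δ * T.d * T.d'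

/-- The forms that occur in pull-backs. -/
def forms (T : Mob) (B : Set Form) : Set Form := {T.den, T.den'} ∪ T.pull '' B

variable {T : Mob}

theorem eval_den (p : ℂ × ℂ) : T.den.eval p = T.c * p.1 + T.d := by simp [Form.eval, den]

theorem eval_den' (p : ℂ × ℂ) : T.den'.eval p = T.c' * p.2 + T.d' := by simp [Form.eval, den']

theorem eval_app (Q : Form) (h : T.den.eval p ≠ 0) (h' : T.den'.eval p ≠ 0) :
    Q.eval (T.app p) = (T.pull Q).eval p / (T.den.eval p * T.den'.eval p) := by
  rw [eval_den] at h ⊢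
  rw [eval_den'] at h' ⊢
  obtain ⟨z, ζ⟩ := p
  obtain ⟨a, b, c, d, a', b', c', d', _, _⟩ := T
  simp only [app, Form.eval, pull] at h h' ⊢
  have h1 : z * c + d ≠ 0 := by rwa [mul_comm]
  have h2 : ζ * c' + d' ≠ 0 := by rwa [mul_comm]
  field_simp
  ring

theorem app_mem_Reg (h : p ∈ Reg (T.forms B)) : T.app p ∈ Reg B := by
  have h1 : T.den.eval p ≠ 0 := h _ (Or.inl (Or.inl rfl))
  have h2 : T.den'.eval p ≠ 0 := h _ (Or.inl (Or.inr rfl))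
  intro Q hQ
  rw [eval_app Q h1 h2]
  exact div_ne_zero (h _ (Or.inr ⟨Q, hQ, rfl⟩)) (mul_ne_zero h1 h2)

/-- The pull-back of a bi-affine form is a bi-affine form divided by the two linear denominators, so
its logarithmic differential is a combination of three of the same kind. The term of `den'` vanishes
in this component; it is kept so that one list of forms serves both components. -/
theorem logDeriv_z (Q : Form) (h : T.den.eval p ≠ 0) (h' : T.den'.eval p ≠ 0)
    (hQ : (T.pull Q).eval p ≠ 0) :
    Q.evalz (T.app p) / Q.eval (T.app p) * ((T.a * T.d - T.b * T.c) / (T.c * p.1 + T.d) ^ 2) =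
      (T.pull Q).evalz p / (T.pull Q).eval p - T.den.evalz p / T.den.eval p -
        T.den'.evalz p / T.den'.eval p := by
  have e : Q.evalz (T.app p) * (T.a * T.d - T.b * T.c) * T.den'.eval p =
      (T.pull Q).evalz p * T.den.eval p - T.c * (T.pull Q).eval p := by
    rw [eval_den'] at h' ⊢
    rw [eval_den] at h ⊢
    clear hQ
    obtain ⟨z, ζ⟩ := p
    obtain ⟨a, b, c, d, a', b', c', d', _, _⟩ := T
    simp only [app, Form.eval, Form.evalz, pull] at h h' ⊢
    have h1 : z * c + d ≠ 0 := by rwa [mul_comm]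
    have h2 : ζ * c' + d' ≠ 0 := by rwa [mul_comm]
    field_simp
    ring
  have e1 : T.den.evalz p = T.c := by simp [Form.evalz, den]
  have e2 : T.den'.evalz p = 0 := by simp [Form.evalz, den']
  rw [eval_app Q h h', e1, e2, ← eval_den]
  field_simp
  linear_combination T.den'.eval p * e

theorem logDeriv_ζ (Q : Form) (h : T.den.eval p ≠ 0) (h' : T.den'.eval p ≠ 0)
    (hQ : (T.pull Q).eval p ≠ 0) :
    Q.evalζ (T.app p) / Q.eval (T.app p) * ((T.a' * T.d' - T.b' * T.c') / (T.c' * p.2 + T.d') ^ 2) =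
      (T.pull Q).evalζ p / (T.pull Q).eval p - T.den.evalζ p / T.den.eval p -
        T.den'.evalζ p / T.den'.eval p := by
  have e : Q.evalζ (T.app p) * (T.a' * T.d' - T.b' * T.c') * T.den.eval p =
      (T.pull Q).evalζ p * T.den'.eval p - T.c' * (T.pull Q).eval p := by
    rw [eval_den'] at h' ⊢
    rw [eval_den] at h ⊢
    clear hQ
    obtain ⟨z, ζ⟩ := p
    obtain ⟨a, b, c, d, a', b', c', d', _, _⟩ := T
    simp only [app, Form.eval, Form.evalζ, pull] at h h' ⊢
    have h1 : z * c + d ≠ 0 := by rwa [mul_comm]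
    have h2 : ζ * c' + d' ≠ 0 := by rwa [mul_comm]
    field_simp
    ring
  have e1 : T.den.evalζ p = 0 := by simp [Form.evalζ, den]
  have e2 : T.den'.evalζ p = T.c' := by simp [Form.evalζ, den']
  rw [eval_app Q h h', e1, e2, ← eval_den']
  field_simp
  linear_combination T.den.eval p * e

theorem analyticAt_app (h : T.den.eval p ≠ 0) (h' : T.den'.eval p ≠ 0) : AnalyticAt ℂ T.app p := by
  rw [eval_den] at h
  rw [eval_den'] at h'
  exact (((analyticAt_const.mul analyticAt_fst).add analyticAt_const).div
    ((analyticAt_const.mul analyticAt_fst).add analyticAt_const) h).prod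
    (((analyticAt_const.mul analyticAt_snd).add analyticAt_const).div
    ((analyticAt_const.mul analyticAt_snd).add analyticAt_const) h')

theorem pdz_comp (h : T.den.eval p ≠ 0) (hg : AnalyticAt ℂ g (T.app p)) :
    pdz (g ∘ T.app) p = pdz g (T.app p) * ((T.a * T.d - T.b * T.c) / (T.c * p.1 + T.d) ^ 2) := by
  rw [eval_den] at h
  exact ((hasDerivAt_pdz hg).comp p.1 (hasDerivAt_linearFractional h)).deriv

theorem pdζ_comp (h : T.den'.eval p ≠ 0) (hg : AnalyticAt ℂ g (T.app p)) :
    pdζ (g ∘ T.app) p =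
      pdζ g (T.app p) * ((T.a' * T.d' - T.b' * T.c') / (T.c' * p.2 + T.d') ^ 2) := by
  rw [eval_den'] at h
  exact ((hasDerivAt_pdζ hg).comp p.2 (hasDerivAt_linearFractional h)).deriv

/-- Pulling back multiplies the matrix of the four coefficients by invertible `2 × 2` matrices on
both sides; their adjugates undo this. -/
theorem pull_nonzero {Q : Form} (h : Q.Nonzero) : (T.pull Q).Nonzero := by
  by_contra hn
  simp only [Form.Nonzero, not_or, not_not, pull] at hn
  obtain ⟨h1, h2, h3, h4⟩ := hn
  have e1 : Q.α * T.a' + Q.β * T.c' = 0 := mul_left_cancel₀ T.det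
    (by linear_combination T.d * h1 - T.c * h3)
  have e2 : Q.γ * T.a' + Q.δ * T.c' = 0 := mul_left_cancel₀ T.det
    (by linear_combination T.a * h3 - T.b * h1)
  have e3 : Q.α * T.b' + Q.β * T.d' = 0 := mul_left_cancel₀ T.det
    (by linear_combination T.d * h2 - T.c * h4)
  have e4 : Q.γ * T.b' + Q.δ * T.d' = 0 := mul_left_cancel₀ T.det
    (by linear_combination T.a * h4 - T.b * h2)
  have f1 : Q.α = 0 := mul_left_cancel₀ T.det' (by linear_combination T.d' * e1 - T.c' * e3)
  have f2 : Q.β = 0 := mul_left_cancel₀ T.det' (by linear_combination T.a' * e3 - T.b' * e1)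
  have f3 : Q.γ = 0 := mul_left_cancel₀ T.det' (by linear_combination T.d' * e2 - T.c' * e4)
  have f4 : Q.δ = 0 := mul_left_cancel₀ T.det' (by linear_combination T.a' * e4 - T.b' * e2)
  simp [Form.Nonzero, f1, f2, f3, f4] at h

theorem alphabet (hB : Alphabet F B) (ha : T.a ∈ F) (hb : T.b ∈ F) (hc : T.c ∈ F) (hd : T.d ∈ F)
    (ha' : T.a' ∈ F) (hb' : T.b' ∈ F) (hc' : T.c' ∈ F) (hd' : T.d' ∈ F) :
    Alphabet F (T.forms B) where
  finite := (Set.toFinite _).union (hB.finite.image _)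
  coeff_mem := by
    have h0 := F.zero_mem
    rintro _ ((rfl | rfl) | ⟨Q, hQ, rfl⟩)
    · exact ⟨h0, hc, h0, hd⟩
    · exact ⟨h0, h0, hc', hd'⟩
    · obtain ⟨h1, h2, h3, h4⟩ := hB.coeff_mem Q hQ
      have key : ∀ {x y x' y' : ℂ}, x ∈ F → y ∈ F → x' ∈ F → y' ∈ F →
          Q.α * x * x' + Q.β * x * y' + Q.γ * y * x' + Q.δ * y * y' ∈ F :=
        fun hx hy hx' hy' => add_mem (add_mem (add_mem (mul_mem (mul_mem h1 hx) hx')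
          (mul_mem (mul_mem h2 hx) hy')) (mul_mem (mul_mem h3 hy) hx')) (mul_mem (mul_mem h4 hy) hy')
      exact ⟨key ha hc ha' hc', key ha hc hb' hd', key hb hd ha' hc', key hb hd hb' hd'⟩
  nonzero := by
    rintro _ ((rfl | rfl) | ⟨Q, hQ, rfl⟩)
    · by_contra h
      simp only [Form.Nonzero, den, not_or, not_not] at h
      exact T.det (by rw [h.2.1, h.2.2.2]; ring)
    · by_contra h
      simp only [Form.Nonzero, den', not_or, not_not] at h
      exact T.det' (by rw [h.2.2.1, h.2.2.2]; ring)
    · exact pull_nonzero (hB.nonzero Q hQ)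

end Mob

variable {T : Mob}

theorem Uni.comp_mob (h : Uni B D g) (hD : D' ⊆ T.app ⁻¹' D) (hD' : D' ⊆ Reg (T.forms B)) :
    Uni (T.forms B) D' (g ∘ T.app) := by
  have h1 : ∀ p ∈ D', T.den.eval p ≠ 0 := fun p hp => hD' hp _ (Or.inl (Or.inl rfl))
  have h2 : ∀ p ∈ D', T.den'.eval p ≠ 0 := fun p hp => hD' hp _ (Or.inl (Or.inr rfl))
  induction h with
  | mk g l hg hB _ hz hζ ih =>
    refine .mk _ (l.flatMap fun x => [(T.pull x.1, x.2 ∘ T.app),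
      (T.den, fun p => -(x.2 ∘ T.app) p), (T.den', fun p => -(x.2 ∘ T.app) p)])
      (fun p hp => (hg _ (hD hp)).comp (Mob.analyticAt_app (h1 p hp) (h2 p hp)))
      ?_ ?_ (fun p hp => ?_) fun p hp => ?_
    · intro x hx
      obtain ⟨y, hy, hx⟩ := List.mem_flatMap.1 hx
      simp only [List.mem_cons, List.not_mem_nil, or_false] at hx
      rcases hx with rfl | rfl | rfl
      · exact Or.inr ⟨_, hB y hy, rfl⟩
      · exact Or.inl (Or.inl rfl)
      · exact Or.inl (Or.inr rfl)
    · intro x hx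
      obtain ⟨y, hy, hx⟩ := List.mem_flatMap.1 hx
      simp only [List.mem_cons, List.not_mem_nil, or_false] at hx
      rcases hx with rfl | rfl | rfl
      · exact ih y hy
      · exact (ih y hy).neg
      · exact (ih y hy).neg
    · rw [Mob.pdz_comp (h1 p hp) (hg _ (hD hp)), hz _ (hD hp), sum_map_flatMap,
        ← List.sum_map_mul_right]
      refine congrArg List.sum (List.map_congr_left fun x hx => ?_)
      have e := Mob.logDeriv_z x.1 (h1 p hp) (h2 p hp) (hD' hp _ (Or.inr ⟨_, hB x hx, rfl⟩))
      simp only [List.map_cons, List.map_nil, List.sum_cons, List.sum_nil, Function.comp_apply]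
      linear_combination x.2 (T.app p) * e
    · rw [Mob.pdζ_comp (h2 p hp) (hg _ (hD hp)), hζ _ (hD hp), sum_map_flatMap,
        ← List.sum_map_mul_right]
      refine congrArg List.sum (List.map_congr_left fun x hx => ?_)
      have e := Mob.logDeriv_ζ x.1 (h1 p hp) (h2 p hp) (hD' hp _ (Or.inr ⟨_, hB x hx, rfl⟩))
      simp only [List.map_cons, List.map_nil, List.sum_cons, List.sum_nil, Function.comp_apply]
      linear_combination x.2 (T.app p) * e

theorem eval_mem_coeffRing (hr : rat) (Q : Form) : Q.eval ∈ coeffRing rat B := by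
  have h1 : (Prod.fst : ℂ × ℂ → ℂ) ∈ coeffRing rat B := Algebra.subset_adjoin ⟨hr, Or.inl rfl⟩
  have h2 : (Prod.snd : ℂ × ℂ → ℂ) ∈ coeffRing rat B :=
    Algebra.subset_adjoin ⟨hr, Or.inr (Or.inl rfl)⟩
  have hc := (coeffRing rat B).algebraMap_mem
  exact add_mem (add_mem (add_mem (mul_mem (mul_mem (hc Q.α) h1) h2) (mul_mem (hc Q.β) h1))
    (mul_mem (hc Q.γ) h2)) (hc Q.δ)

theorem inv_eval_mem_coeffRing (hr : rat) {Q : Form} (hQ : Q ∈ B) :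
    (fun p => (Q.eval p)⁻¹) ∈ coeffRing rat B :=
  Algebra.subset_adjoin ⟨hr, Or.inr (Or.inr ⟨Q, hQ, rfl⟩)⟩

theorem exists_coeffRing_comp_mob {r : ℂ × ℂ → ℂ} (h : r ∈ coeffRing rat B) :
    ∃ r' ∈ coeffRing rat (T.forms B), Set.EqOn (r ∘ T.app) r' (Reg (T.forms B)) := by
  have m1 : T.den ∈ T.forms B := Or.inl (Or.inl rfl)
  have m2 : T.den' ∈ T.forms B := Or.inl (Or.inr rfl)
  induction h using Algebra.adjoin_induction with
  | mem x hx =>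
    obtain ⟨hr, rfl | rfl | ⟨Q, hQ, rfl⟩⟩ := hx
    · refine ⟨_, mul_mem (eval_mem_coeffRing hr ⟨0, T.a, 0, T.b⟩) (inv_eval_mem_coeffRing hr m1),
        fun p hp => ?_⟩
      simp [Mob.app, Form.eval, Mob.den, div_eq_mul_inv]
    · refine ⟨_, mul_mem (eval_mem_coeffRing hr ⟨0, 0, T.a', T.b'⟩) (inv_eval_mem_coeffRing hr m2),
        fun p hp => ?_⟩
      simp [Mob.app, Form.eval, Mob.den', div_eq_mul_inv]
    · refine ⟨_, mul_mem (mul_mem (eval_mem_coeffRing hr T.den) (eval_mem_coeffRing hr T.den'))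
        (inv_eval_mem_coeffRing hr (Or.inr ⟨Q, hQ, rfl⟩)), fun p hp => ?_⟩
      simp [Mob.eval_app Q (hp _ m1) (hp _ m2), div_eq_mul_inv]
  | algebraMap c => exact ⟨_, (coeffRing rat _).algebraMap_mem c, fun p _ => rfl⟩
  | add x y _ _ hx hy =>
    obtain ⟨x', hx, ex⟩ := hx
    obtain ⟨y', hy, ey⟩ := hy
    exact ⟨_, add_mem hx hy, fun p hp => congrArg₂ (· + ·) (ex hp) (ey hp)⟩
  | mul x y _ _ hx hy =>
    obtain ⟨x', hx, ex⟩ := hx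
    obtain ⟨y', hy, ey⟩ := hy
    exact ⟨_, mul_mem hx hy, fun p hp => congrArg₂ (· * ·) (ex hp) (ey hp)⟩

theorem Comb.comp_mob (h : Comb rat B D g) (hD : D' ⊆ T.app ⁻¹' D) (hD' : D' ⊆ Reg (T.forms B)) :
    Comb rat (T.forms B) D' (g ∘ T.app) := by
  obtain ⟨l, hl, H⟩ := h
  have hx : ∀ x : (ℂ × ℂ → ℂ) × (ℂ × ℂ → ℂ), ∃ r', x ∈ l →
      r' ∈ coeffRing rat (T.forms B) ∧ Set.EqOn (x.1 ∘ T.app) r' (Reg (T.forms B)) := by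
    intro x
    by_cases hx : x ∈ l
    · obtain ⟨r', H⟩ := exists_coeffRing_comp_mob (T := T) (hl x hx).1
      exact ⟨r', fun _ => H⟩
    · exact ⟨0, fun h => absurd h hx⟩
  choose r' hr' using hx
  refine ⟨l.map fun x => (r' x, x.2 ∘ T.app), ?_, fun p hp => ?_⟩
  · intro x hx
    obtain ⟨y, hy, rfl⟩ := List.mem_map.1 hx
    exact ⟨(hr' y hy).1, (hl y hy).2.comp_mob hD hD'⟩
  · rw [Function.comp_apply, H _ (hD hp), List.map_map]
    refine congrArg List.sum (List.map_congr_left fun x hx => ?_)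
    simp only [Function.comp_apply, ← (hr' x hx).2 (hD' hp)]

theorem LocV.comp_mob (hB : B.Finite) (h : LocV rat B (T.app p) g) (hp : p ∈ Reg (T.forms B)) :
    LocV rat (T.forms B) p (g ∘ T.app) := by
  obtain ⟨r, hr, h1, h2⟩ := h
  have hcont : ContinuousOn T.app (Reg (T.forms B)) := fun q hq =>
    (Mob.analyticAt_app (hq _ (Or.inl (Or.inl rfl)))
      (hq _ (Or.inl (Or.inr rfl)))).continuousAt.continuousWithinAt
  have hopen : IsOpen (Reg (T.forms B)) := isOpen_Reg ((Set.toFinite _).union (hB.image _))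
  exact .of_comb (hcont.isOpen_inter_preimage hopen (Metric.isOpen_ball (x := T.app p) (ε := r)))
    (h2.comp_mob Set.inter_subset_right Set.inter_subset_left) Set.inter_subset_left
    ⟨hp, Metric.mem_ball_self hr⟩

theorem GoodAt.comp_mob (hB : B.Finite) (h : GoodAt rat B (T.app p) g) (h1 : T.den.eval p ≠ 0)
    (h2 : T.den'.eval p ≠ 0) : GoodAt rat (T.forms B) p (g ∘ T.app) := by
  have h3 := Mob.analyticAt_app h1 h2
  refine ⟨h.1.comp h3, ?_⟩
  filter_upwards [h3.continuousAt.eventually h.2] with x h4 h5 using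
    (h4 (Mob.app_mem_Reg h5)).comp_mob hB h5

end
end GenHyperlog

namespace GenHyperlog
noncomputable section

variable {F : Subfield ℂ} {B : Set Form} {D U : Set (ℂ × ℂ)} {f g : ℂ × ℂ → ℂ} {p : ℂ × ℂ}
  {rat : Prop}

/-! ### Pairs of functions of the form `∑ h dQ / Q` -/

/-- The components of a form `∑ h dQ / Q` with forms `Q ∈ B` and functions `h` of the class `Uni`. -/
def LogForms (B : Set Form) (D : Set (ℂ × ℂ)) (a b : ℂ × ℂ → ℂ) : Prop :=
  ∃ l : List (Form × (ℂ × ℂ → ℂ)), (∀ x ∈ l, x.1 ∈ B ∧ Uni B D x.2) ∧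
    ∀ p ∈ D, a p = (l.map fun x => x.1.evalz p / x.1.eval p * x.2 p).sum ∧
      b p = (l.map fun x => x.1.evalζ p / x.1.eval p * x.2 p).sum

theorem Uni.of_logForms (hg : ∀ p ∈ D, AnalyticAt ℂ g p) (h : LogForms B D (pdz g) (pdζ g)) :
    Uni B D g := by
  obtain ⟨l, hl, H⟩ := h
  exact .mk g l hg (fun x hx => (hl x hx).1) (fun x hx => (hl x hx).2) (fun p hp => (H p hp).1)
    fun p hp => (H p hp).2

namespace LogForms

variable {a b a' b' h : ℂ × ℂ → ℂ}

theorem congr (H : LogForms B D a b) (ha : Set.EqOn a' a D) (hb : Set.EqOn b' b D) :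
    LogForms B D a' b' := by
  obtain ⟨l, hl, H⟩ := H
  exact ⟨l, hl, fun p hp => ⟨(ha hp).trans (H p hp).1, (hb hp).trans (H p hp).2⟩⟩

theorem zero : LogForms B D (fun _ => 0) fun _ => 0 := ⟨[], by simp, by simp⟩

theorem add (H : LogForms B D a b) (H' : LogForms B D a' b') :
    LogForms B D (fun p => a p + a' p) fun p => b p + b' p := by
  obtain ⟨l, hl, H⟩ := H
  obtain ⟨l', hl', H'⟩ := H'
  refine ⟨l ++ l', fun x hx => ?_, fun p hp => ?_⟩
  · rcases List.mem_append.1 hx with hx | hx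
    · exact hl x hx
    · exact hl' x hx
  · simp [(H p hp).1, (H p hp).2, (H' p hp).1, (H' p hp).2]

theorem single {Q : Form} (hQ : Q ∈ B) (hh : Uni B D h) :
    LogForms B D (fun p => Q.evalz p / Q.eval p * h p) fun p => Q.evalζ p / Q.eval p * h p :=
  ⟨[(Q, h)], by simpa using ⟨hQ, hh⟩, by simp⟩

theorem list_sum {α : Type*} (l : List α) {a b : α → ℂ × ℂ → ℂ}
    (H : ∀ x ∈ l, LogForms B D (a x) (b x)) :
    LogForms B D (fun p => (l.map fun x => a x p).sum) fun p => (l.map fun x => b x p).sum := by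
  induction l with
  | nil => exact zero
  | cons x l ih =>
    simp only [List.map_cons, List.sum_cons]
    exact (H x (by simp)).add (ih fun y hy => H y (by simp [hy]))

end LogForms

/-! ### Alphabets that contain given logarithmic forms -/

/-- The form `c ζ + d`. -/
def Form.lin (c d : ℂ) : Form := ⟨0, 0, c, d⟩

theorem Form.eval_lin (c d : ℂ) (p : ℂ × ℂ) : (lin c d).eval p = c * p.2 + d := by
  simp [lin, eval]

theorem Form.evalz_lin (c d : ℂ) (p : ℂ × ℂ) : (lin c d).evalz p = 0 := by simp [lin, evalz]

theorem Form.evalζ_lin (c d : ℂ) (p : ℂ × ℂ) : (lin c d).evalζ p = c := by simp [lin, evalζ]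

theorem alphabet_empty : Alphabet F ∅ := ⟨Set.finite_empty, by simp, by simp⟩

theorem Alphabet.union {B' : Set Form} (h : Alphabet F B) (h' : Alphabet F B') :
    Alphabet F (B ∪ B') where
  finite := h.finite.union h'.finite
  coeff_mem Q hQ := hQ.elim (h.coeff_mem Q) (h'.coeff_mem Q)
  nonzero Q hQ := hQ.elim (h.nonzero Q) (h'.nonzero Q)

theorem Alphabet.biUnion {ι : Type*} {s : Set ι} (hs : s.Finite) {B : ι → Set Form}
    (h : ∀ i ∈ s, Alphabet F (B i)) : Alphabet F (⋃ i ∈ s, B i) where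
  finite := hs.biUnion fun i hi => (h i hi).finite
  coeff_mem Q hQ := by
    obtain ⟨i, hi, hQ⟩ := Set.mem_iUnion₂.1 hQ
    exact (h i hi).coeff_mem Q hQ
  nonzero Q hQ := by
    obtain ⟨i, hi, hQ⟩ := Set.mem_iUnion₂.1 hQ
    exact (h i hi).nonzero Q hQ

theorem alphabet_lin {c d : ℂ} (hc : c ∈ F) (hd : d ∈ F) (h : c ≠ 0 ∨ d ≠ 0) :
    Alphabet F {Form.lin c d} where
  finite := Set.finite_singleton _
  coeff_mem := by
    rintro _ rfl
    exact ⟨F.zero_mem, F.zero_mem, hc, hd⟩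
  nonzero := by
    rintro _ rfl
    exact Or.inr (Or.inr h)

/-- A property of alphabets that holds for all extensions of some alphabet over `F`. -/
def Supported (F : Subfield ℂ) (P : Set Form → Prop) : Prop :=
  ∃ B, Alphabet F B ∧ ∀ B', B ⊆ B' → P B'

theorem Supported.forall {ι : Type*} {s : Set ι} (hs : s.Finite) {P : ι → Set Form → Prop}
    (h : ∀ i ∈ s, Supported F (P i)) : Supported F fun B => ∀ i ∈ s, P i B := by
  have h' : ∀ i, ∃ B, i ∈ s → Alphabet F B ∧ ∀ B', B ⊆ B' → P i B' := by
    intro i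
    by_cases hi : i ∈ s
    · obtain ⟨B, hB⟩ := h i hi
      exact ⟨B, fun _ => hB⟩
    · exact ⟨∅, fun h => absurd h hi⟩
  choose B hB using h'
  refine ⟨_, .biUnion hs fun i hi => (hB i hi).1, fun B' hB' i hi => (hB i hi).2 B' ?_⟩
  exact (Set.subset_biUnion_of_mem hi).trans hB'

theorem Supported.and {P Q : Set Form → Prop} (h : Supported F P) (h' : Supported F Q) :
    Supported F fun B => P B ∧ Q B := by
  obtain ⟨B, hB, H⟩ := h
  obtain ⟨B', hB', H'⟩ := h'
  exact ⟨_, hB.union hB', fun C hC => ⟨H C (Set.subset_union_left.trans hC),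
    H' C (Set.subset_union_right.trans hC)⟩⟩

/-- The logarithmic form of `ζ - c`. -/
def HasConst (c : ℂ) (B : Set Form) : Prop :=
  ∀ D ⊆ Reg B, ∀ h, Uni B D h → LogForms B D (fun _ => 0) fun p => h p / (p.2 - c)

theorem supported_hasConst {c : ℂ} (hc : c ∈ F) : Supported F (HasConst c) := by
  refine ⟨_, alphabet_lin F.one_mem (neg_mem hc) (Or.inl one_ne_zero), fun B hB D hD h hh => ?_⟩
  refine (LogForms.single (Q := Form.lin 1 (-c)) (hB rfl) hh).congr (fun p _ => ?_) fun p _ => ?_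
  · simp [Form.evalz_lin]
  · simp only [Form.evalζ_lin, Form.eval_lin, one_mul, ← sub_eq_add_neg]
    ring

/-- The logarithmic form of `z - a(ζ)`. -/
def HasLetter (a : ℂ → ℂ) (B : Set Form) : Prop :=
  ∀ D ⊆ Reg B, ∀ h, Uni B D h → LogForms B D (fun p => h p / (p.1 - a p.2))
    fun p => deriv a p.2 / (a p.2 - p.1) * h p

/-- `z - a(ζ)` is a bi-affine form divided by `c ζ + d`, so its logarithmic form is a difference of
two forms of the alphabet. -/
theorem supported_hasLetter {a : ℂ → ℂ} (ha : a ∈ FLT F) : Supported F (HasLetter a) := by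
  obtain ⟨α, hα, β, hβ, c, hc, d, hd, hcd, -, H⟩ := exists_coeffs_of_mem_FLT ha
  set Q : Form := ⟨c, d, -α, -β⟩ with hQ
  have hQ1 : Alphabet F {Q} := ⟨Set.finite_singleton _, by
    rintro _ rfl
    exact ⟨hc, hd, neg_mem hα, neg_mem hβ⟩, by
    rintro _ rfl
    rcases hcd with h | h
    · exact Or.inl h
    · exact Or.inr (Or.inl h)⟩
  refine ⟨_, hQ1.union (alphabet_lin hc hd hcd), fun B hB D hD h hh => ?_⟩
  have m1 : Q ∈ B := hB (Or.inl rfl)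
  have m2 : Form.lin c d ∈ B := hB (Or.inr rfl)
  have key : ∀ p ∈ D, c * p.2 + d ≠ 0 ∧ p.1 - a p.2 ≠ 0 ∧
      Q.eval p = (c * p.2 + d) * (p.1 - a p.2) := by
    intro p hp
    have h1 := hD hp _ m2
    have h2 := hD hp _ m1
    rw [Form.eval_lin] at h1
    have h3 : Q.eval p = (c * p.2 + d) * (p.1 - a p.2) := by
      rw [H, mul_sub, mul_div_cancel₀ _ h1]
      simp only [hQ, Form.eval]
      ring
    rw [h3] at h2
    exact ⟨h1, right_ne_zero_of_mul h2, h3⟩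
  refine ((LogForms.single m1 hh).add (LogForms.single m2 hh.neg)).congr (fun p hp => ?_)
    fun p hp => ?_
  · obtain ⟨h1, h2, h3⟩ := key p hp
    have h4 : Q.evalz p = c * p.2 + d := rfl
    simp only [Form.evalz_lin, h3, h4]
    field_simp
    ring
  · obtain ⟨h1, h2, h3⟩ := key p hp
    have h4 : deriv a p.2 = (α * d - β * c) / (c * p.2 + d) ^ 2 := by
      rw [funext H]
      exact (hasDerivAt_linearFractional h1).deriv
    have h5 : Q.evalζ p = c * p.1 - α := by simp only [hQ, Form.evalζ]; ring
    have h6 : α = a p.2 * c + (α * d - β * c) / (c * p.2 + d) := by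
      have h1' : p.2 * c + d ≠ 0 := by rwa [mul_comm]
      rw [H]
      field_simp
      ring
    have h7 : a p.2 - p.1 ≠ 0 := by rwa [← neg_sub, neg_ne_zero]
    simp only [Form.evalζ_lin, Form.eval_lin, h3, h4, h5]
    rw [show c * p.1 - α = c * (p.1 - a p.2) - (α * d - β * c) / (c * p.2 + d) by
      linear_combination -h6, ← neg_sub p.1 (a p.2)]
    field_simp
    ring

theorem hasDerivAt_list_prod (l : List ℂ) {x : ℂ} (h : ∀ r ∈ l, x - r ≠ 0) :
    HasDerivAt (fun x => (l.map fun r => x - r).prod)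
      ((l.map fun r => x - r).prod * (l.map fun r => (x - r)⁻¹).sum) x := by
  induction l with
  | nil => simpa using hasDerivAt_const x (1 : ℂ)
  | cons r l ih =>
    have h1 := ((hasDerivAt_id x).sub_const r).mul (ih fun s hs => h s (by simp [hs]))
    simp only [List.map_cons, List.prod_cons, List.sum_cons]
    refine h1.congr_deriv ?_
    have h2 := h r (by simp)
    simp only [id]
    field_simp

/-- The logarithmic form of `a(ζ) - b(ζ)`. -/
def HasDiff (a b : ℂ → ℂ) (B : Set Form) : Prop :=
  ∀ D ⊆ Reg B, (∀ p ∈ D, DifferentiableAt ℂ a p.2 ∧ DifferentiableAt ℂ b p.2) → ∀ h, Uni B D h →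
    LogForms B D (fun _ => 0) fun p => logDiff a b p.2 * h p

/-- By `exists_sub_eq_quotient` the difference of two distinct letters is a quotient of products of
linear functions of `ζ` over `F`; its logarithmic derivative is the corresponding signed sum. -/
theorem supported_hasDiff (hsqrt : ∀ x : ℂ, x ^ 2 ∈ F → x ∈ F) {a b : ℂ → ℂ} (ha : a ∈ FLT F)
    (hb : b ∈ FLT F) : Supported F (HasDiff a b) := by
  by_cases hab : a = b
  · subst hab
    refine ⟨∅, alphabet_empty, fun B _ D _ _ h _ => LogForms.zero.congr (fun _ _ => rfl) fun p _ => ?_⟩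
    simp [logDiff]
  obtain ⟨c, d, c', d', k, l, hc, hd, hc', hd', hcd, hcd', hk, hl, H⟩ :=
    exists_sub_eq_quotient hsqrt ha hb hab
  refine ⟨_, (Alphabet.biUnion (s := {r | r ∈ l}) (List.finite_toSet l)
    (B := fun r => {Form.lin 1 (-r)}) fun r hr =>
      alphabet_lin F.one_mem (neg_mem (hl r hr)) (Or.inl one_ne_zero)).union
    ((alphabet_lin hc hd hcd).union (alphabet_lin hc' hd' hcd')), fun B hB D hD hdiff h hh => ?_⟩
  have m1 : ∀ r ∈ l, Form.lin 1 (-r) ∈ B := fun r hr =>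
    hB (Or.inl (Set.mem_iUnion₂.2 ⟨r, hr, rfl⟩))
  have m2 : Form.lin c d ∈ B := hB (Or.inr (Or.inl rfl))
  have m3 : Form.lin c' d' ∈ B := hB (Or.inr (Or.inr rfl))
  refine (((LogForms.list_sum l fun r hr => LogForms.single (m1 r hr) hh).add
    (LogForms.single m2 hh.neg)).add (LogForms.single m3 hh.neg)).congr (fun p hp => ?_)
    fun p hp => ?_
  · simp [Form.evalz_lin]
  · have h1 := hD hp _ m2
    have h2 := hD hp _ m3
    have h3 : ∀ r ∈ l, p.2 - r ≠ 0 := fun r hr => by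
      have := hD hp _ (m1 r hr)
      rwa [Form.eval_lin, one_mul, ← sub_eq_add_neg] at this
    rw [Form.eval_lin] at h1 h2
    have hN : ∀ c d : ℂ, HasDerivAt (fun x => c * x + d) c p.2 := fun c d => by
      simpa using ((hasDerivAt_id p.2).const_mul c).add_const d
    have e1 := (((hdiff p hp).1.hasDerivAt.sub (hdiff p hp).2.hasDerivAt).mul
      ((hN c d).mul (hN c' d')))
    have e2 := (hasDerivAt_list_prod l h3).const_mul k
    have e3 : (fun x => k * (l.map fun r => x - r).prod) =ᶠ[𝓝 p.2]
        (a - b) * ((fun x => c * x + d) * fun x => c' * x + d') := by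
      filter_upwards [(hN c d).continuousAt.eventually_ne h1,
        (hN c' d').continuousAt.eventually_ne h2] with x h4 h5
      exact (H x h4 h5).symm
    have e4 := e1.unique (e2.congr_of_eventuallyEq e3.symm)
    have e5 := H p.2 h1 h2
    have h6 : (l.map fun r => p.2 - r).prod ≠ 0 := by
      rw [Ne, List.prod_eq_zero_iff]
      intro h0
      obtain ⟨r, hr, h0⟩ := List.mem_map.1 h0
      exact h3 r hr h0
    have h7 : a p.2 - b p.2 ≠ 0 := by
      intro h0
      rw [h0, zero_mul] at e5
      exact mul_ne_zero hk h6 e5.symm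
    rw [← mul_assoc, ← e5] at e4
    simp only [Form.evalζ_lin, Form.eval_lin, one_mul, ← sub_eq_add_neg, one_div,
      List.sum_map_mul_right, logDiff]
    set σ := (l.map fun r => (p.2 - r)⁻¹).sum
    simp only [Pi.sub_apply, Pi.mul_apply] at e4
    have h8 : (deriv a p.2 - deriv b p.2) / (a p.2 - b p.2) =
        σ - c / (c * p.2 + d) - c' / (c' * p.2 + d') := by
      have h1' : p.2 * c + d ≠ 0 := by rwa [mul_comm]
      have h2' : p.2 * c' + d' ≠ 0 := by rwa [mul_comm]
      field_simp
      linear_combination e4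
    rw [h8]
    ring

/-! ### Hyperlogarithms belong to the class -/

/-- Strong induction on the total length: the differential equations express both derivatives
through products of smaller total length, multiplied by logarithmic forms of constants, letters and
differences of letters. The product of the two hyperlogarithms is treated as a whole, so that
closure of the class under multiplication is not needed. -/
theorem uni_hyperlog {S : Set (ℂ → ℂ)} {C : Set ℂ} {ε : ℝ} (hε : NiceRadius S C ε)
    (hreg : baseRegion ε ⊆ Reg B) (h1 : ∀ c ∈ C, HasConst c B) (h2 : ∀ a ∈ S, HasLetter a B)
    (h3 : ∀ a ∈ S, ∀ b ∈ insert 0 S, HasDiff a b B) (n : ℕ) (v : List ℂ) (u : List (ℂ → ℂ))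
    (hn : v.length + u.length = n) (hv : ∀ c ∈ v, c ∈ C) (hu : ∀ a ∈ u, a ∈ S) :
    Uni B (baseRegion ε) fun p => hyperlogRev v p.2 * revHyperlog u p := by
  induction n using Nat.strong_induction_on generalizing v u with
  | _ n ih =>
  have hL : ∀ {v : List ℂ}, (∀ c ∈ v, c ∈ C) → ∀ p ∈ baseRegion ε, AnalyticAt ℂ (hyperlogRev v) p.2 :=
    fun hv p hp => hε.analyticAt_hyperlogRev hv hp.2.1 hp.2.2.1
  have hlet : ∀ {u : List (ℂ → ℂ)}, (∀ a ∈ u, a ∈ S) → ∀ a ∈ u, LetterOn (baseRegion ε) a :=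
    fun hu a ha => hε.letter a (hu a ha)
  have hH : ∀ {u : List (ℂ → ℂ)}, (∀ a ∈ u, a ∈ S) → ∀ p ∈ baseRegion ε,
      AnalyticAt ℂ (revHyperlog u) p :=
    fun hu p hp => analyticAt_revHyperlog hε.logDomain (hlet hu) hp
  refine .of_logForms (fun p hp => (analyticAt_comp_snd (hL hv p hp)).mul (hH hu p hp)) ?_
  have hbar : LogForms B (baseRegion ε) (fun _ => 0)
      fun p => deriv (hyperlogRev v) p.2 * revHyperlog u p := by
    cases v with
    | nil =>
      refine LogForms.zero.congr (fun _ _ => rfl) fun p _ => ?_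
      have : deriv (hyperlogRev []) p.2 = 0 := by
        change deriv (fun _ => (1 : ℂ)) p.2 = 0
        simp
      rw [this, zero_mul]
    | cons c v =>
      have hv' : ∀ d ∈ v, d ∈ C := fun d hd => hv d (by simp [hd])
      refine (h1 c (hv c (by simp)) _ hreg _ (ih _ ?_ v u rfl hv' hu)).congr (fun _ _ => rfl)
        fun p hp => ?_
      · rw [← hn]
        simp
      · beta_reduce
        rw [(hε.hasDerivAt_hyperlogRev_cons hv hp.2.1 hp.2.2.1).deriv]
        ring
  have hpdζ : ∀ p ∈ baseRegion ε, pdζ (fun p => hyperlogRev v p.2 * revHyperlog u p) p =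
      deriv (hyperlogRev v) p.2 * revHyperlog u p + hyperlogRev v p.2 * pdζ (revHyperlog u) p :=
    fun p hp => ((hL hv p hp).differentiableAt.hasDerivAt.mul (hasDerivAt_pdζ (hH hu p hp))).deriv
  have hpdz : ∀ p ∈ baseRegion ε, pdz (fun p => hyperlogRev v p.2 * revHyperlog u p) p =
      hyperlogRev v p.2 * pdz (revHyperlog u) p :=
    fun p hp => ((hasDerivAt_pdz (hH hu p hp)).const_mul (hyperlogRev v p.2)).deriv
  cases u with
  | nil =>
    have e1 : ∀ p, pdz (revHyperlog []) p = 0 := fun p => by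
      change deriv (fun _ => (1 : ℂ)) _ = 0
      simp
    have e2 : ∀ p, pdζ (revHyperlog []) p = 0 := fun p => by
      change deriv (fun _ => (1 : ℂ)) _ = 0
      simp
    refine hbar.congr (fun p hp => ?_) fun p hp => ?_
    · rw [hpdz p hp, e1, mul_zero]
    · rw [hpdζ p hp, e2, mul_zero, add_zero]
  | cons a u =>
    have hu' : ∀ b ∈ u, b ∈ S := fun b hb => hu b (by simp [hb])
    have hker := h2 a (hu a (by simp)) _ hreg _ (ih _ (by rw [← hn]; simp) v u rfl hv hu')
    -- These terms contribute to the `ζ`-component only.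
    have hlow : LogForms B (baseRegion ε)
        (fun p => ((lowerTerms (a :: u)).map fun _ => (0 : ℂ)).sum) fun p =>
        ((lowerTerms (a :: u)).map fun x =>
          x.1 p.2 * (hyperlogRev v p.2 * revHyperlog x.2 p)).sum := by
      refine LogForms.list_sum _ fun x hx => ?_
      obtain ⟨a', ha', b', hb', k, hk⟩ := coeff_of_mem_lowerTerms hx
      have ha'S := hu a' ha'
      have hb'S : b' ∈ insert 0 S := hb'.imp id (hu b')
      have hb'd : ∀ p ∈ baseRegion ε, DifferentiableAt ℂ b' p.2 := by
        intro p hp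
        rcases hb' with rfl | hb'
        · exact differentiableAt_const 0
        · exact ((hε.letter b' (hu b' hb')).analytic p hp).differentiableAt
      have hx2 := ih _ (by rw [← hn, ← length_of_mem_lowerTerms hx]; omega) v x.2 rfl hv
        fun b hb => hu b (mem_of_mem_lowerTerms hx hb)
      refine (h3 a' ha'S b' hb'S _ hreg (fun p hp =>
        ⟨((hε.letter a' ha'S).analytic p hp).differentiableAt, hb'd p hp⟩) _
        (hx2.const_mul k)).congr (fun _ _ => rfl) fun p _ => ?_
      rw [hk]
      ring
    refine ((hker.add hlow).add hbar).congr (fun p hp => ?_) fun p hp => ?_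
    · rw [hpdz p hp, show pdz (revHyperlog (a :: u)) p = _ from
        (hasDerivAt_revHyperlog_cons hε.logDomain (hlet hu) hp).deriv]
      simp
      ring
    · rw [hpdζ p hp, pdζ_revHyperlog_cons hε.logDomain (hlet hu)
        (fun b hb c hc => hε.sep b (hu b hb) c (hu c hc)) hp]
      have e : ((lowerTerms (a :: u)).map fun x =>
          x.1 p.2 * (hyperlogRev v p.2 * revHyperlog x.2 p)).sum =
          hyperlogRev v p.2 * evalTerms (lowerTerms (a :: u)) p := by
        rw [evalTerms, ← List.sum_map_mul_left]
        refine congrArg List.sum (List.map_congr_left fun x _ => ?_)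
        ring
      beta_reduce
      rw [e]
      ring

end
end GenHyperlog

/-! ### Generalized hyperlogarithms as combinations of iterated integrals -/

namespace GenHyperlog
noncomputable section

variable {F : Subfield ℂ} {B : Set Form} {D U : Set (ℂ × ℂ)} {f g : ℂ × ℂ → ℂ} {p : ℂ × ℂ}
  {rat : Prop}

theorem Comb.add (hf : Comb rat B D f) (hg : Comb rat B D g) : Comb rat B D fun p => f p + g p := by
  obtain ⟨l, hl, H⟩ := hf
  obtain ⟨l', hl', H'⟩ := hg
  refine ⟨l ++ l', fun x hx => ?_, fun p hp => ?_⟩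
  · rcases List.mem_append.1 hx with hx | hx
    · exact hl x hx
    · exact hl' x hx
  · simp [H p hp, H' p hp]

theorem Comb.mul_left {r : ℂ × ℂ → ℂ} (hr : r ∈ coeffRing rat B) (hg : Comb rat B D g) :
    Comb rat B D fun p => r p * g p := by
  obtain ⟨l, hl, H⟩ := hg
  refine ⟨l.map fun x => (r * x.1, x.2), fun x hx => ?_, fun p hp => ?_⟩
  · obtain ⟨y, hy, rfl⟩ := List.mem_map.1 hx
    exact ⟨mul_mem hr (hl y hy).1, (hl y hy).2⟩
  · beta_reduce
    rw [H p hp, List.map_map, ← List.sum_map_mul_left]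
    refine congrArg List.sum (List.map_congr_left fun x _ => ?_)
    simp only [Function.comp_apply, Pi.mul_apply]
    ring

theorem Uni.comb (h : Uni B D g) : Comb rat B D g :=
  ⟨[(1, g)], by
    simp only [List.mem_singleton, forall_eq]
    exact ⟨one_mem _, h⟩, fun p _ => by simp⟩

/-- The germ has a representative that is a combination of functions of the class. -/
def HasComb (F : Subfield ℂ) (rat : Prop) (f : G) : Prop :=
  ∃ B, Alphabet F B ∧ ∃ ε > 0, baseRegion ε ⊆ Reg B ∧
    ∃ f₀, germ f₀ = f ∧ Comb rat B (baseRegion ε) f₀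

theorem Reg_union {B' : Set Form} : Reg (B ∪ B') = Reg B ∩ Reg B' := by
  ext p
  simp only [Reg, Set.mem_union, Set.mem_ofPred_eq, Set.mem_inter_iff, or_imp, forall_and]

theorem HasComb.add {f g : G} (hf : HasComb F rat f) (hg : HasComb F rat g) :
    HasComb F rat (f + g) := by
  obtain ⟨B, hB, ε, hε, h1, f, rfl, h2⟩ := hf
  obtain ⟨B', hB', ε', hε', h1', g, rfl, h2'⟩ := hg
  have m := baseRegion_mono (min_le_left ε ε')
  have m' := baseRegion_mono (min_le_right ε ε')
  refine ⟨B ∪ B', hB.union hB', min ε ε', lt_min hε hε', ?_, fun p => f p + g p, rfl,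
    (h2.mono Set.subset_union_left m).add (h2'.mono Set.subset_union_right m')⟩
  rw [Reg_union]
  exact Set.subset_inter (m.trans h1) (m'.trans h1')

theorem Alphabet.exists_baseRegion (hB : Alphabet F B) : ∃ ε > 0, baseRegion ε ⊆ Reg B := by
  obtain ⟨ε, hε, h⟩ := base_hasBasis.eventually_iff.1 hB.eventually_base
  exact ⟨ε, hε, fun p hp => h hp⟩

theorem HasComb.mul_left {B : Set Form} (hB : Alphabet F B) {r : ℂ × ℂ → ℂ}
    (hr : r ∈ coeffRing rat B) {f : G} (hf : HasComb F rat f) : HasComb F rat (germ r * f) := by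
  obtain ⟨B', hB', ε, hε, h1, f, rfl, h2⟩ := hf
  obtain ⟨ε', hε', h3⟩ := hB.exists_baseRegion
  have m := baseRegion_mono (min_le_left ε ε')
  have m' := baseRegion_mono (min_le_right ε ε')
  refine ⟨B' ∪ B, hB'.union hB, min ε ε', lt_min hε hε', ?_, fun p => r p * f p, rfl,
    (h2.mono Set.subset_union_left m).mul_left (coeffRing_mono Set.subset_union_right hr)⟩
  rw [Reg_union]
  exact Set.subset_inter (m.trans h1) (m'.trans h3)

/-- `1 / (z - β(ζ))` is the denominator `c ζ + d` of `β` divided by a bi-affine form. -/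
theorem exists_coeffRing_of_mem_regular (hconj : ∀ x ∈ F, starRingEnd ℂ x ∈ F) {r : G}
    (hr : r ∈ regular (FLT F)) :
    ∃ B, Alphabet F B ∧ ∃ r₀ ∈ coeffRing True B, germ r₀ = r := by
  induction hr using Algebra.adjoin_induction with
  | mem x hx =>
    obtain ((rfl | rfl) | ⟨β, hβ, rfl⟩) | ⟨c, hc, rfl⟩ := hx
    · exact ⟨∅, alphabet_empty, _, Algebra.subset_adjoin ⟨trivial, Or.inl rfl⟩, rfl⟩
    · exact ⟨∅, alphabet_empty, _, Algebra.subset_adjoin ⟨trivial, Or.inr (Or.inl rfl)⟩, rfl⟩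
    · obtain ⟨a, ha, b, hb, c, hc, d, hd, hcd, -, H⟩ := exists_coeffs_of_mem_FLT hβ
      have hQ : Alphabet F {(⟨c, d, -a, -b⟩ : Form)} := ⟨Set.finite_singleton _, by
        rintro _ rfl
        exact ⟨hc, hd, neg_mem ha, neg_mem hb⟩, by
        rintro _ rfl
        rcases hcd with h | h
        · exact Or.inl h
        · exact Or.inr (Or.inl h)⟩
      refine ⟨_, hQ, _, mul_mem (eval_mem_coeffRing trivial (Form.lin c d))
        (inv_eval_mem_coeffRing trivial rfl), germ_congr ?_⟩
      filter_upwards [eventually_base_linear_ne_zero hcd] with p hp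
      have e : (⟨c, d, -a, -b⟩ : Form).eval p = (c * p.2 + d) * (p.1 - β p.2) := by
        rw [H, mul_sub, mul_div_cancel₀ _ hp]
        simp only [Form.eval]
        ring
      rw [Pi.mul_apply, Form.eval_lin, e, mul_inv, mul_inv_cancel_left₀ hp]
    · have hcF : c ∈ F := by
        rw [← SetLike.mem_coe, ← conjConsts_FLT hconj]
        exact hc
      refine ⟨_, alphabet_lin F.one_mem (neg_mem hcF) (Or.inl one_ne_zero), _,
        inv_eval_mem_coeffRing trivial rfl, germ_congr (Eventually.of_forall fun p => ?_)⟩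
      rw [Form.eval_lin, one_mul, sub_eq_add_neg]
  | algebraMap c =>
    exact ⟨∅, alphabet_empty, _, (coeffRing True ∅).algebraMap_mem c, (algebraMap_G c).symm⟩
  | add x y _ _ hx hy =>
    obtain ⟨B, hB, x, hx, rfl⟩ := hx
    obtain ⟨B', hB', y, hy, rfl⟩ := hy
    exact ⟨_, hB.union hB', _, add_mem (coeffRing_mono Set.subset_union_left hx)
      (coeffRing_mono Set.subset_union_right hy), rfl⟩
  | mul x y _ _ hx hy =>
    obtain ⟨B, hB, x, hx, rfl⟩ := hx
    obtain ⟨B', hB', y, hy, rfl⟩ := hy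
    exact ⟨_, hB.union hB', _, mul_mem (coeffRing_mono Set.subset_union_left hx)
      (coeffRing_mono Set.subset_union_right hy), rfl⟩

theorem hasComb_zero : HasComb F rat 0 :=
  ⟨∅, alphabet_empty, 1, one_pos, by simp [Reg], fun _ => 0, rfl, .const 0⟩

/-- Finitely many letters and constants need finitely many forms. `Supported` merges the alphabets
into one, and the radius is shrunk until no form vanishes on the base region and the letters are
separated. -/
theorem hasComb_generator (hsqrt : ∀ x : ℂ, x ^ 2 ∈ F → x ∈ F) {v : List ℂ} {u : List (ℂ → ℂ)}
    (hv : ∀ c ∈ v, c ∈ F) (hu : ∀ a ∈ u, a ∈ FLT F) : HasComb F rat (germBar v * germZ u) := by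
  have hS : {a | a ∈ u}.Finite := List.finite_toSet u
  have hC : {c | c ∈ v}.Finite := List.finite_toSet v
  have h0 : (0 : ℂ → ℂ) ∈ FLT F := const_mem_FLT F.zero_mem
  obtain ⟨B, hB, H⟩ := ((Supported.forall hC fun c hc => supported_hasConst (hv c hc)).and
    (Supported.forall hS fun a ha => supported_hasLetter (hu a ha))).and
    (Supported.forall hS fun a ha => Supported.forall (hS.insert 0) fun b hb =>
      supported_hasDiff hsqrt (hu a ha) (hb.elim (fun h => h ▸ h0) fun h => hu b h))
  obtain ⟨⟨h1, h2⟩, h3⟩ := H B le_rfl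
  obtain ⟨ε₀, hε₀, h4⟩ := hB.exists_baseRegion
  obtain ⟨ε, h5, h6⟩ := ((eventually_niceRadius hS hu hC).and (Ioo_mem_nhdsGT hε₀)).exists
  have h7 := (baseRegion_mono h6.2.le).trans h4
  exact ⟨B, hB, ε, h5.pos, h7, _, rfl, (uni_hyperlog h5 h7 h1 h2 h3 _ v u rfl (fun _ => id)
    fun _ => id).comb⟩

theorem hasComb_of_mem_GHC (hconj : ∀ x ∈ F, starRingEnd ℂ x ∈ F)
    (hsqrt : ∀ x : ℂ, x ^ 2 ∈ F → x ∈ F) {f : G} (hf : f ∈ GHC (FLT F)) : HasComb F rat f := by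
  refine GHC_induction (P := HasComb F rat) hf hasComb_zero (fun _ _ => HasComb.add)
    (fun c x hx => ?_) fun v u hv hu => hasComb_generator hsqrt (fun c hc => ?_) hu
  · rw [Algebra.smul_def, algebraMap_G]
    exact hx.mul_left alphabet_empty ((coeffRing rat ∅).algebraMap_mem c)
  · rw [← SetLike.mem_coe, ← conjConsts_FLT hconj]
    exact hv c hc

theorem hasComb_of_mem_GH (hconj : ∀ x ∈ F, starRingEnd ℂ x ∈ F)
    (hsqrt : ∀ x : ℂ, x ^ 2 ∈ F → x ∈ F) {f : G} (hf : f ∈ GH (FLT F)) : HasComb F True f := by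
  refine GH_induction (P := HasComb F True) hf hasComb_zero (fun _ _ => HasComb.add)
    (fun r hr x hx => ?_) fun v u hv hu => hasComb_generator hsqrt (fun c hc => ?_) hu
  · obtain ⟨B, hB, r, hr', rfl⟩ := exists_coeffRing_of_mem_regular hconj hr
    exact hx.mul_left hB hr'
  · rw [← SetLike.mem_coe, ← conjConsts_FLT hconj]
    exact hv c hc

end
end GenHyperlog

namespace GenHyperlog
noncomputable section

variable {F : Subfield ℂ} {B : Set Form} {D U : Set (ℂ × ℂ)} {f g : ℂ × ℂ → ℂ} {p : ℂ × ℂ}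
  {rat : Prop} {S : Set (ℂ → ℂ)} {C : Set ℂ} {ε : ℝ}

/-! ### Spaces of functions that are spanned by products of hyperlogarithms -/

/-- The span of the products `L_v(ζ) L_{w(ζ)}(z)` as functions. -/
def wordSpan (S : Set (ℂ → ℂ)) (C : Set ℂ) : Submodule ℂ (ℂ × ℂ → ℂ) :=
  Submodule.span ℂ {f | ∃ v u, (∀ c ∈ v, c ∈ C) ∧ (∀ a ∈ u, a ∈ S) ∧
    f = fun p => hyperlogRev v p.2 * revHyperlog u p}

/-- The span of the `L_v(ζ)` as functions. -/
def barSpan (C : Set ℂ) : Submodule ℂ (ℂ × ℂ → ℂ) :=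
  Submodule.span ℂ {f | ∃ v, (∀ c ∈ v, c ∈ C) ∧ f = fun p => hyperlogRev v p.2}

theorem barSpan_le_wordSpan : barSpan C ≤ wordSpan S C := by
  refine Submodule.span_le.2 ?_
  rintro _ ⟨v, hv, rfl⟩
  refine Submodule.subset_span ⟨v, [], hv, by simp, ?_⟩
  funext p
  exact (mul_one _).symm

theorem const_mem_wordSpan (c : ℂ) : (fun _ => c) ∈ wordSpan S C := by
  have h : (fun p => hyperlogRev [] p.2 * revHyperlog [] p) ∈ wordSpan S C :=
    Submodule.subset_span ⟨[], [], by simp, by simp, rfl⟩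
  convert (wordSpan S C).smul_mem c h using 1
  funext p
  change c = c * (1 * 1)
  ring

theorem NiceRadius.analyticAt_snd (hε : NiceRadius S C ε) {v : List ℂ} (hv : ∀ c ∈ v, c ∈ C)
    (hp : p ∈ baseRegion ε) : AnalyticAt ℂ (hyperlogRev v) p.2 :=
  hε.analyticAt_hyperlogRev hv hp.2.1 hp.2.2.1

theorem NiceRadius.letterOn (hε : NiceRadius S C ε) {u : List (ℂ → ℂ)} (hu : ∀ a ∈ u, a ∈ S) :
    ∀ a ∈ u, LetterOn (baseRegion ε) a := fun a ha => hε.letter a (hu a ha)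

theorem analyticAt_of_mem_wordSpan (hε : NiceRadius S C ε) (hf : f ∈ wordSpan S C)
    (hp : p ∈ baseRegion ε) : AnalyticAt ℂ f p := by
  induction hf using Submodule.span_induction with
  | mem f hf =>
    obtain ⟨v, u, hv, hu, rfl⟩ := hf
    exact (analyticAt_comp_snd (hε.analyticAt_snd hv hp)).mul
      (analyticAt_revHyperlog hε.logDomain (hε.letterOn hu) hp)
  | zero => exact analyticAt_const
  | add f g _ _ hf hg => exact hf.add hg
  | smul c f _ hf => exact analyticAt_const.mul hf

theorem LogExpansion.const_mul {P : Polynomial ℂ} (h : LogExpansion f p P) (c : ℂ) :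
    LogExpansion (fun q => c * f q) p (Polynomial.C c * P) :=
  (LogExpansion.of_snd (fun _ => c) p).mul h

theorem logExpansion_zero (p : ℂ × ℂ) : LogExpansion (fun _ => 0) p 0 :=
  (LogExpansion.of_snd (fun _ => 0) p).congr (fun _ _ => rfl) |> fun h => by simpa using h

/-- Only the empty word in `z` has a nonzero regularized value at `z = 0`, so the constant term is a
combination of the `L_v(ζ)`. -/
theorem exists_logExpansion_of_mem_wordSpan (hε : NiceRadius S C ε) (hf : f ∈ wordSpan S C) :
    ∃ w ∈ barSpan C, ∀ p ∈ baseRegion ε, ∃ P, LogExpansion f p P ∧ P.coeff 0 = w p := by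
  induction hf using Submodule.span_induction with
  | mem f hf =>
    obtain ⟨v, u, hv, hu, rfl⟩ := hf
    by_cases hu0 : u = []
    · subst hu0
      refine ⟨_, Submodule.subset_span ⟨v, hv, rfl⟩, fun p _ =>
        ⟨_, (LogExpansion.of_snd (hyperlogRev v) p).congr fun t _ => (mul_one _).symm, ?_⟩⟩
      simp
    · refine ⟨0, zero_mem _, fun p hp => ?_⟩
      obtain ⟨c, hc⟩ := exists_logExpansion_revHyperlog hε.logDomain (hε.letterOn hu) hp
      refine ⟨_, (LogExpansion.of_snd (hyperlogRev v) p).mul hc, ?_⟩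
      have h0 : (Polynomial.X ^ u.length : Polynomial ℂ).coeff 0 = 0 := by
        rw [Polynomial.coeff_X_pow, if_neg]
        exact fun h => hu0 (List.length_eq_zero_iff.1 h.symm)
      simp [Polynomial.mul_coeff_zero, h0]
  | zero => exact ⟨0, zero_mem _, fun p _ => ⟨0, logExpansion_zero p, by simp⟩⟩
  | add f g _ _ hf hg =>
    obtain ⟨w, hw, hf⟩ := hf
    obtain ⟨w', hw', hg⟩ := hg
    refine ⟨_, add_mem hw hw', fun p hp => ?_⟩
    obtain ⟨P, h1, h2⟩ := hf p hp
    obtain ⟨Q, h3, h4⟩ := hg p hp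
    exact ⟨_, h1.add h3, by simp [h2, h4]⟩
  | smul c f _ hf =>
    obtain ⟨w, hw, hf⟩ := hf
    refine ⟨_, (barSpan C).smul_mem c hw, fun p hp => ?_⟩
    obtain ⟨P, h1, h2⟩ := hf p hp
    exact ⟨_, h1.const_mul c, by simp [h2]⟩

/-- Appending a letter gives a primitive in `z` whose `ζ`-derivative has regularized value `0`. -/
theorem exists_primitive_wordSpan (hε : NiceRadius S C ε) {b : ℂ → ℂ} (hb : b ∈ S)
    (hf : f ∈ wordSpan S C) : ∃ g ∈ wordSpan S C, ∀ p ∈ baseRegion ε,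
      pdz g p = f p / (p.1 - b p.2) ∧ ∃ P, LogExpansion (pdζ g) p P ∧ P.coeff 0 = 0 := by
  have hA := fun {f p} => analyticAt_of_mem_wordSpan (f := f) (p := p) hε
  induction hf using Submodule.span_induction with
  | mem f hf =>
    obtain ⟨v, u, hv, hu, rfl⟩ := hf
    have hu' : ∀ a ∈ b :: u, a ∈ S := by simpa using ⟨hb, hu⟩
    have hl := hε.letterOn hu'
    refine ⟨_, Submodule.subset_span ⟨v, b :: u, hv, hu', rfl⟩, fun p hp => ⟨?_, ?_⟩⟩
    · refine ((hasDerivAt_revHyperlog_cons hε.logDomain hl hp).const_mul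
        (hyperlogRev v p.2)).deriv.trans ?_
      ring
    -- Neither term of the Leibniz rule has a constant term: the word `b :: u` is nonempty, and its
    -- `ζ`-derivative decays at the origin.
    · obtain ⟨c, hc⟩ := exists_logExpansion_revHyperlog hε.logDomain hl hp
      refine ⟨_, (((LogExpansion.of_snd (deriv (hyperlogRev v)) p).mul hc).add
        ((LogExpansion.of_snd (hyperlogRev v) p).mul
        (logExpansion_pdζ_revHyperlog hε.logDomain hl hp))).congr fun t ht => ?_, ?_⟩
      · have hr := hε.logDomain.radial p hp t ht
        exact ((hε.analyticAt_snd hv hr).differentiableAt.hasDerivAt.mul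
          (hasDerivAt_pdζ (analyticAt_revHyperlog hε.logDomain hl hr))).deriv.symm
      · simp [Polynomial.mul_coeff_zero]
  | zero =>
    refine ⟨0, zero_mem _, fun p _ => ⟨by simp [pdz], 0, ?_, by simp⟩⟩
    exact (logExpansion_zero p).congr fun t _ => by simp [pdζ]
  | add f f' _ _ hf hf' =>
    obtain ⟨g, hg, h⟩ := hf
    obtain ⟨g', hg', h'⟩ := hf'
    refine ⟨_, add_mem hg hg', fun p hp => ?_⟩
    obtain ⟨h1, P, h2, h3⟩ := h p hp
    obtain ⟨h1', P', h2', h3'⟩ := h' p hp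
    refine ⟨?_, P + P', (h2.add h2').congr fun t ht => ?_, by simp [h3, h3']⟩
    · refine (pdz_add (hA hg hp) (hA hg' hp)).trans ?_
      rw [h1, h1', Pi.add_apply, add_div]
    · have hr := hε.logDomain.radial p hp t ht
      exact (pdζ_add (hA hg hr) (hA hg' hr)).symm
  | smul c f _ hf =>
    obtain ⟨g, hg, h⟩ := hf
    refine ⟨_, (wordSpan S C).smul_mem c hg, fun p hp => ?_⟩
    obtain ⟨h1, P, h2, h3⟩ := h p hp
    refine ⟨?_, Polynomial.C c * P, (h2.const_mul c).congr fun t ht => ?_, by simp [h3]⟩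
    · refine ((hasDerivAt_pdz (hA hg hp)).const_mul c).deriv.trans ?_
      rw [h1, Pi.smul_apply, smul_eq_mul, mul_div_assoc]
    · have hr := hε.logDomain.radial p hp t ht
      exact ((hasDerivAt_pdζ (hA hg hr)).const_mul c).deriv.symm

theorem exists_primitive_barSpan (hε : NiceRadius S C ε) {c : ℂ} (hc : c ∈ C)
    (hf : f ∈ barSpan C) : ∃ g ∈ barSpan C, ∀ p ∈ baseRegion ε,
      pdz g p = 0 ∧ pdζ g p = f p / (p.2 - c) := by
  have hA := fun {f p} (hf : f ∈ barSpan C) =>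
    analyticAt_of_mem_wordSpan (f := f) (p := p) hε (barSpan_le_wordSpan hf)
  induction hf using Submodule.span_induction with
  | mem f hf =>
    obtain ⟨v, hv, rfl⟩ := hf
    have hv' : ∀ a ∈ c :: v, a ∈ C := by simpa using ⟨hc, hv⟩
    exact ⟨_, Submodule.subset_span ⟨c :: v, hv', rfl⟩, fun p hp => ⟨by simp [pdz],
      (hε.hasDerivAt_hyperlogRev_cons hv' hp.2.1 hp.2.2.1).deriv⟩⟩
  | zero => exact ⟨0, zero_mem _, fun p _ => ⟨by simp [pdz], by simp [pdζ]⟩⟩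
  | add f f' _ _ hf hf' =>
    obtain ⟨g, hg, h⟩ := hf
    obtain ⟨g', hg', h'⟩ := hf'
    refine ⟨_, add_mem hg hg', fun p hp => ⟨?_, ?_⟩⟩
    · refine (pdz_add (hA hg hp) (hA hg' hp)).trans ?_
      rw [(h p hp).1, (h' p hp).1, add_zero]
    · refine (pdζ_add (hA hg hp) (hA hg' hp)).trans ?_
      rw [(h p hp).2, (h' p hp).2, Pi.add_apply, add_div]
  | smul k f _ hf =>
    obtain ⟨g, hg, h⟩ := hf
    refine ⟨_, (barSpan C).smul_mem k hg, fun p hp => ⟨?_, ?_⟩⟩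
    · refine ((hasDerivAt_pdz (hA hg hp)).const_mul k).deriv.trans ?_
      rw [(h p hp).1, mul_zero]
    · refine ((hasDerivAt_pdζ (hA hg hp)).const_mul k).deriv.trans ?_
      rw [(h p hp).2, Pi.smul_apply, smul_eq_mul, mul_div_assoc]

/-- The form has its zero among the letters, and its boundary forms at `z = 0` and `z = ∞` have no
zero in the base region and their zero among the constants. -/
structure Adapted (S : Set (ℂ → ℂ)) (C : Set ℂ) (ε : ℝ) (Q : Form) : Prop where
  nonzero : Q.Nonzero
  eval_ne_zero : ∀ p ∈ baseRegion ε, Q.eval p ≠ 0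
  letter : Q.α ≠ 0 ∨ Q.β ≠ 0 →
    ∃ b ∈ S, ∀ p ∈ baseRegion ε, Q.evalz p ≠ 0 ∧ Q.eval p = Q.evalz p * (p.1 - b p.2)
  linear : ∀ m n, m = Q.α ∧ n = Q.β ∨ m = Q.γ ∧ n = Q.δ → m ≠ 0 ∨ n ≠ 0 →
    (∀ p ∈ baseRegion ε, m * p.2 + n ≠ 0) ∧ (m ≠ 0 → -n / m ∈ C)

/-- The regularized value of the `ζ`-component of `dQ / Q` at `z = 0`. -/
theorem Adapted.exists_logExpansion (hε : NiceRadius S C ε) {Q : Form} (hQ : Adapted S C ε Q) :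
    ∃ m n, (m ≠ 0 → -n / m ∈ C) ∧ ∀ p ∈ baseRegion ε,
      LogExpansion (fun q => Q.evalζ q / Q.eval q) p (Polynomial.C (m / (m * p.2 + n))) := by
  by_cases h : Q.γ ≠ 0 ∨ Q.δ ≠ 0
  · obtain ⟨h1, h2⟩ := hQ.linear _ _ (Or.inr ⟨rfl, rfl⟩) h
    refine ⟨_, _, h2, fun p hp => ?_⟩
    have e1 : Q.evalζ (0, p.2) = Q.γ := by simp [Form.evalζ]
    have e2 : Q.eval (0, p.2) = Q.γ * p.2 + Q.δ := by simp [Form.eval]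
    have hd : DifferentiableAt ℂ (fun z => Q.evalζ (z, p.2) / Q.eval (z, p.2)) 0 := by
      refine DifferentiableAt.div ?_ ?_ (by rw [e2]; exact h1 p hp)
      · exact (Q.analyticAt_evalζ (0, p.2)).differentiableAt_fst
      · exact (Q.analyticAt_eval (0, p.2)).differentiableAt_fst
    have h3 := LogExpansion.of_differentiableAt (f := fun q => Q.evalζ q / Q.eval q)
      (hε.logDomain.ne_zero hp) (hε.logDomain.norm_le p hp) hd
    simp only [e1, e2] at h3
    exact h3
  -- Here `Q = z (α ζ + β)` vanishes at `z = 0`, but the factor `z` cancels in the `ζ`-component.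
  · push Not at h
    have h' : Q.α ≠ 0 ∨ Q.β ≠ 0 := by simpa [Form.Nonzero, h.1, h.2] using hQ.nonzero
    obtain ⟨h1, h2⟩ := hQ.linear Q.α Q.β (Or.inl ⟨rfl, rfl⟩) h'
    refine ⟨_, _, h2, fun p hp => ?_⟩
    refine (LogExpansion.of_snd (fun ζ => Q.α / (Q.α * ζ + Q.β)) p).congr fun t ht => ?_
    have hr := hε.logDomain.ne_zero (hε.logDomain.radial p hp t ht)
    have h3 := h1 p hp
    have e : Q.eval ((t : ℂ) * p.1, p.2) = (t : ℂ) * p.1 * (Q.α * p.2 + Q.β) := by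
      simp only [Form.eval, h.1, h.2]
      ring
    have e' : Q.evalζ ((t : ℂ) * p.1, p.2) = (t : ℂ) * p.1 * Q.α := by
      simp only [Form.evalζ, h.1]
      ring
    simp only at hr
    rw [e, e', mul_div_mul_left _ _ hr]

theorem exists_primitive_barSpan_linear (hε : NiceRadius S C ε) {m n : ℂ}
    (h2 : m ≠ 0 → -n / m ∈ C) (hf : f ∈ barSpan C) :
    ∃ g ∈ barSpan C, ∀ p ∈ baseRegion ε, pdz g p = 0 ∧ pdζ g p = m / (m * p.2 + n) * f p := by
  by_cases hm : m = 0
  · exact ⟨0, zero_mem _, fun p _ => ⟨by simp [pdz], by simp [pdζ, hm]⟩⟩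
  · obtain ⟨g, hg, h⟩ := exists_primitive_barSpan hε (h2 hm) hf
    refine ⟨g, hg, fun p hp => ⟨(h p hp).1, ?_⟩⟩
    have e : m * p.2 + n = m * (p.2 - -n / m) := by
      field_simp
      ring
    rw [(h p hp).2, e, ← div_div, div_self hm]
    ring

/-- The integral of `f dQ / Q` up to functions of `ζ`. -/
theorem Adapted.exists_primitive (hε : NiceRadius S C ε) {Q : Form} (hQ : Adapted S C ε Q)
    (hf : f ∈ wordSpan S C) : ∃ g ∈ wordSpan S C, ∃ R ∈ barSpan C, ∀ p ∈ baseRegion ε,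
      pdz g p = Q.evalz p / Q.eval p * f p ∧ pdz R p = 0 ∧
      ∃ P, LogExpansion (fun p => Q.evalζ p / Q.eval p * f p - pdζ g p) p P ∧
        P.coeff 0 = pdζ R p := by
  obtain ⟨m, n, h2, h3⟩ := hQ.exists_logExpansion hε
  obtain ⟨w, hw, h4⟩ := exists_logExpansion_of_mem_wordSpan hε hf
  obtain ⟨R, hR, h5⟩ := exists_primitive_barSpan_linear hε h2 hw
  have key : ∃ g ∈ wordSpan S C, ∀ p ∈ baseRegion ε, pdz g p = Q.evalz p / Q.eval p * f p ∧
      ∃ P, LogExpansion (pdζ g) p P ∧ P.coeff 0 = 0 := by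
    by_cases h : Q.α ≠ 0 ∨ Q.β ≠ 0
    · obtain ⟨b, hb, hbQ⟩ := hQ.letter h
      obtain ⟨g, hg, h6⟩ := exists_primitive_wordSpan hε hb hf
      refine ⟨g, hg, fun p hp => ⟨?_, (h6 p hp).2⟩⟩
      rw [(h6 p hp).1, (hbQ p hp).2, ← div_div, div_self (hbQ p hp).1]
      ring
    · push Not at h
      refine ⟨0, zero_mem _, fun p _ => ⟨by simp [pdz, Form.evalz, h.1, h.2], 0, ?_, by simp⟩⟩
      exact (logExpansion_zero p).congr fun t _ => by simp [pdζ]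
  obtain ⟨g, hg, h6⟩ := key
  refine ⟨g, hg, R, hR, fun p hp => ⟨(h6 p hp).1, (h5 p hp).1, ?_⟩⟩
  obtain ⟨P, h7, h8⟩ := h4 p hp
  obtain ⟨P', h9, h10⟩ := (h6 p hp).2
  exact ⟨_, ((h3 p hp).mul h7).sub h9, by
    simp [Polynomial.mul_coeff_zero, h8, h10, (h5 p hp).2]⟩

theorem exists_primitive_of_adapted (hε : NiceRadius S C ε) (l : List (Form × (ℂ × ℂ → ℂ)))
    (hl : ∀ x ∈ l, Adapted S C ε x.1 ∧ x.2 ∈ wordSpan S C) :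
    ∃ g ∈ wordSpan S C, ∃ R ∈ barSpan C, ∀ p ∈ baseRegion ε,
      pdz g p = (l.map fun x => x.1.evalz p / x.1.eval p * x.2 p).sum ∧ pdz R p = 0 ∧
      ∃ P, LogExpansion (fun p => (l.map fun x => x.1.evalζ p / x.1.eval p * x.2 p).sum - pdζ g p)
        p P ∧ P.coeff 0 = pdζ R p := by
  have hA := fun {f p} => analyticAt_of_mem_wordSpan (f := f) (p := p) hε
  induction l with
  | nil =>
    refine ⟨0, zero_mem _, 0, zero_mem _, fun p _ => ⟨by simp [pdz], by simp [pdz], 0, ?_, ?_⟩⟩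
    · exact (logExpansion_zero p).congr fun t _ => by simp [pdζ]
    · simp [pdζ]
  | cons x l ih =>
    obtain ⟨g, hg, R, hR, h⟩ := ih fun y hy => hl y (by simp [hy])
    obtain ⟨h1, h2⟩ := hl x (by simp)
    obtain ⟨g', hg', R', hR', h'⟩ := h1.exists_primitive hε h2
    refine ⟨_, add_mem hg' hg, _, add_mem hR' hR, fun p hp => ?_⟩
    obtain ⟨a1, a2, P, a3, a4⟩ := h p hp
    obtain ⟨b1, b2, P', b3, b4⟩ := h' p hp
    have e1 := pdz_add (hA hg' hp) (hA hg hp)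
    have e2 := pdz_add (hA (barSpan_le_wordSpan hR') hp) (hA (barSpan_le_wordSpan hR) hp)
    have e3 := pdζ_add (hA (barSpan_le_wordSpan hR') hp) (hA (barSpan_le_wordSpan hR) hp)
    refine ⟨?_, ?_, P' + P, (b3.add a3).congr fun t ht => ?_, ?_⟩
    · rw [List.map_cons, List.sum_cons, ← b1, ← a1]
      exact e1
    · exact e2.trans (by rw [a2, b2, add_zero])
    · have hr := hε.logDomain.radial p hp t ht
      have e4 := pdζ_add (hA hg' hr) (hA hg hr)
      simp only [List.map_cons, List.sum_cons]
      refine Eq.trans ?_ (congrArg (fun y => _ - y) e4.symm)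
      ring
    · rw [Polynomial.coeff_add, a4, b4]
      exact e3.symm

/-- Functions of the class on a subset of the base region are combinations of hyperlogarithms. -/
theorem Uni.exists_mem_wordSpan (hε : NiceRadius S C ε) (hB : ∀ Q ∈ B, Adapted S C ε Q)
    (hD : IsOpen D) (hDc : IsPreconnected D) (hne : D.Nonempty) (hDε : D ⊆ baseRegion ε)
    (h : Uni B D g) : ∃ f ∈ wordSpan S C, Set.EqOn g f D := by
  have hA := fun {f p} => analyticAt_of_mem_wordSpan (f := f) (p := p) hε
  induction h with
  | mk g l hg hlB _ hz hζ ih =>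
    have hx : ∀ x : Form × (ℂ × ℂ → ℂ), ∃ h', x ∈ l → h' ∈ wordSpan S C ∧ Set.EqOn x.2 h' D := by
      intro x
      by_cases hx : x ∈ l
      · obtain ⟨h', H⟩ := ih x hx
        exact ⟨h', fun _ => H⟩
      · exact ⟨0, fun h => absurd h hx⟩
    choose ext hext using hx
    set l' := l.map fun x => (x.1, ext x) with hl'
    have hl'' : ∀ x ∈ l', Adapted S C ε x.1 ∧ x.2 ∈ wordSpan S C := by
      intro x hx
      obtain ⟨y, hy, rfl⟩ := List.mem_map.1 hx
      exact ⟨hB _ (hlB y hy), (hext y hy).1⟩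
    obtain ⟨P, hP, R, hR, H⟩ := exists_primitive_of_adapted hε l' hl''
    have hR' := barSpan_le_wordSpan (S := S) hR
    have hzD : ∀ p ∈ D, pdz g p = pdz P p := by
      intro p hp
      rw [(H p (hDε hp)).1, hz p hp, hl', List.map_map]
      refine congrArg List.sum (List.map_congr_left fun x hx => ?_)
      simp only [Function.comp_apply, (hext x hx).2 hp]
    set b : ℂ × ℂ → ℂ := fun p => (l'.map fun x => x.1.evalζ p / x.1.eval p * x.2 p).sum with hb
    have hζD : ∀ p ∈ D, pdζ g p = b p := by
      intro p hp
      simp only [hζ p hp, hb, hl', List.map_map]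
      refine congrArg List.sum (List.map_congr_left fun x hx => ?_)
      simp only [Function.comp_apply, (hext x hx).2 hp]
    -- The error in the `ζ`-component after integration in `z`. Since `dg` is closed, `E` is
    -- independent of `z` on `D`, and by the identity theorem on the base region, where the rays
    -- towards `z = 0` are available. So `E` equals its regularized value, which `R` integrates.
    set E : ℂ × ℂ → ℂ := fun p => b p - pdζ P p with hE
    have hbA : ∀ p ∈ baseRegion ε, AnalyticAt ℂ b p := fun p hp => analyticAt_list_sum l'
      fun x hx => ((x.1.analyticAt_evalζ p).div (x.1.analyticAt_eval p)
        ((hl'' x hx).1.eval_ne_zero p hp)).mul (hA (hl'' x hx).2 hp)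
    have hEA : ∀ p ∈ baseRegion ε, AnalyticAt ℂ E p := fun p hp => (hbA p hp).sub (hA hP hp).pdζ
    have hψA : ∀ p ∈ D, AnalyticAt ℂ (fun p => g p - P p) p := fun p hp =>
      (hg p hp).sub (hA hP (hDε hp))
    have hψz : ∀ p ∈ D, pdz (fun p => g p - P p) p = 0 := fun p hp => by
      rw [pdz_sub (hg p hp) (hA hP (hDε hp)), hzD p hp, sub_self]
    have hψζ : ∀ p ∈ D, pdζ (fun p => g p - P p) p = E p := fun p hp => by
      rw [pdζ_sub (hg p hp) (hA hP (hDε hp)), hζD p hp]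
    obtain ⟨p₀, hp₀⟩ := hne
    have hEz : Set.EqOn (pdz E) (fun _ => 0) (baseRegion ε) := by
      refine AnalyticOnNhd.eqOn_of_preconnected_of_eventuallyEq (𝕜 := ℂ)
        (fun p hp => (hEA p hp).pdz) (fun p _ => analyticAt_const)
        (isPreconnected_baseRegion hε.pos) (hDε hp₀) ?_
      filter_upwards [hD.mem_nhds hp₀] with p hp
      rw [← pdz_congr (eventually_of_mem (hD.mem_nhds hp) hψζ), pdz_pdζ_comm (hψA p hp),
        pdζ_congr (g := fun _ => 0) (eventually_of_mem (hD.mem_nhds hp) hψz)]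
      simp [pdζ]
    have hER : ∀ p ∈ baseRegion ε, E p = pdζ R p := by
      intro p hp
      obtain ⟨-, -, Q, h1, h2⟩ := H p hp
      rw [← h2]
      refine (hε.logDomain.eq_coeff_of_hasDerivAt_zero (fun q hq => ?_) hp h1).1
      have h3 := hasDerivAt_pdz (hEA q hq)
      rwa [hEz hq] at h3
    set c := g p₀ - P p₀ - R p₀ with hc
    refine ⟨_, add_mem (add_mem hP hR') (const_mem_wordSpan c), fun p hp => ?_⟩
    have h1 : (fun p => g p - P p - R p) p = (fun p => g p - P p - R p) p₀ := by
      refine convex_eq_of_pd_eq_zero hD hDc (fun q hq => (hψA q hq).sub (hA hR' (hDε hq)))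
        (fun q hq => ?_) (fun q hq => ?_) hp hp₀
      · refine (pdz_sub (hψA q hq) (hA hR' (hDε hq))).trans ?_
        rw [hψz q hq, (H q (hDε hq)).2.1, sub_self]
      · refine (pdζ_sub (hψA q hq) (hA hR' (hDε hq))).trans ?_
        rw [hψζ q hq, hER q (hDε hq), sub_self]
    simp only [Pi.add_apply, hc]
    linear_combination h1

/-- Every alphabet is adapted to some letters over `F`. -/
theorem Alphabet.exists_adapted (hB : Alphabet F B) :
    ∃ S C ε, S ⊆ FLT F ∧ C ⊆ (F : Set ℂ) ∧ NiceRadius S C ε ∧ ∀ Q ∈ B, Adapted S C ε Q := by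
  have hb : ∀ Q : Form, ∃ b ∈ FLT F, Q ∈ B → Q.α ≠ 0 ∨ Q.β ≠ 0 →
      ∀ p, Q.evalz p ≠ 0 → Q.eval p = Q.evalz p * (p.1 - b p.2) := by
    intro Q
    by_cases h : Q ∈ B ∧ (Q.α ≠ 0 ∨ Q.β ≠ 0)
    · obtain ⟨b, hb, H⟩ := Q.exists_letter (hB.coeff_mem Q h.1) h.2
      exact ⟨b, hb, fun _ _ => H⟩
    · exact ⟨_, const_mem_FLT F.zero_mem, fun h1 h2 => absurd ⟨h1, h2⟩ h⟩
  choose b hbF hb using hb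
  set S := b '' B with hS
  -- The zeros of the boundary forms at `z = ∞` and `z = 0`. A vanishing leading coefficient only
  -- adds the default value `0` of the division, which is harmless.
  set C := (fun Q : Form => -Q.β / Q.α) '' B ∪ (fun Q : Form => -Q.δ / Q.γ) '' B with hC
  have hSF : S ⊆ FLT F := by
    rintro _ ⟨Q, -, rfl⟩
    exact hbF Q
  have hCF : C ⊆ (F : Set ℂ) := by
    rintro _ (⟨Q, hQ, rfl⟩ | ⟨Q, hQ, rfl⟩)
    · obtain ⟨h1, h2, h3, h4⟩ := hB.coeff_mem Q hQ
      exact F.div_mem (neg_mem h2) h1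
    · obtain ⟨h1, h2, h3, h4⟩ := hB.coeff_mem Q hQ
      exact F.div_mem (neg_mem h4) h3
  have hlin : ∀ m n : ℂ, ∀ᶠ p in base, m ≠ 0 ∨ n ≠ 0 → m * p.2 + n ≠ 0 := by
    intro m n
    by_cases h : m ≠ 0 ∨ n ≠ 0
    · filter_upwards [eventually_base_linear_ne_zero h] with p hp _ using hp
    · exact Eventually.of_forall fun p h' => absurd h' h
  have hev : ∀ᶠ p in base, p ∈ Reg B ∧ ∀ Q ∈ B, (Q.α ≠ 0 ∨ Q.β ≠ 0 → Q.α * p.2 + Q.β ≠ 0) ∧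
      (Q.γ ≠ 0 ∨ Q.δ ≠ 0 → Q.γ * p.2 + Q.δ ≠ 0) :=
    hB.eventually_base.and ((eventually_all_finite hB.finite).2 fun Q _ =>
      (hlin _ _).and (hlin _ _))
  obtain ⟨ε₀, hε₀, h1⟩ := base_hasBasis.eventually_iff.1 hev
  obtain ⟨ε, h2, h3⟩ := ((eventually_niceRadius (hB.finite.image b) hSF
    ((hB.finite.image _).union (hB.finite.image _))).and (Ioo_mem_nhdsGT hε₀)).exists
  have h4 : ∀ p ∈ baseRegion ε, _ := fun p hp => h1 (baseRegion_mono h3.2.le hp)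
  refine ⟨S, C, ε, hSF, hCF, h2, fun Q hQ => ⟨hB.nonzero Q hQ, fun p hp => (h4 p hp).1 Q hQ,
    fun h => ⟨b Q, ⟨Q, hQ, rfl⟩, fun p hp => ?_⟩, ?_⟩⟩
  · have h5 : Q.evalz p ≠ 0 := ((h4 p hp).2 Q hQ).1 h
    exact ⟨h5, hb Q hQ h p h5⟩
  · rintro m n (⟨rfl, rfl⟩ | ⟨rfl, rfl⟩) h
    · exact ⟨fun p hp => ((h4 p hp).2 Q hQ).1 h, fun _ => Or.inl ⟨Q, hQ, rfl⟩⟩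
    · exact ⟨fun p hp => ((h4 p hp).2 Q hQ).2 h, fun _ => Or.inr ⟨Q, hQ, rfl⟩⟩

end
end GenHyperlog

namespace GenHyperlog
noncomputable section

variable {F : Subfield ℂ} {B : Set Form} {D U : Set (ℂ × ℂ)} {g : ℂ × ℂ → ℂ} {p q : ℂ × ℂ}
  {rat : Prop} {S : Set (ℂ → ℂ)} {C : Set ℂ} {ε : ℝ}

/-! ### From local combinations to generalized hyperlogarithms -/

theorem germ_mem_regular_of_mem_coeffRing (hconj : ∀ x ∈ F, starRingEnd ℂ x ∈ F) (hB : Alphabet F B)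
    {r : ℂ × ℂ → ℂ} (hr : r ∈ coeffRing rat B) : germ r ∈ regular (FLT F) := by
  have hbar : regularBar (F : Set ℂ) ≤ regular (FLT F) :=
    conjConsts_FLT hconj ▸ regularBar_conjConsts_le (FLT F)
  induction hr using Algebra.adjoin_induction with
  | mem x hx =>
    obtain ⟨-, rfl | rfl | ⟨Q, hQ, rfl⟩⟩ := hx
    · exact germ_fst_mem_regular _
    · exact germ_snd_mem_regular _
    · obtain ⟨h1, h2, h3, h4⟩ := hB.coeff_mem Q hQ
      by_cases hz : Q.α ≠ 0 ∨ Q.β ≠ 0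
      · obtain ⟨b, hb, H⟩ := Q.exists_letter (hB.coeff_mem Q hQ) hz
        have h5 := mul_mem (hbar (germ_inv_linear_mem h1 h2 hz)) (germ_inv_mem_regular hb)
        convert h5 using 1
        refine germ_congr ?_
        filter_upwards [eventually_base_linear_ne_zero hz] with p hp
        rw [H p hp, mul_inv]
        rfl
      · push Not at hz
        have h5 := hbar (germ_inv_linear_mem h3 h4 (by
          simpa [Form.Nonzero, hz.1, hz.2] using hB.nonzero Q hQ))
        convert h5 using 1
        refine germ_congr (Eventually.of_forall fun p => ?_)
        simp [Form.eval, hz.1, hz.2]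
  | algebraMap c =>
    have h := (regular (FLT F)).algebraMap_mem c
    rwa [algebraMap_G] at h
  | add x y _ _ hx hy => exact add_mem hx hy
  | mul x y _ _ hx hy => exact mul_mem hx hy

theorem exists_const_of_mem_coeffRing (hrat : ¬rat) {r : ℂ × ℂ → ℂ} (hr : r ∈ coeffRing rat B) :
    ∃ c : ℂ, r = fun _ => c := by
  have h : r ∈ (⊥ : Subalgebra ℂ (ℂ × ℂ → ℂ)) := by
    refine Algebra.adjoin_le (S := ⊥) ?_ hr
    exact fun x hx => absurd hx.1 hrat
  obtain ⟨c, rfl⟩ := Algebra.mem_bot.1 h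
  exact ⟨c, rfl⟩

theorem germ_mem_GHC_of_mem_wordSpan (hconj : ∀ x ∈ F, starRingEnd ℂ x ∈ F) (hS : S ⊆ FLT F)
    (hC : C ⊆ (F : Set ℂ)) {f : ℂ × ℂ → ℂ} (hf : f ∈ wordSpan S C) : germ f ∈ GHC (FLT F) := by
  induction hf using Submodule.span_induction with
  | mem f hf =>
    obtain ⟨v, u, hv, hu, rfl⟩ := hf
    refine germBar_mul_germZ_mem_GHC (v := v) (fun c hc => ?_) fun a ha => hS (hu a ha)
    rw [conjConsts_FLT hconj]
    exact hC (hv c hc)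
  | zero => exact zero_mem (GHC (FLT F))
  | add f g _ _ hf hg => exact add_mem hf hg
  | smul c f _ hf => exact (GHC (FLT F)).smul_mem c hf

/-- The generalized hyperlogarithms over `F`, with regular or with constant coefficients. -/
def hyperlogSpace (F : Subfield ℂ) (rat : Prop) : Set G :=
  {f | (rat → f ∈ GH (FLT F)) ∧ (¬rat → f ∈ GHC (FLT F))}

theorem hyperlogSpace_true : hyperlogSpace F True = GHF F := by
  ext f
  simp [hyperlogSpace, mem_GHF_iff]

theorem hyperlogSpace_false : hyperlogSpace F False = GHCF F := by
  ext f
  simp [hyperlogSpace, mem_GHCF_iff]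

theorem hasComb_of_mem_hyperlogSpace (hconj : ∀ x ∈ F, starRingEnd ℂ x ∈ F)
    (hsqrt : ∀ x : ℂ, x ^ 2 ∈ F → x ∈ F) {f : G} (hf : f ∈ hyperlogSpace F rat) :
    HasComb F rat f := by
  by_cases h : rat
  · have h1 := hasComb_of_mem_GH hconj hsqrt (hf.1 h)
    rwa [eq_true h]
  · exact hasComb_of_mem_GHC hconj hsqrt (hf.2 h)

/-- Each iterated integral is replaced by a combination of hyperlogarithms on the base region, where
the coefficients are already holomorphic. If `rat` fails, they are constants, and the result has
constant coefficients. -/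
theorem Comb.exists_mem_hyperlogSpace (hconj : ∀ x ∈ F, starRingEnd ℂ x ∈ F) (hB : Alphabet F B)
    (hS : S ⊆ FLT F) (hC : C ⊆ (F : Set ℂ)) (hε : NiceRadius S C ε)
    (hBS : ∀ Q ∈ B, Adapted S C ε Q) (hD : IsOpen D) (hDc : IsPreconnected D) (hne : D.Nonempty)
    (hDε : D ⊆ baseRegion ε) (h : Comb rat B D g) :
    ∃ f, (∀ p ∈ baseRegion ε, AnalyticAt ℂ f p) ∧ Set.EqOn f g D ∧ germ f ∈ hyperlogSpace F rat := by
  obtain ⟨l, hl, H⟩ := h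
  have hx : ∀ x : (ℂ × ℂ → ℂ) × (ℂ × ℂ → ℂ), ∃ h', x ∈ l → h' ∈ wordSpan S C ∧ Set.EqOn x.2 h' D := by
    intro x
    by_cases hx : x ∈ l
    · obtain ⟨h', H⟩ := (hl x hx).2.exists_mem_wordSpan hε hBS hD hDc hne hDε
      exact ⟨h', fun _ => H⟩
    · exact ⟨0, fun h => absurd h hx⟩
  choose ext hext using hx
  have hgerm : ∀ x ∈ l, germ (ext x) ∈ GHC (FLT F) := fun x hx =>
    germ_mem_GHC_of_mem_wordSpan hconj hS hC (hext x hx).1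
  refine ⟨fun p => (l.map fun x => x.1 p * ext x p).sum, fun p hp => ?_, fun p hp => ?_,
    fun _ => ?_, fun hrat => ?_⟩
  · exact analyticAt_list_sum l fun x hx => (analyticAt_coeffRing (hl x hx).1
      fun Q hQ => (hBS Q hQ).eval_ne_zero p hp).mul (analyticAt_of_mem_wordSpan hε (hext x hx).1 hp)
  · rw [H p hp]
    refine congrArg List.sum (List.map_congr_left fun x hx => ?_)
    rw [(hext x hx).2 hp]
  · rw [germ_list_sum l fun x p => x.1 p * ext x p]
    refine list_sum_mem fun y hy => ?_
    obtain ⟨x, hx, rfl⟩ := List.mem_map.1 hy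
    exact mul_mem_GH (germ_mem_regular_of_mem_coeffRing hconj hB (hl x hx).1)
      (GHC_le_GH (hgerm x hx))
  · rw [germ_list_sum l fun x p => x.1 p * ext x p]
    refine list_sum_mem fun y hy => ?_
    obtain ⟨x, hx, rfl⟩ := List.mem_map.1 hy
    obtain ⟨c, hc⟩ := exists_const_of_mem_coeffRing hrat (hl x hx).1
    rw [hc]
    exact (GHC (FLT F)).smul_mem c (hgerm x hx)

theorem LocV.exists_mem_hyperlogSpace (hconj : ∀ x ∈ F, starRingEnd ℂ x ∈ F) (hB : Alphabet F B)
    (hS : S ⊆ FLT F) (hC : C ⊆ (F : Set ℂ)) (hε : NiceRadius S C ε)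
    (hBS : ∀ Q ∈ B, Adapted S C ε Q) (hp : p ∈ baseRegion ε) (h : LocV rat B p g) :
    ∃ f, (∀ p ∈ baseRegion ε, AnalyticAt ℂ f p) ∧ f =ᶠ[𝓝 p] g ∧ germ f ∈ hyperlogSpace F rat := by
  obtain ⟨r, hr, -, h2⟩ := h
  obtain ⟨s, hs, h3⟩ := Metric.isOpen_iff.1 (isOpen_baseRegion ε) p hp
  have hp' : p ∈ Metric.ball p (min r s) := Metric.mem_ball_self (lt_min hr hs)
  obtain ⟨f, h4, h5, h6⟩ := (h2.mono (D' := Metric.ball p (min r s)) le_rfl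
    (Metric.ball_subset_ball (min_le_left _ _))).exists_mem_hyperlogSpace hconj hB hS hC hε hBS
    Metric.isOpen_ball (convex_ball p _).isPreconnected ⟨p, hp'⟩
    ((Metric.ball_subset_ball (min_le_right _ _)).trans h3)
  exact ⟨f, h4, eventually_of_mem (Metric.isOpen_ball.mem_nhds hp') h5, h6⟩

/-! ### Branches -/

/-- `g` is holomorphic at `q` and generated by logarithmic forms over `F`. -/
def IsGood (F : Subfield ℂ) (rat : Prop) (q : ℂ × ℂ) (g : ℂ × ℂ → ℂ) : Prop :=
  ∃ B, Alphabet F B ∧ GoodAt rat B q g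

/-- At points of the base region the germ is a local combination, and continuation transports
goodness to `q`. The two representatives of the germ agree only close to the base point, so the path
is started at a point where they do. -/
theorem HasComb.isGood {f : G} (hf : HasComb F rat f) (h : IsBranchAt f q g) :
    IsGood F rat q g := by
  obtain ⟨B, hB, ε, hε, h1, f, rfl, h2⟩ := hf
  obtain ⟨f', h3, h4⟩ := h
  obtain ⟨p, ⟨hp, γ, h5⟩, h6⟩ := (((eventually_base_baseRegion hε).and h4).and
    (eventually_eventually_nhds_base (germ_eq_germ.1 h3))).exists
  have h7 : LocV rat B p f := .of_comb (isOpen_baseRegion ε) h2 h1 hp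
  exact ⟨B, hB, (h7.congr (EventuallyEq.symm h6)).goodAt.of_continuesTo hB h5⟩

/-- From `q` the function is moved to a regular point nearby and continued to the base region, where
an element of the space can be read off; the reversed path exhibits `g` as a branch of it. -/
theorem IsGood.exists_isBranchAt (hconj : ∀ x ∈ F, starRingEnd ℂ x ∈ F) (h : IsGood F rat q g) :
    ∃ h ∈ hyperlogSpace F rat, IsBranchAt h q g := by
  obtain ⟨B, hB, h⟩ := h
  obtain ⟨S, C, ε, hS, hC, hε, hBS⟩ := hB.exists_adapted
  obtain ⟨r, hr, h1⟩ := Metric.eventually_nhds_iff_ball.1 h.1.eventually_analyticAt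
  obtain ⟨x, h2, hx⟩ := ((h.frequently hB).and_eventually (Metric.ball_mem_nhds q hr)).exists
  obtain ⟨γ₁, hγ₁⟩ := exists_path_of_convex (convex_ball q r) hx (Metric.mem_ball_self hr)
  obtain ⟨p₀, hp₀⟩ := nonempty_baseRegion hε.pos
  obtain ⟨g', h3, γ₂, h4⟩ := h2.exists_continuesTo hB.finite
    (y := p₀) fun Q hQ => (hBS Q hQ).eval_ne_zero p₀ hp₀
  obtain ⟨f, h5, h6, h7⟩ := h3.exists_mem_hyperlogSpace hconj hB hS hC hε hBS hp₀
  have hpath : IsPathConnected (baseRegion ε) :=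
    (isOpen_baseRegion ε).isConnected_iff_isPathConnected.1
      ⟨⟨p₀, hp₀⟩, isPreconnected_baseRegion hε.pos⟩
  refine ⟨germ f, h7, f, rfl, ?_⟩
  filter_upwards [eventually_base_baseRegion hε.pos] with p hp
  have hj := hpath.joinedIn p hp p₀ hp₀
  have h8 : ContinuesTo hj.somePath f g' :=
    (ContinuesTo.refl_of_analyticAt fun t => h5 _ (hj.somePath_mem t)).congr .rfl h6
  exact ⟨_, (h8.trans h4.symm).trans (.refl_of_analyticAt fun t => h1 _ (hγ₁ t))⟩

/-- Continuation along the reversed paths shows that the principal branch itself is good on a base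
region, hence a combination of hyperlogarithms. So a single good branch decides membership. -/
theorem IsGood.mem_hyperlogSpace (hconj : ∀ x ∈ F, starRingEnd ℂ x ∈ F) (h : IsGood F rat q g)
    {f : G} (hf : IsBranchAt f q g) : f ∈ hyperlogSpace F rat := by
  obtain ⟨B, hB, h⟩ := h
  obtain ⟨S, C, ε, hS, hC, hε, hBS⟩ := hB.exists_adapted
  obtain ⟨f, rfl, hf⟩ := hf
  obtain ⟨δ, hδ, h1⟩ := base_hasBasis.eventually_iff.1 hf
  have m := baseRegion_mono (min_le_left ε δ)
  have hgood : ∀ p ∈ baseRegion (min ε δ), GoodAt rat B p f := by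
    intro p hp
    obtain ⟨γ, h2⟩ := h1 (baseRegion_mono (min_le_right ε δ) hp)
    exact h.of_continuesTo hB h2.symm
  obtain ⟨p₀, hp₀⟩ := nonempty_baseRegion (lt_min hε.pos hδ)
  have h3 : LocV rat B p₀ f := (hgood p₀ hp₀).2.self_of_nhds
    fun Q hQ => (hBS Q hQ).eval_ne_zero p₀ (m hp₀)
  obtain ⟨f', h4, h5, h6⟩ := h3.exists_mem_hyperlogSpace hconj hB hS hC hε hBS (m hp₀)
  have h7 : Set.EqOn f f' (baseRegion (min ε δ)) :=
    AnalyticOnNhd.eqOn_of_preconnected_of_eventuallyEq (𝕜 := ℂ) (fun p hp => (hgood p hp).1)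
      (fun p hp => h4 p (m hp)) (isPreconnected_baseRegion (lt_min hε.pos hδ)) hp₀ h5.symm
  rwa [germ_congr (base_hasBasis.eventually_iff.2 ⟨_, lt_min hε.pos hδ, fun p hp => h7 hp⟩)]

theorem IsGood.conj (hconj : ∀ x ∈ F, starRingEnd ℂ x ∈ F) (h : IsGood F rat q g) :
    IsGood F rat (conjPt q) (conjFun g) := by
  obtain ⟨B, hB, h⟩ := h
  exact ⟨_, hB.conj hconj, h.conj hB.finite⟩

theorem isGood_const (c : ℂ) : IsGood F rat q fun _ => c :=
  ⟨∅, alphabet_empty, (LocV.of_comb isOpen_univ (.const c) (by simp [Reg])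
    (Set.mem_univ q)).goodAt⟩

/-- Conjugation preserves goodness of branches and is an involution, so the argument for one
direction of the equivalence also gives the other. -/
theorem conjStable_hyperlogSpace (hconj : ∀ x ∈ F, starRingEnd ℂ x ∈ F)
    (hsqrt : ∀ x : ℂ, x ^ 2 ∈ F → x ∈ F) : ConjStable (hyperlogSpace F rat) := by
  have key : ∀ {f : G}, f ∈ hyperlogSpace F rat → ∀ {p g}, IsBranchAt f p g →
      IsGood F rat (conjPt p) (conjFun g) := fun hf _ _ hg =>
    ((hasComb_of_mem_hyperlogSpace hconj hsqrt hf).isGood hg).conj hconj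
  refine ⟨fun f hf p g hg => (key hf hg).exists_isBranchAt hconj,
    fun f h p g hf hh => ⟨fun hfX => (key hfX hf).mem_hyperlogSpace hconj hh, fun hhX => ?_⟩⟩
  have h1 := key hhX hh
  rw [conjPt_conjPt, conjFun_conjFun] at h1
  exact h1.mem_hyperlogSpace hconj hf

/-- At a zero of the denominator the division has the default value `0`, but continuity of the
quotient would force the numerator to vanish as well, contrary to the determinant. -/
theorem linear_ne_zero_of_analyticAt {a b c d x : ℂ} (hdet : a * d - b * c ≠ 0)
    (h : AnalyticAt ℂ (fun x => (a * x + b) / (c * x + d)) x) : c * x + d ≠ 0 := by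
  intro h0
  have hcd : c ≠ 0 ∨ d ≠ 0 := by
    by_contra! hn
    rw [hn.1, hn.2] at hdet
    simp at hdet
  have hc : c ≠ 0 := by
    rintro rfl
    rw [zero_mul, zero_add] at h0
    simp [h0] at hcd
  have h1 : Tendsto (fun y => (a * y + b) / (c * y + d) * (c * y + d)) (𝓝[≠] x)
      (𝓝 ((a * x + b) / (c * x + d) * (c * x + d))) := by
    have h2 : ContinuousAt (fun y => c * y + d) x := by fun_prop
    exact (h.continuousAt.mul h2).tendsto.mono_left nhdsWithin_le_nhds
  have h2 : Tendsto (fun y => (a * y + b) / (c * y + d) * (c * y + d)) (𝓝[≠] x) (𝓝 (a * x + b)) := by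
    have h3 : ContinuousAt (fun y => a * y + b) x := by fun_prop
    refine (h3.tendsto.mono_left nhdsWithin_le_nhds).congr' ?_
    filter_upwards [self_mem_nhdsWithin] with y hy
    have h4 : c * y + d ≠ 0 := by
      intro h5
      exact hy (mul_left_cancel₀ hc (by linear_combination h5 - h0))
    rw [div_mul_cancel₀ _ h4]
  have h3 := tendsto_nhds_unique h1 h2
  rw [h0, mul_zero] at h3
  exact hdet (by linear_combination a * h0 + c * h3)

/-- The pair of `β` and its conjugate is a `Mob`, and analyticity of `β` at the point excludes
poles. For constant `β` the pull-back of a branch is a constant function, which is good without any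
condition. -/
theorem fltStable_hyperlogSpace (hconj : ∀ x ∈ F, starRingEnd ℂ x ∈ F)
    (hsqrt : ∀ x : ℂ, x ^ 2 ∈ F → x ∈ F) : FLTStable F (hyperlogSpace F rat) := by
  intro β hβ p h1 h2 f hf g hg
  have hgood : IsGood F rat p (g ∘ substPt β) := by
    rcases hβ with ⟨b, -, rfl⟩ | ⟨a, ha, b, hb, c, hc, d, hd, hdet, rfl⟩
    · change IsGood F rat p fun _ => g (b, starRingEnd ℂ b)
      exact isGood_const _
    · let T : Mob := ⟨a, b, c, d, starRingEnd ℂ a, starRingEnd ℂ b, starRingEnd ℂ c,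
        starRingEnd ℂ d, hdet, by
          rw [← map_mul, ← map_mul, ← map_sub]
          exact (map_ne_zero _).2 hdet⟩
      have hT : substPt (fun x => (a * x + b) / (c * x + d)) = T.app := by
        funext p
        simp [substPt, Mob.app, T]
      have hd1 : T.den.eval p ≠ 0 := by
        rw [Mob.eval_den]
        exact linear_ne_zero_of_analyticAt hdet h1
      have hd2 : T.den'.eval p ≠ 0 := by
        rw [Mob.eval_den']
        have h3 := (map_ne_zero (starRingEnd ℂ)).2 (linear_ne_zero_of_analyticAt hdet h2)
        simpa [T] using h3
      rw [hT] at hg ⊢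
      obtain ⟨B, hB, h3⟩ := (hasComb_of_mem_hyperlogSpace hconj hsqrt hf).isGood hg
      exact ⟨_, Mob.alphabet hB ha hb hc hd (hconj a ha) (hconj b hb) (hconj c hc) (hconj d hd),
        h3.comp_mob hB.finite hd1 hd2⟩
  exact ⟨hgood.exists_isBranchAt hconj, fun h hh => hgood.mem_hyperlogSpace hconj hh⟩

end
end GenHyperlog

theorem mainTheorem3 (F : Subfield ℂ)
    (hconj : ∀ x ∈ F, starRingEnd ℂ x ∈ F) (hsqrt : ∀ x : ℂ, x ^ 2 ∈ F → x ∈ F) :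
    -- generalized hyperlogarithms are holomorphic in the two variables
    (∀ f ∈ GenHyperlog.GHF F, GenHyperlog.IsHolomorphic f) ∧
    -- freeness and multiplication
    (∀ S : Set (ℂ → ℂ), S.Finite → S ⊆ GenHyperlog.FLT F →
      Module.Free (GenHyperlog.regular S) (GenHyperlog.GH S) ∧
      LinearIndependent (GenHyperlog.regular S) (GenHyperlog.generators S) ∧
      (1 : GenHyperlog.G) ∈ GenHyperlog.GH S ∧
      (∀ f ∈ GenHyperlog.GH S, ∀ g ∈ GenHyperlog.GH S, f * g ∈ GenHyperlog.GH S) ∧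
      ∃ A : Subalgebra ℂ GenHyperlog.G, Subalgebra.toSubmodule A = GenHyperlog.GHC S) ∧
    -- the exact sequence for the derivative with respect to z
    (GenHyperlog.HLbarF F ⊆ GenHyperlog.GHF F ∧
      (∀ f ∈ GenHyperlog.GHF F, GenHyperlog.dz f ∈ GenHyperlog.GHF F) ∧
      (∀ f ∈ GenHyperlog.GHF F, GenHyperlog.dz f = 0 ↔ f ∈ GenHyperlog.HLbarF F) ∧
      (∀ f ∈ GenHyperlog.GHF F, ∃ P ∈ GenHyperlog.GHF F, GenHyperlog.dz P = f)) ∧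
    -- differential simplicity
    (∀ S : Set (ℂ → ℂ), S.Finite → S ⊆ GenHyperlog.FLT F → ∀ f ∈ GenHyperlog.GH S, f ≠ 0 →
      ∃ (N : ℕ) (c : ℕ → ℕ → GenHyperlog.G), (∀ i j, c i j ∈ GenHyperlog.regular S) ∧
        ∑ i ∈ Finset.range N, ∑ j ∈ Finset.range N,
          c i j * GenHyperlog.dz^[i] (GenHyperlog.dzbar^[j] f) = 1) ∧
    -- complex conjugation
    (GenHyperlog.ConjStable (GenHyperlog.GHF F) ∧ GenHyperlog.ConjStable (GenHyperlog.GHCF F)) ∧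
    -- fractional linear transformations
    (GenHyperlog.FLTStable F (GenHyperlog.GHF F) ∧
      GenHyperlog.FLTStable F (GenHyperlog.GHCF F)) := by
  simp only [GenHyperlog.mem_GHF_iff]
  refine ⟨fun f hf => GenHyperlog.isHolomorphic_of_mem_GH le_rfl hf, fun S hS hSF => ?_, ?_,
    fun S hS hSF f hf hf0 => GenHyperlog.exists_differential_operator hS hSF hf hf0,
    ⟨GenHyperlog.hyperlogSpace_true ▸ GenHyperlog.conjStable_hyperlogSpace hconj hsqrt,
      GenHyperlog.hyperlogSpace_false ▸ GenHyperlog.conjStable_hyperlogSpace hconj hsqrt⟩,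
    GenHyperlog.hyperlogSpace_true ▸ GenHyperlog.fltStable_hyperlogSpace hconj hsqrt,
    GenHyperlog.hyperlogSpace_false ▸ GenHyperlog.fltStable_hyperlogSpace hconj hsqrt⟩
  · have hli := GenHyperlog.linearIndependent_generators hS hSF
    exact ⟨Module.Free.of_basis (Module.Basis.span hli), hli,
      GenHyperlog.GHC_le_GH (GenHyperlog.one_mem_GHC S),
      fun f hf g hg => GenHyperlog.GH_mul_mem hSF hf hg,
      GenHyperlog.subalgebraGHC hSF, Submodule.toSubalgebra_toSubmodule _ _ _⟩
  · refine ⟨fun f hf => ?_, fun f hf => GenHyperlog.dz_mem_GH le_rfl hf, fun f hf => ⟨fun h => ?_, fun h => ?_⟩,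
      fun f hf => GenHyperlog.exists_primitive hconj hsqrt hf⟩
    · exact GenHyperlog.mem_GHF_iff.2 (GenHyperlog.HLbar_le_GH hconj (GenHyperlog.mem_HLbarF_iff.1 hf))
    · obtain ⟨S, hS, hSF, hfS⟩ := GenHyperlog.mem_GHF_iff.2 hf
      exact GenHyperlog.mem_HLbarF_iff.2
        (GenHyperlog.mem_HLbar_of_dz_eq_zero hconj hsqrt hS hSF hfS h)
    · exact GenHyperlog.dz_of_mem_HLbar (GenHyperlog.mem_HLbarF_iff.1 h)
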